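/- **Setting.** Let $(M,g,I,J,K)$ be a hyperkähler manifold, $IJ=K$, with Kähler forms $\omega_1=g(I\cdot,\cdot)$, $\omega_2=g(J\cdot,\cdot)$, $\omega_3=g(K\cdot,\cdot)$, and let the circle act smoothly on $M$ so that $e^{i\theta}$ fixes $\omega_1$ and pulls $\omega_2+i\omega_3$ back to $e^{i\theta}(\omega_2+i\omega_3)$. Let $X$ be the vector field generated by the action. A *hyperholomorphic line bundle* of such a manifold consists of a hermitian line bundle $(L,h)$ with a unitary connection $\nabla$ of curvature $\omega_1$ (meaning $F_\nabla=i\omega_1$; this is the prequantum bundle), a lift of the circle action to $L$ preserving $h$ and $\nabla$, the moment map $\mu$, $i_X\omega_1=d\mu$, determined by the lift (the infinitesimal action on sections is $\nabla_X+i\mu$), and the connection $\nabla^{\mathrm{hyp}}$ on $L$ that is compatible with the rescaled metric $e^{2\mu}h$ and has the same $\bar\partial$-operator with respect to $I$ as $\nabla$. Let $(L,h,\nabla,\mu,\nabla^{\mathrm{hyp}})$ be a hyperholomorphic line bundle of $M$. Let a Lie group $G$ with Lie algebra $\mathfrak g$ act smoothly on $M$, preserving $\omega_1,\omega_2,\omega_3$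 and commuting with the circle action, with a lift to $L$ that preserves $h$ and $\nabla$ and commutes with the lifted circle action. Let $\nu=(\nu_1,\nu_2,\nu_3):M\to\mathfrak g^*\otimes\mathbf R^3$ be an equivariant hyperkähler moment map, where $\nu_1$ is the moment map determined by the lift of $G$ and $\nu_2+i\nu_3$ is multiplied by $e^{i\theta}$ under the action of $e^{i\theta}$. Assume that $\nu^{-1}(0)$ is a submanifold on which $G$ acts freely, so that $\pi:\nu^{-1}(0)\to\bar M=\nu^{-1}(0)/G$ is a smooth principal $G$-bundle, and let $\bar M$ carry the smooth quotient structure $(\bar g,\bar I,\bar J,\bar K)$: $\bar g$ is the quotient metric and $\pi^*\bar\omega_i=\omega_i|_{\nu^{-1}(0)}$ for $i=1,2,3$. **Theorem 2.** The quotient $\bar M$ is hyperkähler, the circle action preserves $\nu^{-1}(0)$ and induces a smooth circle action on $\bar M$, which fixes $\bar\omega_1$ and transforms $\bar\omega_2+i\bar\omega_3$ into $e^{i\theta}(\bar\omega_2+i\bar\omega_3)$. There are a hyperholomorphic line bundle $(\bar L,\bar h,\bar\nabla,\bar\mu,\bar\nabla^{\mathrm{hyp}})$ of $\bar M$, with the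 curvature of $\bar\nabla^{\mathrm{hyp}}$ of type $(1,1)$ with respect to $\bar I,\bar J,\bar K$, and a smooth $G$-invariant identification of $L|_{\nu^{-1}(0)}$ with $\pi^*\bar L$, equivariant for the lifted circle actions, under which * $\mu|_{\nu^{-1}(0)}=\pi^*\bar\mu$, $h|_{\nu^{-1}(0)}=\pi^*\bar h$ and $\nabla|_{\nu^{-1}(0)}=\pi^*\bar\nabla$; * $e^{2\mu}h|_{\nu^{-1}(0)}=\pi^*(e^{2\bar\mu}\bar h)$, and $\bar\nabla^{\mathrm{hyp}}$ is the connection induced on the quotient by $\nabla^{\mathrm{hyp}}$: for a section $\bar s$ of $\bar L$, the corresponding $G$-invariant section $s$ of $L|_{\nu^{-1}(0)}$ and every $v$ tangent to $\nu^{-1}(0)$ and orthogonal to the $G$-orbit, $\bar\nabla^{\mathrm{hyp}}_{\pi_*v}\bar s$ corresponds to $\nabla^{\mathrm{hyp}}_v s$. The descended hyperholomorphic line bundle is unique up to unique isomorphism compatible with the identifications. -/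

import Mathlib

open scoped Manifold ContDiff Topology Bundle
open Bundle

universe w w'

noncomputable section

namespace HyperKahler

/-! ### Hyperkähler manifolds -/

section Hyperkahler

variable (E : Type*) [NormedAddCommGroup E] [NormedSpace ℝ E] [FiniteDimensional ℝ E]
  (M : Type*) [TopologicalSpace M] [ChartedSpace E M] [IsManifold 𝓘(ℝ, E) ∞ M]

/-- An almost hyperhermitian structure on a smooth manifold: a smooth Riemannian metric `g` and
three smooth orthogonal almost complex structures `I`, `J`, `K` with `I J = K`. -/
structure AlmostHyperhermitian where
  /-- the Riemannian metric -/
  g : ContMDiffRiemannianMetric 𝓘(ℝ, E) ∞ E (fun x : M ↦ TangentSpace 𝓘(ℝ, E) x)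
  /-- the first almost complex structure -/
  I : ∀ x : M, TangentSpace 𝓘(ℝ, E) x →L[ℝ] TangentSpace 𝓘(ℝ, E) x
  /-- the second almost complex structure -/
  J : ∀ x : M, TangentSpace 𝓘(ℝ, E) x →L[ℝ] TangentSpace 𝓘(ℝ, E) x
  /-- the third almost complex structure -/
  K : ∀ x : M, TangentSpace 𝓘(ℝ, E) x →L[ℝ] TangentSpace 𝓘(ℝ, E) x
  smooth_I : ContMDiff 𝓘(ℝ, E) (𝓘(ℝ, E).prod 𝓘(ℝ, E →L[ℝ] E)) ∞
    (fun x ↦ TotalSpace.mk' (E →L[ℝ] E)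
      (E := fun x : M ↦ TangentSpace 𝓘(ℝ, E) x →L[ℝ] TangentSpace 𝓘(ℝ, E) x) x (I x))
  smooth_J : ContMDiff 𝓘(ℝ, E) (𝓘(ℝ, E).prod 𝓘(ℝ, E →L[ℝ] E)) ∞
    (fun x ↦ TotalSpace.mk' (E →L[ℝ] E)
      (E := fun x : M ↦ TangentSpace 𝓘(ℝ, E) x →L[ℝ] TangentSpace 𝓘(ℝ, E) x) x (J x))
  smooth_K : ContMDiff 𝓘(ℝ, E) (𝓘(ℝ, E).prod 𝓘(ℝ, E →L[ℝ] E)) ∞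
    (fun x ↦ TotalSpace.mk' (E →L[ℝ] E)
      (E := fun x : M ↦ TangentSpace 𝓘(ℝ, E) x →L[ℝ] TangentSpace 𝓘(ℝ, E) x) x (K x))
  I_sq : ∀ x v, I x (I x v) = -v
  J_sq : ∀ x v, J x (J x v) = -v
  K_sq : ∀ x v, K x (K x v) = -v
  I_J : ∀ x v, I x (J x v) = K x v
  orth_I : ∀ x v v', g.inner x (I x v) (I x v') = g.inner x v v'
  orth_J : ∀ x v v', g.inner x (J x v) (J x v') = g.inner x v v'
  orth_K : ∀ x v v', g.inner x (K x v) (K x v') = g.inner x v v'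

variable {E M}

/-- The vector field `X` is smooth at `x`. -/
def SmoothFieldAt (X : ∀ x : M, TangentSpace 𝓘(ℝ, E) x) (x : M) : Prop :=
  ContMDiffAt 𝓘(ℝ, E) (𝓘(ℝ, E).prod 𝓘(ℝ, E)) ∞
    (fun y ↦ TotalSpace.mk' E (E := fun x : M ↦ TangentSpace 𝓘(ℝ, E) x) y (X y)) x

/-- The differential of a real function, as a 1-form. -/
def dfun (f : M → ℝ) (x : M) (v : TangentSpace 𝓘(ℝ, E) x) : ℝ :=
  mfderiv 𝓘(ℝ, E) 𝓘(ℝ, ℝ) f x v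

/-- `dα = 0` for a 2-form `α`, where `dα` is given by the invariant (Cartan) formula. -/
def IsClosedTwoForm
    (α : ∀ x : M, TangentSpace 𝓘(ℝ, E) x →L[ℝ] TangentSpace 𝓘(ℝ, E) x →L[ℝ] ℝ) : Prop :=
  ∀ (x : M) (X Y Z : ∀ x : M, TangentSpace 𝓘(ℝ, E) x),
    SmoothFieldAt X x → SmoothFieldAt Y x → SmoothFieldAt Z x →
    dfun (fun y ↦ α y (Y y) (Z y)) x (X x) + dfun (fun y ↦ α y (Z y) (X y)) x (Y x)
      + dfun (fun y ↦ α y (X y) (Y y)) x (Z x)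
      - α x (VectorField.mlieBracket 𝓘(ℝ, E) X Y x) (Z x)
      - α x (VectorField.mlieBracket 𝓘(ℝ, E) Y Z x) (X x)
      - α x (VectorField.mlieBracket 𝓘(ℝ, E) Z X x) (Y x) = 0

/-- Integrability of an almost complex structure: its Nijenhuis tensor vanishes. -/
def IsIntegrable
    (A : ∀ x : M, TangentSpace 𝓘(ℝ, E) x →L[ℝ] TangentSpace 𝓘(ℝ, E) x) : Prop :=
  ∀ (x : M) (X Y : ∀ x : M, TangentSpace 𝓘(ℝ, E) x), SmoothFieldAt X x → SmoothFieldAt Y x →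
    VectorField.mlieBracket 𝓘(ℝ, E) (fun y ↦ A y (X y)) (fun y ↦ A y (Y y)) x
      - A x (VectorField.mlieBracket 𝓘(ℝ, E) (fun y ↦ A y (X y)) Y x)
      - A x (VectorField.mlieBracket 𝓘(ℝ, E) X (fun y ↦ A y (Y y)) x)
      - VectorField.mlieBracket 𝓘(ℝ, E) X Y x = 0

/-- The 2-form `F` is of type `(1,1)` with respect to the almost complex structure `A`. -/
def IsOneOne (A : ∀ x : M, TangentSpace 𝓘(ℝ, E) x →L[ℝ] TangentSpace 𝓘(ℝ, E) x)
    (F : ∀ x : M, TangentSpace 𝓘(ℝ, E) x →L[ℝ] TangentSpace 𝓘(ℝ, E) x →L[ℝ] ℝ) : Prop :=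
  ∀ x v v', F x (A x v) (A x v') = F x v v'

namespace AlmostHyperhermitian

variable (H : AlmostHyperhermitian E M)

/-- The form `ω₁(v, v') = g(I v, v')`. -/
def ω₁ (x : M) : TangentSpace 𝓘(ℝ, E) x →L[ℝ] TangentSpace 𝓘(ℝ, E) x →L[ℝ] ℝ :=
  (H.g.inner x).comp (H.I x)

/-- The form `ω₂(v, v') = g(J v, v')`. -/
def ω₂ (x : M) : TangentSpace 𝓘(ℝ, E) x →L[ℝ] TangentSpace 𝓘(ℝ, E) x →L[ℝ] ℝ :=
  (H.g.inner x).comp (H.J x)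

/-- The form `ω₃(v, v') = g(K v, v')`. -/
def ω₃ (x : M) : TangentSpace 𝓘(ℝ, E) x →L[ℝ] TangentSpace 𝓘(ℝ, E) x →L[ℝ] ℝ :=
  (H.g.inner x).comp (H.K x)

/-- The structure is hyperkähler: `g` is Kähler with respect to each of the complex structures
`I`, `J`, `K`, that is, these are integrable and the three forms are closed. -/
structure IsHyperkahler : Prop where
  integrable_I : IsIntegrable H.I
  integrable_J : IsIntegrable H.J
  integrable_K : IsIntegrable H.K
  closed₁ : IsClosedTwoForm H.ω₁
  closed₂ : IsClosedTwoForm H.ω₂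
  closed₃ : IsClosedTwoForm H.ω₃

end AlmostHyperhermitian

end Hyperkahler

/-! ### Group actions on manifolds -/

section Actions

variable {E : Type*} [NormedAddCommGroup E] [NormedSpace ℝ E]
  {M : Type*} [TopologicalSpace M] [ChartedSpace E M]
  {EA : Type*} [NormedAddCommGroup EA] [NormedSpace ℝ EA]
  {HA : Type*} [TopologicalSpace HA] (IA : ModelWithCorners ℝ EA HA)
  (A : Type*) [TopologicalSpace A] [ChartedSpace HA A] [Group A] [MulAction A M]

/-- The vector field on `M` generated by an element `a` of the Lie algebra of `A`. -/
def fundField (a : GroupLieAlgebra IA A) (x : M) : TangentSpace 𝓘(ℝ, E) x :=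
  (mfderiv IA 𝓘(ℝ, E) (fun g : A ↦ g • x) 1 a : E)

/-- The differential at `x` of the diffeomorphism by which `g` acts on `M`. -/
def dAct {A : Type*} [Group A] [MulAction A M] (g : A) (x : M) :
    TangentSpace 𝓘(ℝ, E) x →L[ℝ] TangentSpace 𝓘(ℝ, E) (g • x) :=
  mfderiv 𝓘(ℝ, E) 𝓘(ℝ, E) (fun y : M ↦ g • y) x

/-- The adjoint action of `g` on the Lie algebra: the derivative at `1` of conjugation by `g`. -/
def Ad (g : A) (a : GroupLieAlgebra IA A) : GroupLieAlgebra IA A :=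
  (mfderiv IA IA (fun h : A ↦ g * h * g⁻¹) 1 a : EA)

/-- The derivative at `1 : A` of a complex function, in the direction of the Lie algebra element
`a`. -/
def derivOne {EA : Type*} [NormedAddCommGroup EA] [NormedSpace ℝ EA]
    {HA : Type*} [TopologicalSpace HA] (IA : ModelWithCorners ℝ EA HA)
    (A : Type*) [TopologicalSpace A] [ChartedSpace HA A] [Group A]
    (c : A → ℂ) (a : GroupLieAlgebra IA A) : ℂ :=
  mfderiv IA 𝓘(ℝ, ℂ) c 1 a

end Actions

/-- The generator `d/dθ e^{iθ}` at `θ = 0` of the Lie algebra of the circle. -/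
def circleGen : GroupLieAlgebra (𝓡 1) Circle :=
  (mfderiv 𝓘(ℝ, ℝ) (𝓡 1) (fun θ : ℝ ↦ Circle.exp θ) 0 (1 : ℝ) : EuclideanSpace ℝ (Fin 1))

section Actions2

variable {E : Type*} [NormedAddCommGroup E] [NormedSpace ℝ E] [FiniteDimensional ℝ E]
  {M : Type*} [TopologicalSpace M] [ChartedSpace E M] [IsManifold 𝓘(ℝ, E) ∞ M]
  (H : AlmostHyperhermitian E M)

/-- The circle action fixes `ω₁` and transforms `ω₂ + i ω₃` into `e^{iθ} (ω₂ + i ω₃)`. -/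
structure IsRotating [MulAction Circle M] : Prop where
  smooth : ContMDiffSMul (𝓡 1) 𝓘(ℝ, E) ∞ Circle M
  fixes : ∀ (t : Circle) (x : M) (v v' : TangentSpace 𝓘(ℝ, E) x),
    H.ω₁ (t • x) (dAct t x v) (dAct t x v') = H.ω₁ x v v'
  rotates : ∀ (t : Circle) (x : M) (v v' : TangentSpace 𝓘(ℝ, E) x),
    (H.ω₂ (t • x) (dAct t x v) (dAct t x v') : ℂ)
        + Complex.I * (H.ω₃ (t • x) (dAct t x v) (dAct t x v') : ℂ)
      = (t : ℂ) * ((H.ω₂ x v v' : ℂ) + Complex.I * (H.ω₃ x v v' : ℂ))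

variable {EG : Type*} [NormedAddCommGroup EG] [NormedSpace ℝ EG]
  (G : Type*) [TopologicalSpace G] [ChartedSpace EG G] [Group G] [MulAction G M]

/-- The action of `G` is smooth and triholomorphic: it preserves the three Kähler forms. -/
structure IsTriholomorphic : Prop where
  smooth : ContMDiffSMul 𝓘(ℝ, EG) 𝓘(ℝ, E) ∞ G M
  fixes₁ : ∀ (g : G) (x : M) (v v' : TangentSpace 𝓘(ℝ, E) x),
    H.ω₁ (g • x) (dAct g x v) (dAct g x v') = H.ω₁ x v v'
  fixes₂ : ∀ (g : G) (x : M) (v v' : TangentSpace 𝓘(ℝ, E) x),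
    H.ω₂ (g • x) (dAct g x v) (dAct g x v') = H.ω₂ x v v'
  fixes₃ : ∀ (g : G) (x : M) (v v' : TangentSpace 𝓘(ℝ, E) x),
    H.ω₃ (g • x) (dAct g x v) (dAct g x v') = H.ω₃ x v v'

variable {G}

/-- `ν : M → 𝔤*` is a moment map for the action of `G` and the 2-form `α`: it is smooth and
equivariant, and `i_{X_a} α = d⟨ν, a⟩` for all `a` in the Lie algebra. -/
structure IsMomentMap
    (α : ∀ x : M, TangentSpace 𝓘(ℝ, E) x →L[ℝ] TangentSpace 𝓘(ℝ, E) x →L[ℝ] ℝ)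
    (ν : M → GroupLieAlgebra 𝓘(ℝ, EG) G →L[ℝ] ℝ) : Prop where
  smooth : ∀ a, ContMDiff 𝓘(ℝ, E) 𝓘(ℝ, ℝ) ∞ (fun x ↦ ν x a)
  equivariant : ∀ (g : G) (x : M) a, ν (g • x) (Ad 𝓘(ℝ, EG) G g a) = ν x a
  moment : ∀ (a : GroupLieAlgebra 𝓘(ℝ, EG) G) (x : M) (v : TangentSpace 𝓘(ℝ, E) x),
    α x (fundField 𝓘(ℝ, EG) G a x) v = dfun (fun y ↦ ν y a) x v

end Actions2

/-! ### Hermitian line bundles with connection -/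

section LineBundles

variable (E : Type*) [NormedAddCommGroup E] [NormedSpace ℝ E] [FiniteDimensional ℝ E]
  (M : Type*) [TopologicalSpace M] [ChartedSpace E M] [IsManifold 𝓘(ℝ, E) ∞ M]

/-- A smooth complex line bundle on the real manifold `M`. -/
structure ComplexLineBundle where
  /-- the fibres -/
  Fiber : M → Type w
  [topTotal : TopologicalSpace (TotalSpace ℂ Fiber)]
  [topFiber : ∀ x, TopologicalSpace (Fiber x)]
  [addCommGroup : ∀ x, AddCommGroup (Fiber x)]
  [module : ∀ x, Module ℂ (Fiber x)]
  [topAddGroup : ∀ x, IsTopologicalAddGroup (Fiber x)]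
  [contSMul : ∀ x, ContinuousSMul ℝ (Fiber x)]
  [fiberBundle : FiberBundle ℂ Fiber]
  [vectorBundleC : VectorBundle ℂ ℂ Fiber]
  [vectorBundleR : VectorBundle ℝ ℂ Fiber]
  [smooth : ContMDiffVectorBundle ∞ ℂ Fiber 𝓘(ℝ, E)]

attribute [instance] ComplexLineBundle.topTotal ComplexLineBundle.topFiber
  ComplexLineBundle.addCommGroup ComplexLineBundle.module ComplexLineBundle.topAddGroup
  ComplexLineBundle.contSMul ComplexLineBundle.fiberBundle ComplexLineBundle.vectorBundleC
  ComplexLineBundle.vectorBundleR ComplexLineBundle.smooth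

namespace ComplexLineBundle

variable {E M} (L : ComplexLineBundle.{w} E M)

/-- The total space of the line bundle. -/
abbrev Tot : Type _ := TotalSpace ℂ L.Fiber

/-- The section `s` of `L`, as a map to the total space. -/
def sec (s : ∀ x, L.Fiber x) (x : M) : L.Tot := ⟨x, s x⟩

/-- The section `s` is differentiable at `x`. -/
def DiffAt (s : ∀ x, L.Fiber x) (x : M) : Prop :=
  MDifferentiableAt 𝓘(ℝ, E) (𝓘(ℝ, E).prod 𝓘(ℝ, ℂ)) (L.sec s) x

/-- The section `s` is smooth at `x`. -/
def SmoothAt (s : ∀ x, L.Fiber x) (x : M) : Prop :=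
  ContMDiffAt 𝓘(ℝ, E) (𝓘(ℝ, E).prod 𝓘(ℝ, ℂ)) ∞ (L.sec s) x

/-- A smooth hermitian metric on `L`, given by its real part: a smooth real inner product on the
fibres that is invariant under multiplication by `i`. -/
structure HermitianMetric where
  /-- the real part of the hermitian metric -/
  re : ContMDiffRiemannianMetric 𝓘(ℝ, E) ∞ ℂ L.Fiber
  invariant : ∀ x v v', re.inner x (Complex.I • v) (Complex.I • v') = re.inner x v v'

/-- A smooth connection on the complex line bundle `L`; `∇ s x v` is the covariant derivative of
the section `s` at `x` in the direction `v`. -/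
structure Connection where
  /-- the covariant derivative -/
  cov : CovariantDerivative 𝓘(ℝ, E) ℂ L.Fiber
  smooth : CovariantDerivative.ContMDiffCovariantDerivative cov ∞
  complexLinear : ∀ (s : ∀ x, L.Fiber x) (x : M), L.DiffAt s x → ∀ v,
    cov (fun y ↦ Complex.I • s y) x v = Complex.I • cov s x v

variable {L}

/-- The connection is compatible with the fibrewise inner product `e^{2f} h`. For `f = 0` this says
that the connection is unitary for `h`. -/
def Connection.IsCompatible (D : L.Connection) (h : L.HermitianMetric) (f : M → ℝ) : Prop :=
  ∀ (s s' : ∀ x, L.Fiber x) (x : M), L.DiffAt s x → L.DiffAt s' x →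
    ∀ v : TangentSpace 𝓘(ℝ, E) x,
      dfun (fun y ↦ Real.exp (2 * f y) * h.re.inner y (s y) (s' y)) x v
        = Real.exp (2 * f x) *
          (h.re.inner x (D.cov s x v) (s' x) + h.re.inner x (s x) (D.cov s' x v))

/-- The curvature of the connection is the real 2-form `F`, that is,
`∇_X ∇_Y s - ∇_Y ∇_X s - ∇_{[X,Y]} s = i F(X, Y) s`. -/
def Connection.HasCurvature (D : L.Connection)
    (F : ∀ x : M, TangentSpace 𝓘(ℝ, E) x →L[ℝ] TangentSpace 𝓘(ℝ, E) x →L[ℝ] ℝ) : Prop :=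
  ∀ (x : M) (X Y : ∀ x : M, TangentSpace 𝓘(ℝ, E) x) (s : ∀ x, L.Fiber x),
    SmoothFieldAt X x → SmoothFieldAt Y x → L.SmoothAt s x →
    D.cov (fun y ↦ D.cov s y (Y y)) x (X x) - D.cov (fun y ↦ D.cov s y (X y)) x (Y x)
      - D.cov s x (VectorField.mlieBracket 𝓘(ℝ, E) X Y x)
      = (Complex.I * (F x (X x) (Y x) : ℂ)) • s x

/-- The connections `D` and `D'` have the same `(0,1)`-part with respect to the almost complex
structure `A`, that is, they define the same `∂̄`-operator on `L`. -/
def Connection.SameDbar (A : ∀ x : M, TangentSpace 𝓘(ℝ, E) x →L[ℝ] TangentSpace 𝓘(ℝ, E) x)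
    (D D' : L.Connection) : Prop :=
  ∀ (s : ∀ x, L.Fiber x) (x : M), L.DiffAt s x → ∀ v : TangentSpace 𝓘(ℝ, E) x,
    D.cov s x v + Complex.I • D.cov s x (A x v) = D'.cov s x v + Complex.I • D'.cov s x (A x v)

end ComplexLineBundle

end LineBundles

/-! ### Lifts of group actions to line bundles -/

section Lifts

variable {E : Type*} [NormedAddCommGroup E] [NormedSpace ℝ E] [FiniteDimensional ℝ E]
  {M : Type*} [TopologicalSpace M] [ChartedSpace E M] [IsManifold 𝓘(ℝ, E) ∞ M]
  {EA : Type*} [NormedAddCommGroup EA] [NormedSpace ℝ EA]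
  {HA : Type*} [TopologicalSpace HA] (IA : ModelWithCorners ℝ EA HA)
  (A : Type*) [TopologicalSpace A] [ChartedSpace HA A] [Group A] [MulAction A M]
  {L : ComplexLineBundle.{w} E M} (h : L.HermitianMetric) (D : L.Connection)

/-- A lift of the action of `A` on `M` to the line bundle `L` with hermitian metric `h` and
connection `D`: a smooth action on the total space, linear on the fibres and covering the action
on `M`, that preserves the metric and the connection. -/
structure Lift where
  /-- the map from the fibre at `x` to the fibre at `g • x` -/
  map : ∀ (g : A) (x : M), L.Fiber x →ₗ[ℂ] L.Fiber (g • x)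
  map_one : ∀ (x : M) (v : L.Fiber x), (⟨(1 : A) • x, map 1 x v⟩ : L.Tot) = ⟨x, v⟩
  map_mul : ∀ (g k : A) (x : M) (v : L.Fiber x),
    (⟨(g * k) • x, map (g * k) x v⟩ : L.Tot) = ⟨g • k • x, map g (k • x) (map k x v)⟩
  smooth : ContMDiff (IA.prod (𝓘(ℝ, E).prod 𝓘(ℝ, ℂ))) (𝓘(ℝ, E).prod 𝓘(ℝ, ℂ)) ∞
    (fun p : A × L.Tot ↦ (⟨p.1 • p.2.1, map p.1 p.2.1 p.2.2⟩ : L.Tot))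
  isometry : ∀ (g : A) (x : M) (v v' : L.Fiber x),
    h.re.inner (g • x) (map g x v) (map g x v') = h.re.inner x v v'
  parallel : ∀ (g : A) (s s' : ∀ x, L.Fiber x), (∀ x, s' (g • x) = map g x (s x)) →
    ∀ x, L.DiffAt s x → ∀ v : TangentSpace 𝓘(ℝ, E) x,
      D.cov s' (g • x) (dAct g x v) = map g x (D.cov s x v)

variable {IA A h D}

/-- The lifted action on the total space. -/
def Lift.act (ρ : Lift IA A h D) (g : A) (p : L.Tot) : L.Tot := ⟨g • p.1, ρ.map g p.1 p.2⟩

/-- The function `f` is the moment function that the lift determines for the Lie algebra element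
`a`: the derivative at `1`, in the direction `a`, of `g ↦ g⁻¹ · s(g • x)` is
`∇_{X_a} s + i f s`. For a section `s` with `s x ≠ 0` one writes `g⁻¹ · s(g • x) = c(g) s(x)`. -/
def Lift.IsMomentFunction (ρ : Lift IA A h D) (a : GroupLieAlgebra IA A) (f : M → ℝ) : Prop :=
  ∀ (x : M) (s : ∀ x, L.Fiber x) (c : A → ℂ), L.DiffAt s x → s x ≠ 0 →
    (∀ g : A, s (g • x) = c g • ρ.map g x (s x)) →
    derivOne IA A c a • s x
      = D.cov s x (fundField IA A a x) + (Complex.I * (f x : ℂ)) • s x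

end Lifts

/-! ### The hyperholomorphic line bundle -/

section Hyperholomorphic

variable {E : Type*} [NormedAddCommGroup E] [NormedSpace ℝ E] [FiniteDimensional ℝ E]
  {M : Type*} [TopologicalSpace M] [ChartedSpace E M] [IsManifold 𝓘(ℝ, E) ∞ M]

/-- The hyperholomorphic line bundle of a hyperkähler manifold with a circle action, together with
the choices on which it depends: the line bundle `L` with hermitian metric `h` and unitary
connection `nabla` of curvature `ω₁` (the prequantum bundle), the lift of the circle action, the
moment map `μ` for `ω₁` that the lift determines, and the hyperholomorphic connection `hyp`, which
is the connection that is compatible with the rescaled metric `e^{2μ} h` and that defines the same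
`I`-holomorphic structure as `nabla`. -/
structure HyperholomorphicLineBundle (H : AlmostHyperhermitian E M) [MulAction Circle M] where
  /-- the line bundle -/
  L : ComplexLineBundle.{w} E M
  /-- the hermitian metric of the prequantum bundle -/
  h : L.HermitianMetric
  /-- the connection of the prequantum bundle -/
  nabla : L.Connection
  unitary : nabla.IsCompatible h 0
  curvature : nabla.HasCurvature H.ω₁
  /-- the lift of the circle action -/
  lift : Lift (𝓡 1) Circle h nabla
  /-- the moment map of the circle action -/
  μ : M → ℝ
  smooth_μ : ContMDiff 𝓘(ℝ, E) 𝓘(ℝ, ℝ) ∞ μ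
  moment_μ : ∀ (x : M) (v : TangentSpace 𝓘(ℝ, E) x),
    H.ω₁ x (fundField (𝓡 1) Circle circleGen x) v = dfun μ x v
  lift_μ : lift.IsMomentFunction circleGen μ
  /-- the hyperholomorphic connection -/
  hyp : L.Connection
  hyp_compatible : hyp.IsCompatible h μ
  hyp_dbar : ComplexLineBundle.Connection.SameDbar H.I hyp nabla

/-- The hyperholomorphic metric `e^{2μ} h` (its real part). -/
def HyperholomorphicLineBundle.hypMetric {H : AlmostHyperhermitian E M} [MulAction Circle M]
    (Q : HyperholomorphicLineBundle.{w} H) (x : M) (v v' : Q.L.Fiber x) : ℝ :=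
  Real.exp (2 * Q.μ x) * Q.h.re.inner x v v'

/-- The connection `D` is hyperholomorphic: its curvature is of type `(1,1)` with respect to the
complex structures `I`, `J`, `K`. -/
def IsHyperholomorphic (H : AlmostHyperhermitian E M) {L : ComplexLineBundle.{w} E M}
    (D : L.Connection) : Prop :=
  ∃ F : ∀ x : M, TangentSpace 𝓘(ℝ, E) x →L[ℝ] TangentSpace 𝓘(ℝ, E) x →L[ℝ] ℝ,
    D.HasCurvature F ∧ IsOneOne H.I F ∧ IsOneOne H.J F ∧ IsOneOne H.K F

end Hyperholomorphic

/-! ### Hyperkähler quotients and descent -/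

section Quotient

variable {EG : Type*} [NormedAddCommGroup EG] [NormedSpace ℝ EG]
  (G : Type*) [TopologicalSpace G] [ChartedSpace EG G] [Group G]
  {EN : Type*} [NormedAddCommGroup EN] [NormedSpace ℝ EN]
  {N : Type*} [TopologicalSpace N] [ChartedSpace EN N] [MulAction G N]
  {EB : Type*} [NormedAddCommGroup EB] [NormedSpace ℝ EB]
  {B : Type*} [TopologicalSpace B] [ChartedSpace EB B]

/-- `pr : N → B` exhibits the manifold `B` as the quotient of `N` by a free smooth action of `G`,
and `N` as a smooth principal `G`-bundle on `B`: locally on `B` there are a smooth section `σ` and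
a smooth equivariant map `τ` to `G` such that `n = τ(n) • σ(pr n)`. -/
structure IsPrincipalQuotient (pr : N → B) : Prop where
  smooth_act : ContMDiffSMul 𝓘(ℝ, EG) 𝓘(ℝ, EN) ∞ G N
  free : ∀ (g : G) (n : N), g • n = n → g = 1
  smooth : ContMDiff 𝓘(ℝ, EN) 𝓘(ℝ, EB) ∞ pr
  surjective : Function.Surjective pr
  invariant : ∀ (g : G) (n : N), pr (g • n) = pr n
  locally_trivial : ∀ b : B, ∃ U : Set B, IsOpen U ∧ b ∈ U ∧ ∃ (σ : B → N) (τ : N → G),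
    ContMDiffOn 𝓘(ℝ, EB) 𝓘(ℝ, EN) ∞ σ U ∧
    ContMDiffOn 𝓘(ℝ, EN) 𝓘(ℝ, EG) ∞ τ (pr ⁻¹' U) ∧
    (∀ m ∈ U, pr (σ m) = m) ∧ ∀ n ∈ pr ⁻¹' U, n = τ n • σ (pr n)

variable {G}

variable {E : Type*} [NormedAddCommGroup E] [NormedSpace ℝ E] [FiniteDimensional ℝ E]
  {M : Type*} [TopologicalSpace M] [ChartedSpace E M] [IsManifold 𝓘(ℝ, E) ∞ M]
  [MulAction G M] [FiniteDimensional ℝ EB] [IsManifold 𝓘(ℝ, EB) ∞ B]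

variable (G) in
/-- A tangent vector at `n` of the manifold `N`, mapped to `M` by `ι`, is horizontal if it is
orthogonal to the `G`-orbit. -/
def IsHorizontal (H : AlmostHyperhermitian E M) (ι : N → M) (n : N)
    (v : TangentSpace 𝓘(ℝ, EN) n) : Prop :=
  ∀ a : GroupLieAlgebra 𝓘(ℝ, EG) G,
    H.g.inner (ι n) (fundField 𝓘(ℝ, EG) G a (ι n)) (mfderiv 𝓘(ℝ, EN) 𝓘(ℝ, E) ι n v) = 0

/-- The manifold `B` with its almost hyperhermitian structure `HB` is the hyperkähler quotient of
`M` by `G` for the moment maps `ν₁`, `ν₂`, `ν₃`. Here `ι : N → M` is the inclusion of the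
submanifold `ν⁻¹(0)`, the map `pr : N → B` is the projection to `ν⁻¹(0)/G`, on which `G` acts
freely, the metric on `B` is the quotient metric, and the forms on `B` pull back to the
restrictions to `ν⁻¹(0)` of the forms on `M`. -/
structure IsHyperkahlerQuotient (H : AlmostHyperhermitian E M)
    (ν₁ ν₂ ν₃ : M → GroupLieAlgebra 𝓘(ℝ, EG) G →L[ℝ] ℝ)
    (ι : N → M) (pr : N → B) (HB : AlmostHyperhermitian EB B) : Prop where
  embedding : Manifold.IsSmoothEmbedding 𝓘(ℝ, EN) 𝓘(ℝ, E) ∞ ι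
  range_ι : Set.range ι = {x | ν₁ x = 0 ∧ ν₂ x = 0 ∧ ν₃ x = 0}
  equivariant : ∀ (g : G) (n : N), ι (g • n) = g • ι n
  quotient : IsPrincipalQuotient (EG := EG) (EN := EN) (EB := EB) G pr
  metric : ∀ (n : N) (v v' : TangentSpace 𝓘(ℝ, EN) n),
    IsHorizontal (EG := EG) G H ι n v → IsHorizontal (EG := EG) G H ι n v' →
    HB.g.inner (pr n) (mfderiv 𝓘(ℝ, EN) 𝓘(ℝ, EB) pr n v) (mfderiv 𝓘(ℝ, EN) 𝓘(ℝ, EB) pr n v')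
      = H.g.inner (ι n) (mfderiv 𝓘(ℝ, EN) 𝓘(ℝ, E) ι n v) (mfderiv 𝓘(ℝ, EN) 𝓘(ℝ, E) ι n v')
  form₁ : ∀ (n : N) (v v' : TangentSpace 𝓘(ℝ, EN) n),
    HB.ω₁ (pr n) (mfderiv 𝓘(ℝ, EN) 𝓘(ℝ, EB) pr n v) (mfderiv 𝓘(ℝ, EN) 𝓘(ℝ, EB) pr n v')
      = H.ω₁ (ι n) (mfderiv 𝓘(ℝ, EN) 𝓘(ℝ, E) ι n v) (mfderiv 𝓘(ℝ, EN) 𝓘(ℝ, E) ι n v')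
  form₂ : ∀ (n : N) (v v' : TangentSpace 𝓘(ℝ, EN) n),
    HB.ω₂ (pr n) (mfderiv 𝓘(ℝ, EN) 𝓘(ℝ, EB) pr n v) (mfderiv 𝓘(ℝ, EN) 𝓘(ℝ, EB) pr n v')
      = H.ω₂ (ι n) (mfderiv 𝓘(ℝ, EN) 𝓘(ℝ, E) ι n v) (mfderiv 𝓘(ℝ, EN) 𝓘(ℝ, E) ι n v')
  form₃ : ∀ (n : N) (v v' : TangentSpace 𝓘(ℝ, EN) n),
    HB.ω₃ (pr n) (mfderiv 𝓘(ℝ, EN) 𝓘(ℝ, EB) pr n v) (mfderiv 𝓘(ℝ, EN) 𝓘(ℝ, EB) pr n v')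
      = H.ω₃ (ι n) (mfderiv 𝓘(ℝ, EN) 𝓘(ℝ, E) ι n v) (mfderiv 𝓘(ℝ, EN) 𝓘(ℝ, E) ι n v')

variable {H : AlmostHyperhermitian E M} [MulAction Circle M]
  {HB : AlmostHyperhermitian EB B} [MulAction Circle B]

/-- The hyperholomorphic line bundle `Q` on `M` descends to the hyperholomorphic line bundle `R`
on the quotient `B` through the fibrewise linear isomorphisms `q` from the restriction of `Q` to
`N` onto the pullback of `R` to `N`. -/
structure Descends {Q : HyperholomorphicLineBundle.{w} H}
    (ρ : Lift 𝓘(ℝ, EG) G Q.h Q.nabla) (ι : N → M) (pr : N → B)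
    (R : HyperholomorphicLineBundle.{w'} HB)
    (q : ∀ n : N, Q.L.Fiber (ι n) ≃ₗ[ℂ] R.L.Fiber (pr n)) : Prop where
  /-- `q` is smooth: it carries smooth sections of the quotient bundle to smooth sections of the
  restriction to `N`. -/
  smooth : ∀ (r : ∀ b, R.L.Fiber b) (n : N), R.L.SmoothAt r (pr n) →
    ContMDiffAt 𝓘(ℝ, EN) (𝓘(ℝ, E).prod 𝓘(ℝ, ℂ)) ∞
      (fun n' ↦ (⟨ι n', (q n').symm (r (pr n'))⟩ : Q.L.Tot)) n
  /-- `q` identifies the points of the `G`-orbits in the restriction of `Q` to `N`. -/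
  invariant : ∀ (g : G) (n : N) (v : Q.L.Fiber (ι n)) (v' : Q.L.Fiber (ι (g • n))),
    ρ.act g ⟨ι n, v⟩ = ⟨ι (g • n), v'⟩ →
    (⟨pr (g • n), q (g • n) v'⟩ : R.L.Tot) = ⟨pr n, q n v⟩
  /-- `q` is compatible with the lifted circle actions. -/
  circle : ∀ (t : Circle) (n n' : N) (v : Q.L.Fiber (ι n)) (v' : Q.L.Fiber (ι n')),
    Q.lift.act t ⟨ι n, v⟩ = ⟨ι n', v'⟩ →
    R.lift.act t ⟨pr n, q n v⟩ = ⟨pr n', q n' v'⟩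
  /-- the moment maps for the circle actions agree. -/
  μ_eq : ∀ n, R.μ (pr n) = Q.μ (ι n)
  /-- `q` is an isometry for the prequantum metrics. -/
  isometry : ∀ (n : N) (v v' : Q.L.Fiber (ι n)),
    R.h.re.inner (pr n) (q n v) (q n v') = Q.h.re.inner (ι n) v v'
  /-- the prequantum connection of the quotient pulls back to the restriction to `N` of the
  prequantum connection on `M`. -/
  connection : ∀ (s : ∀ x, Q.L.Fiber x) (r : ∀ b, R.L.Fiber b) (n : N),
    Q.L.DiffAt s (ι n) → R.L.DiffAt r (pr n) → (∀ᶠ n' in 𝓝 n, q n' (s (ι n')) = r (pr n')) →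
    ∀ v : TangentSpace 𝓘(ℝ, EN) n,
      q n (Q.nabla.cov s (ι n) (mfderiv 𝓘(ℝ, EN) 𝓘(ℝ, E) ι n v))
        = R.nabla.cov r (pr n) (mfderiv 𝓘(ℝ, EN) 𝓘(ℝ, EB) pr n v)
  /-- `q` is an isometry for the hyperholomorphic metrics. -/
  hyp_isometry : ∀ (n : N) (v v' : Q.L.Fiber (ι n)),
    R.hypMetric (pr n) (q n v) (q n v') = Q.hypMetric (ι n) v v'
  /-- the hyperholomorphic connection of the quotient is the one induced by the hyperholomorphic
  connection on `M`: the derivative of an invariant section in a direction tangent to the quotient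
  is its derivative in the direction of the horizontal lift. -/
  hyp_connection : ∀ (s : ∀ x, Q.L.Fiber x) (r : ∀ b, R.L.Fiber b) (n : N),
    Q.L.DiffAt s (ι n) → R.L.DiffAt r (pr n) → (∀ᶠ n' in 𝓝 n, q n' (s (ι n')) = r (pr n')) →
    ∀ v : TangentSpace 𝓘(ℝ, EN) n, IsHorizontal (EG := EG) G H ι n v →
      q n (Q.hyp.cov s (ι n) (mfderiv 𝓘(ℝ, EN) 𝓘(ℝ, E) ι n v))
        = R.hyp.cov r (pr n) (mfderiv 𝓘(ℝ, EN) 𝓘(ℝ, EB) pr n v)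

/-- The fibrewise linear isomorphisms `φ` are an isomorphism of hyperholomorphic line bundles
(over the identity): it is smooth, isometric, parallel and circle-equivariant. -/
structure IsIsomorphism (R : HyperholomorphicLineBundle.{w} HB)
    (R' : HyperholomorphicLineBundle.{w'} HB)
    (φ : ∀ b : B, R.L.Fiber b ≃ₗ[ℂ] R'.L.Fiber b) : Prop where
  smooth : ∀ (r : ∀ b, R.L.Fiber b) (b : B),
    R.L.SmoothAt r b ↔ R'.L.SmoothAt (fun b ↦ φ b (r b)) b
  circle : ∀ (t : Circle) (b : B) (v : R.L.Fiber b),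
    φ (t • b) (R.lift.map t b v) = R'.lift.map t b (φ b v)
  μ_eq : ∀ b, R.μ b = R'.μ b
  isometry : ∀ (b : B) (v v' : R.L.Fiber b),
    R'.h.re.inner b (φ b v) (φ b v') = R.h.re.inner b v v'
  connection : ∀ (r : ∀ b, R.L.Fiber b) (b : B), R.L.DiffAt r b →
    ∀ v : TangentSpace 𝓘(ℝ, EB) b,
      R'.nabla.cov (fun b ↦ φ b (r b)) b v = φ b (R.nabla.cov r b v)
  hyp_connection : ∀ (r : ∀ b, R.L.Fiber b) (b : B), R.L.DiffAt r b →
    ∀ v : TangentSpace 𝓘(ℝ, EB) b,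
      R'.hyp.cov (fun b ↦ φ b (r b)) b v = φ b (R.hyp.cov r b v)

end Quotient

end HyperKahler

end

open HyperKahler

set_option linter.unusedSectionVars false

noncomputable section

namespace HyperKahler

open ComplexLineBundle

/-! ### Exterior derivatives on normed spaces -/

section VectorSpace

variable {P V W : Type*} [NormedAddCommGroup P] [NormedSpace ℝ P]
  [NormedAddCommGroup V] [NormedSpace ℝ V] [NormedAddCommGroup W] [NormedSpace ℝ W]

/-! Everything on the quotient `B` is compared with `M` through `N = ν⁻¹(0)`, by pulling back along
the inclusion `ι` and along the projection `pr`. A local section `σ` of `pr` transfers structure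
from `M` to `B` through `ι ∘ σ`, and identities on `B` are proved by lifting points, vectors and
sections to `N` and `M`.

Hyperkähler structure: the forms of `B` are locally pullbacks of closed forms by `ι ∘ σ`, hence
closed. Closedness suffices (`IsHyperkahler.of_closed`): `ω₂ + i ω₃` is of type (2,0) for `I`,
cyclically for `J` and `K`, and a closed form of this kind with nondegenerate real part kills the
Nijenhuis tensor.

Circle action: `ν₂ + i ν₃` is rotated, so its zero set is preserved. `ν₁` is invariant because it is
read off from a lift that commutes with the lifted circle action (`Lift.momentFunction_smul`).

Prequantum bundle: equivariant frames of `L` along `N` exist over small open subsets of `B`. Their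
quotients are `G`-invariant and form a cocycle on `B`, which defines the new bundle. An invariant
section satisfies `∇_{X_a} s = -i ν₁(a) s`, which vanishes on `N`. Together with the `G`-invariance
of `∇` this shows that the covariant derivative of an equivariant frame along `N` comes from a
1-form on `B` (`DescentFrame.cov_eq_form`), so `∇` descends. Metric, curvature, circle lift and
moment map follow.

Hyperholomorphic connection: compatibility with `e^{2μ} h` and equality of the `∂̄`-operators force
it to be `∇ + dμ - i dμ ∘ I` (`cov_eq_add_hypOne`). The function `μ` descends, and `dμ ∘ I = g(X,
·)` for the generator `X` of the circle action. Pairing with a horizontal vector is the same on `M`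
and on `B`, so the two 1-forms agree on horizontal vectors, which is what the induced connection
sees.

Its curvature is given by the form `ω₁ - d(dμ ∘ I)`. Type (1,1) for `I` follows from `d(dμ) = 0` and
integrability. For `J` and `K` one uses that `dμ ∘ I` is `i_X ω₂` composed with `J` and `i_X ω₃`
composed with `K`, while Cartan's formula gives `d i_X ω₂ = -ω₃` and `d i_X ω₃ = ω₂`. The argument
holds for every hyperholomorphic line bundle and is applied on `B`.

Uniqueness: for two descents `q` and `q'` the maps `q' ∘ q⁻¹` agree along `G`-orbits and define the
only possible isomorphism. It respects all structures since each of them on `B` is determined by its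
counterpart along `N`. -/

/-- The exterior derivative of a vector-valued 1-form on a normed space. -/
def extOne (α : V → V →L[ℝ] W) (p : V) : V →L[ℝ] V →L[ℝ] W :=
  fderiv ℝ α p - (fderiv ℝ α p).flip

/-- The exterior derivative of a 2-form on a normed space. -/
def extTwo (η : V → V →L[ℝ] V →L[ℝ] ℝ) (p a b c : V) : ℝ :=
  fderiv ℝ η p a b c + fderiv ℝ η p b c a + fderiv ℝ η p c a b

theorem extOne_apply (α : V → V →L[ℝ] W) (p a b : V) :
    extOne α p a b = fderiv ℝ α p a b - fderiv ℝ α p b a := rfl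

theorem hasFDerivAt_comp_fderiv {α : V → W} {F : P → V} {F' : P →L[ℝ] V} {p : P}
    (hα : DifferentiableAt ℝ α (F p)) (hF : HasFDerivAt F F' p) :
    HasFDerivAt (fun q ↦ α (F q)) ((fderiv ℝ α (F p)).comp F') p :=
  hα.hasFDerivAt.comp p hF

/-- The derivative of `(α ∘ F) ∘ F'` has one term with the second derivative of `F`. That derivative
is symmetric, so antisymmetrizing removes the term. -/
theorem extOne_pullback {α : V → V →L[ℝ] W} {β : P → P →L[ℝ] W} {F : P → V} {p : P}
    (hα : DifferentiableAt ℝ α (F p)) (hF : ContDiffAt ℝ 2 F p)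
    (hβ : β =ᶠ[𝓝 p] fun q ↦ (α (F q)).comp (fderiv ℝ F q)) (a b : P) :
    extOne β p a b = extOne α (F p) (fderiv ℝ F p a) (fderiv ℝ F p b) := by
  have hF1 : HasFDerivAt F (fderiv ℝ F p) p := (hF.differentiableAt (by norm_num)).hasFDerivAt
  have hF2 : HasFDerivAt (fderiv ℝ F) (fderiv ℝ (fderiv ℝ F) p) p :=
    ((hF.fderiv_right (m := 1) (by norm_num)).differentiableAt (by norm_num)).hasFDerivAt
  have hsymm := hF.isSymmSndFDerivAt (by simp)
  have hd := (hα.hasFDerivAt.comp p hF1).clm_comp hF2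
  have hd' : HasFDerivAt β _ p := hd.congr_of_eventuallyEq hβ
  rw [extOne_apply, extOne_apply, hd'.fderiv]
  simp [hsymm.eq a b]

/-- The terms with second derivatives of `F` cancel in pairs, by their symmetry and the antisymmetry
of `η` at `F p`. Since `β` is prescribed only through its values on pairs of vectors, its
differentiability is a separate hypothesis. -/
theorem extTwo_pullback {η : V → V →L[ℝ] V →L[ℝ] ℝ} {β : P → P →L[ℝ] P →L[ℝ] ℝ} {F : P → V} {p : P}
    (hη : DifferentiableAt ℝ η (F p)) (hanti : ∀ u v, η (F p) u v = - η (F p) v u)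
    (hF : ContDiffAt ℝ 2 F p) (hβd : DifferentiableAt ℝ β p)
    (hβ : ∀ᶠ q in 𝓝 p, ∀ u v, β q u v = η (F q) (fderiv ℝ F q u) (fderiv ℝ F q v)) (a b c : P) :
    extTwo β p a b c
      = extTwo η (F p) (fderiv ℝ F p a) (fderiv ℝ F p b) (fderiv ℝ F p c) := by
  have hF1 : HasFDerivAt F (fderiv ℝ F p) p := (hF.differentiableAt (by norm_num)).hasFDerivAt
  have hF2 : HasFDerivAt (fderiv ℝ F) (fderiv ℝ (fderiv ℝ F) p) p :=
    ((hF.fderiv_right (m := 1) (by norm_num)).differentiableAt (by norm_num)).hasFDerivAt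
  have hsymm := hF.isSymmSndFDerivAt (by simp)
  have h0 := hasFDerivAt_comp_fderiv (W := V →L[ℝ] V →L[ℝ] ℝ) hη hF1
  have key : ∀ u v w : P, fderiv ℝ β p u v w
      = fderiv ℝ η (F p) (fderiv ℝ F p u) (fderiv ℝ F p v) (fderiv ℝ F p w)
        + η (F p) (fderiv ℝ (fderiv ℝ F) p u v) (fderiv ℝ F p w)
        + η (F p) (fderiv ℝ F p v) (fderiv ℝ (fderiv ℝ F) p u w) := by
    intro u v w
    have h1 : HasFDerivAt (fun q ↦ β q v w) _ p :=
      (hβd.hasFDerivAt.clm_apply (hasFDerivAt_const v p)).clm_apply (hasFDerivAt_const w p)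
    have h2 := (h0.clm_apply (hF2.clm_apply (hasFDerivAt_const v p))).clm_apply
      (hF2.clm_apply (hasFDerivAt_const w p))
    have h3 : HasFDerivAt (fun q ↦ β q v w) _ p :=
      h2.congr_of_eventuallyEq (hβ.mono fun q hq ↦ by simp [hq])
    have := congrArg (fun L : P →L[ℝ] ℝ ↦ L u) (h1.unique h3)
    simp at this
    rw [this]; ring
  simp only [extTwo, key, hsymm.eq b a, hsymm.eq c a, hsymm.eq c b]
  rw [hanti (fderiv ℝ F p a) (fderiv ℝ (fderiv ℝ F) p b c),
    hanti (fderiv ℝ F p b) (fderiv ℝ (fderiv ℝ F) p a c),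
    hanti (fderiv ℝ F p c) (fderiv ℝ (fderiv ℝ F) p a b)]
  ring

/-- The derivatives of the fields `X` and `Y` produced by the product rule are exactly the two terms
of the bracket. -/
theorem extOne_lieBracket {α : V → V →L[ℝ] W} {X Y : V → V} {p : V}
    (hα : DifferentiableAt ℝ α p) (hX : DifferentiableAt ℝ X p) (hY : DifferentiableAt ℝ Y p) :
    fderiv ℝ (fun q ↦ α q (Y q)) p (X p) - fderiv ℝ (fun q ↦ α q (X q)) p (Y p)
      - α p (VectorField.lieBracket ℝ X Y p) = extOne α p (X p) (Y p) := by
  rw [(hα.hasFDerivAt.clm_apply hX.hasFDerivAt).fderiv,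
    (hα.hasFDerivAt.clm_apply hY.hasFDerivAt).fderiv, VectorField.lieBracket, extOne_apply]
  simp
  abel

theorem extTwo_lieBracket {η : V → V →L[ℝ] V →L[ℝ] ℝ} {X Y Z : V → V} {p : V}
    (hη : DifferentiableAt ℝ η p) (hanti : ∀ u v, η p u v = - η p v u)
    (hX : DifferentiableAt ℝ X p) (hY : DifferentiableAt ℝ Y p) (hZ : DifferentiableAt ℝ Z p) :
    fderiv ℝ (fun q ↦ η q (Y q) (Z q)) p (X p) + fderiv ℝ (fun q ↦ η q (Z q) (X q)) p (Y p)
      + fderiv ℝ (fun q ↦ η q (X q) (Y q)) p (Z p)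
      - η p (VectorField.lieBracket ℝ X Y p) (Z p)
      - η p (VectorField.lieBracket ℝ Y Z p) (X p)
      - η p (VectorField.lieBracket ℝ Z X p) (Y p) = extTwo η p (X p) (Y p) (Z p) := by
  have hη' := hη.hasFDerivAt
  rw [((hη'.clm_apply hY.hasFDerivAt).clm_apply hZ.hasFDerivAt).fderiv,
    ((hη'.clm_apply hZ.hasFDerivAt).clm_apply hX.hasFDerivAt).fderiv,
    ((hη'.clm_apply hX.hasFDerivAt).clm_apply hY.hasFDerivAt).fderiv]
  simp only [VectorField.lieBracket, extTwo, map_sub]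
  simp
  rw [hanti (X p) (fderiv ℝ Y p (Z p)), hanti (Y p) (fderiv ℝ Z p (X p)),
    hanti (Z p) (fderiv ℝ X p (Y p))]
  ring

end VectorSpace

/-- In finite dimension a linear map is a tuple of values on a basis. -/
theorem contDiffAt_clm_of_apply {D E F : Type*} [NormedAddCommGroup D] [NormedSpace ℝ D]
    [NormedAddCommGroup E] [NormedSpace ℝ E] [NormedAddCommGroup F] [NormedSpace ℝ F]
    [FiniteDimensional ℝ E] {n : ℕ∞ω} {f : D → E →L[ℝ] F} {p : D}
    (h : ∀ u, ContDiffAt ℝ n (fun z ↦ f z u) p) : ContDiffAt ℝ n f p := by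
  let d := Module.finrank ℝ E
  have hd : d = Module.finrank ℝ (Fin d → ℝ) := (Module.finrank_fin_fun ℝ).symm
  let e₁ := ContinuousLinearEquiv.ofFinrankEq hd
  let e₂ := (e₁.arrowCongr (1 : F ≃L[ℝ] F)).trans (ContinuousLinearEquiv.piRing (Fin d))
  rw [← Function.id_comp f, ← e₂.symm_comp_self]
  exact e₂.symm.contDiff.contDiffAt.comp p (contDiffAt_pi.mpr fun i ↦ h _)

/-! ### Vector fields and forms in coordinates -/

section Coordinates

variable {E : Type*} [NormedAddCommGroup E] [NormedSpace ℝ E] [FiniteDimensional ℝ E]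
  {M : Type*} [TopologicalSpace M] [ChartedSpace E M] [IsManifold 𝓘(ℝ, E) ∞ M]
  {W : Type*} [NormedAddCommGroup W] [NormedSpace ℝ W]

/-- The inclusion of the model space into the tangent space at `y`, in the chart at `x`. -/
def frameAt (x y : M) : E →L[ℝ] TangentSpace 𝓘(ℝ, E) y :=
  (trivializationAt E (fun x : M ↦ TangentSpace 𝓘(ℝ, E) x) x).symmL ℝ y

/-- The coordinates of a tangent vector at `y` in the chart at `x`. -/
def coframeAt (x y : M) : TangentSpace 𝓘(ℝ, E) y →L[ℝ] E :=
  (trivializationAt E (fun x : M ↦ TangentSpace 𝓘(ℝ, E) x) x).continuousLinearMapAt ℝ y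

theorem coframeAt_apply {x y : M} (hy : y ∈ (chartAt E x).source) (v : TangentSpace 𝓘(ℝ, E) y) :
    coframeAt x y v = (trivializationAt E (fun x : M ↦ TangentSpace 𝓘(ℝ, E) x) x ⟨y, v⟩).2 := by
  rw [coframeAt, Trivialization.continuousLinearMapAt_apply,
    Trivialization.linearMapAt_apply, if_pos (by simpa using hy)]

theorem frameAt_coframeAt {x y : M} (hy : y ∈ (chartAt E x).source)
    (v : TangentSpace 𝓘(ℝ, E) y) : frameAt x y (coframeAt x y v) = v :=
  (trivializationAt E (fun x : M ↦ TangentSpace 𝓘(ℝ, E) x) x).symmL_continuousLinearMapAt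
    (by simpa using hy) v

theorem coframeAt_frameAt {x y : M} (hy : y ∈ (chartAt E x).source) (v : E) :
    coframeAt x y (frameAt x y v) = v :=
  (trivializationAt E (fun x : M ↦ TangentSpace 𝓘(ℝ, E) x) x).continuousLinearMapAt_symmL
    (by simpa using hy) v

theorem mfderivWithin_symm_eq_frameAt {x : M} {z : E} (hz : z ∈ (extChartAt 𝓘(ℝ, E) x).target) :
    mfderivWithin 𝓘(ℝ, E) 𝓘(ℝ, E) (extChartAt 𝓘(ℝ, E) x).symm (Set.range 𝓘(ℝ, E)) z
      = frameAt (E := E) x ((extChartAt 𝓘(ℝ, E) x).symm z) := by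
  have h := TangentBundle.symmL_trivializationAt (I := 𝓘(ℝ, E)) (x₀ := x)
    (x := (extChartAt 𝓘(ℝ, E) x).symm z) (by simpa using (extChartAt 𝓘(ℝ, E) x).map_target hz)
  rw [(extChartAt 𝓘(ℝ, E) x).right_inv hz] at h
  exact h.symm

theorem mfderiv_symm_eq_frameAt {x : M} {z : E} (hz : z ∈ (extChartAt 𝓘(ℝ, E) x).target) :
    mfderiv 𝓘(ℝ, E) 𝓘(ℝ, E) (extChartAt 𝓘(ℝ, E) x).symm z
      = frameAt (E := E) x ((extChartAt 𝓘(ℝ, E) x).symm z) := by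
  rw [← mfderivWithin_symm_eq_frameAt hz, modelWithCornersSelf_coe, Set.range_id,
    mfderivWithin_univ]

theorem coframeAt_eq_mfderiv {x y : M} (hy : y ∈ (chartAt E x).source) :
    coframeAt x y = mfderiv 𝓘(ℝ, E) 𝓘(ℝ, E) (extChartAt 𝓘(ℝ, E) x) y :=
  TangentBundle.continuousLinearMapAt_trivializationAt (I := 𝓘(ℝ, E)) hy

/-- The tangent space at `x` is the model space seen through the preferred chart at `x`, so
coordinates in that chart are the vector itself. Computations in the chart at `x` can therefore be
read at `x` without a change of frame. -/
theorem coframeAt_self (x : M) (v : TangentSpace 𝓘(ℝ, E) x) : coframeAt x x v = v := by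
  have h := TangentBundle.continuousLinearMapAt_trivializationAt_eq_core (I := 𝓘(ℝ, E))
    (mem_chart_source E x)
  refine (congrArg (fun L : TangentSpace 𝓘(ℝ, E) x →L[ℝ] E ↦ L v) h).trans ?_
  exact (tangentBundleCore 𝓘(ℝ, E) M).coordChange_self (achart E x) x (mem_chart_source E x) v

theorem frameAt_self (x : M) (v : E) : frameAt x x v = v := by
  have h := coframeAt_frameAt (mem_chart_source E x) v
  rw [coframeAt_self] at h
  exact h

/-- These chart-constant fields are the test fields with which tensorial identities are evaluated on
given vectors. -/
theorem smoothFieldAt_frameAt (x : M) (u : E) :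
    SmoothFieldAt (fun y : M ↦ frameAt x y u) x := by
  rw [SmoothFieldAt, contMDiffAt_section]
  refine (contMDiffAt_const (c := u)).congr_of_eventuallyEq ?_
  filter_upwards [(chartAt E x).open_source.mem_nhds (mem_chart_source E x)] with y hy
  exact (coframeAt_apply hy _).symm.trans (coframeAt_frameAt hy u)

theorem symm_tendsto (x : M) : Filter.Tendsto (extChartAt 𝓘(ℝ, E) x).symm
    (𝓝 (extChartAt 𝓘(ℝ, E) x x)) (𝓝 x) := by
  have := (continuousAt_extChartAt_symm (I := 𝓘(ℝ, E)) x).tendsto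
  rwa [extChartAt_to_inv] at this

theorem eventually_symm_mem_source (x : M) : ∀ᶠ z in 𝓝 (extChartAt 𝓘(ℝ, E) x x),
    (extChartAt 𝓘(ℝ, E) x).symm z ∈ (chartAt E x).source :=
  (symm_tendsto x).eventually ((chartAt E x).open_source.mem_nhds (mem_chart_source E x))

theorem contMDiffAt_symm (x : M) : ContMDiffAt 𝓘(ℝ, E) 𝓘(ℝ, E) ∞ (extChartAt 𝓘(ℝ, E) x).symm
    (extChartAt 𝓘(ℝ, E) x x) :=
  (contMDiffOn_extChartAt_symm x).contMDiffAt (extChartAt_target_mem_nhds x)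

theorem contDiffAt_comp_symm {f : M → W} {x : M} {n : ℕ∞ω} (hn : n ≤ ∞)
    (hf : ContMDiffAt 𝓘(ℝ, E) 𝓘(ℝ, W) n f x) :
    ContDiffAt ℝ n (fun z ↦ f ((extChartAt 𝓘(ℝ, E) x).symm z)) (extChartAt 𝓘(ℝ, E) x x) := by
  rw [← contMDiffAt_iff_contDiffAt]
  refine ContMDiffAt.comp _ (g := f) ?_ ((contMDiffAt_symm x).of_le hn)
  rwa [extChartAt_to_inv]

/-- A vector field in the chart at `x`. -/
def fieldCoord (x : M) (X : ∀ y : M, TangentSpace 𝓘(ℝ, E) y) (z : E) : E :=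
  coframeAt x ((extChartAt 𝓘(ℝ, E) x).symm z) (X ((extChartAt 𝓘(ℝ, E) x).symm z))

/-- A 1-form in the chart at `x`. -/
def oneCoord (x : M) (α : ∀ y : M, TangentSpace 𝓘(ℝ, E) y →L[ℝ] W) (z : E) : E →L[ℝ] W :=
  (α ((extChartAt 𝓘(ℝ, E) x).symm z)).comp (frameAt x ((extChartAt 𝓘(ℝ, E) x).symm z))

/-- A 2-form in the chart at `x`. -/
def twoCoord (x : M) (α : ∀ y : M, TangentSpace 𝓘(ℝ, E) y →L[ℝ] TangentSpace 𝓘(ℝ, E) y →L[ℝ] ℝ)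
    (z : E) : E →L[ℝ] E →L[ℝ] ℝ :=
  let A : E →L[ℝ] E →L[ℝ] ℝ := α ((extChartAt 𝓘(ℝ, E) x).symm z)
  let S : E →L[ℝ] E := frameAt x ((extChartAt 𝓘(ℝ, E) x).symm z)
  A.bilinearComp S S

theorem oneCoord_apply (x : M) (α : ∀ y : M, TangentSpace 𝓘(ℝ, E) y →L[ℝ] W) (z u : E) :
    oneCoord x α z u = α ((extChartAt 𝓘(ℝ, E) x).symm z) (frameAt x _ u) := rfl

theorem twoCoord_apply (x : M)
    (α : ∀ y : M, TangentSpace 𝓘(ℝ, E) y →L[ℝ] TangentSpace 𝓘(ℝ, E) y →L[ℝ] ℝ) (z u v : E) :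
    twoCoord x α z u v
      = α ((extChartAt 𝓘(ℝ, E) x).symm z) (frameAt x _ u) (frameAt x _ v) := rfl

/-- The 1-form `α` is smooth at `x`. -/
def SmoothOneAt (α : ∀ y : M, TangentSpace 𝓘(ℝ, E) y →L[ℝ] W) (x : M) : Prop :=
  ∀ X : ∀ y : M, TangentSpace 𝓘(ℝ, E) y, SmoothFieldAt X x →
    ContMDiffAt 𝓘(ℝ, E) 𝓘(ℝ, W) ∞ (fun y ↦ α y (X y)) x

/-- The 2-form `α` is smooth at `x`. -/
def SmoothTwoAt (α : ∀ y : M, TangentSpace 𝓘(ℝ, E) y →L[ℝ] TangentSpace 𝓘(ℝ, E) y →L[ℝ] ℝ)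
    (x : M) : Prop :=
  ∀ X Y : ∀ y : M, TangentSpace 𝓘(ℝ, E) y, SmoothFieldAt X x → SmoothFieldAt Y x →
    ContMDiffAt 𝓘(ℝ, E) 𝓘(ℝ, ℝ) ∞ (fun y ↦ α y (X y) (Y y)) x

theorem contDiffAt_fieldCoord {x : M} {X : ∀ y : M, TangentSpace 𝓘(ℝ, E) y}
    (hX : SmoothFieldAt X x) : ContDiffAt ℝ ∞ (fieldCoord x X) (extChartAt 𝓘(ℝ, E) x x) := by
  rw [SmoothFieldAt, contMDiffAt_section] at hX
  refine (contDiffAt_comp_symm le_rfl hX).congr_of_eventuallyEq ?_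
  filter_upwards [eventually_symm_mem_source x] with z hz
  exact coframeAt_apply hz _

/-- Smoothness of a form is defined by testing on fields; the chart-constant fields already give
every component. -/
theorem contDiffAt_oneCoord {x : M} {α : ∀ y : M, TangentSpace 𝓘(ℝ, E) y →L[ℝ] W}
    (hα : SmoothOneAt α x) : ContDiffAt ℝ ∞ (oneCoord x α) (extChartAt 𝓘(ℝ, E) x x) :=
  contDiffAt_clm_of_apply fun u ↦ contDiffAt_comp_symm le_rfl (hα _ (smoothFieldAt_frameAt x u))

theorem contDiffAt_twoCoord {x : M}
    {α : ∀ y : M, TangentSpace 𝓘(ℝ, E) y →L[ℝ] TangentSpace 𝓘(ℝ, E) y →L[ℝ] ℝ}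
    (hα : SmoothTwoAt α x) : ContDiffAt ℝ ∞ (twoCoord x α) (extChartAt 𝓘(ℝ, E) x x) :=
  contDiffAt_clm_of_apply fun u ↦ contDiffAt_clm_of_apply fun v ↦
    contDiffAt_comp_symm le_rfl (hα _ _ (smoothFieldAt_frameAt x u) (smoothFieldAt_frameAt x v))

theorem fieldCoord_self (x : M) (X : ∀ y : M, TangentSpace 𝓘(ℝ, E) y) :
    fieldCoord x X (extChartAt 𝓘(ℝ, E) x x) = X x := by
  rw [fieldCoord, extChartAt_to_inv]
  exact coframeAt_self x _

theorem oneCoord_self (x : M) (α : ∀ y : M, TangentSpace 𝓘(ℝ, E) y →L[ℝ] W) :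
    oneCoord x α (extChartAt 𝓘(ℝ, E) x x) = (α x : E →L[ℝ] W) := by
  ext u
  rw [oneCoord_apply, extChartAt_to_inv, frameAt_self]
  rfl

theorem twoCoord_self (x : M)
    (α : ∀ y : M, TangentSpace 𝓘(ℝ, E) y →L[ℝ] TangentSpace 𝓘(ℝ, E) y →L[ℝ] ℝ) :
    twoCoord x α (extChartAt 𝓘(ℝ, E) x x) = (α x : E →L[ℝ] E →L[ℝ] ℝ) := by
  ext u v
  rw [twoCoord_apply, extChartAt_to_inv, frameAt_self, frameAt_self]
  rfl

theorem oneCoord_fieldCoord {x : M} (α : ∀ y : M, TangentSpace 𝓘(ℝ, E) y →L[ℝ] W)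
    (X : ∀ y : M, TangentSpace 𝓘(ℝ, E) y) {z : E}
    (hz : (extChartAt 𝓘(ℝ, E) x).symm z ∈ (chartAt E x).source) :
    oneCoord x α z (fieldCoord x X z) = α ((extChartAt 𝓘(ℝ, E) x).symm z) (X _) := by
  rw [oneCoord_apply, fieldCoord, frameAt_coframeAt hz]

theorem twoCoord_fieldCoord {x : M}
    (α : ∀ y : M, TangentSpace 𝓘(ℝ, E) y →L[ℝ] TangentSpace 𝓘(ℝ, E) y →L[ℝ] ℝ)
    (X Y : ∀ y : M, TangentSpace 𝓘(ℝ, E) y) {z : E}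
    (hz : (extChartAt 𝓘(ℝ, E) x).symm z ∈ (chartAt E x).source) :
    twoCoord x α z (fieldCoord x X z) (fieldCoord x Y z)
      = α ((extChartAt 𝓘(ℝ, E) x).symm z) (X _) (Y _) := by
  rw [twoCoord_apply, fieldCoord, fieldCoord, frameAt_coframeAt hz, frameAt_coframeAt hz]

theorem mvfderiv_eq_fderiv_symm {f : M → W} {x : M} (hf : MDifferentiableAt 𝓘(ℝ, E) 𝓘(ℝ, W) f x) :
    mvfderiv 𝓘(ℝ, E) f x
      = (fderiv ℝ (fun z ↦ f ((extChartAt 𝓘(ℝ, E) x).symm z)) (extChartAt 𝓘(ℝ, E) x x) :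
        E →L[ℝ] W) := by
  have h : mvfderiv 𝓘(ℝ, E) f x = (fderivWithin ℝ (writtenInExtChartAt 𝓘(ℝ, E) 𝓘(ℝ, W) x f)
      (Set.range 𝓘(ℝ, E)) (extChartAt 𝓘(ℝ, E) x x) : E →L[ℝ] W) := by
    rw [mvfderiv, hf.mfderiv]
    rfl
  refine h.trans ?_
  rw [modelWithCornersSelf_coe, Set.range_id, fderivWithin_univ]
  rfl

/-- The bracket on a manifold is the bracket of the fields pulled back to the chart, followed by the
inverse of the differential of the chart at `x`, which is the identity. -/
theorem mlieBracket_eq_lieBracket (X Y : ∀ y : M, TangentSpace 𝓘(ℝ, E) y) (x : M) :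
    VectorField.mlieBracket 𝓘(ℝ, E) X Y x
      = VectorField.lieBracket ℝ (fieldCoord x X) (fieldCoord x Y) (extChartAt 𝓘(ℝ, E) x x) := by
  have key : ∀ Z : ∀ y : M, TangentSpace 𝓘(ℝ, E) y,
      (fun z ↦ VectorField.mpullbackWithin 𝓘(ℝ, E) 𝓘(ℝ, E) (extChartAt 𝓘(ℝ, E) x).symm Z
        (Set.range 𝓘(ℝ, E)) z) =ᶠ[𝓝 (extChartAt 𝓘(ℝ, E) x x)] fieldCoord x Z := by
    intro Z
    filter_upwards [eventually_symm_mem_source x, extChartAt_target_mem_nhds (I := 𝓘(ℝ, E)) x]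
      with z hz hzt
    have h3 : (frameAt (E := E) x ((extChartAt 𝓘(ℝ, E) x).symm z)).inverse
        = coframeAt x ((extChartAt 𝓘(ℝ, E) x).symm z) :=
      ContinuousLinearMap.inverse_eq (by ext v; exact frameAt_coframeAt hz v)
        (by ext v; exact coframeAt_frameAt hz v)
    rw [VectorField.mpullbackWithin_apply, mfderivWithin_symm_eq_frameAt hzt]
    exact congrArg (fun L : TangentSpace 𝓘(ℝ, E) ((extChartAt 𝓘(ℝ, E) x).symm z) →L[ℝ] E ↦
      L (Z _)) h3
  have hid : ∀ v : E, (mfderiv 𝓘(ℝ, E) 𝓘(ℝ, E) (extChartAt 𝓘(ℝ, E) x) x).inverse v = v := by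
    intro v
    have h3 : (coframeAt (E := E) x x).inverse = frameAt (E := E) x x :=
      ContinuousLinearMap.inverse_eq
        (by ext v; exact coframeAt_frameAt (mem_chart_source E x) v)
        (by ext v; exact frameAt_coframeAt (mem_chart_source E x) v)
    rw [coframeAt_eq_mfderiv (mem_chart_source E x)] at h3
    exact (congrArg (fun L : E →L[ℝ] TangentSpace 𝓘(ℝ, E) x ↦ L v) h3).trans (frameAt_self x v)
  refine (hid _).trans ?_
  have hX := key X
  have hY := key Y
  have hs : (extChartAt 𝓘(ℝ, E) x).symm ⁻¹' Set.univ ∩ Set.range 𝓘(ℝ, E) = Set.univ := by simp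
  refine (congrArg (fun s ↦ VectorField.lieBracketWithin ℝ _ _ s _) hs).trans ?_
  refine (congrFun VectorField.lieBracketWithin_univ _).trans ?_
  exact Filter.EventuallyEq.lieBracket_vectorField_eq hX hY

/-- The exterior derivative of a vector-valued 1-form on a manifold. -/
def extD (α : ∀ y : M, TangentSpace 𝓘(ℝ, E) y →L[ℝ] W) (x : M) :
    TangentSpace 𝓘(ℝ, E) x →L[ℝ] TangentSpace 𝓘(ℝ, E) x →L[ℝ] W :=
  (extOne (oneCoord x α) (extChartAt 𝓘(ℝ, E) x x) : E →L[ℝ] E →L[ℝ] W)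

/-- The invariant formula for the exterior derivative of a 1-form. -/
theorem extD_apply_fields {α : ∀ y : M, TangentSpace 𝓘(ℝ, E) y →L[ℝ] W} {x : M}
    (hα : SmoothOneAt α x) {X Y : ∀ y : M, TangentSpace 𝓘(ℝ, E) y}
    (hX : SmoothFieldAt X x) (hY : SmoothFieldAt Y x) :
    mvfderiv 𝓘(ℝ, E) (fun y ↦ α y (Y y)) x (X x)
      - mvfderiv 𝓘(ℝ, E) (fun y ↦ α y (X y)) x (Y x)
      - α x (VectorField.mlieBracket 𝓘(ℝ, E) X Y x) = extD α x (X x) (Y x) := by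
  have h := extOne_lieBracket ((contDiffAt_oneCoord hα).differentiableAt (by simp))
    ((contDiffAt_fieldCoord hX).differentiableAt (by simp))
    ((contDiffAt_fieldCoord hY).differentiableAt (by simp))
  have hev : ∀ Z : ∀ y : M, TangentSpace 𝓘(ℝ, E) y,
      fderiv ℝ (fun z ↦ oneCoord x α z (fieldCoord x Z z)) (extChartAt 𝓘(ℝ, E) x x)
        = fderiv ℝ (fun z ↦ α ((extChartAt 𝓘(ℝ, E) x).symm z) (Z _)) (extChartAt 𝓘(ℝ, E) x x) :=
    fun Z ↦ Filter.EventuallyEq.fderiv_eq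
      ((eventually_symm_mem_source x).mono fun z hz ↦ oneCoord_fieldCoord α Z hz)
  rw [hev, hev, fieldCoord_self, fieldCoord_self, oneCoord_self] at h
  rw [mvfderiv_eq_fderiv_symm ((hα Y hY).mdifferentiableAt (by simp)),
    mvfderiv_eq_fderiv_symm ((hα X hX).mdifferentiableAt (by simp)), mlieBracket_eq_lieBracket]
  exact h

theorem dfun_eq_mvfderiv (f : M → ℝ) (x : M) (v : TangentSpace 𝓘(ℝ, E) x) :
    dfun f x v = mvfderiv 𝓘(ℝ, E) f x v := rfl

/-- The invariant formula for the exterior derivative of a 2-form. -/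
theorem extTwo_apply_fields
    {α : ∀ y : M, TangentSpace 𝓘(ℝ, E) y →L[ℝ] TangentSpace 𝓘(ℝ, E) y →L[ℝ] ℝ} {x : M}
    (hα : SmoothTwoAt α x) (hanti : ∀ u v, α x u v = - α x v u)
    {X Y Z : ∀ y : M, TangentSpace 𝓘(ℝ, E) y}
    (hX : SmoothFieldAt X x) (hY : SmoothFieldAt Y x) (hZ : SmoothFieldAt Z x) :
    dfun (fun y ↦ α y (Y y) (Z y)) x (X x) + dfun (fun y ↦ α y (Z y) (X y)) x (Y x)
      + dfun (fun y ↦ α y (X y) (Y y)) x (Z x)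
      - α x (VectorField.mlieBracket 𝓘(ℝ, E) X Y x) (Z x)
      - α x (VectorField.mlieBracket 𝓘(ℝ, E) Y Z x) (X x)
      - α x (VectorField.mlieBracket 𝓘(ℝ, E) Z X x) (Y x)
    = extTwo (twoCoord x α) (extChartAt 𝓘(ℝ, E) x x) (X x) (Y x) (Z x) := by
  have h := extTwo_lieBracket ((contDiffAt_twoCoord hα).differentiableAt (by simp))
    (fun u v ↦ by rw [twoCoord_self]; exact hanti u v)
    ((contDiffAt_fieldCoord hX).differentiableAt (by simp))
    ((contDiffAt_fieldCoord hY).differentiableAt (by simp))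
    ((contDiffAt_fieldCoord hZ).differentiableAt (by simp))
  have hev : ∀ Z Z' : ∀ y : M, TangentSpace 𝓘(ℝ, E) y,
      fderiv ℝ (fun z ↦ twoCoord x α z (fieldCoord x Z z) (fieldCoord x Z' z))
          (extChartAt 𝓘(ℝ, E) x x)
        = fderiv ℝ (fun z ↦ α ((extChartAt 𝓘(ℝ, E) x).symm z) (Z _) (Z' _))
          (extChartAt 𝓘(ℝ, E) x x) :=
    fun Z Z' ↦ Filter.EventuallyEq.fderiv_eq
      ((eventually_symm_mem_source x).mono fun z hz ↦ twoCoord_fieldCoord α Z Z' hz)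
  rw [hev, hev, hev, fieldCoord_self, fieldCoord_self, fieldCoord_self, twoCoord_self] at h
  rw [dfun_eq_mvfderiv, dfun_eq_mvfderiv, dfun_eq_mvfderiv,
    mvfderiv_eq_fderiv_symm ((hα Y Z hY hZ).mdifferentiableAt (by simp)),
    mvfderiv_eq_fderiv_symm ((hα Z X hZ hX).mdifferentiableAt (by simp)),
    mvfderiv_eq_fderiv_symm ((hα X Y hX hY).mdifferentiableAt (by simp)),
    mlieBracket_eq_lieBracket, mlieBracket_eq_lieBracket, mlieBracket_eq_lieBracket]
  exact h

end Coordinates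

/-! ### Pullback of forms -/

section Pullback

variable {E : Type*} [NormedAddCommGroup E] [NormedSpace ℝ E] [FiniteDimensional ℝ E]
  {M : Type*} [TopologicalSpace M] [ChartedSpace E M] [IsManifold 𝓘(ℝ, E) ∞ M]
  {EB : Type*} [NormedAddCommGroup EB] [NormedSpace ℝ EB] [FiniteDimensional ℝ EB]
  {B : Type*} [TopologicalSpace B] [ChartedSpace EB B] [IsManifold 𝓘(ℝ, EB) ∞ B]
  {W : Type*} [NormedAddCommGroup W] [NormedSpace ℝ W]

theorem eventually_mdifferentiableAt {f : B → M} {b : B}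
    (hf : ContMDiffAt 𝓘(ℝ, EB) 𝓘(ℝ, E) ∞ f b) :
    ∀ᶠ y in 𝓝 b, MDifferentiableAt 𝓘(ℝ, EB) 𝓘(ℝ, E) f y := by
  have h1 : ContMDiffAt 𝓘(ℝ, EB) 𝓘(ℝ, E) 1 f b := hf.of_le (by simp)
  have : IsManifold 𝓘(ℝ, EB) 1 B := .of_le (n := ∞) (by simp)
  have : IsManifold 𝓘(ℝ, E) 1 M := .of_le (n := ∞) (by simp)
  exact ((contMDiffAt_iff_contMDiffAt_nhds (by simp)).1 h1).mono fun y hy ↦ hy.mdifferentiableAt (by simp)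

/-- A map between manifolds in the charts at `b` and `f b`. -/
def mapCoord (f : B → M) (b : B) (z : EB) : E :=
  extChartAt 𝓘(ℝ, E) (f b) (f ((extChartAt 𝓘(ℝ, EB) b).symm z))

theorem contDiffAt_mapCoord {f : B → M} {b : B} (hf : ContMDiffAt 𝓘(ℝ, EB) 𝓘(ℝ, E) ∞ f b) :
    ContDiffAt ℝ ∞ (mapCoord (E := E) (EB := EB) f b) (extChartAt 𝓘(ℝ, EB) b b) := by
  have := (contMDiffAt_iff.1 hf).2
  rw [modelWithCornersSelf_coe, Set.range_id, contDiffWithinAt_univ] at this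
  exact this

theorem mapCoord_self (f : B → M) (b : B) :
    mapCoord (E := E) (EB := EB) f b (extChartAt 𝓘(ℝ, EB) b b) = extChartAt 𝓘(ℝ, E) (f b) (f b) := by
  rw [mapCoord, extChartAt_to_inv]

/-- The chain rule in charts. It is needed on a neighbourhood, not only at the point, because the
pullback relation between forms is going to be differentiated. -/
theorem eventually_frameAt_fderiv_mapCoord {f : B → M} {b : B}
    (hf : ContMDiffAt 𝓘(ℝ, EB) 𝓘(ℝ, E) ∞ f b) :
    ∀ᶠ z in 𝓝 (extChartAt 𝓘(ℝ, EB) b b),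
      f ((extChartAt 𝓘(ℝ, EB) b).symm z) ∈ (chartAt E (f b)).source ∧
      ∀ u : EB, frameAt (f b) (f ((extChartAt 𝓘(ℝ, EB) b).symm z))
          (fderiv ℝ (mapCoord (E := E) (EB := EB) f b) z u)
        = mfderiv 𝓘(ℝ, EB) 𝓘(ℝ, E) f ((extChartAt 𝓘(ℝ, EB) b).symm z) (frameAt b _ u) := by
  have h2 : ∀ᶠ y in 𝓝 b, f y ∈ (chartAt E (f b)).source :=
    hf.continuousAt.eventually ((chartAt E (f b)).open_source.mem_nhds (mem_chart_source E (f b)))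
  filter_upwards [eventually_symm_mem_source (E := EB) b,
    (extChartAt_target_mem_nhds (I := 𝓘(ℝ, EB)) b),
    (symm_tendsto (E := EB) b).eventually (eventually_mdifferentiableAt hf),
    (symm_tendsto (E := EB) b).eventually h2] with z hz hzt hd hs
  refine ⟨hs, fun u ↦ ?_⟩
  have e1 : HasMFDerivAt 𝓘(ℝ, EB) 𝓘(ℝ, EB) (extChartAt 𝓘(ℝ, EB) b).symm z
      (frameAt (E := EB) b ((extChartAt 𝓘(ℝ, EB) b).symm z)) := by
    rw [← mfderiv_symm_eq_frameAt hzt]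
    exact ((contMDiffOn_extChartAt_symm b).contMDiffAt
      ((isOpen_extChartAt_target b).mem_nhds hzt)).mdifferentiableAt (n := ∞) (by simp)
      |>.hasMFDerivAt
  have e3 : HasMFDerivAt 𝓘(ℝ, E) 𝓘(ℝ, E) (extChartAt 𝓘(ℝ, E) (f b))
      (f ((extChartAt 𝓘(ℝ, EB) b).symm z))
      (coframeAt (E := E) (f b) (f ((extChartAt 𝓘(ℝ, EB) b).symm z))) := by
    rw [coframeAt_eq_mfderiv hs]
    exact (mdifferentiableAt_extChartAt hs).hasMFDerivAt
  have e4 := (e3.comp z (hd.hasMFDerivAt.comp z e1))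
  have e5 := e4.mfderiv
  rw [mfderiv_eq_fderiv] at e5
  have e6 : fderiv ℝ (mapCoord (E := E) (EB := EB) f b) z u
      = coframeAt (f b) (f ((extChartAt 𝓘(ℝ, EB) b).symm z))
        (mfderiv 𝓘(ℝ, EB) 𝓘(ℝ, E) f ((extChartAt 𝓘(ℝ, EB) b).symm z) (frameAt b _ u)) :=
    congrArg (fun L : EB →L[ℝ] E ↦ L u) e5
  rw [e6, frameAt_coframeAt hs]

theorem fderiv_mapCoord_self {f : B → M} {b : B} (hf : ContMDiffAt 𝓘(ℝ, EB) 𝓘(ℝ, E) ∞ f b) :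
    fderiv ℝ (mapCoord (E := E) (EB := EB) f b) (extChartAt 𝓘(ℝ, EB) b b)
      = (mfderiv 𝓘(ℝ, EB) 𝓘(ℝ, E) f b : EB →L[ℝ] E) := by
  ext u
  have h := (eventually_frameAt_fderiv_mapCoord hf).self_of_nhds.2 u
  rw [extChartAt_to_inv, frameAt_self, frameAt_self] at h
  exact h

theorem extD_pullback {f : B → M} {b : B} (hf : ContMDiffAt 𝓘(ℝ, EB) 𝓘(ℝ, E) ∞ f b)
    {α : ∀ y : M, TangentSpace 𝓘(ℝ, E) y →L[ℝ] W} (hα : SmoothOneAt α (f b))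
    {β : ∀ y : B, TangentSpace 𝓘(ℝ, EB) y →L[ℝ] W}
    (hβ : ∀ᶠ y in 𝓝 b, ∀ u, β y u = α (f y) (mfderiv 𝓘(ℝ, EB) 𝓘(ℝ, E) f y u))
    (u v : TangentSpace 𝓘(ℝ, EB) b) :
    extD β b u v = extD α (f b) (mfderiv 𝓘(ℝ, EB) 𝓘(ℝ, E) f b u)
      (mfderiv 𝓘(ℝ, EB) 𝓘(ℝ, E) f b v) := by
  have hd : DifferentiableAt ℝ (oneCoord (f b) α)
      (mapCoord (E := E) (EB := EB) f b (extChartAt 𝓘(ℝ, EB) b b)) := by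
    rw [mapCoord_self]
    exact (contDiffAt_oneCoord hα).differentiableAt (by simp)
  have h := extOne_pullback (β := oneCoord b β) hd
    ((contDiffAt_mapCoord hf).of_le ENat.LEInfty.out) ?_ u v
  · rw [fderiv_mapCoord_self hf, mapCoord_self] at h
    exact h
  · filter_upwards [eventually_frameAt_fderiv_mapCoord hf,
      (symm_tendsto (E := EB) b).eventually hβ] with z hz hz'
    ext w
    have h1 : (extChartAt 𝓘(ℝ, E) (f b)).symm (mapCoord (E := E) (EB := EB) f b z)
        = f ((extChartAt 𝓘(ℝ, EB) b).symm z) :=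
      (extChartAt 𝓘(ℝ, E) (f b)).left_inv (by rw [extChartAt_source]; exact hz.1)
    rw [ContinuousLinearMap.comp_apply, oneCoord_apply, oneCoord_apply, h1, hz.2, hz']

theorem extTwo_pullback_manifold {f : B → M} {b : B} (hf : ContMDiffAt 𝓘(ℝ, EB) 𝓘(ℝ, E) ∞ f b)
    {α : ∀ y : M, TangentSpace 𝓘(ℝ, E) y →L[ℝ] TangentSpace 𝓘(ℝ, E) y →L[ℝ] ℝ}
    (hα : SmoothTwoAt α (f b)) (hanti : ∀ u v, α (f b) u v = - α (f b) v u)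
    {β : ∀ y : B, TangentSpace 𝓘(ℝ, EB) y →L[ℝ] TangentSpace 𝓘(ℝ, EB) y →L[ℝ] ℝ}
    (hβs : SmoothTwoAt β b)
    (hβ : ∀ᶠ y in 𝓝 b, ∀ u v, β y u v = α (f y) (mfderiv 𝓘(ℝ, EB) 𝓘(ℝ, E) f y u)
      (mfderiv 𝓘(ℝ, EB) 𝓘(ℝ, E) f y v)) (u v w : TangentSpace 𝓘(ℝ, EB) b) :
    extTwo (twoCoord b β) (extChartAt 𝓘(ℝ, EB) b b) u v w
      = extTwo (twoCoord (f b) α) (extChartAt 𝓘(ℝ, E) (f b) (f b))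
        (mfderiv 𝓘(ℝ, EB) 𝓘(ℝ, E) f b u) (mfderiv 𝓘(ℝ, EB) 𝓘(ℝ, E) f b v)
        (mfderiv 𝓘(ℝ, EB) 𝓘(ℝ, E) f b w) := by
  have hd : DifferentiableAt ℝ (twoCoord (f b) α)
      (mapCoord (E := E) (EB := EB) f b (extChartAt 𝓘(ℝ, EB) b b)) := by
    rw [mapCoord_self]
    exact (contDiffAt_twoCoord hα).differentiableAt (by simp)
  have h := extTwo_pullback (β := twoCoord b β) hd
    (by rw [mapCoord_self, twoCoord_self]; exact hanti)
    ((contDiffAt_mapCoord hf).of_le ENat.LEInfty.out)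
    ((contDiffAt_twoCoord hβs).differentiableAt (by simp)) ?_ u v w
  · rw [fderiv_mapCoord_self hf, mapCoord_self] at h
    exact h
  · filter_upwards [eventually_frameAt_fderiv_mapCoord hf,
      (symm_tendsto (E := EB) b).eventually hβ] with z hz hz' u v
    have h1 : (extChartAt 𝓘(ℝ, E) (f b)).symm (mapCoord (E := E) (EB := EB) f b z)
        = f ((extChartAt 𝓘(ℝ, EB) b).symm z) :=
      (extChartAt 𝓘(ℝ, E) (f b)).left_inv (by rw [extChartAt_source]; exact hz.1)
    rw [twoCoord_apply, twoCoord_apply, h1, hz.2, hz.2, hz']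

/-- The invariant formula is tensorial in the fields, so chart-constant fields suffice to test it.
-/
theorem isClosedTwoForm_iff {α : ∀ y : M, TangentSpace 𝓘(ℝ, E) y →L[ℝ] TangentSpace 𝓘(ℝ, E) y →L[ℝ] ℝ}
    (hα : ∀ x, SmoothTwoAt α x) (hanti : ∀ x u v, α x u v = - α x v u) :
    IsClosedTwoForm α ↔ ∀ (x : M) (u v w : E),
      extTwo (twoCoord x α) (extChartAt 𝓘(ℝ, E) x x) u v w = 0 := by
  constructor
  · intro h x u v w
    have h1 := h x _ _ _ (smoothFieldAt_frameAt x u) (smoothFieldAt_frameAt x v)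
      (smoothFieldAt_frameAt x w)
    rw [extTwo_apply_fields (hα x) (hanti x) (smoothFieldAt_frameAt x u)
      (smoothFieldAt_frameAt x v) (smoothFieldAt_frameAt x w), frameAt_self, frameAt_self,
      frameAt_self] at h1
    exact h1
  · intro h x X Y Z hX hY hZ
    rw [extTwo_apply_fields (hα x) (hanti x) hX hY hZ]
    exact h x _ _ _

/-- Closedness is local and natural, so the map `f` may depend on the point. On a quotient, local
sections of the projection provide it. -/
theorem IsClosedTwoForm.of_local_pullback
    {α : ∀ y : M, TangentSpace 𝓘(ℝ, E) y →L[ℝ] TangentSpace 𝓘(ℝ, E) y →L[ℝ] ℝ}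
    (hα : ∀ x, SmoothTwoAt α x) (hanti : ∀ x u v, α x u v = - α x v u) (hcl : IsClosedTwoForm α)
    {β : ∀ y : B, TangentSpace 𝓘(ℝ, EB) y →L[ℝ] TangentSpace 𝓘(ℝ, EB) y →L[ℝ] ℝ}
    (hβ : ∀ x, SmoothTwoAt β x) (hanti' : ∀ x u v, β x u v = - β x v u)
    (h : ∀ b : B, ∃ f : B → M, ContMDiffAt 𝓘(ℝ, EB) 𝓘(ℝ, E) ∞ f b ∧ ∀ᶠ y in 𝓝 b, ∀ u v,
      β y u v = α (f y) (mfderiv 𝓘(ℝ, EB) 𝓘(ℝ, E) f y u) (mfderiv 𝓘(ℝ, EB) 𝓘(ℝ, E) f y v)) :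
    IsClosedTwoForm β := by
  rw [isClosedTwoForm_iff hα hanti] at hcl
  rw [isClosedTwoForm_iff hβ hanti']
  intro b u v w
  obtain ⟨f, hf, hfβ⟩ := h b
  exact (extTwo_pullback_manifold hf (hα _) (hanti _) (hβ b) hfβ u v w).trans (hcl _ _ _ _)

end Pullback

/-! ### Almost hyperhermitian manifolds -/

section Algebra

variable {E : Type*} [NormedAddCommGroup E] [NormedSpace ℝ E] [FiniteDimensional ℝ E]
  {M : Type*} [TopologicalSpace M] [ChartedSpace E M] [IsManifold 𝓘(ℝ, E) ∞ M]
  {W : Type*} [NormedAddCommGroup W] [NormedSpace ℝ W]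

theorem SmoothOneAt.add {α β : ∀ y : M, TangentSpace 𝓘(ℝ, E) y →L[ℝ] W} {x : M}
    (hα : SmoothOneAt α x) (hβ : SmoothOneAt β x) : SmoothOneAt (fun y ↦ α y + β y) x :=
  fun X hX ↦ (hα X hX).add (hβ X hX)

theorem SmoothOneAt.neg {α : ∀ y : M, TangentSpace 𝓘(ℝ, E) y →L[ℝ] W} {x : M}
    (hα : SmoothOneAt α x) : SmoothOneAt (fun y ↦ - α y) x :=
  fun X hX ↦ (hα X hX).neg

theorem dfun_neg (f : M → ℝ) (x : M) (v : TangentSpace 𝓘(ℝ, E) x) :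
    dfun (fun y ↦ - f y) x v = - dfun f x v := by
  rw [dfun_eq_mvfderiv, dfun_eq_mvfderiv, mvfderiv_fun_neg]
  rfl

theorem exists_smoothFieldAt (x : M) (v : TangentSpace 𝓘(ℝ, E) x) :
    ∃ X : ∀ y : M, TangentSpace 𝓘(ℝ, E) y, SmoothFieldAt X x ∧ X x = v :=
  ⟨_, smoothFieldAt_frameAt (E := E) x v, frameAt_self (E := E) x v⟩

/-- An almost complex structure `A` is integrable if there are closed 2-forms `p` and `q` such that
`p` is nondegenerate and `p + i q` is of type `(2,0)`. -/
theorem isIntegrable_of_closed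
    {A : ∀ x : M, TangentSpace 𝓘(ℝ, E) x →L[ℝ] TangentSpace 𝓘(ℝ, E) x}
    {p q : ∀ x : M, TangentSpace 𝓘(ℝ, E) x →L[ℝ] TangentSpace 𝓘(ℝ, E) x →L[ℝ] ℝ}
    (hA : ∀ X x, SmoothFieldAt X x → SmoothFieldAt (fun y : M ↦ A y (X y)) x)
    (hp : IsClosedTwoForm p) (hq : IsClosedTwoForm q)
    (hpa : ∀ x u v, p x u v = - p x v u) (hqa : ∀ x u v, q x u v = - q x v u)
    (hpA : ∀ x u v, p x (A x u) v = - q x u v) (hqA : ∀ x u v, q x (A x u) v = p x u v)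
    (hnd : ∀ x u, (∀ v, p x u v = 0) → u = 0) : IsIntegrable A := by
  intro x X Y hX hY
  apply hnd
  intro w
  obtain ⟨Z, hZ, rfl⟩ := exists_smoothFieldAt x w
  -- The combination `dp(AX, AY, Z) + dq(AX, Y, Z) + dq(X, AY, Z) - dp(X, Y, Z)` contains no
  -- derivatives of functions after cancellation and equals, up to sign, `p` of the Nijenhuis tensor
  -- and `Z`.
  have h1 := hp x X Y Z hX hY hZ
  have h2 := hp x _ _ Z (hA X x hX) (hA Y x hY) hZ
  have h3 := hq x _ Y Z (hA X x hX) hY hZ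
  have h4 := hq x X _ Z hX (hA Y x hY) hZ
  have pA' : ∀ y u v, p y u (A y v) = - q y u v := fun y u v ↦ by
    rw [hpa, hpA, hqa, neg_neg]
  have qA' : ∀ y u v, q y u (A y v) = p y u v := fun y u v ↦ by
    rw [hqa, hqA, hpa, neg_neg]
  simp only [hpA, pA', hqA, qA', dfun_neg] at h1 h2 h3 h4
  simp only [map_sub, sub_apply, hpA]
  linarith

/-- The exterior derivative of the composition of a 1-form with an integrable almost complex
structure. -/
theorem extD_comp_of_isIntegrable
    {A : ∀ x : M, TangentSpace 𝓘(ℝ, E) x →L[ℝ] TangentSpace 𝓘(ℝ, E) x}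
    (hA : ∀ X x, SmoothFieldAt X x → SmoothFieldAt (fun y : M ↦ A y (X y)) x)
    (hint : IsIntegrable A) (hsq : ∀ x v, A x (A x v) = - v)
    {α β : ∀ y : M, TangentSpace 𝓘(ℝ, E) y →L[ℝ] ℝ} {x : M}
    (hα : SmoothOneAt α x) (hβ : ∀ y v, β y v = α y (A y v)) (u v : TangentSpace 𝓘(ℝ, E) x) :
    extD β x (A x u) (A x v) - extD β x u v = - extD α x (A x u) v - extD α x u (A x v) := by
  have hβs : SmoothOneAt β x := by
    intro X hX
    simp only [hβ]
    exact hα _ (hA X x hX)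
  obtain ⟨X, hX, rfl⟩ := exists_smoothFieldAt x u
  obtain ⟨Y, hY, rfl⟩ := exists_smoothFieldAt x v
  have h := congrArg (α x) (hint x X Y hX hY)
  have h1 := extD_apply_fields hβs hX hY
  have h2 := extD_apply_fields hβs (hA X x hX) (hA Y x hY)
  have h3 := extD_apply_fields hα (hA X x hX) hY
  have h4 := extD_apply_fields hα hX (hA Y x hY)
  -- In the four invariant formulas the derivatives of functions cancel; what is left over is `α ∘
  -- A` applied to the Nijenhuis tensor.
  have h5 := congrArg (fun w ↦ α x (A x w)) (hint x X Y hX hY)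
  simp only [hβ, hsq, map_neg, map_sub, map_zero] at h h1 h2 h3 h4 h5
  rw [mvfderiv_fun_neg, mvfderiv_fun_neg] at h2
  simp only [neg_apply] at h2
  linarith

end Algebra

/-! ### Quaternionic algebra, and integrability from closed Kähler forms -/

namespace AlmostHyperhermitian

variable {E : Type*} [NormedAddCommGroup E] [NormedSpace ℝ E] [FiniteDimensional ℝ E]
  {M : Type*} [TopologicalSpace M] [ChartedSpace E M] [IsManifold 𝓘(ℝ, E) ∞ M]
  (H : AlmostHyperhermitian E M)

theorem I_K (x : M) (v : TangentSpace 𝓘(ℝ, E) x) : H.I x (H.K x v) = - H.J x v := by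
  rw [← H.I_J, H.I_sq]

theorem K_J (x : M) (v : TangentSpace 𝓘(ℝ, E) x) : H.K x (H.J x v) = - H.I x v := by
  rw [← H.I_J, H.J_sq, map_neg]

theorem J_I (x : M) (v : TangentSpace 𝓘(ℝ, E) x) : H.J x (H.I x v) = - H.K x v := by
  have h := H.K_sq x (H.J x (H.I x v))
  rw [H.K_J, H.I_sq, neg_neg] at h
  rw [← neg_neg (H.J x (H.I x v)), ← h]

theorem K_I (x : M) (v : TangentSpace 𝓘(ℝ, E) x) : H.K x (H.I x v) = H.J x v := by
  rw [← H.I_J, H.J_I, map_neg, H.I_K, neg_neg]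

theorem J_K (x : M) (v : TangentSpace 𝓘(ℝ, E) x) : H.J x (H.K x v) = H.I x v := by
  rw [← neg_neg (H.K x v), ← H.J_I, map_neg, H.J_sq, neg_neg]

theorem g_I_left (x : M) (u v : TangentSpace 𝓘(ℝ, E) x) :
    H.g.inner x (H.I x u) v = - H.g.inner x u (H.I x v) := by
  rw [← H.orth_I x (H.I x u), H.I_sq, map_neg]; rfl

theorem g_J_left (x : M) (u v : TangentSpace 𝓘(ℝ, E) x) :
    H.g.inner x (H.J x u) v = - H.g.inner x u (H.J x v) := by
  rw [← H.orth_J x (H.J x u), H.J_sq, map_neg]; rfl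

theorem g_K_left (x : M) (u v : TangentSpace 𝓘(ℝ, E) x) :
    H.g.inner x (H.K x u) v = - H.g.inner x u (H.K x v) := by
  rw [← H.orth_K x (H.K x u), H.K_sq, map_neg]; rfl

theorem ω₁_apply (x : M) (u v : TangentSpace 𝓘(ℝ, E) x) :
    H.ω₁ x u v = H.g.inner x (H.I x u) v := rfl

theorem ω₂_apply (x : M) (u v : TangentSpace 𝓘(ℝ, E) x) :
    H.ω₂ x u v = H.g.inner x (H.J x u) v := rfl

theorem ω₃_apply (x : M) (u v : TangentSpace 𝓘(ℝ, E) x) :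
    H.ω₃ x u v = H.g.inner x (H.K x u) v := rfl

theorem ω₁_anti (x : M) (u v : TangentSpace 𝓘(ℝ, E) x) : H.ω₁ x u v = - H.ω₁ x v u := by
  rw [ω₁_apply, ω₁_apply, g_I_left, H.g.symm]

theorem ω₂_anti (x : M) (u v : TangentSpace 𝓘(ℝ, E) x) : H.ω₂ x u v = - H.ω₂ x v u := by
  rw [ω₂_apply, ω₂_apply, g_J_left, H.g.symm]

theorem ω₃_anti (x : M) (u v : TangentSpace 𝓘(ℝ, E) x) : H.ω₃ x u v = - H.ω₃ x v u := by
  rw [ω₃_apply, ω₃_apply, g_K_left, H.g.symm]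

theorem eq_zero_of_g {x : M} {u : TangentSpace 𝓘(ℝ, E) x} (h : H.g.inner x u u = 0) : u = 0 := by
  by_contra hu
  exact (H.g.pos x u hu).ne' h

theorem ω₁_nondegenerate {x : M} {u : TangentSpace 𝓘(ℝ, E) x} (h : ∀ v, H.ω₁ x u v = 0) :
    u = 0 :=
  H.eq_zero_of_g (by simpa only [ω₁_apply, H.orth_I] using h (H.I x u))

theorem ω₂_nondegenerate {x : M} {u : TangentSpace 𝓘(ℝ, E) x} (h : ∀ v, H.ω₂ x u v = 0) :
    u = 0 :=
  H.eq_zero_of_g (by simpa only [ω₂_apply, H.orth_J] using h (H.J x u))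

theorem ω₃_nondegenerate {x : M} {u : TangentSpace 𝓘(ℝ, E) x} (h : ∀ v, H.ω₃ x u v = 0) :
    u = 0 :=
  H.eq_zero_of_g (by simpa only [ω₃_apply, H.orth_K] using h (H.K x u))

theorem smoothFieldAt_I {X : ∀ x : M, TangentSpace 𝓘(ℝ, E) x} {x : M} (hX : SmoothFieldAt X x) :
    SmoothFieldAt (fun y ↦ H.I y (X y)) x :=
  (H.smooth_I x).clm_bundle_apply hX

theorem smoothFieldAt_J {X : ∀ x : M, TangentSpace 𝓘(ℝ, E) x} {x : M} (hX : SmoothFieldAt X x) :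
    SmoothFieldAt (fun y ↦ H.J y (X y)) x :=
  (H.smooth_J x).clm_bundle_apply hX

theorem smoothFieldAt_K {X : ∀ x : M, TangentSpace 𝓘(ℝ, E) x} {x : M} (hX : SmoothFieldAt X x) :
    SmoothFieldAt (fun y ↦ H.K y (X y)) x :=
  (H.smooth_K x).clm_bundle_apply hX

theorem contMDiffAt_g {X Y : ∀ x : M, TangentSpace 𝓘(ℝ, E) x} {x : M} (hX : SmoothFieldAt X x)
    (hY : SmoothFieldAt Y x) :
    ContMDiffAt 𝓘(ℝ, E) 𝓘(ℝ, ℝ) ∞ (fun y ↦ H.g.inner y (X y) (Y y)) x := by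
  have h := ContMDiffAt.clm_bundle_apply₂ (F₁ := E) (F₂ := E) (F₃ := ℝ)
    (E₃ := fun _ : M ↦ ℝ) (H.g.contMDiff x) hX hY
  exact (contMDiffAt_totalSpace.1 h).2

theorem smoothTwoAt_ω₁ (x : M) : SmoothTwoAt H.ω₁ x :=
  fun _ _ hX hY ↦ H.contMDiffAt_g (H.smoothFieldAt_I hX) hY

theorem smoothTwoAt_ω₂ (x : M) : SmoothTwoAt H.ω₂ x :=
  fun _ _ hX hY ↦ H.contMDiffAt_g (H.smoothFieldAt_J hX) hY

theorem smoothTwoAt_ω₃ (x : M) : SmoothTwoAt H.ω₃ x :=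
  fun _ _ hX hY ↦ H.contMDiffAt_g (H.smoothFieldAt_K hX) hY

/-- If the three Kähler forms are closed, the almost complex structures are integrable. -/
theorem IsHyperkahler.of_closed {H : AlmostHyperhermitian E M} (h₁ : IsClosedTwoForm H.ω₁)
    (h₂ : IsClosedTwoForm H.ω₂) (h₃ : IsClosedTwoForm H.ω₃) : H.IsHyperkahler where
  -- `ω₂ + i ω₃` is of type (2,0) for `I`; the other two cases are the cyclic permutations.
  integrable_I := isIntegrable_of_closed (fun _ _ ↦ H.smoothFieldAt_I) h₂ h₃ H.ω₂_anti H.ω₃_anti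
    (fun x u v ↦ by rw [ω₂_apply, J_I, map_neg]; rfl) (fun x u v ↦ by rw [ω₃_apply, K_I]; rfl)
    (fun _ _ ↦ H.ω₂_nondegenerate)
  integrable_J := isIntegrable_of_closed (fun _ _ ↦ H.smoothFieldAt_J) h₃ h₁ H.ω₃_anti H.ω₁_anti
    (fun x u v ↦ by rw [ω₃_apply, K_J, map_neg]; rfl) (fun x u v ↦ by rw [ω₁_apply, I_J]; rfl)
    (fun _ _ ↦ H.ω₃_nondegenerate)
  integrable_K := isIntegrable_of_closed (fun _ _ ↦ H.smoothFieldAt_K) h₁ h₂ H.ω₁_anti H.ω₂_anti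
    (fun x u v ↦ by rw [ω₁_apply, I_K, map_neg]; rfl) (fun x u v ↦ by rw [ω₂_apply, J_K]; rfl)
    (fun _ _ ↦ H.ω₁_nondegenerate)
  closed₁ := h₁
  closed₂ := h₂
  closed₃ := h₃

end AlmostHyperhermitian

/-! ### Circle actions -/

section Flow

variable {V : Type*} [NormedAddCommGroup V] [NormedSpace ℝ V] [FiniteDimensional ℝ V]

/-- Cartan's formula: if the flow `F` transforms the closed form `η` by
`F_t^* η = cos t η + sin t ζ`, then the derivative of the interior product `α` of `η` with the
generator of the flow is `ζ`. -/
theorem extOne_of_flow {η : V → V →L[ℝ] V →L[ℝ] ℝ} {ζ : V →L[ℝ] V →L[ℝ] ℝ} {α : V → V →L[ℝ] ℝ}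
    {F : ℝ × V → V} {z : V} (hη : ContDiffAt ℝ ∞ η z)
    (hcl : ∀ u v w, extTwo η z u v w = 0) (hanti : ∀ y u v, η y u v = - η y v u)
    (hF : ContDiffAt ℝ ∞ F (0, z)) (hF0 : F (0, z) = z) (hα : DifferentiableAt ℝ α z) (u v : V)
    (hflow : ∀ᶠ t in 𝓝 (0 : ℝ), η (F (t, z)) (fderiv ℝ F (t, z) (0, u)) (fderiv ℝ F (t, z) (0, v))
      = Real.cos t * η z u v + Real.sin t * ζ u v)
    (hgen : ∀ᶠ y in 𝓝 z, ∀ w, η (F (0, y)) (fderiv ℝ F (0, y) (1, 0)) (fderiv ℝ F (0, y) (0, w))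
      = α y w) :
    extOne α z u v = ζ u v := by
  -- The pullback of `η` to time × space. It is closed at `(0, z)`, and evaluating `dβ` on `∂_t, u,
  -- v` gives three terms: the time derivative of `F_t^* η`, which is `ζ(u, v)`, and two space
  -- derivatives of `β(∂_t, ·)`, which is `α` at time `0`.
  let β : ℝ × V → (ℝ × V) →L[ℝ] (ℝ × V) →L[ℝ] ℝ :=
    fun q ↦ (η (F q)).bilinearComp (fderiv ℝ F q) (fderiv ℝ F q)
  have hη' : ContDiffAt ℝ ∞ η (F (0, z)) := by rwa [hF0]
  have hF1 : ContDiffAt ℝ ∞ (fderiv ℝ F) (0, z) := hF.fderiv_right (m := ∞) (by simp)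
  have hβ : ContDiffAt ℝ ∞ β (0, z) := by
    refine contDiffAt_clm_of_apply fun a ↦ contDiffAt_clm_of_apply fun b ↦ ?_
    exact ((hη'.comp (0, z) hF).clm_apply (hF1.clm_apply contDiffAt_const)).clm_apply
      (hF1.clm_apply contDiffAt_const)
  have hβd : DifferentiableAt ℝ β (0, z) := hβ.differentiableAt (by simp)
  have key := extTwo_pullback (β := β) (p := (0, z)) (hη'.differentiableAt (by simp))
    (hanti _) (hF.of_le ENat.LEInfty.out) hβd (.of_forall fun q u v ↦ rfl)
    (1, 0) (0, u) (0, v)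
  rw [hF0, hcl] at key
  have hbc : ∀ b c : ℝ × V, HasFDerivAt (fun q ↦ β q b c)
      (((fderiv ℝ β (0, z)).flip b).flip c) (0, z) := fun b c ↦ by
    have h := (hβd.hasFDerivAt.clm_apply (hasFDerivAt_const b _)).clm_apply
      (hasFDerivAt_const c _)
    refine h.congr_fderiv ?_
    ext w <;> simp
  have hspace : ∀ (b c : ℝ × V) (w : V),
      fderiv ℝ (fun y ↦ β (0, y) b c) z w = fderiv ℝ β (0, z) (0, w) b c := by
    intro b c w
    have h := (hbc b c).comp z (hasFDerivAt_prodMk_right (𝕜 := ℝ) (0 : ℝ) z)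
    rw [show (fun y ↦ β (0, y) b c) = (fun q ↦ β q b c) ∘ (fun y ↦ ((0 : ℝ), y)) from rfl, h.fderiv]
    simp
  have htime : fderiv ℝ β (0, z) (1, 0) (0, u) (0, v) = ζ u v := by
    have h := (hbc (0, u) (0, v)).comp (0 : ℝ) (hasFDerivAt_prodMk_left (𝕜 := ℝ) (0 : ℝ) z)
    -- The derivative at `0` of `cos t η + sin t ζ`.
    have h1 : HasDerivAt (fun t : ℝ ↦ Real.cos t * η z u v + Real.sin t * ζ u v)
        (-Real.sin 0 * η z u v + Real.cos 0 * ζ u v) 0 :=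
      ((Real.hasDerivAt_cos 0).mul_const _).add ((Real.hasDerivAt_sin 0).mul_const _)
    have h2 := h.hasDerivAt.unique (h1.congr_of_eventuallyEq hflow)
    simpa using h2
  have hαd : ∀ a w : V, fderiv ℝ (fun y ↦ α y w) z a = fderiv ℝ α z a w := fun a w ↦ by
    rw [fderiv_clm_apply hα (differentiableAt_const w)]
    simp
  have h1 : fderiv ℝ β (0, z) (0, v) (1, 0) (0, u) = fderiv ℝ α z v u := by
    rw [← hspace, ← hαd]
    exact congrArg (fun L : V →L[ℝ] ℝ ↦ L v) (Filter.EventuallyEq.fderiv_eq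
      (hgen.mono fun y hy ↦ hy u))
  have h2 : fderiv ℝ β (0, z) (0, u) (0, v) (1, 0) = - fderiv ℝ α z u v := by
    rw [← hspace, ← hαd, ← neg_apply, ← fderiv_fun_neg]
    refine congrArg (fun L : V →L[ℝ] ℝ ↦ L u) (Filter.EventuallyEq.fderiv_eq
      (hgen.mono fun y hy ↦ ?_))
    change η (F (0, y)) (fderiv ℝ F (0, y) (0, v)) (fderiv ℝ F (0, y) (1, 0)) = _
    rw [hanti, hy v]
  rw [extTwo, htime, h1, h2] at key
  rw [extOne_apply]
  linarith

end Flow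

section CircleAction

variable {E : Type*} [NormedAddCommGroup E] [NormedSpace ℝ E] [FiniteDimensional ℝ E]
  {M : Type*} [TopologicalSpace M] [ChartedSpace E M] [IsManifold 𝓘(ℝ, E) ∞ M]

theorem hasMFDerivAt_coframe {x y : M} (hy : y ∈ (chartAt E x).source) :
    HasMFDerivAt 𝓘(ℝ, E) 𝓘(ℝ, E) (extChartAt 𝓘(ℝ, E) x) y (coframeAt (E := E) x y) := by
  rw [coframeAt_eq_mfderiv hy]
  exact (mdifferentiableAt_extChartAt hy).hasMFDerivAt

theorem hasMFDerivAt_frame {x : M} {z : E} (hz : z ∈ (extChartAt 𝓘(ℝ, E) x).target) :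
    HasMFDerivAt 𝓘(ℝ, E) 𝓘(ℝ, E) (extChartAt 𝓘(ℝ, E) x).symm z
      (frameAt (E := E) x ((extChartAt 𝓘(ℝ, E) x).symm z)) := by
  rw [← mfderiv_symm_eq_frameAt hz]
  exact ((contMDiffOn_extChartAt_symm x).contMDiffAt
    ((isOpen_extChartAt_target x).mem_nhds hz)).mdifferentiableAt (n := ∞) (by simp)
    |>.hasMFDerivAt

variable {EA : Type*} [NormedAddCommGroup EA] [NormedSpace ℝ EA]
  {HA : Type*} [TopologicalSpace HA] (IA : ModelWithCorners ℝ EA HA)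
  {A : Type*} [TopologicalSpace A] [ChartedSpace HA A] [Group A] [MulAction A M]

theorem mdifferentiableAt_smul_left (hA : ContMDiffSMul IA 𝓘(ℝ, E) ∞ A M) (g : A) (x : M) :
    MDifferentiableAt IA 𝓘(ℝ, E) (fun h : A ↦ h • x) g :=
  (ContMDiffAt.smul (n := ∞) contMDiffAt_id contMDiffAt_const).mdifferentiableAt (by simp)

theorem mdifferentiableAt_smul_right (hA : ContMDiffSMul IA 𝓘(ℝ, E) ∞ A M) (g : A) (x : M) :
    MDifferentiableAt 𝓘(ℝ, E) 𝓘(ℝ, E) (fun y : M ↦ g • y) x :=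
  (ContMDiffAt.smul (n := ∞) (f := fun _ ↦ g) (I := IA) contMDiffAt_const
    contMDiffAt_id).mdifferentiableAt (by simp)

variable [MulAction Circle M]

theorem hasMFDerivAt_circle_smul (hT : ContMDiffSMul (𝓡 1) 𝓘(ℝ, E) ∞ Circle M) (x : M) :
    HasMFDerivAt 𝓘(ℝ, ℝ) 𝓘(ℝ, E) (fun t : ℝ ↦ Circle.exp t • x) 0
      (ContinuousLinearMap.toSpanSingleton ℝ
        (fundField (𝓡 1) Circle circleGen x : E) : ℝ →L[ℝ] E) := by
  have h1 : HasMFDerivAt 𝓘(ℝ, ℝ) (𝓡 1) (fun t : ℝ ↦ Circle.exp t) 0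
      (mfderiv 𝓘(ℝ, ℝ) (𝓡 1) (fun t : ℝ ↦ Circle.exp t) 0) :=
    ((contMDiff_circleExp (m := ∞)).mdifferentiable (by simp) 0).hasMFDerivAt
  have h2 : HasMFDerivAt (𝓡 1) 𝓘(ℝ, E) (fun g : Circle ↦ g • x) (Circle.exp 0)
      (mfderiv (𝓡 1) 𝓘(ℝ, E) (fun g : Circle ↦ g • x) (Circle.exp 0)) :=
    (mdifferentiableAt_smul_left (𝓡 1) hT _ x).hasMFDerivAt
  have h3 := h2.comp (0 : ℝ) h1
  have h4 : (mfderiv (𝓡 1) 𝓘(ℝ, E) (fun g : Circle ↦ g • x) (Circle.exp 0)).comp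
      (mfderiv 𝓘(ℝ, ℝ) (𝓡 1) (fun t : ℝ ↦ Circle.exp t) 0)
      = (ContinuousLinearMap.toSpanSingleton ℝ
        (fundField (𝓡 1) Circle circleGen x : E) : ℝ →L[ℝ] E) := by
    refine ContinuousLinearMap.ext_ring ?_
    refine Eq.trans ?_ (one_smul ℝ _).symm
    -- The chain rule gives the derivative at `Circle.exp 0`, the fundamental field uses the
    -- derivative at `1`; the two points are only propositionally equal.
    have key : ∀ (g : Circle) (_ : g = 1) (w : EuclideanSpace ℝ (Fin 1)),
        (mfderiv (𝓡 1) 𝓘(ℝ, E) (fun g : Circle ↦ g • x) g w : E)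
          = mfderiv (𝓡 1) 𝓘(ℝ, E) (fun g : Circle ↦ g • x) 1 w := by
      rintro g rfl w
      rfl
    exact key _ Circle.exp_zero _
  rw [h4] at h3
  exact h3

/-- This is `d i_X η = L_X η` for closed `η`. The action read in the chart at `x` is a map of time ×
space to which `extOne_of_flow` applies. -/
theorem extD_interior_of_rotating (hT : ContMDiffSMul (𝓡 1) 𝓘(ℝ, E) ∞ Circle M)
    {η ζ : ∀ x : M, TangentSpace 𝓘(ℝ, E) x →L[ℝ] TangentSpace 𝓘(ℝ, E) x →L[ℝ] ℝ}
    {α : ∀ x : M, TangentSpace 𝓘(ℝ, E) x →L[ℝ] ℝ} {x : M}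
    (hη : ∀ x, SmoothTwoAt η x) (hanti : ∀ x u v, η x u v = - η x v u) (hcl : IsClosedTwoForm η)
    (hrot : ∀ (t : ℝ) (x : M) (u v : TangentSpace 𝓘(ℝ, E) x),
      η (Circle.exp t • x) (dAct (Circle.exp t) x u) (dAct (Circle.exp t) x v)
        = Real.cos t * η x u v + Real.sin t * ζ x u v)
    (hα : SmoothOneAt α x)
    (hαη : ∀ y v, α y v = η y (fundField (𝓡 1) Circle circleGen y) v)
    (u v : TangentSpace 𝓘(ℝ, E) x) : extD α x u v = ζ x u v := by
  set z := extChartAt 𝓘(ℝ, E) x x with hz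
  let S := (extChartAt 𝓘(ℝ, E) x).symm
  let f : ℝ × E → M := fun q ↦ Circle.exp q.1 • S q.2
  let F : ℝ × E → E := fun q ↦ extChartAt 𝓘(ℝ, E) x (f q)
  have hSz : S z = x := extChartAt_to_inv x
  have hf0 : f (0, z) = x := by simp [f, hSz]
  have hf : ContMDiffAt 𝓘(ℝ, ℝ × E) 𝓘(ℝ, E) ∞ f (0, z) := by
    have h1 : ContMDiffAt 𝓘(ℝ, ℝ × E) (𝓡 1) ∞ (fun q : ℝ × E ↦ Circle.exp q.1) (0, z) :=
      contMDiff_circleExp.contMDiffAt.comp (0, z) contDiff_fst.contMDiff.contMDiffAt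
    have h2 : ContMDiffAt 𝓘(ℝ, ℝ × E) 𝓘(ℝ, E) ∞ (fun q : ℝ × E ↦ S q.2) (0, z) :=
      ContMDiffAt.comp (0, z) (g := S) (contMDiffAt_symm x) contDiff_snd.contMDiff.contMDiffAt
    exact h1.smul h2
  have hFM : ContMDiffAt 𝓘(ℝ, ℝ × E) 𝓘(ℝ, E) ∞ F (0, z) := by
    refine ContMDiffAt.comp (0, z) (g := extChartAt 𝓘(ℝ, E) x) ?_ hf
    rw [hf0]
    exact contMDiffAt_extChartAt
  have hF : ContDiffAt ℝ ∞ F (0, z) := hFM.contDiffAt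
  have hFd : ∀ᶠ q in 𝓝 ((0 : ℝ), z), DifferentiableAt ℝ F q :=
    ((hF.of_le (m := 1) ENat.LEInfty.out).eventually (by simp)).mono
      fun q hq ↦ hq.differentiableAt (by simp)
  have hfs : ∀ᶠ q in 𝓝 ((0 : ℝ), z), f q ∈ (chartAt E x).source :=
    hf.continuousAt.eventually ((chartAt E x).open_source.mem_nhds (by
      rw [hf0]; exact mem_chart_source E x))
  have hSt : ∀ᶠ y in 𝓝 z, y ∈ (extChartAt 𝓘(ℝ, E) x).target :=
    extChartAt_target_mem_nhds (I := 𝓘(ℝ, E)) x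
  -- The space derivative of `F` is the differential of the action by `exp(it)`, and the time
  -- derivative at `t = 0` is the generating field.
  have hspace : ∀ (t : ℝ) (y : E), DifferentiableAt ℝ F (t, y) → f (t, y) ∈ (chartAt E x).source →
      y ∈ (extChartAt 𝓘(ℝ, E) x).target → ∀ w : E,
      frameAt x (f (t, y)) (fderiv ℝ F (t, y) (0, w))
        = dAct (Circle.exp t) (S y) (frameAt x (S y) w) := by
    intro t y hd hs hy w
    have h1 := (hasMFDerivAt_coframe hs).comp y
      ((mdifferentiableAt_smul_right (𝓡 1) hT (Circle.exp t) (S y)).hasMFDerivAt.comp y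
        (hasMFDerivAt_frame hy))
    have h2 := hd.hasFDerivAt.comp y (hasFDerivAt_prodMk_right (𝕜 := ℝ) t y)
    have h3 := congrArg (fun L : E →L[ℝ] E ↦ L w) (h2.unique h1.hasFDerivAt)
    have h4 : fderiv ℝ F (t, y) (0, w) = coframeAt x (f (t, y))
        (dAct (Circle.exp t) (S y) (frameAt x (S y) w)) := h3
    rw [h4]
    exact frameAt_coframeAt hs _
  have htime : ∀ y : E, DifferentiableAt ℝ F (0, y) → f (0, y) ∈ (chartAt E x).source →
      frameAt x (f (0, y)) (fderiv ℝ F (0, y) (1, 0))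
        = (fundField (𝓡 1) Circle circleGen (S y) : E) := by
    intro y hd hs
    have hs' : Circle.exp 0 • S y ∈ (chartAt E x).source := hs
    have h1 := (hasMFDerivAt_coframe hs').comp (0 : ℝ) (hasMFDerivAt_circle_smul hT (S y))
    have h2 := hd.hasFDerivAt.comp (0 : ℝ) (hasFDerivAt_prodMk_left (𝕜 := ℝ) (0 : ℝ) y)
    have h3 := congrArg (fun L : ℝ →L[ℝ] E ↦ L 1) (h2.unique h1.hasFDerivAt)
    have h4 : fderiv ℝ F (0, y) (1, 0) = coframeAt x (Circle.exp 0 • S y)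
        ((1 : ℝ) • (fundField (𝓡 1) Circle circleGen (S y) : E)) := h3
    rw [h4, one_smul]
    exact frameAt_coframeAt hs' _
  have hf1 : ∀ y, f (0, y) = S y := fun y ↦ by simp [f]
  have hSF : ∀ q, f q ∈ (chartAt E x).source → S (F q) = f q := fun q hq ↦
    (extChartAt 𝓘(ℝ, E) x).left_inv (by rw [extChartAt_source]; exact hq)
  have main := extOne_of_flow (η := twoCoord x η) (ζ := (ζ x : E →L[ℝ] E →L[ℝ] ℝ))
    (α := oneCoord x α) (F := F) (z := z)
    (contDiffAt_twoCoord (hη x)) ((isClosedTwoForm_iff hη hanti).1 hcl x)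
    (fun y u v ↦ by rw [twoCoord_apply, twoCoord_apply, hanti]) hF (by simp only [F, hf0]; rfl)
    ((contDiffAt_oneCoord hα).differentiableAt (by simp)) u v ?_ ?_
  · exact main
  · have hc : Filter.Tendsto (fun t : ℝ ↦ (t, z)) (𝓝 0) (𝓝 (0, z)) :=
      (Continuous.prodMk_left z).tendsto 0
    filter_upwards [hc.eventually hFd, hc.eventually hfs] with t hd hs
    have h1 := hspace t z hd hs hSt.self_of_nhds
    have h2 : ∀ w w' : E, twoCoord x η (F (t, z)) w w'
        = η (f (t, z)) (frameAt x (f (t, z)) w) (frameAt x (f (t, z)) w') := by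
      intro w w'
      have := hSF _ hs
      rw [twoCoord_apply]
      change η (S (F (t, z))) _ _ = _
      rw [this]
    refine (h2 _ _).trans ?_
    refine (congrArg₂ (fun a b : E ↦ η (f (t, z)) a b) (h1 u) (h1 v)).trans ?_
    refine (hrot t (S z) _ _).trans ?_
    have h5 : ∀ (ξ : ∀ x : M, TangentSpace 𝓘(ℝ, E) x →L[ℝ] TangentSpace 𝓘(ℝ, E) x →L[ℝ] ℝ)
        (y : M), y = x → ξ y (frameAt x y u) (frameAt x y v) = ξ x u v := by
      rintro ξ y rfl
      exact congrArg₂ (fun a b : E ↦ ξ y a b) (frameAt_self (E := E) y u)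
        (frameAt_self (E := E) y v)
    rw [h5 η _ hSz, h5 ζ _ hSz]
    refine congrArg (fun r : ℝ ↦ Real.cos t * r + _) ?_
    exact (congrArg (fun b : E →L[ℝ] E →L[ℝ] ℝ ↦ b u v) (twoCoord_self x η)).symm
  · have hc : Filter.Tendsto (fun y : E ↦ ((0 : ℝ), y)) (𝓝 z) (𝓝 (0, z)) :=
      (Continuous.prodMk_right (0 : ℝ)).tendsto z
    filter_upwards [hc.eventually hFd, hc.eventually hfs, hSt] with y hd hs hy w
    have h1 := hspace 0 y hd hs hy w
    have h0 := htime y hd hs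
    have h2 : ∀ w w' : E, twoCoord x η (F (0, y)) w w'
        = η (f (0, y)) (frameAt x (f (0, y)) w) (frameAt x (f (0, y)) w') := by
      intro w w'
      have := hSF _ hs
      rw [twoCoord_apply]
      change η (S (F (0, y))) _ _ = _
      rw [this]
    have h3 : (dAct (Circle.exp 0) (S y) (frameAt x (S y) w) : E) = frameAt x (S y) w := by
      have : (fun y : M ↦ Circle.exp 0 • y) = id := by funext; simp
      rw [dAct, this, mfderiv_id]
      rfl
    rw [h2, h1, h0, oneCoord_apply, hαη]
    have key : ∀ (p q : M) (_ : p = q) (a b a' b' : E), a = a' → b = b' →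
        η p a b = η q a' b' := by
      rintro p _ rfl a b _ _ rfl rfl; rfl
    exact key _ _ (hf1 y) _ _ _ _ rfl h3

end CircleAction

/-! ### Exterior derivatives of 1-forms -/

section ExtD

variable {E : Type*} [NormedAddCommGroup E] [NormedSpace ℝ E] [FiniteDimensional ℝ E]
  {M : Type*} [TopologicalSpace M] [ChartedSpace E M] [IsManifold 𝓘(ℝ, E) ∞ M]
  {W : Type*} [NormedAddCommGroup W] [NormedSpace ℝ W]
  {W' : Type*} [NormedAddCommGroup W'] [NormedSpace ℝ W']

theorem extOne_add {V : Type*} [NormedAddCommGroup V] [NormedSpace ℝ V] {α β : V → V →L[ℝ] W}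
    {p : V} (hα : DifferentiableAt ℝ α p) (hβ : DifferentiableAt ℝ β p) (a b : V) :
    extOne (fun q ↦ α q + β q) p a b = extOne α p a b + extOne β p a b := by
  rw [extOne_apply, extOne_apply, extOne_apply, fderiv_fun_add hα hβ]
  simp only [add_apply]
  abel

theorem extOne_clm_comp {V : Type*} [NormedAddCommGroup V] [NormedSpace ℝ V] (A : W →L[ℝ] W')
    {α : V → V →L[ℝ] W} {p : V} (hα : DifferentiableAt ℝ α p) (a b : V) :
    extOne (fun q ↦ A.comp (α q)) p a b = A (extOne α p a b) := by
  have h : HasFDerivAt (fun q ↦ A.comp (α q))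
      ((ContinuousLinearMap.compL ℝ V W W' A).comp (fderiv ℝ α p)) p :=
    (ContinuousLinearMap.compL ℝ V W W' A).hasFDerivAt.comp p hα.hasFDerivAt
  rw [extOne_apply, extOne_apply, h.fderiv, map_sub]
  rfl

theorem extD_congr {α β : ∀ y : M, TangentSpace 𝓘(ℝ, E) y →L[ℝ] W} {x : M}
    (h : ∀ᶠ y in 𝓝 x, α y = β y) : extD α x = extD β x := by
  have h1 : oneCoord x α =ᶠ[𝓝 (extChartAt 𝓘(ℝ, E) x x)] oneCoord x β := by
    filter_upwards [(symm_tendsto x).eventually h] with z hz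
    rw [oneCoord, oneCoord, hz]
  rw [extD, extD, extOne, extOne, h1.fderiv_eq]

theorem extD_add {α β : ∀ y : M, TangentSpace 𝓘(ℝ, E) y →L[ℝ] W} {x : M}
    (hα : SmoothOneAt α x) (hβ : SmoothOneAt β x) (u v : TangentSpace 𝓘(ℝ, E) x) :
    extD (fun y ↦ α y + β y) x u v = extD α x u v + extD β x u v :=
  extOne_add ((contDiffAt_oneCoord hα).differentiableAt (by simp))
    ((contDiffAt_oneCoord hβ).differentiableAt (by simp)) u v

theorem extD_clm_comp (A : W →L[ℝ] W') {α : ∀ y : M, TangentSpace 𝓘(ℝ, E) y →L[ℝ] W} {x : M}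
    (hα : SmoothOneAt α x) (u v : TangentSpace 𝓘(ℝ, E) x) :
    extD (fun y ↦ A.comp (α y)) x u v = A (extD α x u v) :=
  extOne_clm_comp A ((contDiffAt_oneCoord hα).differentiableAt (by simp)) u v

theorem SmoothOneAt.clm_comp (A : W →L[ℝ] W') {α : ∀ y : M, TangentSpace 𝓘(ℝ, E) y →L[ℝ] W}
    {x : M} (hα : SmoothOneAt α x) : SmoothOneAt (fun y ↦ A.comp (α y)) x :=
  fun X hX ↦ A.contDiff.contMDiff.contMDiffAt.comp x (hα X hX)

/-- In a chart `df` is the derivative of the function in coordinates, on a whole neighbourhood, so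
that it can be differentiated again. -/
theorem eventually_oneCoord_mvfderiv {f : M → W} {x : M}
    (hf : ContMDiffAt 𝓘(ℝ, E) 𝓘(ℝ, W) ∞ f x) :
    oneCoord x (fun y ↦ mvfderiv 𝓘(ℝ, E) f y) =ᶠ[𝓝 (extChartAt 𝓘(ℝ, E) x x)]
      fderiv ℝ (fun z ↦ f ((extChartAt 𝓘(ℝ, E) x).symm z)) := by
  have h1 : ContMDiffAt 𝓘(ℝ, E) 𝓘(ℝ, W) 1 f x := hf.of_le (by simp)
  have : IsManifold 𝓘(ℝ, E) 1 M := .of_le (n := ∞) (by simp)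
  have hd : ∀ᶠ y in 𝓝 x, MDifferentiableAt 𝓘(ℝ, E) 𝓘(ℝ, W) f y :=
    ((contMDiffAt_iff_contMDiffAt_nhds (by simp)).1 h1).mono
      fun y hy ↦ hy.mdifferentiableAt (by simp)
  filter_upwards [(symm_tendsto x).eventually hd,
    extChartAt_target_mem_nhds (I := 𝓘(ℝ, E)) x] with z hz hzt
  have h2 := hz.hasMFDerivAt.comp z (hasMFDerivAt_frame hzt)
  have h3 : HasFDerivAt (fun z ↦ f ((extChartAt 𝓘(ℝ, E) x).symm z))
    (oneCoord x (fun y ↦ mvfderiv 𝓘(ℝ, E) f y) z) z := h2.hasFDerivAt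
  exact h3.fderiv.symm

theorem smoothOneAt_mvfderiv {f : M → W} {x : M} (hf : ContMDiffAt 𝓘(ℝ, E) 𝓘(ℝ, W) ∞ f x) :
    SmoothOneAt (fun y ↦ mvfderiv 𝓘(ℝ, E) f y) x := by
  intro X hX
  have h1 : ContDiffAt ℝ ∞ (fderiv ℝ (fun z ↦ f ((extChartAt 𝓘(ℝ, E) x).symm z)))
      (extChartAt 𝓘(ℝ, E) x x) :=
    (contDiffAt_comp_symm le_rfl hf).fderiv_right (m := ∞) (by simp)
  have h2 := (h1.clm_apply (contDiffAt_fieldCoord hX)).contMDiffAt.comp x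
    (contMDiffAt_extChartAt (I := 𝓘(ℝ, E)) (n := ∞) (x := x))
  refine h2.congr_of_eventuallyEq ?_
  filter_upwards [(chartAt E x).open_source.mem_nhds (mem_chart_source E x),
    (continuousAt_extChartAt (I := 𝓘(ℝ, E)) x).eventually (eventually_oneCoord_mvfderiv hf)]
    with y hy hz
  have hs : (extChartAt 𝓘(ℝ, E) x).symm (extChartAt 𝓘(ℝ, E) x y) = y :=
    (extChartAt 𝓘(ℝ, E) x).left_inv (by rwa [extChartAt_source])
  have h3 := oneCoord_fieldCoord (fun y ↦ mvfderiv 𝓘(ℝ, E) f y) X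
    (z := extChartAt 𝓘(ℝ, E) x y) (by rwa [hs])
  rw [hz] at h3
  refine Eq.trans ?_ h3.symm
  exact congrArg (fun y' : M ↦ mvfderiv 𝓘(ℝ, E) f y' (X y')) hs.symm

/-- Symmetry of the second derivative in the chart. -/
theorem extD_mvfderiv {f : M → W} {x : M} (hf : ContMDiffAt 𝓘(ℝ, E) 𝓘(ℝ, W) ∞ f x)
    (u v : TangentSpace 𝓘(ℝ, E) x) : extD (fun y ↦ mvfderiv 𝓘(ℝ, E) f y) x u v = 0 := by
  have h1 : IsSymmSndFDerivAt ℝ (fun z ↦ f ((extChartAt 𝓘(ℝ, E) x).symm z))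
      (extChartAt 𝓘(ℝ, E) x x) :=
    (contDiffAt_comp_symm le_rfl hf).isSymmSndFDerivAt (by simpa using ENat.LEInfty.out)
  have main : ∀ u v : E, extOne (oneCoord x (fun y ↦ mvfderiv 𝓘(ℝ, E) f y))
      (extChartAt 𝓘(ℝ, E) x x) u v = 0 := by
    intro u v
    rw [extOne_apply, (eventually_oneCoord_mvfderiv hf).fderiv_eq]
    exact sub_eq_zero.2 (h1 u v)
  exact main u v

end ExtD

/-! ### The curvature of the hyperholomorphic connection -/

namespace AlmostHyperhermitian

variable {E : Type*} [NormedAddCommGroup E] [NormedSpace ℝ E] [FiniteDimensional ℝ E]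
  {M : Type*} [TopologicalSpace M] [ChartedSpace E M] [IsManifold 𝓘(ℝ, E) ∞ M]
  (H : AlmostHyperhermitian E M)

/-- The 1-form `dμ ∘ I`. -/
def dI (μ : M → ℝ) (x : M) : TangentSpace 𝓘(ℝ, E) x →L[ℝ] ℝ :=
  (mvfderiv 𝓘(ℝ, E) μ x).comp (H.I x)

/-- The 2-form `ω₁ - d(dμ ∘ I)`. -/
def hypForm (μ : M → ℝ) (x : M) : TangentSpace 𝓘(ℝ, E) x →L[ℝ] TangentSpace 𝓘(ℝ, E) x →L[ℝ] ℝ :=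
  H.ω₁ x - extD (H.dI μ) x

theorem dI_apply (μ : M → ℝ) (x : M) (v : TangentSpace 𝓘(ℝ, E) x) :
    H.dI μ x v = dfun μ x (H.I x v) := rfl

theorem hypForm_apply (μ : M → ℝ) (x : M) (u v : TangentSpace 𝓘(ℝ, E) x) :
    H.hypForm μ x u v = H.ω₁ x u v - extD (H.dI μ) x u v := rfl

theorem smoothOneAt_dI {μ : M → ℝ} (hμ : ContMDiff 𝓘(ℝ, E) 𝓘(ℝ, ℝ) ∞ μ) (x : M) :
    SmoothOneAt (H.dI μ) x :=
  fun _ hX ↦ smoothOneAt_mvfderiv (hμ x) _ (H.smoothFieldAt_I hX)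

/-- `dμ` is closed, so by integrability `d(dμ ∘ I)` takes the same value on `(Iu, Iv)` and `(u, v)`.
-/
theorem isOneOne_I_hypForm (hH : H.IsHyperkahler) {μ : M → ℝ}
    (hμ : ContMDiff 𝓘(ℝ, E) 𝓘(ℝ, ℝ) ∞ μ) : IsOneOne H.I (H.hypForm μ) := by
  intro x u v
  have h := extD_comp_of_isIntegrable (fun _ _ ↦ H.smoothFieldAt_I) hH.integrable_I H.I_sq
    (smoothOneAt_mvfderiv (hμ x)) (β := H.dI μ) (fun y v ↦ rfl) u v
  rw [extD_mvfderiv (hμ x), extD_mvfderiv (hμ x)] at h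
  rw [hypForm_apply, hypForm_apply, ω₁_apply, H.orth_I, ← ω₁_apply]
  linarith

variable [MulAction Circle M]

theorem rotating_ω₂ {H : AlmostHyperhermitian E M} (hT : IsRotating H) (t : ℝ) (x : M)
    (u v : TangentSpace 𝓘(ℝ, E) x) :
    H.ω₂ (Circle.exp t • x) (dAct (Circle.exp t) x u) (dAct (Circle.exp t) x v)
      = Real.cos t * H.ω₂ x u v + Real.sin t * (- H.ω₃ x u v) := by
  have h := congrArg Complex.re (hT.rotates (Circle.exp t) x u v)
  rw [Circle.coe_exp, Complex.exp_mul_I, ← Complex.ofReal_cos, ← Complex.ofReal_sin] at h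
  simp at h
  rw [Complex.cos_ofReal_re, Complex.sin_ofReal_re] at h
  linarith

theorem rotating_ω₃ {H : AlmostHyperhermitian E M} (hT : IsRotating H) (t : ℝ) (x : M)
    (u v : TangentSpace 𝓘(ℝ, E) x) :
    H.ω₃ (Circle.exp t • x) (dAct (Circle.exp t) x u) (dAct (Circle.exp t) x v)
      = Real.cos t * H.ω₃ x u v + Real.sin t * H.ω₂ x u v := by
  have h := congrArg Complex.im (hT.rotates (Circle.exp t) x u v)
  rw [Circle.coe_exp, Complex.exp_mul_I, ← Complex.ofReal_cos, ← Complex.ofReal_sin] at h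
  simp at h
  rw [Complex.cos_ofReal_re, Complex.sin_ofReal_re] at h
  linarith

variable {μ : M → ℝ}

/-- `dμ(Iv) = ω₁(X, Iv) = g(IX, Iv)`. This metric description is what makes the form accessible on a
Riemannian quotient. -/
theorem dI_eq_inner (hμ : ∀ (x : M) (v : TangentSpace 𝓘(ℝ, E) x),
      H.ω₁ x (fundField (𝓡 1) Circle circleGen x) v = dfun μ x v)
    (x : M) (v : TangentSpace 𝓘(ℝ, E) x) :
    H.dI μ x v = H.g.inner x (fundField (𝓡 1) Circle circleGen x) v := by
  rw [dI_apply, ← hμ, ω₁_apply, orth_I]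

/-- With `α = i_X ω₂` one has `dμ ∘ I = α ∘ J` and `dα = -ω₃`. Integrability of `J` then makes `d(dμ
∘ I)` change by `-2 ω₁(u, v)` when `u, v` are replaced by `Ju, Jv`. Since `ω₁` changes by the same
amount, the difference is of type (1,1). -/
theorem isOneOne_J_hypForm (hH : H.IsHyperkahler) (hT : IsRotating H)
    (hμ : ContMDiff 𝓘(ℝ, E) 𝓘(ℝ, ℝ) ∞ μ)
    (hm : ∀ (x : M) (v : TangentSpace 𝓘(ℝ, E) x),
      H.ω₁ x (fundField (𝓡 1) Circle circleGen x) v = dfun μ x v) :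
    IsOneOne H.J (H.hypForm μ) := by
  intro x u v
  let α : ∀ y : M, TangentSpace 𝓘(ℝ, E) y →L[ℝ] ℝ := fun y ↦ - (H.dI μ y).comp (H.J y)
  have hα : SmoothOneAt α x :=
    SmoothOneAt.neg (α := fun y ↦ (H.dI μ y).comp (H.J y))
      fun _ hX ↦ H.smoothOneAt_dI hμ x _ (H.smoothFieldAt_J hX)
  have hd := extD_interior_of_rotating hT.smooth (ζ := fun x ↦ - H.ω₃ x) H.smoothTwoAt_ω₂ H.ω₂_anti
    hH.closed₂ (rotating_ω₂ hT) hα (fun y v ↦ by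
      change - H.dI μ y (H.J y v) = _
      rw [H.dI_eq_inner hm, ω₂_apply, g_J_left])
  have h := extD_comp_of_isIntegrable (fun _ _ ↦ H.smoothFieldAt_J) hH.integrable_J H.J_sq
    hα (β := H.dI μ) (fun y v ↦ by
      change _ = - H.dI μ y (H.J y (H.J y v))
      rw [J_sq, map_neg, neg_neg]) u v
  rw [hd, hd] at h
  change _ = - - H.ω₃ x (H.J x u) v - - H.ω₃ x u (H.J x v) at h
  rw [ω₃_apply, ω₃_apply, K_J, map_neg, ← neg_neg (H.g.inner x (H.K x u) (H.J x v)), ← g_J_left,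
    J_K] at h
  rw [hypForm_apply, hypForm_apply, ω₁_apply, ω₁_apply, I_J,
    ← neg_neg (H.g.inner x (H.K x u) (H.J x v)), ← g_J_left, J_K]
  simp only [neg_apply] at h
  linarith

/-- As for `J`, with `α = i_X ω₃`, whose differential is `ω₂`. -/
theorem isOneOne_K_hypForm (hH : H.IsHyperkahler) (hT : IsRotating H)
    (hμ : ContMDiff 𝓘(ℝ, E) 𝓘(ℝ, ℝ) ∞ μ)
    (hm : ∀ (x : M) (v : TangentSpace 𝓘(ℝ, E) x),
      H.ω₁ x (fundField (𝓡 1) Circle circleGen x) v = dfun μ x v) :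
    IsOneOne H.K (H.hypForm μ) := by
  intro x u v
  let α : ∀ y : M, TangentSpace 𝓘(ℝ, E) y →L[ℝ] ℝ := fun y ↦ - (H.dI μ y).comp (H.K y)
  have hα : SmoothOneAt α x :=
    SmoothOneAt.neg (α := fun y ↦ (H.dI μ y).comp (H.K y))
      fun _ hX ↦ H.smoothOneAt_dI hμ x _ (H.smoothFieldAt_K hX)
  have hd := extD_interior_of_rotating hT.smooth (ζ := H.ω₂) H.smoothTwoAt_ω₃ H.ω₃_anti
    hH.closed₃ (rotating_ω₃ hT) hα (fun y v ↦ by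
      change - H.dI μ y (H.K y v) = _
      rw [H.dI_eq_inner hm, ω₃_apply, g_K_left])
  have h := extD_comp_of_isIntegrable (fun _ _ ↦ H.smoothFieldAt_K) hH.integrable_K H.K_sq
    hα (β := H.dI μ) (fun y v ↦ by
      change _ = - H.dI μ y (H.K y (H.K y v))
      rw [K_sq, map_neg, neg_neg]) u v
  rw [hd, hd, ω₂_apply, ω₂_apply, J_K, ← neg_neg (H.g.inner x (H.J x u) (H.K x v)), ← g_K_left,
    K_J, map_neg] at h
  rw [hypForm_apply, hypForm_apply, ω₁_apply, ω₁_apply, I_K, map_neg]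
  simp only [neg_apply] at h ⊢
  rw [← neg_neg (H.g.inner x (H.J x u) (H.K x v)), ← g_K_left, K_J, map_neg]
  simp only [neg_apply] at h ⊢
  linarith

end AlmostHyperhermitian

/-! ### Complex line bundles -/

namespace ComplexLineBundle

variable {E : Type*} [NormedAddCommGroup E] [NormedSpace ℝ E] [FiniteDimensional ℝ E]
  {M : Type*} [TopologicalSpace M] [ChartedSpace E M] [IsManifold 𝓘(ℝ, E) ∞ M]
  (L : ComplexLineBundle.{w} E M)

theorem triv_smul (e : Trivialization ℂ (TotalSpace.proj : L.Tot → M)) [MemTrivializationAtlas e]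
    {x : M} (hx : x ∈ e.baseSet) (c : ℂ) (a : L.Fiber x) :
    (e ⟨x, c • a⟩).2 = c * (e ⟨x, a⟩).2 :=
  (e.linear ℂ hx).map_smul c a

theorem triv_add (e : Trivialization ℂ (TotalSpace.proj : L.Tot → M)) [MemTrivializationAtlas e]
    {x : M} (hx : x ∈ e.baseSet) (a b : L.Fiber x) :
    (e ⟨x, a + b⟩).2 = (e ⟨x, a⟩).2 + (e ⟨x, b⟩).2 :=
  (e.linear ℂ hx).map_add a b

theorem triv_injective (e : Trivialization ℂ (TotalSpace.proj : L.Tot → M))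
    [MemTrivializationAtlas e] {x : M} (hx : x ∈ e.baseSet) :
    Function.Injective (fun a : L.Fiber x ↦ (e ⟨x, a⟩).2) :=
  (e.linearEquivAt ℂ x hx).injective

theorem triv_ne_zero (e : Trivialization ℂ (TotalSpace.proj : L.Tot → M))
    [MemTrivializationAtlas e] {x : M} (hx : x ∈ e.baseSet) {a : L.Fiber x} (ha : a ≠ 0) :
    (e ⟨x, a⟩).2 ≠ 0 :=
  (e.linearEquivAt ℂ x hx).map_ne_zero_iff.2 ha

/-- The quotient of two points in the same fibre. -/
def ratio (p q : L.Tot) : ℂ :=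
  (trivializationAt ℂ L.Fiber q.1 p).2 / (trivializationAt ℂ L.Fiber q.1 q).2

variable {L}

theorem ratio_smul {x : M} {b : L.Fiber x} (hb : b ≠ 0) (a : L.Fiber x) :
    L.ratio ⟨x, a⟩ ⟨x, b⟩ • b = a := by
  have hx := mem_baseSet_trivializationAt ℂ L.Fiber x
  refine L.triv_injective _ hx ?_
  change (trivializationAt ℂ L.Fiber x ⟨x, _⟩).2 = (trivializationAt ℂ L.Fiber x ⟨x, a⟩).2
  rw [L.triv_smul _ hx]
  exact div_mul_cancel₀ _ (L.triv_ne_zero _ hx hb)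

theorem smul_cancel {x : M} {b : L.Fiber x} (hb : b ≠ 0) {c c' : ℂ} (h : c • b = c' • b) :
    c = c' := by
  have hx := mem_baseSet_trivializationAt ℂ L.Fiber x
  have h1 := congrArg (fun a ↦ (trivializationAt ℂ L.Fiber x ⟨x, a⟩).2) h
  simp only [L.triv_smul _ hx] at h1
  exact mul_right_cancel₀ (L.triv_ne_zero _ hx hb) h1

theorem ratio_smul_self {x : M} {b : L.Fiber x} (hb : b ≠ 0) (c : ℂ) :
    L.ratio ⟨x, c • b⟩ ⟨x, b⟩ = c :=
  smul_cancel hb (ratio_smul hb _)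

theorem ratio_self {x : M} {b : L.Fiber x} (hb : b ≠ 0) : L.ratio ⟨x, b⟩ ⟨x, b⟩ = 1 :=
  smul_cancel hb (by rw [ratio_smul hb, one_smul])

/-- All trivializations are complex linear, so the quotient of two points of a fibre does not depend
on the one used to compute it. -/
theorem ratio_eq_triv (e : Trivialization ℂ (TotalSpace.proj : L.Tot → M))
    [MemTrivializationAtlas e] {p q : L.Tot} (hq : q.1 ∈ e.baseSet) (h : p.1 = q.1)
    (h0 : q.2 ≠ 0) : L.ratio p q = (e p).2 / (e q).2 := by
  obtain ⟨x, a⟩ := p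
  obtain ⟨y, b⟩ := q
  obtain rfl : x = y := h
  have := L.triv_smul e hq (L.ratio ⟨x, a⟩ ⟨x, b⟩) b
  rw [ratio_smul h0] at this
  rw [this, mul_div_cancel_right₀ _ (L.triv_ne_zero e hq h0)]

/-- Scalar multiplication on the total space. -/
def smulTot (c : ℂ) (p : L.Tot) : L.Tot := ⟨p.1, c • p.2⟩

theorem ratio_smulTot {p q : L.Tot} (h : p.1 = q.1) (h0 : q.2 ≠ 0) :
    smulTot (L.ratio p q) q = p := by
  obtain ⟨x, a⟩ := p
  obtain ⟨y, b⟩ := q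
  obtain rfl : x = y := h
  exact congrArg (fun a ↦ (⟨x, a⟩ : L.Tot)) (ratio_smul h0 a)

theorem ratio_smulTot_self {q : L.Tot} (h0 : q.2 ≠ 0) (c : ℂ) : L.ratio (smulTot c q) q = c :=
  ratio_smul_self h0 c

theorem ratio_smulTot_left {p q : L.Tot} (h : p.1 = q.1) (h0 : q.2 ≠ 0) (c : ℂ) :
    L.ratio (smulTot c p) q = c * L.ratio p q := by
  have h1 : smulTot c p = smulTot (c * L.ratio p q) q := by
    conv_lhs => rw [← ratio_smulTot h h0]
    exact congrArg (fun a ↦ (⟨q.1, a⟩ : L.Tot)) (smul_smul _ _ _)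
  rw [h1, ratio_smulTot_self h0]

theorem ratio_mul {p q r : L.Tot} (h : p.1 = q.1) (h' : q.1 = r.1) (hq : q.2 ≠ 0) (hr : r.2 ≠ 0) :
    L.ratio p q * L.ratio q r = L.ratio p r := by
  conv_rhs => rw [← ratio_smulTot h hq, ratio_smulTot_left h' hr]

section Smooth

variable {EX : Type*} [NormedAddCommGroup EX] [NormedSpace ℝ EX] {HX : Type*} [TopologicalSpace HX]
  {IX : ModelWithCorners ℝ EX HX} {X : Type*} [TopologicalSpace X] [ChartedSpace HX X]
  {p q : X → L.Tot} {c : X → ℂ} {x : X}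

theorem _root_.ContMDiffAt.complexMul {n : ℕ∞ω} {a b : X → ℂ} (ha : ContMDiffAt IX 𝓘(ℝ, ℂ) n a x)
    (hb : ContMDiffAt IX 𝓘(ℝ, ℂ) n b x) : ContMDiffAt IX 𝓘(ℝ, ℂ) n (fun y ↦ a y * b y) x :=
  (contDiff_mul (𝕜 := ℝ) (𝔸 := ℂ)).contMDiff.contMDiffAt.comp x (ha.prodMk_space hb)

theorem mem_source_triv (p : L.Tot) : p ∈ (trivializationAt ℂ L.Fiber p.1).source := by
  rw [Trivialization.mem_source]
  exact mem_baseSet_trivializationAt ℂ L.Fiber p.1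

theorem mem_source_triv_of_eq {p q : L.Tot} (h : p.1 = q.1) :
    p ∈ (trivializationAt ℂ L.Fiber q.1).source := by
  rw [← h]
  exact mem_source_triv p

/-- Near `x` both points are read in the single trivialization at the base point of `q x`, where the
ratio is a quotient of smooth functions. -/
theorem _root_.ContMDiffAt.lineRatio (hp : ContMDiffAt IX (𝓘(ℝ, E).prod 𝓘(ℝ, ℂ)) ∞ p x)
    (hq : ContMDiffAt IX (𝓘(ℝ, E).prod 𝓘(ℝ, ℂ)) ∞ q x) (h : ∀ᶠ y in 𝓝 x, (p y).1 = (q y).1)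
    (h0 : (q x).2 ≠ 0) : ContMDiffAt IX 𝓘(ℝ, ℂ) ∞ (fun y ↦ L.ratio (p y) (q y)) x := by
  set e := trivializationAt ℂ L.Fiber (q x).1 with he
  have hp1 := (e.contMDiffAt_iff (IB := 𝓘(ℝ, E)) (mem_source_triv_of_eq h.self_of_nhds)).1 hp
  have hq1 := (e.contMDiffAt_iff (IB := 𝓘(ℝ, E)) (mem_source_triv (q x))).1 hq
  have hx := mem_baseSet_trivializationAt ℂ L.Fiber (q x).1
  have h2 : (e (q x)).2 ≠ 0 := L.triv_ne_zero e hx h0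
  have hs := hq1.1.continuousAt.eventually (e.open_baseSet.mem_nhds hx)
  have hn := hq1.2.continuousAt.eventually_ne h2
  have h1 : ContMDiffAt IX 𝓘(ℝ, ℂ) ∞ (fun y ↦ (e (p y)).2 * ((e (q y)).2)⁻¹) x :=
    hp1.2.complexMul (ContMDiffAt.comp x (g := fun z : ℂ ↦ z⁻¹) (contDiffAt_inv ℝ h2).contMDiffAt hq1.2)
  refine h1.congr_of_eventuallyEq ?_
  filter_upwards [h, hs, hn] with y hy hys hyn
  refine ratio_eq_triv e hys hy fun h3 ↦ hyn ?_
  have h4 := L.triv_smul e hys 0 (q y).2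
  rw [zero_smul, zero_mul, ← h3] at h4
  exact h4

theorem _root_.MDifferentiableAt.lineRatio
    (hp : MDifferentiableAt IX (𝓘(ℝ, E).prod 𝓘(ℝ, ℂ)) p x)
    (hq : MDifferentiableAt IX (𝓘(ℝ, E).prod 𝓘(ℝ, ℂ)) q x) (h : ∀ᶠ y in 𝓝 x, (p y).1 = (q y).1)
    (h0 : (q x).2 ≠ 0) : MDifferentiableAt IX 𝓘(ℝ, ℂ) (fun y ↦ L.ratio (p y) (q y)) x := by
  set e := trivializationAt ℂ L.Fiber (q x).1 with he
  have hp1 := (e.mdifferentiableAt_totalSpace_iff 𝓘(ℝ, E) _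
    (mem_source_triv_of_eq h.self_of_nhds)).1 hp
  have hq1 := (e.mdifferentiableAt_totalSpace_iff 𝓘(ℝ, E) _ (mem_source_triv (q x))).1 hq
  have hx := mem_baseSet_trivializationAt ℂ L.Fiber (q x).1
  have h2 : (e (q x)).2 ≠ 0 := L.triv_ne_zero e hx h0
  have hs := hq1.1.continuousAt.eventually (e.open_baseSet.mem_nhds hx)
  have hn := hq1.2.continuousAt.eventually_ne h2
  have h1 : MDifferentiableAt IX 𝓘(ℝ, ℂ) (fun y ↦ (e (p y)).2 * ((e (q y)).2)⁻¹) x := by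
    have h5 : MDifferentiableAt IX 𝓘(ℝ, ℂ) (fun y ↦ ((e (q y)).2)⁻¹) x :=
      MDifferentiableAt.comp x (g := fun z : ℂ ↦ z⁻¹)
        ((contDiffAt_inv ℝ (n := 1) h2).differentiableAt (by simp)).mdifferentiableAt hq1.2
    exact hp1.2.mul h5
  refine h1.congr_of_eventuallyEq ?_
  filter_upwards [h, hs, hn] with y hy hys hyn
  refine ratio_eq_triv e hys hy fun h3 ↦ hyn ?_
  have h4 := L.triv_smul e hys 0 (q y).2
  rw [zero_smul, zero_mul, ← h3] at h4
  exact h4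

theorem _root_.ContMDiffAt.lineSmul (hc : ContMDiffAt IX 𝓘(ℝ, ℂ) ∞ c x)
    (hp : ContMDiffAt IX (𝓘(ℝ, E).prod 𝓘(ℝ, ℂ)) ∞ p x) :
    ContMDiffAt IX (𝓘(ℝ, E).prod 𝓘(ℝ, ℂ)) ∞ (fun y ↦ smulTot (c y) (p y)) x := by
  set e := trivializationAt ℂ L.Fiber (p x).1 with he
  have hp1 := (e.contMDiffAt_iff (IB := 𝓘(ℝ, E)) (mem_source_triv (p x))).1 hp
  refine (e.contMDiffAt_iff (IB := 𝓘(ℝ, E)) (f := fun y ↦ smulTot (c y) (p y))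
    (mem_source_triv_of_eq (p := smulTot (c x) (p x)) rfl)).2 ⟨hp1.1, ?_⟩
  have hs := hp1.1.continuousAt.eventually (e.open_baseSet.mem_nhds
    (mem_baseSet_trivializationAt ℂ L.Fiber (p x).1))
  exact (hc.complexMul hp1.2).congr_of_eventuallyEq (hs.mono fun y hy ↦ L.triv_smul e hy _ _)

theorem _root_.MDifferentiableAt.lineSmul (hc : MDifferentiableAt IX 𝓘(ℝ, ℂ) c x)
    (hp : MDifferentiableAt IX (𝓘(ℝ, E).prod 𝓘(ℝ, ℂ)) p x) :
    MDifferentiableAt IX (𝓘(ℝ, E).prod 𝓘(ℝ, ℂ)) (fun y ↦ smulTot (c y) (p y)) x := by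
  set e := trivializationAt ℂ L.Fiber (p x).1 with he
  have hp1 := (e.mdifferentiableAt_totalSpace_iff 𝓘(ℝ, E) _ (mem_source_triv (p x))).1 hp
  refine (e.mdifferentiableAt_totalSpace_iff 𝓘(ℝ, E) (fun y ↦ smulTot (c y) (p y))
    (mem_source_triv_of_eq (p := smulTot (c x) (p x)) rfl)).2 ⟨hp1.1, ?_⟩
  have hs := hp1.1.continuousAt.eventually (e.open_baseSet.mem_nhds
    (mem_baseSet_trivializationAt ℂ L.Fiber (p x).1))
  exact (hc.mul hp1.2).congr_of_eventuallyEq (hs.mono fun y hy ↦ L.triv_smul e hy _ _)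

end Smooth

/-- A section that is smooth everywhere. -/
def SmoothSec (u : ∀ x, L.Fiber x) : Prop := ∀ x, L.SmoothAt u x

theorem SmoothAt.diffAt {s : ∀ x, L.Fiber x} {x : M} (h : L.SmoothAt s x) : L.DiffAt s x :=
  ContMDiffAt.mdifferentiableAt h (by simp)

/-- A local extension times a bump function. Sections smooth on all of `M` are required because
smoothness of a connection is a condition on such sections. -/
theorem exists_smoothSec [T2Space M] (x : M) (v : L.Fiber x) :
    ∃ u : ∀ x, L.Fiber x, SmoothSec u ∧ u x = v := by
  let e := trivializationAt ℂ L.Fiber x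
  let t : ∀ y, L.Fiber y := FiberBundle.extend ℂ v
  obtain ⟨S, hS, hSm⟩ := FiberBundle.exists_contMDiffOn_extend (k := ∞) 𝓘(ℝ, E) ℂ v
  obtain ⟨ψ, -, hψ⟩ := (SmoothBumpFunction.nhds_basis_tsupport (I := 𝓘(ℝ, E)) x).mem_iff.1
    (interior_mem_nhds.2 hS)
  refine ⟨fun y ↦ (ψ y : ℝ) • t y, ?_, ?_⟩
  · have h1 : ContMDiffOn 𝓘(ℝ, E) (𝓘(ℝ, E).prod 𝓘(ℝ, ℂ)) ∞
        (fun y ↦ TotalSpace.mk' ℂ y (t y)) (interior S) := hSm.mono interior_subset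
    have h2 := ContMDiffOn.smul_section_of_tsupport (V := L.Fiber) (F := ℂ) (ψ := ψ)
      (ψ.contMDiff.contMDiffOn) isOpen_interior hψ h1
    exact h2
  · change (ψ x : ℝ) • FiberBundle.extend ℂ v x = v
    rw [ψ.eq_one, one_smul]
    simp

theorem exists_frame [T2Space M] (x : M) :
    ∃ u : ∀ x, L.Fiber x, SmoothSec u ∧ u x ≠ 0 := by
  obtain ⟨u, hu, hux⟩ := exists_smoothSec x ((trivializationAt ℂ L.Fiber x).symm x 1)
  refine ⟨u, hu, fun h0 ↦ ?_⟩
  have hb := mem_baseSet_trivializationAt ℂ L.Fiber x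
  have h1 := (trivializationAt ℂ L.Fiber x).apply_mk_symm hb (1 : ℂ)
  rw [← hux, h0] at h1
  have h2 := L.triv_smul _ hb 0 (0 : L.Fiber x)
  rw [smul_zero, zero_mul, h1] at h2
  exact one_ne_zero h2

end ComplexLineBundle

/-! ### Covariant derivatives and connection forms in a local frame -/

namespace ComplexLineBundle

variable {E : Type*} [NormedAddCommGroup E] [NormedSpace ℝ E] [FiniteDimensional ℝ E]
  {M : Type*} [TopologicalSpace M] [ChartedSpace E M] [IsManifold 𝓘(ℝ, E) ∞ M]
  {L : ComplexLineBundle.{w} E M} {x : M}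

theorem DiffAt.smul {F : M → ℂ} {s : ∀ x, L.Fiber x} (hF : MDifferentiableAt 𝓘(ℝ, E) 𝓘(ℝ, ℂ) F x)
    (hs : L.DiffAt s x) : L.DiffAt (fun y ↦ F y • s y) x :=
  hF.lineSmul hs

theorem SmoothAt.smul {F : M → ℂ} {s : ∀ x, L.Fiber x}
    (hF : ContMDiffAt 𝓘(ℝ, E) 𝓘(ℝ, ℂ) ∞ F x)
    (hs : L.SmoothAt s x) : L.SmoothAt (fun y ↦ F y • s y) x :=
  hF.lineSmul hs

/-- The ratio of `u` to itself is continuous with value `1` at `x`, while by division by zero it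
takes the value `0` where `u` vanishes. -/
theorem eventually_ne_zero {u : ∀ x, L.Fiber x} (hu : L.DiffAt u x) (h0 : u x ≠ 0) :
    ∀ᶠ y in 𝓝 x, u y ≠ 0 := by
  have h := (MDifferentiableAt.lineRatio hu hu (.of_forall fun _ ↦ rfl) h0).continuousAt
  have h1 : L.ratio (L.sec u x) (L.sec u x) ≠ 0 := by
    rw [sec, ratio_self h0]; exact one_ne_zero
  filter_upwards [h.eventually_ne h1] with y hy h2
  apply hy
  have h3 : (0 : L.Fiber y) = (0 : ℂ) • u y := (zero_smul ℂ _).symm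
  have hy := mem_baseSet_trivializationAt ℂ L.Fiber y
  have h4 := L.triv_smul _ hy 0 (u y)
  rw [zero_smul, zero_mul, ← h2] at h4
  rw [ratio, sec, h4, zero_div]

/-- A differentiable section is a differentiable multiple of a local frame. -/
theorem DiffAt.exists_smul {u s : ∀ x, L.Fiber x} (hu : L.DiffAt u x) (h0 : u x ≠ 0)
    (hs : L.DiffAt s x) : ∃ F : M → ℂ, MDifferentiableAt 𝓘(ℝ, E) 𝓘(ℝ, ℂ) F x ∧
      ∀ᶠ y in 𝓝 x, s y = F y • u y :=
  ⟨fun y ↦ L.ratio (L.sec s y) (L.sec u y), .lineRatio hs hu (.of_forall fun _ ↦ rfl) h0,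
    (eventually_ne_zero hu h0).mono fun _ hy ↦ (ratio_smul hy _).symm⟩

theorem SmoothAt.exists_smul {u s : ∀ x, L.Fiber x} (hu : L.SmoothAt u x) (h0 : u x ≠ 0)
    (hs : L.SmoothAt s x) : ∃ F : M → ℂ, ContMDiffAt 𝓘(ℝ, E) 𝓘(ℝ, ℂ) ∞ F x ∧
      ∀ᶠ y in 𝓝 x, s y = F y • u y :=
  ⟨fun y ↦ L.ratio (L.sec s y) (L.sec u y), .lineRatio hs hu (.of_forall fun _ ↦ rfl) h0,
    (eventually_ne_zero hu.diffAt h0).mono fun _ hy ↦ (ratio_smul hy _).symm⟩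

theorem DiffAt.congr {s s' : ∀ x, L.Fiber x} (hs : L.DiffAt s x) (h : ∀ᶠ y in 𝓝 x, s' y = s y) :
    L.DiffAt s' x :=
  MDifferentiableAt.congr_of_eventuallyEq hs (h.mono fun _ hy ↦ congrArg (TotalSpace.mk' ℂ _) hy)

theorem SmoothAt.congr {s s' : ∀ x, L.Fiber x} (hs : L.SmoothAt s x)
    (h : ∀ᶠ y in 𝓝 x, s' y = s y) : L.SmoothAt s' x :=
  ContMDiffAt.congr_of_eventuallyEq hs (h.mono fun _ hy ↦ congrArg (TotalSpace.mk' ℂ _) hy)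

namespace Connection

variable (D : L.Connection)

theorem cov_congr {s s' : ∀ x, L.Fiber x} (hs : L.DiffAt s x) (h : ∀ᶠ y in 𝓝 x, s' y = s y) :
    D.cov s' x = D.cov s x :=
  D.cov.isCovariantDerivativeOnUniv.congr_of_eventuallyEq (hs.congr h) hs Filter.univ_mem h

/-- The Leibniz rule for complex functions. -/
theorem cov_smul {F : M → ℂ} {s : ∀ x, L.Fiber x} (hF : MDifferentiableAt 𝓘(ℝ, E) 𝓘(ℝ, ℂ) F x)
    (hs : L.DiffAt s x) (v : TangentSpace 𝓘(ℝ, E) x) :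
    D.cov (fun y ↦ F y • s y) x v = F x • D.cov s x v + (mvfderiv 𝓘(ℝ, E) F x v : ℂ) • s x := by
  have hre : HasMFDerivAt 𝓘(ℝ, E) 𝓘(ℝ, ℝ) (fun y ↦ (F y).re) x
      (Complex.reCLM.comp (mfderiv 𝓘(ℝ, E) 𝓘(ℝ, ℂ) F x)) :=
    (Complex.reCLM.hasFDerivAt (x := F x)).hasMFDerivAt.comp x hF.hasMFDerivAt
  have him : HasMFDerivAt 𝓘(ℝ, E) 𝓘(ℝ, ℝ) (fun y ↦ (F y).im) x
      (Complex.imCLM.comp (mfderiv 𝓘(ℝ, E) 𝓘(ℝ, ℂ) F x)) :=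
    (Complex.imCLM.hasFDerivAt (x := F x)).hasMFDerivAt.comp x hF.hasMFDerivAt
  have hIs : L.DiffAt (fun y ↦ Complex.I • s y) x := DiffAt.smul mdifferentiableAt_const hs
  have hofReal : ∀ f : M → ℝ, MDifferentiableAt 𝓘(ℝ, E) 𝓘(ℝ, ℝ) f x →
      MDifferentiableAt 𝓘(ℝ, E) 𝓘(ℝ, ℂ) (fun y ↦ (f y : ℂ)) x := fun f hf ↦
    Complex.ofRealCLM.mdifferentiableAt.comp x hf
  have h1 := D.cov.isCovariantDerivativeOnUniv.leibniz hs hre.mdifferentiableAt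
  have h2 := D.cov.isCovariantDerivativeOnUniv.leibniz hIs him.mdifferentiableAt
  have hd1 : L.DiffAt ((fun y ↦ (F y).re) • s) x :=
    DiffAt.smul (hofReal _ hre.mdifferentiableAt) hs
  have hd2 : L.DiffAt ((fun y ↦ (F y).im) • (fun y ↦ Complex.I • s y)) x :=
    DiffAt.smul (hofReal _ him.mdifferentiableAt) hIs
  have h3 := D.cov.isCovariantDerivativeOnUniv.add hd1 hd2
  -- Covariant derivatives satisfy the Leibniz rule for real functions, so the real and imaginary
  -- parts are treated separately and recombined by complex linearity.
  have h4 : (fun y ↦ F y • s y)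
      = (fun y ↦ (F y).re) • s + (fun y ↦ (F y).im) • (fun y ↦ Complex.I • s y) := by
    funext y
    change F y • s y = ((F y).re : ℂ) • s y + ((F y).im : ℂ) • (Complex.I • s y)
    rw [smul_smul, ← add_smul, Complex.re_add_im]
  rw [h4]
  have hmre : (mvfderiv 𝓘(ℝ, E) (fun y ↦ (F y).re) x v : ℝ)
      = (mvfderiv 𝓘(ℝ, E) F x v : ℂ).re :=
    congrArg (fun A : E →L[ℝ] ℝ ↦ A v) hre.mfderiv
  have hmim : (mvfderiv 𝓘(ℝ, E) (fun y ↦ (F y).im) x v : ℝ)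
      = (mvfderiv 𝓘(ℝ, E) F x v : ℂ).im :=
    congrArg (fun A : E →L[ℝ] ℝ ↦ A v) him.mfderiv
  refine (congrArg (fun A : TangentSpace 𝓘(ℝ, E) x →L[ℝ] L.Fiber x ↦ A v) h3).trans ?_
  refine (congrArg₂ (fun A A' : TangentSpace 𝓘(ℝ, E) x →L[ℝ] L.Fiber x ↦ A v + A' v) h1 h2).trans ?_
  change (((F x).re : ℂ) • D.cov s x v
      + ((mvfderiv 𝓘(ℝ, E) (fun y ↦ (F y).re) x v : ℝ) : ℂ) • s x)
    + (((F x).im : ℂ) • D.cov (fun y ↦ Complex.I • s y) x v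
      + ((mvfderiv 𝓘(ℝ, E) (fun y ↦ (F y).im) x v : ℝ) : ℂ) • Complex.I • s x) = _
  rw [D.complexLinear s x hs v, hmre, hmim]
  have e1 := Complex.re_add_im (F x)
  have e2 := Complex.re_add_im (mvfderiv 𝓘(ℝ, E) F x v : ℂ)
  conv_rhs => rw [← e1, ← e2]
  simp only [add_smul, smul_smul]
  abel

/-- The connection form of the connection in the local frame `u`. -/
def form (u : ∀ x, L.Fiber x) (x : M) : TangentSpace 𝓘(ℝ, E) x →L[ℝ] ℂ :=
  (ContinuousLinearMap.mul ℝ ℂ ((trivializationAt ℂ L.Fiber x ⟨x, u x⟩).2)⁻¹).comp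
    (((trivializationAt ℂ L.Fiber x).continuousLinearMapAt ℝ x).comp (D.cov u x))

theorem form_apply (u : ∀ x, L.Fiber x) (x : M) (v : TangentSpace 𝓘(ℝ, E) x) :
    D.form u x v = L.ratio ⟨x, D.cov u x v⟩ ⟨x, u x⟩ := by
  change (_)⁻¹ * ((trivializationAt ℂ L.Fiber x).continuousLinearMapAt ℝ x (D.cov u x v)) = _
  rw [Trivialization.continuousLinearMapAt_apply, Trivialization.linearMapAt_apply,
    if_pos (mem_baseSet_trivializationAt ℂ L.Fiber x), ratio, div_eq_inv_mul]

theorem form_smul {u : ∀ x, L.Fiber x} (h0 : u x ≠ 0) (v : TangentSpace 𝓘(ℝ, E) x) :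
    D.form u x v • u x = D.cov u x v := by
  rw [form_apply, ratio_smul h0]

theorem cov_eq {u s : ∀ x, L.Fiber x} {F : M → ℂ} (hu : L.DiffAt u x) (h0 : u x ≠ 0)
    (hF : MDifferentiableAt 𝓘(ℝ, E) 𝓘(ℝ, ℂ) F x) (h : ∀ᶠ y in 𝓝 x, s y = F y • u y)
    (v : TangentSpace 𝓘(ℝ, E) x) :
    D.cov s x v = ((mvfderiv 𝓘(ℝ, E) F x v : ℂ) + F x * D.form u x v) • u x := by
  rw [D.cov_congr (DiffAt.smul hF hu) h, D.cov_smul hF hu, ← D.form_smul h0, smul_smul, add_smul,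
    add_comm]

/-- The covariant derivative of a section along a map depends only on the values of the section
along the map. -/
theorem cov_congr_comp [T2Space M] {EB : Type*} [NormedAddCommGroup EB] [NormedSpace ℝ EB]
    {HB : Type*} [TopologicalSpace HB] {IB : ModelWithCorners ℝ EB HB}
    {B : Type*} [TopologicalSpace B] [ChartedSpace HB B] {f : B → M} {b : B}
    (hf : MDifferentiableAt IB 𝓘(ℝ, E) f b) {s s' : ∀ x, L.Fiber x}
    (hs : L.DiffAt s (f b)) (hs' : L.DiffAt s' (f b)) (h : ∀ᶠ y in 𝓝 b, s (f y) = s' (f y))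
    (v : TangentSpace IB b) :
    D.cov s (f b) (mfderiv IB 𝓘(ℝ, E) f b v) = D.cov s' (f b) (mfderiv IB 𝓘(ℝ, E) f b v) := by
  obtain ⟨u, hu, hu0⟩ := exists_frame (L := L) (f b)
  obtain ⟨F, hF, hFs⟩ := (hu (f b)).diffAt.exists_smul hu0 hs
  obtain ⟨F', hF', hFs'⟩ := (hu (f b)).diffAt.exists_smul hu0 hs'
  rw [D.cov_eq (hu _).diffAt hu0 hF hFs, D.cov_eq (hu _).diffAt hu0 hF' hFs']
  have hc := hf.continuousAt
  -- The coefficients agree only along `f`, which is enough: the directional derivative along `f`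
  -- sees nothing else.
  have h1 : F ∘ f =ᶠ[𝓝 b] F' ∘ f := by
    filter_upwards [h, hc.eventually hFs, hc.eventually hFs',
      hc.eventually (eventually_ne_zero (hu _).diffAt hu0)] with y hy h2 h3 h4
    rw [h2, h3] at hy
    exact smul_cancel h4 hy
  have h2 : mvfderiv 𝓘(ℝ, E) F (f b) (mfderiv IB 𝓘(ℝ, E) f b v)
      = mvfderiv 𝓘(ℝ, E) F' (f b) (mfderiv IB 𝓘(ℝ, E) f b v) := by
    have h3 := (hF.hasMFDerivAt.comp b hf.hasMFDerivAt).congr_of_eventuallyEq h1.symm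
    have h4 := hasMFDerivAt_unique h3 (hF'.hasMFDerivAt.comp b hf.hasMFDerivAt)
    exact congrArg (fun A : TangentSpace IB b →L[ℝ] ℂ ↦ A v) h4
  have h3 : F (f b) = F' (f b) := h1.self_of_nhds
  rw [h2, h3]

theorem smoothAt_cov {u : ∀ x, L.Fiber x} (hu : SmoothSec u) {X : ∀ x : M, TangentSpace 𝓘(ℝ, E) x}
    (hX : SmoothFieldAt X x) : L.SmoothAt (fun y ↦ D.cov u y (X y)) x := by
  have h : ContMDiffOn 𝓘(ℝ, E) (𝓘(ℝ, E).prod 𝓘(ℝ, ℂ)) (∞ + 1) (L.sec u) Set.univ :=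
    fun y _ ↦ (hu y).contMDiffWithinAt
  have h1 := (D.smooth.contMDiff.contMDiff h).contMDiffAt (x := x) Filter.univ_mem
  exact h1.clm_bundle_apply hX

theorem smoothOneAt_form {u : ∀ x, L.Fiber x} (hu : SmoothSec u) (h0 : u x ≠ 0) :
    SmoothOneAt (D.form u) x := by
  intro X hX
  simp only [form_apply]
  exact ContMDiffAt.lineRatio (D.smoothAt_cov hu hX) (hu x) (.of_forall fun _ ↦ rfl) h0

end Connection

end ComplexLineBundle

/-! ### Curvature as the differential of the connection form -/

namespace ComplexLineBundle

variable {E : Type*} [NormedAddCommGroup E] [NormedSpace ℝ E] [FiniteDimensional ℝ E]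
  {M : Type*} [TopologicalSpace M] [ChartedSpace E M] [IsManifold 𝓘(ℝ, E) ∞ M]
  {L : ComplexLineBundle.{w} E M} {x : M}

theorem mvfderiv_complexMul {a b : M → ℂ} (ha : MDifferentiableAt 𝓘(ℝ, E) 𝓘(ℝ, ℂ) a x)
    (hb : MDifferentiableAt 𝓘(ℝ, E) 𝓘(ℝ, ℂ) b x) (v : TangentSpace 𝓘(ℝ, E) x) :
    (mvfderiv 𝓘(ℝ, E) (fun y ↦ a y * b y) x v : ℂ)
      = a x * (mvfderiv 𝓘(ℝ, E) b x v : ℂ) + (mvfderiv 𝓘(ℝ, E) a x v : ℂ) * b x := by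
  have h := congrArg (fun A : E →L[ℝ] ℂ ↦ A v) (ha.hasMFDerivAt.mul hb.hasMFDerivAt).mfderiv
  refine Eq.trans h ?_
  change a x * (mvfderiv 𝓘(ℝ, E) b x v : ℂ) + b x * (mvfderiv 𝓘(ℝ, E) a x v : ℂ) = _
  ring

namespace Connection

variable (D : L.Connection)

/-- The curvature of a connection is the exterior derivative of the connection form. -/
theorem curvature_eq {u s : ∀ x, L.Fiber x} (hu : SmoothSec u) (h0 : u x ≠ 0)
    (hs : L.SmoothAt s x) {X Y : ∀ x : M, TangentSpace 𝓘(ℝ, E) x} (hX : SmoothFieldAt X x)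
    (hY : SmoothFieldAt Y x) :
    D.cov (fun y ↦ D.cov s y (Y y)) x (X x) - D.cov (fun y ↦ D.cov s y (X y)) x (Y x)
      - D.cov s x (VectorField.mlieBracket 𝓘(ℝ, E) X Y x)
      = (extD (D.form u) x (X x) (Y x) : ℂ) • s x := by
  obtain ⟨F, hF, hFs⟩ := (hu x).exists_smul h0 hs
  have hFd : ∀ᶠ y in 𝓝 x, MDifferentiableAt 𝓘(ℝ, E) 𝓘(ℝ, ℂ) F y := eventually_mdifferentiableAt hF
  have hθ := D.smoothOneAt_form hu h0
  have hdF := smoothOneAt_mvfderiv hF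
  let FZ : (∀ x : M, TangentSpace 𝓘(ℝ, E) x) → M → ℂ := fun Z y ↦
    (mvfderiv 𝓘(ℝ, E) F y (Z y) : ℂ) + F y * D.form u y (Z y)
  have hcov : ∀ Z : ∀ x : M, TangentSpace 𝓘(ℝ, E) x,
      ∀ᶠ y in 𝓝 x, D.cov s y (Z y) = FZ Z y • u y := by
    intro Z
    filter_upwards [hFd, eventually_ne_zero (hu x).diffAt h0, hFs.eventually_nhds] with y h1 h2 h3
    exact D.cov_eq (hu y).diffAt h2 h1 h3 _
  have hmd : ∀ {f : M → ℂ}, ContMDiffAt 𝓘(ℝ, E) 𝓘(ℝ, ℂ) ∞ f x →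
      MDifferentiableAt 𝓘(ℝ, E) 𝓘(ℝ, ℂ) f x := fun hf ↦ hf.mdifferentiableAt (by simp)
  have hcov2 : ∀ Z : ∀ x : M, TangentSpace 𝓘(ℝ, E) x, SmoothFieldAt Z x →
      ∀ v : TangentSpace 𝓘(ℝ, E) x, D.cov (fun y ↦ D.cov s y (Z y)) x v
        = ((mvfderiv 𝓘(ℝ, E) (fun y ↦ (mvfderiv 𝓘(ℝ, E) F y (Z y) : ℂ)) x v : ℂ)
          + (F x * (mvfderiv 𝓘(ℝ, E) (fun y ↦ D.form u y (Z y)) x v : ℂ)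
            + (mvfderiv 𝓘(ℝ, E) F x v : ℂ) * D.form u x (Z x))
          + ((mvfderiv 𝓘(ℝ, E) F x (Z x) : ℂ) + F x * D.form u x (Z x)) * D.form u x v) • u x := by
    intro Z hZ v
    have h1 := hmd (hdF Z hZ)
    have h2 := hmd (hθ Z hZ)
    have h3 := hmd (hF.complexMul (hθ Z hZ))
    rw [D.cov_eq (hu x).diffAt h0 (h1.add h3) (hcov Z), mvfderiv_add h1 h3,
      ← mvfderiv_complexMul (hmd hF) h2]
    rfl
  rw [hcov2 X hX, hcov2 Y hY, (hcov (VectorField.mlieBracket 𝓘(ℝ, E) X Y)).self_of_nhds,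
    hFs.self_of_nhds, smul_smul, ← sub_smul, ← sub_smul]
  congr 1
  have e1 := extD_apply_fields hdF hX hY
  have e2 := extD_apply_fields hθ hX hY
  rw [extD_mvfderiv hF] at e1
  rw [← e2]
  -- This is `d(dF) = 0`. The mixed terms in `dF` and the connection form cancel by antisymmetry,
  -- and so do the quadratic terms because the structure group is commutative. Only `F` times the
  -- differential of the form remains.
  have e3 : (mvfderiv 𝓘(ℝ, E) (fun y ↦ (mvfderiv 𝓘(ℝ, E) F y (Y y) : ℂ)) x (X x) : ℂ)
      - (mvfderiv 𝓘(ℝ, E) (fun y ↦ (mvfderiv 𝓘(ℝ, E) F y (X y) : ℂ)) x (Y x) : ℂ)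
      - (mvfderiv 𝓘(ℝ, E) F x (VectorField.mlieBracket 𝓘(ℝ, E) X Y x) : ℂ) = 0 := e1
  simp only [FZ]
  linear_combination e3

theorem extD_form {F : ∀ x : M, TangentSpace 𝓘(ℝ, E) x →L[ℝ] TangentSpace 𝓘(ℝ, E) x →L[ℝ] ℝ}
    (hF : D.HasCurvature F) {u : ∀ x, L.Fiber x} (hu : SmoothSec u) (h0 : u x ≠ 0)
    (v v' : TangentSpace 𝓘(ℝ, E) x) :
    (extD (D.form u) x v v' : ℂ) = Complex.I * (F x v v' : ℂ) := by
  obtain ⟨X, hX, rfl⟩ := exists_smoothFieldAt x v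
  obtain ⟨Y, hY, rfl⟩ := exists_smoothFieldAt x v'
  have h := hF x X Y u hX hY (hu x)
  rw [D.curvature_eq hu h0 (hu x) hX hY] at h
  exact smul_cancel h0 h

/-- Curvature is tensorial, so at each point a single frame determines it. -/
theorem hasCurvature_of_extD_form
    {F : ∀ x : M, TangentSpace 𝓘(ℝ, E) x →L[ℝ] TangentSpace 𝓘(ℝ, E) x →L[ℝ] ℝ}
    (h : ∀ x, ∃ u : ∀ x, L.Fiber x, SmoothSec u ∧ u x ≠ 0 ∧
      ∀ v v', (extD (D.form u) x v v' : ℂ) = Complex.I * (F x v v' : ℂ)) : D.HasCurvature F := by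
  intro x X Y s hX hY hs
  obtain ⟨u, hu, h0, hc⟩ := h x
  rw [D.curvature_eq hu h0 hs hX hY, hc]

end Connection

end ComplexLineBundle

/-! ### Adding a 1-form to a connection; identities for hermitian metrics -/

namespace ComplexLineBundle

variable {E : Type*} [NormedAddCommGroup E] [NormedSpace ℝ E] [FiniteDimensional ℝ E]
  {M : Type*} [TopologicalSpace M] [ChartedSpace E M] [IsManifold 𝓘(ℝ, E) ∞ M]
  {L : ComplexLineBundle.{w} E M} {x : M}

theorem contMDiffAt_clm_of_apply {V F : Type*} [NormedAddCommGroup V] [NormedSpace ℝ V]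
    [FiniteDimensional ℝ V] [NormedAddCommGroup F] [NormedSpace ℝ F]
    {f : M → V →L[ℝ] F} (h : ∀ u, ContMDiffAt 𝓘(ℝ, E) 𝓘(ℝ, F) ∞ (fun y ↦ f y u) x) :
    ContMDiffAt 𝓘(ℝ, E) 𝓘(ℝ, V →L[ℝ] F) ∞ f x := by
  have h1 : ContDiffAt ℝ ∞ (fun z ↦ f ((extChartAt 𝓘(ℝ, E) x).symm z))
      (extChartAt 𝓘(ℝ, E) x x) :=
    contDiffAt_clm_of_apply fun u ↦ contDiffAt_comp_symm le_rfl (h u)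
  refine (h1.contMDiffAt.comp x
    (contMDiffAt_extChartAt (I := 𝓘(ℝ, E)) (n := ∞) (x := x))).congr_of_eventuallyEq ?_
  filter_upwards [(chartAt E x).open_source.mem_nhds (mem_chart_source E x)] with y hy
  exact congrArg f ((extChartAt 𝓘(ℝ, E) x).left_inv (by rwa [extChartAt_source])).symm

/-- A covariant derivative is smooth if it maps smooth sections and vector fields to smooth
sections. -/
theorem contMDiffCovariantDerivative_of_apply {cov : CovariantDerivative 𝓘(ℝ, E) ℂ L.Fiber}
    (h : ∀ (s : ∀ x, L.Fiber x) (X : ∀ x : M, TangentSpace 𝓘(ℝ, E) x) (x : M), SmoothSec s →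
      SmoothFieldAt X x → L.SmoothAt (fun y ↦ cov s y (X y)) x) :
    CovariantDerivative.ContMDiffCovariantDerivative cov ∞ := by
  refine ⟨⟨fun {s} hs ↦ fun x _ ↦ ContMDiffAt.contMDiffWithinAt ?_⟩⟩
  have hs' : SmoothSec s := fun y ↦ (hs y (Set.mem_univ y)).contMDiffAt Filter.univ_mem
  rw [contMDiffAt_hom_bundle]
  refine ⟨contMDiffAt_id, contMDiffAt_clm_of_apply fun u ↦ ?_⟩
  have h1 := h s _ x hs' (smoothFieldAt_frameAt (E := E) x u)
  have h2 := ((trivializationAt ℂ L.Fiber x).contMDiffAt_section_iff (IB := 𝓘(ℝ, E))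
    (mem_baseSet_trivializationAt ℂ L.Fiber x)).1 h1
  refine h2.congr_of_eventuallyEq ?_
  filter_upwards [(trivializationAt ℂ L.Fiber x).open_baseSet.mem_nhds
      (mem_baseSet_trivializationAt ℂ L.Fiber x)] with y hy
  change (trivializationAt ℂ L.Fiber x).continuousLinearMapAt ℝ y (cov s y (frameAt x y u)) = _
  rw [Trivialization.continuousLinearMapAt_apply, Trivialization.linearMapAt_apply, if_pos hy]

theorem contMDiffAt_triv {s : ∀ x, L.Fiber x} :
    L.SmoothAt s x ↔
      ContMDiffAt 𝓘(ℝ, E) 𝓘(ℝ, ℂ) ∞ (fun y ↦ (trivializationAt ℂ L.Fiber x ⟨y, s y⟩).2) x :=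
  (trivializationAt ℂ L.Fiber x).contMDiffAt_section_iff (IB := 𝓘(ℝ, E))
    (mem_baseSet_trivializationAt ℂ L.Fiber x)

theorem SmoothAt.add {s s' : ∀ x, L.Fiber x} (h : L.SmoothAt s x) (h' : L.SmoothAt s' x) :
    L.SmoothAt (fun y ↦ s y + s' y) x := by
  rw [contMDiffAt_triv] at h h' ⊢
  refine (h.add h').congr_of_eventuallyEq ?_
  filter_upwards [(trivializationAt ℂ L.Fiber x).open_baseSet.mem_nhds
      (mem_baseSet_trivializationAt ℂ L.Fiber x)] with y hy
  exact L.triv_add _ hy _ _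

/-- The endomorphism-valued form `v ↦ β(v) a`. -/
def smulForm (β : TangentSpace 𝓘(ℝ, E) x →L[ℝ] ℂ) (a : L.Fiber x) :
    TangentSpace 𝓘(ℝ, E) x →L[ℝ] L.Fiber x :=
  (Complex.reCLM.comp β).smulRight a + (Complex.imCLM.comp β).smulRight (Complex.I • a)

theorem smulForm_apply (β : TangentSpace 𝓘(ℝ, E) x →L[ℝ] ℂ) (a : L.Fiber x)
    (v : TangentSpace 𝓘(ℝ, E) x) : smulForm β a v = β v • a := by
  change ((β v).re : ℂ) • a + ((β v).im : ℂ) • Complex.I • a = _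
  rw [smul_smul, ← add_smul, Complex.re_add_im]

namespace Connection

/-- The sum of a connection and a complex 1-form. -/
def addForm (D : L.Connection) (β : ∀ x : M, TangentSpace 𝓘(ℝ, E) x →L[ℝ] ℂ)
    (hβ : ∀ x, SmoothOneAt β x) : L.Connection where
  cov :=
    { toFun := fun s x ↦ D.cov s x + smulForm (β x) (s x)
      isCovariantDerivativeOnUniv :=
        { add := by
            intro s s' x hs hs' _
            ext v
            simp only [D.cov.isCovariantDerivativeOnUniv.add hs hs', add_apply, smulForm_apply,
              Pi.add_apply, smul_add]
            abel
          leibniz := by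
            intro s g x hs hg _
            have h := congrArg (fun A ↦ A) (D.cov.isCovariantDerivativeOnUniv.leibniz hs hg)
            ext v
            have h1 : D.cov (g • s) x v
                = g x • D.cov s x v + (mvfderiv 𝓘(ℝ, E) g x v : ℝ) • s x :=
              congrArg (fun A : TangentSpace 𝓘(ℝ, E) x →L[ℝ] L.Fiber x ↦ A v) h
            change D.cov (g • s) x v + smulForm (β x) ((g x : ℂ) • s x) v
              = (g x : ℂ) • (D.cov s x v + smulForm (β x) (s x) v)
                + (mvfderiv 𝓘(ℝ, E) g x v : ℝ) • s x
            have h2 : (g x : ℂ) • D.cov s x v = g x • D.cov s x v := rfl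
            rw [h1, smulForm_apply, smulForm_apply, smul_add, smul_comm (β x v), h2]
            abel } }
  smooth := by
    refine contMDiffCovariantDerivative_of_apply fun s X x hs hX ↦ ?_
    refine ((D.smoothAt_cov hs hX).add (SmoothAt.smul (hβ x X hX) (hs x))).congr ?_
    exact .of_forall fun y ↦ congrArg (fun a : L.Fiber y ↦ D.cov s y (X y) + a)
      (smulForm_apply _ _ _)
  complexLinear := by
    intro s x hs v
    change D.cov (fun y ↦ Complex.I • s y) x v + smulForm (β x) (Complex.I • s x) v
      = Complex.I • (D.cov s x v + smulForm (β x) (s x) v)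
    rw [D.complexLinear s x hs, smulForm_apply, smulForm_apply, smul_add, smul_comm Complex.I]

theorem addForm_cov (D : L.Connection) {β : ∀ x : M, TangentSpace 𝓘(ℝ, E) x →L[ℝ] ℂ}
    (hβ : ∀ x, SmoothOneAt β x) (s : ∀ x, L.Fiber x) (x : M) (v : TangentSpace 𝓘(ℝ, E) x) :
    (D.addForm β hβ).cov s x v = D.cov s x v + β x v • s x :=
  congrArg (fun a : L.Fiber x ↦ D.cov s x v + a) (smulForm_apply _ _ _)

end Connection

namespace HermitianMetric

variable (h : L.HermitianMetric)

theorem inner_I_left (v v' : L.Fiber x) :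
    h.re.inner x (Complex.I • v) v' = - h.re.inner x v (Complex.I • v') := by
  rw [← h.invariant, smul_smul, Complex.I_mul_I, neg_smul, one_smul, map_neg]
  rfl

theorem inner_smul_left (c : ℂ) (v v' : L.Fiber x) :
    h.re.inner x (c • v) v'
      = c.re * h.re.inner x v v' + c.im * h.re.inner x (Complex.I • v) v' := by
  have h1 : c • v = c.re • v + c.im • (Complex.I • v) := by
    change c • v = (c.re : ℂ) • v + (c.im : ℂ) • (Complex.I • v)
    rw [smul_smul, ← add_smul, Complex.re_add_im]
  rw [h1, map_add, (h.re.inner x).map_smul, (h.re.inner x).map_smul]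
  rfl

/-- Multiplication by `i` is skew for the metric, so only the real part of `c` contributes. Hence
compatibility with a metric constrains exactly the real part of a connection form. -/
theorem inner_smul_add (c : ℂ) (v v' : L.Fiber x) :
    h.re.inner x (c • v) v' + h.re.inner x v (c • v') = 2 * c.re * h.re.inner x v v' := by
  rw [h.re.symm x v (c • v'), h.inner_smul_left c v, h.inner_smul_left c v', h.inner_I_left,
    h.re.symm x v' v, h.re.symm x (Complex.I • v') v]
  ring

theorem inner_smul_self (c : ℂ) (v : L.Fiber x) :
    h.re.inner x (c • v) v = c.re * h.re.inner x v v := by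
  have h1 : h.re.inner x (Complex.I • v) v = 0 := by
    have h2 := h.inner_I_left v v
    rw [h.re.symm x v] at h2
    linarith
  rw [h.inner_smul_left, h1, mul_zero, add_zero]

theorem mdifferentiableAt_inner {s s' : ∀ x, L.Fiber x} (hs : L.DiffAt s x) (hs' : L.DiffAt s' x) :
    MDifferentiableAt 𝓘(ℝ, E) 𝓘(ℝ, ℝ) (fun y ↦ h.re.inner y (s y) (s' y)) x := by
  have h1 := MDifferentiableAt.clm_bundle_apply₂ (F₁ := ℂ) (F₂ := ℂ) (F₃ := ℝ)
    (E₃ := fun _ : M ↦ ℝ) ((h.re.contMDiff x).mdifferentiableAt (by simp)) hs hs'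
  exact (mdifferentiableAt_totalSpace _ _).1 h1 |>.2

end HermitianMetric

theorem dfun_exp_mul {f k : M → ℝ} (hf : MDifferentiableAt 𝓘(ℝ, E) 𝓘(ℝ, ℝ) f x)
    (hk : MDifferentiableAt 𝓘(ℝ, E) 𝓘(ℝ, ℝ) k x) (v : TangentSpace 𝓘(ℝ, E) x) :
    dfun (fun y ↦ Real.exp (2 * f y) * k y) x v
      = Real.exp (2 * f x) * (2 * dfun f x v * k x + dfun k x v) := by
  have h1 : HasMFDerivAt 𝓘(ℝ, E) 𝓘(ℝ, ℝ) (fun y ↦ Real.exp (2 * f y)) x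
      ((ContinuousLinearMap.toSpanSingleton ℝ (Real.exp (2 * f x) * 2)).comp
        (mfderiv 𝓘(ℝ, E) 𝓘(ℝ, ℝ) f x)) := by
    have h2 : HasDerivAt (fun r : ℝ ↦ Real.exp (2 * r)) (Real.exp (2 * f x) * 2) (f x) := by
      simpa using ((hasDerivAt_id (f x)).const_mul 2).exp
    exact h2.hasFDerivAt.hasMFDerivAt.comp x hf.hasMFDerivAt
  have h3 := congrArg (fun A : E →L[ℝ] ℝ ↦ A v) (h1.mul hk.hasMFDerivAt).mfderiv
  refine Eq.trans h3 ?_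
  change Real.exp (2 * f x) * dfun k x v + k x * (dfun f x v * (Real.exp (2 * f x) * 2)) = _
  ring

end ComplexLineBundle

/-! ### The hyperholomorphic connection -/

section Hyp


variable {E : Type*} [NormedAddCommGroup E] [NormedSpace ℝ E] [FiniteDimensional ℝ E]
  {M : Type*} [TopologicalSpace M] [ChartedSpace E M] [IsManifold 𝓘(ℝ, E) ∞ M]
  (H : AlmostHyperhermitian E M)

/-- The complex 1-form `dμ - i dμ ∘ I`. -/
def hypOne (μ : M → ℝ) (x : M) : TangentSpace 𝓘(ℝ, E) x →L[ℝ] ℂ :=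
  Complex.ofRealCLM.comp (mvfderiv 𝓘(ℝ, E) μ x)
    + ((ContinuousLinearMap.mul ℝ ℂ (-Complex.I)).comp Complex.ofRealCLM).comp (H.dI μ x)

theorem hypOne_apply (μ : M → ℝ) (x : M) (v : TangentSpace 𝓘(ℝ, E) x) :
    hypOne H μ x v = (dfun μ x v : ℂ) - Complex.I * (dfun μ x (H.I x v) : ℂ) := by
  change (dfun μ x v : ℂ) + -Complex.I * (dfun μ x (H.I x v) : ℂ) = _
  ring

variable {μ : M → ℝ}

theorem smoothOneAt_hypOne (hμ : ContMDiff 𝓘(ℝ, E) 𝓘(ℝ, ℝ) ∞ μ) (x : M) : SmoothOneAt (hypOne H μ) x :=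
  ((smoothOneAt_mvfderiv (hμ x)).clm_comp _).add ((H.smoothOneAt_dI hμ x).clm_comp _)

theorem extD_hypOne (hμ : ContMDiff 𝓘(ℝ, E) 𝓘(ℝ, ℝ) ∞ μ) (x : M) (u v : TangentSpace 𝓘(ℝ, E) x) :
    (extD (hypOne H μ) x u v : ℂ) = - Complex.I * (extD (H.dI μ) x u v : ℂ) := by
  refine (extD_add ((smoothOneAt_mvfderiv (hμ x)).clm_comp _)
    ((H.smoothOneAt_dI hμ x).clm_comp _) u v).trans ?_
  rw [extD_clm_comp _ (smoothOneAt_mvfderiv (hμ x)), extD_clm_comp _ (H.smoothOneAt_dI hμ x),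
    extD_mvfderiv (hμ x), map_zero, zero_add]
  rfl

variable {L : ComplexLineBundle.{w} E M} {h : L.HermitianMetric} {D D' : L.Connection}

/-- The form `β = dμ - i dμ ∘ I` is of type (1,0): `β(v) + i β(Iv) = 0`. Adding it leaves the
`∂̄`-operator unchanged. -/
theorem addForm_hypOne_sameDbar (hβ : ∀ x, SmoothOneAt (hypOne H μ) x) :
    ComplexLineBundle.Connection.SameDbar H.I (D.addForm (hypOne H μ) hβ) D := by
  intro s x hs v
  rw [Connection.addForm_cov, Connection.addForm_cov, hypOne_apply, hypOne_apply, H.I_sq]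
  have h1 : dfun μ x (-v) = - dfun μ x v := map_neg (mvfderiv 𝓘(ℝ, E) μ x) v
  rw [h1, smul_add, smul_smul, add_add_add_comm, ← add_smul]
  convert add_zero _
  convert zero_smul ℂ (s x)
  push_cast
  ring_nf
  rw [Complex.I_sq]
  ring

/-- The real part of `dμ - i dμ ∘ I` is `dμ`, and twice this is the logarithmic derivative of the
factor `e^{2μ}`. -/
theorem addForm_hypOne_isCompatible (hμ : ContMDiff 𝓘(ℝ, E) 𝓘(ℝ, ℝ) ∞ μ)
    (hD : D.IsCompatible h 0)
    (hβ : ∀ x, SmoothOneAt (hypOne H μ) x) :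
    (D.addForm (hypOne H μ) hβ).IsCompatible h μ := by
  intro s s' x hs hs' v
  have h1 := hD s s' x hs hs' v
  simp only [Pi.zero_apply, mul_zero, Real.exp_zero, one_mul] at h1
  rw [dfun_exp_mul ((hμ x).mdifferentiableAt (by simp)) (h.mdifferentiableAt_inner hs hs'), h1,
    Connection.addForm_cov, Connection.addForm_cov]
  have h4 := h.inner_smul_add (hypOne H μ x v) (s x) (s' x)
  have h5 : (hypOne H μ x v).re = dfun μ x v := by rw [hypOne_apply]; simp
  rw [h5] at h4
  rw [map_add, map_add]
  change _ = Real.exp (2 * μ x) * (h.re.inner x (D.cov s x v) (s' x)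
    + h.re.inner x (hypOne H μ x v • s x) (s' x)
    + (h.re.inner x (s x) (D.cov s' x v) + h.re.inner x (s x) (hypOne H μ x v • s' x)))
  congr 1
  linarith

/-- The hyperholomorphic connection differs from the prequantum connection by `dμ - i dμ ∘ I`. -/
theorem cov_eq_add_hypOne [T2Space M] (hμ : ContMDiff 𝓘(ℝ, E) 𝓘(ℝ, ℝ) ∞ μ)
    (hD : D.IsCompatible h 0) (hD' : D'.IsCompatible h μ)
    (hdbar : ComplexLineBundle.Connection.SameDbar H.I D' D) {s : ∀ x, L.Fiber x} {x : M}
    (hs : L.DiffAt s x) (v : TangentSpace 𝓘(ℝ, E) x) :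
    D'.cov s x v = D.cov s x v + hypOne H μ x v • s x := by
  obtain ⟨u, hu, h0⟩ := exists_frame (L := L) x
  have hud := (hu x).diffAt
  have key : ∀ v, D'.form u x v - D.form u x v = hypOne H μ x v := by
    -- Comparing the two compatibility conditions on the frame `u` shows that the difference of
    -- connection forms has real part `dμ`.
    have hre : ∀ v, (D'.form u x v - D.form u x v).re = dfun μ x v := by
      intro v
      have h1 := hD u u x hud hud v
      have h2 := hD' u u x hud hud v
      simp only [Pi.zero_apply, mul_zero, Real.exp_zero, one_mul] at h1
      rw [dfun_exp_mul ((hμ x).mdifferentiableAt (by simp)) (h.mdifferentiableAt_inner hud hud),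
        h1, ← D.form_smul h0, ← D'.form_smul h0, h.re.symm x (u x) (D.form u x v • u x),
        h.re.symm x (u x) (D'.form u x v • u x), h.inner_smul_self, h.inner_smul_self] at h2
      have h3 := mul_left_cancel₀ (Real.exp_ne_zero _) h2
      have h4 := h.re.pos x (u x) h0
      rw [Complex.sub_re]
      refine mul_right_cancel₀ h4.ne' ?_
      linarith
    -- Equality of the `∂̄`-operators makes the difference of type (1,0), so its imaginary part at
    -- `v` is minus its real part at `Iv`.
    have him : ∀ v, (D'.form u x v - D.form u x v)
        + Complex.I * (D'.form u x (H.I x v) - D.form u x (H.I x v)) = 0 := by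
      intro v
      have h1 := hdbar u x hud v
      simp only [← Connection.form_smul _ h0, smul_smul, ← add_smul] at h1
      have h2 := smul_cancel h0 h1
      linear_combination h2
    intro v
    rw [hypOne_apply]
    refine Complex.ext ?_ ?_
    · rw [hre]
      simp
    · have h1 := congrArg Complex.im (him v)
      simp only [Complex.add_im, Complex.I_mul_im, Complex.zero_im] at h1
      rw [hre] at h1
      simp
      simp at h1
      linarith
  obtain ⟨F, hF, hFs⟩ := hud.exists_smul h0 hs
  rw [D.cov_eq hud h0 hF hFs, D'.cov_eq hud h0 hF hFs, hFs.self_of_nhds, ← key, smul_smul,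
    ← add_smul]
  congr 1
  ring

/-- The curvature of the hyperholomorphic connection. -/
theorem hasCurvature_hypForm [T2Space M] (hμ : ContMDiff 𝓘(ℝ, E) 𝓘(ℝ, ℝ) ∞ μ)
    (hD : D.IsCompatible h 0) (hD' : D'.IsCompatible h μ)
    (hdbar : ComplexLineBundle.Connection.SameDbar H.I D' D) (hc : D.HasCurvature H.ω₁) :
    D'.HasCurvature (H.hypForm μ) := by
  refine D'.hasCurvature_of_extD_form fun x ↦ ?_
  obtain ⟨u, hu, h0⟩ := exists_frame (L := L) x
  refine ⟨u, hu, h0, fun v v' ↦ ?_⟩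
  -- The forms must agree near `x`, since the identity is differentiated; nearby `u` is still
  -- nonzero.
  have h1 : ∀ᶠ y in 𝓝 x, D'.form u y = D.form u y + hypOne H μ y := by
    filter_upwards [eventually_ne_zero (hu x).diffAt h0] with y hy
    ext v
    refine smul_cancel hy ?_
    rw [D'.form_smul hy, cov_eq_add_hypOne H hμ hD hD' hdbar (hu y).diffAt, ← D.form_smul hy,
      ← add_smul]
    rfl
  rw [extD_congr h1, extD_add (D.smoothOneAt_form hu h0) (smoothOneAt_hypOne H hμ x),
    D.extD_form hc hu h0, extD_hypOne H hμ, H.hypForm_apply]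
  push_cast
  ring

theorem HyperholomorphicLineBundle.isHyperholomorphic [T2Space M] {H : AlmostHyperhermitian E M}
    [MulAction Circle M] (hH : H.IsHyperkahler) (hT : IsRotating H)
    (Q : HyperholomorphicLineBundle.{w} H) : IsHyperholomorphic H Q.hyp :=
  ⟨H.hypForm Q.μ, hasCurvature_hypForm H Q.smooth_μ Q.unitary Q.hyp_compatible Q.hyp_dbar
    Q.curvature, H.isOneOne_I_hypForm hH Q.smooth_μ,
    H.isOneOne_J_hypForm hH hT Q.smooth_μ Q.moment_μ,
    H.isOneOne_K_hypForm hH hT Q.smooth_μ Q.moment_μ⟩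

end Hyp

/-! ### Lifts of group actions -/

namespace ComplexLineBundle

variable {E : Type*} [NormedAddCommGroup E] [NormedSpace ℝ E] [FiniteDimensional ℝ E]
  {M : Type*} [TopologicalSpace M] [ChartedSpace E M] [IsManifold 𝓘(ℝ, E) ∞ M]
  {L : ComplexLineBundle.{w} E M}

/-- A point of the total space, as an element of the fibre. -/
def fiberOf {y : M} (p : L.Tot) (h : p.1 = y) : L.Fiber y := h ▸ p.2

theorem mk_fiberOf {y : M} (p : L.Tot) (h : p.1 = y) : (⟨y, fiberOf p h⟩ : L.Tot) = p := by
  subst h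
  rfl

theorem mk_inj {x : M} {a b : L.Fiber x} : (⟨x, a⟩ : L.Tot) = ⟨x, b⟩ ↔ a = b :=
  TotalSpace.mk_inj

theorem snd_ne_zero_of_eq {p q : L.Tot} (h : p = q) (hq : q.2 ≠ 0) : p.2 ≠ 0 := by
  subst h
  exact hq

end ComplexLineBundle


namespace Lift

variable {E : Type*} [NormedAddCommGroup E] [NormedSpace ℝ E] [FiniteDimensional ℝ E]
  {M : Type*} [TopologicalSpace M] [ChartedSpace E M] [IsManifold 𝓘(ℝ, E) ∞ M]
  {EA : Type*} [NormedAddCommGroup EA] [NormedSpace ℝ EA]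
  {HA : Type*} [TopologicalSpace HA] {IA : ModelWithCorners ℝ EA HA}
  {A : Type*} [TopologicalSpace A] [ChartedSpace HA A] [Group A] [MulAction A M]
  {L : ComplexLineBundle.{w} E M} {h : L.HermitianMetric} {D : L.Connection}
  (ρ : Lift IA A h D)

theorem act_fst (g : A) (p : L.Tot) : (ρ.act g p).1 = g • p.1 := rfl

theorem act_one (p : L.Tot) : ρ.act 1 p = p := ρ.map_one p.1 p.2

theorem act_mul (g k : A) (p : L.Tot) : ρ.act (g * k) p = ρ.act g (ρ.act k p) :=
  ρ.map_mul g k p.1 p.2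

theorem act_smulTot (g : A) (c : ℂ) (p : L.Tot) :
    ρ.act g (smulTot c p) = smulTot c (ρ.act g p) :=
  congrArg (fun a ↦ (⟨g • p.1, a⟩ : L.Tot)) ((ρ.map g p.1).map_smul c p.2)

/-- A lift is isometric, so it cannot annihilate a nonzero vector. -/
theorem map_ne_zero (g : A) {x : M} {v : L.Fiber x} (hv : v ≠ 0) : ρ.map g x v ≠ 0 := by
  intro h0
  have h1 := ρ.isometry g x v v
  rw [h0, map_zero] at h1
  exact (h.re.pos x v hv).ne h1

theorem act_ne_zero (g : A) {p : L.Tot} (hp : p.2 ≠ 0) : (ρ.act g p).2 ≠ 0 :=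
  ρ.map_ne_zero g hp

theorem ratio_act (g : A) {p q : L.Tot} (hpq : p.1 = q.1) (hq : q.2 ≠ 0) :
    L.ratio (ρ.act g p) (ρ.act g q) = L.ratio p q := by
  conv_lhs => rw [← ratio_smulTot hpq hq, act_smulTot, ratio_smulTot_self (ρ.act_ne_zero g hq)]

section Smooth

variable {EX : Type*} [NormedAddCommGroup EX] [NormedSpace ℝ EX] {HX : Type*} [TopologicalSpace HX]
  {IX : ModelWithCorners ℝ EX HX} {X : Type*} [TopologicalSpace X] [ChartedSpace HX X]
  {k : X → A} {p : X → L.Tot} {x : X}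

theorem contMDiffAt_act (hk : ContMDiffAt IX IA ∞ k x)
    (hp : ContMDiffAt IX (𝓘(ℝ, E).prod 𝓘(ℝ, ℂ)) ∞ p x) :
    ContMDiffAt IX (𝓘(ℝ, E).prod 𝓘(ℝ, ℂ)) ∞ (fun y ↦ ρ.act (k y) (p y)) x :=
  ContMDiffAt.comp x (g := fun p : A × L.Tot ↦ ρ.act p.1 p.2) (ρ.smooth (k x, p x))
    (hk.prodMk hp)

theorem mdifferentiableAt_act (hk : MDifferentiableAt IX IA k x)
    (hp : MDifferentiableAt IX (𝓘(ℝ, E).prod 𝓘(ℝ, ℂ)) p x) :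
    MDifferentiableAt IX (𝓘(ℝ, E).prod 𝓘(ℝ, ℂ)) (fun y ↦ ρ.act (k y) (p y)) x :=
  MDifferentiableAt.comp x (g := fun p : A × L.Tot ↦ ρ.act p.1 p.2)
    ((ρ.smooth (k x, p x)).mdifferentiableAt (by simp)) (hk.prodMk hp)

end Smooth

/-- The section `s` transported by the action of `g`. -/
def push (g : A) (s : ∀ x, L.Fiber x) (y : M) : L.Fiber y :=
  fiberOf (ρ.act g (L.sec s (g⁻¹ • y))) (smul_inv_smul g y)

theorem sec_push (g : A) (s : ∀ x, L.Fiber x) (y : M) :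
    L.sec (ρ.push g s) y = ρ.act g (L.sec s (g⁻¹ • y)) :=
  mk_fiberOf _ _

theorem push_smul (g : A) (s : ∀ x, L.Fiber x) (x : M) :
    ρ.push g s (g • x) = ρ.map g x (s x) := by
  refine mk_inj.1 ((ρ.sec_push g s (g • x)).trans ?_)
  rw [inv_smul_smul]
  rfl

theorem diffAt_push (hA : ContMDiffSMul IA 𝓘(ℝ, E) ∞ A M) (g : A) {s : ∀ x, L.Fiber x} {x : M}
    (hs : L.DiffAt s x) : L.DiffAt (ρ.push g s) (g • x) := by
  have h1 : MDifferentiableAt 𝓘(ℝ, E) (𝓘(ℝ, E).prod 𝓘(ℝ, ℂ)) (fun y ↦ L.sec s (g⁻¹ • y))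
      (g • x) := by
    refine MDifferentiableAt.comp (g • x) (g := L.sec s) ?_
      (mdifferentiableAt_smul_right IA hA g⁻¹ (g • x))
    rw [inv_smul_smul]
    exact hs
  have h2 := ρ.mdifferentiableAt_act (k := fun _ ↦ g) mdifferentiableAt_const h1
  exact h2.congr_of_eventuallyEq (.of_forall fun y ↦ ρ.sec_push g s y)

theorem cov_push (g : A) {s : ∀ x, L.Fiber x} {x : M} (hs : L.DiffAt s x)
    (v : TangentSpace 𝓘(ℝ, E) x) :
    D.cov (ρ.push g s) (g • x) (dAct g x v) = ρ.map g x (D.cov s x v) :=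
  ρ.parallel g s _ (ρ.push_smul g s) x hs v

/-- A section is covariantly constant in the direction of the orbit if it is invariant near `x`
and the moment function vanishes at `x`. -/
theorem cov_fundField_eq_zero {a : GroupLieAlgebra IA A} {f : M → ℝ}
    (hf : ρ.IsMomentFunction a f) {x : M} (hx : f x = 0) {s : ∀ x, L.Fiber x} (hs : L.DiffAt s x)
    (h0 : s x ≠ 0) (hinv : ∀ᶠ g in 𝓝 (1 : A), s (g • x) = ρ.map g x (s x)) :
    D.cov s x (fundField IA A a x) = 0 := by
  let c : A → ℂ := fun g ↦ L.ratio ⟨g • x, s (g • x)⟩ ⟨g • x, ρ.map g x (s x)⟩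
  have h1 := hf x s c hs h0 fun g ↦ (ratio_smul (ρ.map_ne_zero g h0) _).symm
  have h2 : c =ᶠ[𝓝 1] fun _ ↦ 1 := by
    filter_upwards [hinv] with g hg
    change L.ratio _ _ = 1
    rw [hg, ratio_self (ρ.map_ne_zero g h0)]
  have h3 : derivOne IA A c a = 0 := by
    rw [derivOne, h2.mfderiv_eq, mfderiv_const]
    rfl
  rw [h3, zero_smul, hx] at h1
  simpa using h1.symm

theorem fundField_smul (hA : ContMDiffSMul IA 𝓘(ℝ, E) ∞ A M) {A' : Type*} [Group A']
    [MulAction A' M] [SMulCommClass A A' M] {t : A'} {x : M}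
    (ht : MDifferentiableAt 𝓘(ℝ, E) 𝓘(ℝ, E) (fun y : M ↦ t • y) x) (a : GroupLieAlgebra IA A) :
    fundField (E := E) IA A a (t • x) = dAct t x (fundField IA A a x) := by
  have h1 : (fun g : A ↦ g • (t • x)) = (fun y : M ↦ t • y) ∘ fun g : A ↦ g • x :=
    funext fun g ↦ smul_comm g t x
  have h2 : HasMFDerivAt IA 𝓘(ℝ, E) (fun g : A ↦ g • x) 1
      (mfderiv IA 𝓘(ℝ, E) (fun g : A ↦ g • x) 1) :=
    (mdifferentiableAt_smul_left IA hA 1 x).hasMFDerivAt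
  have ht' : MDifferentiableAt 𝓘(ℝ, E) 𝓘(ℝ, E) (fun y : M ↦ t • y) ((1 : A) • x) := by
    rwa [one_smul]
  have h3 := (ht'.hasMFDerivAt.comp (1 : A) h2).mfderiv
  rw [← h1] at h3
  refine (congrArg (fun B : GroupLieAlgebra IA A →L[ℝ] E ↦ B a) h3).trans ?_
  have key : ∀ (y : M) (_ : y = x) (w : E), (mfderiv 𝓘(ℝ, E) 𝓘(ℝ, E) (fun y : M ↦ t • y) y w : E)
      = mfderiv 𝓘(ℝ, E) 𝓘(ℝ, E) (fun y : M ↦ t • y) x w := by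
    rintro y rfl w
    rfl
  exact key _ (one_smul A x) _

/-- The moment function of a lift is invariant under a commuting lift of another action. -/
theorem momentFunction_smul [T2Space M] (hA : ContMDiffSMul IA 𝓘(ℝ, E) ∞ A M)
    {EA' : Type*} [NormedAddCommGroup EA'] [NormedSpace ℝ EA']
    {HA' : Type*} [TopologicalSpace HA'] {IA' : ModelWithCorners ℝ EA' HA'}
    {A' : Type*} [TopologicalSpace A'] [ChartedSpace HA' A'] [Group A'] [MulAction A' M]
    [SMulCommClass A A' M] (hA' : ContMDiffSMul IA' 𝓘(ℝ, E) ∞ A' M) (ρ' : Lift IA' A' h D)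
    (hcomm : ∀ (g : A) (t : A') (p : L.Tot), ρ.act g (ρ'.act t p) = ρ'.act t (ρ.act g p))
    {a : GroupLieAlgebra IA A} {f : M → ℝ} (hf : ρ.IsMomentFunction a f) (t : A') (x : M) :
    f (t • x) = f x := by
  obtain ⟨s, hs, h0⟩ := exists_frame (L := L) x
  let c : A → ℂ := fun g ↦ L.ratio ⟨g • x, s (g • x)⟩ ⟨g • x, ρ.map g x (s x)⟩
  -- The function `c` measures how far `s` is from being invariant along the orbit of `x`; it is
  -- defined on all of the group.
  have hc : ∀ g, s (g • x) = c g • ρ.map g x (s x) :=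
    fun g ↦ (ratio_smul (ρ.map_ne_zero g h0) _).symm
  have h1 := hf x s c (hs x).diffAt h0 hc
  have h0' : ρ'.push t s (t • x) ≠ 0 := by
    rw [push_smul]
    exact ρ'.map_ne_zero t h0
  -- Since the two lifts commute, the transported section has the same function `c` along the orbit
  -- of `t • x`. The two moment identities then differ only in the value of `f`.
  have h2 := hf (t • x) (ρ'.push t s) c (ρ'.diffAt_push hA' t (hs x).diffAt) h0' fun g ↦ by
    refine mk_inj.1 ?_
    change L.sec (ρ'.push t s) (g • t • x) = smulTot (c g) (ρ.act g (L.sec (ρ'.push t s) (t • x)))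
    rw [smul_comm g t x, sec_push, sec_push, inv_smul_smul, inv_smul_smul, hcomm, ← act_smulTot]
    congr 1
    exact mk_inj.2 (hc g)
  rw [fundField_smul hA (mdifferentiableAt_smul_right IA' hA' t x), ρ'.cov_push t (hs x).diffAt,
    push_smul, ← map_smul, h1, map_add, map_smul] at h2
  have h3 := smul_cancel (ρ'.map_ne_zero t h0) (add_left_cancel h2)
  exact (Complex.ofReal_injective (mul_left_cancel₀ Complex.I_ne_zero h3)).symm

end Lift

/-! ### Retractions onto embedded submanifolds -/

section Retraction

variable {E : Type*} [NormedAddCommGroup E] [NormedSpace ℝ E]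
  {M : Type*} [TopologicalSpace M] [ChartedSpace E M] [IsManifold 𝓘(ℝ, E) ∞ M]
  {EN : Type*} [NormedAddCommGroup EN] [NormedSpace ℝ EN]
  {N : Type*} [TopologicalSpace N] [ChartedSpace EN N] [IsManifold 𝓘(ℝ, EN) ∞ N]

/-- In charts in which `ι` is the inclusion of the first factor of a product, project to that
factor. Functions along `N` are extended to `M` by composition with the result. -/
theorem exists_retraction {ι : N → M} {n : N}
    (h : Manifold.IsImmersionAt 𝓘(ℝ, EN) 𝓘(ℝ, E) ∞ ι n) :
    ∃ ret : M → N, ContMDiffAt 𝓘(ℝ, E) 𝓘(ℝ, EN) ∞ ret (ι n) ∧ ∀ᶠ n' in 𝓝 n, ret (ι n') = n' := by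
  have key : ∀ n' ∈ h.domChart.source,
      (h.equiv.symm (h.codChart (ι n'))).1 = h.domChart n' := by
    intro n' hn'
    have h1 := h.writtenInCharts ((h.domChart.extend 𝓘(ℝ, EN)).map_source (x := n')
      (by rwa [OpenPartialHomeomorph.extend_source]))
    simp only [Function.comp_apply, OpenPartialHomeomorph.extend_coe, modelWithCornersSelf_coe,
      OpenPartialHomeomorph.extend_coe_symm, modelWithCornersSelf_coe_symm, id_eq,
      h.domChart.left_inv hn'] at h1
    rw [h1]
    simp
  have hs : ∀ᶠ n' in 𝓝 n, n' ∈ h.domChart.source :=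
    h.domChart.open_source.mem_nhds h.mem_domChart_source
  refine ⟨fun y ↦ h.domChart.symm (h.equiv.symm (h.codChart y)).1, ?_, hs.mono fun n' hn' ↦ ?_⟩
  · have h1 : ContMDiffAt 𝓘(ℝ, E) 𝓘(ℝ, E) ∞ h.codChart (ι n) :=
      (contMDiffOn_of_mem_maximalAtlas h.codChart_mem_maximalAtlas).contMDiffAt
        (h.codChart.open_source.mem_nhds h.mem_codChart_source)
    have h2 : ContMDiffAt 𝓘(ℝ, E) 𝓘(ℝ, EN) ∞ (fun y ↦ (h.equiv.symm (h.codChart y)).1) (ι n) :=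
      (contDiff_fst.comp h.equiv.symm.contDiff).contMDiff.contMDiffAt.comp (ι n) h1
    refine ContMDiffAt.comp (ι n) (g := h.domChart.symm) ?_ h2
    rw [key n h.mem_domChart_source]
    exact (contMDiffOn_symm_of_mem_maximalAtlas h.domChart_mem_maximalAtlas).contMDiffAt
      (h.domChart.open_target.mem_nhds (h.domChart.map_source h.mem_domChart_source))
  · change h.domChart.symm _ = n'
    rw [key n' hn', h.domChart.left_inv hn']

end Retraction

/-- A tangent vector, as a vector of the model space. -/
abbrev vec {E : Type*} [NormedAddCommGroup E] [NormedSpace ℝ E] {M : Type*} [TopologicalSpace M]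
    [ChartedSpace E M] {x : M} (v : TangentSpace 𝓘(ℝ, E) x) : E := v

/-! ### Principal quotients -/

section Principal

variable {EG : Type*} [NormedAddCommGroup EG] [NormedSpace ℝ EG]
  {G : Type*} [TopologicalSpace G] [ChartedSpace EG G] [Group G]
  {EN : Type*} [NormedAddCommGroup EN] [NormedSpace ℝ EN]
  {N : Type*} [TopologicalSpace N] [ChartedSpace EN N] [MulAction G N]
  {EB : Type*} [NormedAddCommGroup EB] [NormedSpace ℝ EB]
  {B : Type*} [TopologicalSpace B] [ChartedSpace EB B]

/-- The product rule for `k y • m y`. At a point with `k = 1` the derivative in `k` is a fundamental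
field and the derivative in `m` is unchanged. -/
theorem mfderiv_smul_of_eq_one (hA : ContMDiffSMul 𝓘(ℝ, EG) 𝓘(ℝ, EN) ∞ G N)
    {EX : Type*} [NormedAddCommGroup EX] [NormedSpace ℝ EX]
    {X : Type*} [TopologicalSpace X] [ChartedSpace EX X] {k : X → G} {m : X → N} {x : X}
    (hk : MDifferentiableAt 𝓘(ℝ, EX) 𝓘(ℝ, EG) k x) (hm : MDifferentiableAt 𝓘(ℝ, EX) 𝓘(ℝ, EN) m x)
    (hx : k x = 1) (v : EX) :
    (mfderiv 𝓘(ℝ, EX) 𝓘(ℝ, EN) (fun y ↦ k y • m y) x v : EN)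
      = (fundField (E := EN) 𝓘(ℝ, EG) G (mfderiv 𝓘(ℝ, EX) 𝓘(ℝ, EG) k x v : EG) (m x) : EN)
        + mfderiv 𝓘(ℝ, EX) 𝓘(ℝ, EN) m x v := by
  have h1 : MDifferentiableAt (𝓘(ℝ, EG).prod 𝓘(ℝ, EN)) 𝓘(ℝ, EN) (fun p : G × N ↦ p.1 • p.2)
      (k x, m x) := (hA.contMDiff_smul _).mdifferentiableAt (by simp)
  have h2 := (h1.hasMFDerivAt.comp x (hk.hasMFDerivAt.prodMk hm.hasMFDerivAt)).mfderiv
  refine (congrArg (fun A : EX →L[ℝ] EN ↦ A v) h2).trans ?_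
  refine (mfderiv_prod_eq_add_apply h1).trans ?_
  have key : ∀ (g : G) (_ : g = 1) (a : EG) (w : TangentSpace 𝓘(ℝ, EN) (m x)),
      (mfderiv 𝓘(ℝ, EG) 𝓘(ℝ, EN) (fun z : G ↦ z • m x) g a : EN)
        + mfderiv 𝓘(ℝ, EN) 𝓘(ℝ, EN) (fun z : N ↦ g • z) (m x) w
      = fundField (E := EN) 𝓘(ℝ, EG) G a (m x) + w := by
    rintro g rfl a w
    have h3 : (fun z : N ↦ (1 : G) • z) = id := funext fun z ↦ one_smul G z
    rw [h3, mfderiv_id]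
    rfl
  exact key _ hx _ _

namespace IsPrincipalQuotient

variable {pr : N → B} (hq : IsPrincipalQuotient (EG := EG) (EN := EN) (EB := EB) G pr)
include hq

theorem tau_section {U : Set B} {σ : B → N} {τ : N → G} (hσ : ∀ m ∈ U, pr (σ m) = m)
    (h : ∀ n ∈ pr ⁻¹' U, n = τ n • σ (pr n)) {b : B} (hb : b ∈ U) : τ (σ b) = 1 := by
  have h1 := h (σ b) (by rwa [Set.mem_preimage, hσ b hb])
  rw [hσ b hb] at h1
  exact hq.free _ _ h1.symm

/-- Both `τ (g • n)` and `g * τ n` carry the point of the section in the orbit to `g • n`; the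
action is free. -/
theorem tau_smul {U : Set B} {σ : B → N} {τ : N → G}
    (h : ∀ n ∈ pr ⁻¹' U, n = τ n • σ (pr n)) {n : N} (hn : pr n ∈ U) (g : G) :
    τ (g • n) = g * τ n := by
  have h1 := h n hn
  have h2 := h (g • n) (by rwa [Set.mem_preimage, hq.invariant])
  rw [hq.invariant] at h2
  have h3 : ((g * τ n)⁻¹ * τ (g • n)) • σ (pr n) = σ (pr n) := by
    rw [mul_smul, ← h2, mul_inv_rev, mul_smul, inv_smul_smul, inv_smul_eq_iff]
    exact h1
  exact (inv_mul_eq_one.1 (hq.free _ _ h3)).symm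

theorem exists_smul_eq {n n' : N} (h : pr n = pr n') : ∃ g : G, n' = g • n := by
  obtain ⟨U, -, hU, σ, τ, -, -, -, h1⟩ := hq.locally_trivial (pr n)
  refine ⟨τ n' * (τ n)⁻¹, ?_⟩
  have h2 := h1 n hU
  have h3 := h1 n' (by rwa [Set.mem_preimage, ← h])
  rw [← h] at h3
  rw [mul_smul, ← eq_inv_smul_iff.2 h2.symm]
  exact h3

/-- Through every point there is a local section of the quotient map. -/
theorem exists_section [LieGroup 𝓘(ℝ, EG) ∞ G] (n : N) : ∃ (σ : B → N) (τ : N → G),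
    (∀ᶠ b in 𝓝 (pr n), ContMDiffAt 𝓘(ℝ, EB) 𝓘(ℝ, EN) ∞ σ b ∧ pr (σ b) = b) ∧ σ (pr n) = n ∧
    (∀ᶠ n' in 𝓝 n, ContMDiffAt 𝓘(ℝ, EN) 𝓘(ℝ, EG) ∞ τ n' ∧ n' = τ n' • σ (pr n')) ∧ τ n = 1 := by
  obtain ⟨U, hUo, hU, σ, τ, hσ, hτ, hpr, h1⟩ := hq.locally_trivial (pr n)
  have hA := hq.smooth_act
  have hUn : ∀ᶠ n' in 𝓝 n, n' ∈ pr ⁻¹' U :=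
    (hUo.preimage hq.smooth.continuous).mem_nhds hU
  -- Translating by `τ n` makes the section pass through `n` itself and normalizes `τ` to `1` there.
  refine ⟨fun b ↦ τ n • σ b, fun n' ↦ τ n' * (τ n)⁻¹, ?_, (h1 n hU).symm, ?_, mul_inv_cancel _⟩
  · filter_upwards [hUo.mem_nhds hU] with b hb
    refine ⟨?_, by rw [hq.invariant, hpr b hb]⟩
    exact ContMDiffAt.smul (n := ∞) (f := fun _ ↦ τ n) (I := 𝓘(ℝ, EG)) contMDiffAt_const
      (hσ.contMDiffAt (hUo.mem_nhds hb))
  · filter_upwards [hUn] with n' hn'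
    refine ⟨?_, ?_⟩
    · exact (hτ.contMDiffAt ((hUo.preimage hq.smooth.continuous).mem_nhds hn')).mul
        contMDiffAt_const
    · rw [mul_smul, inv_smul_smul]
      exact h1 n' hn'

/-- `pr` is constant on orbits. -/
theorem mfderiv_fundField (a : GroupLieAlgebra 𝓘(ℝ, EG) G) (n : N) :
    (mfderiv 𝓘(ℝ, EN) 𝓘(ℝ, EB) pr n (fundField (E := EN) 𝓘(ℝ, EG) G a n : EN) : EB) = 0 := by
  have hA := hq.smooth_act
  have h1 : MDifferentiableAt 𝓘(ℝ, EG) 𝓘(ℝ, EN) (fun g : G ↦ g • n) 1 :=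
    (ContMDiffAt.smul (n := ∞) contMDiffAt_id contMDiffAt_const).mdifferentiableAt (by simp)
  have h2 : MDifferentiableAt 𝓘(ℝ, EN) 𝓘(ℝ, EB) pr ((1 : G) • n) :=
    (hq.smooth _).mdifferentiableAt (by simp)
  have h3 := (h2.hasMFDerivAt.comp (1 : G) h1.hasMFDerivAt).mfderiv
  have h4 : pr ∘ (fun g : G ↦ g • n) = fun _ ↦ pr n := funext fun g ↦ hq.invariant g n
  rw [h4, mfderiv_const] at h3
  have h5 := congrArg (fun A : EG →L[ℝ] EB ↦ A a) h3
  have key : ∀ (y : N) (_ : y = n) (w : EN), (mfderiv 𝓘(ℝ, EN) 𝓘(ℝ, EB) pr y w : EB)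
      = mfderiv 𝓘(ℝ, EN) 𝓘(ℝ, EB) pr n w := by
    rintro y rfl w
    rfl
  exact (key _ (one_smul G n) _).symm.trans h5.symm

theorem mfderiv_section {σ : B → N} {b : B} (hσ : ContMDiffAt 𝓘(ℝ, EB) 𝓘(ℝ, EN) ∞ σ b)
    (h : ∀ᶠ b' in 𝓝 b, pr (σ b') = b') (w : EB) :
    (mfderiv 𝓘(ℝ, EN) 𝓘(ℝ, EB) pr (σ b) (mfderiv 𝓘(ℝ, EB) 𝓘(ℝ, EN) σ b w : EN) : EB) = w := by
  have h1 := ((hq.smooth (σ b)).mdifferentiableAt (by simp)).hasMFDerivAt.comp b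
    (hσ.mdifferentiableAt (by simp)).hasMFDerivAt
  have h2 : HasMFDerivAt 𝓘(ℝ, EB) 𝓘(ℝ, EB) (pr ∘ σ) b (ContinuousLinearMap.id ℝ _) :=
    (hasMFDerivAt_id b).congr_of_eventuallyEq h
  exact congrArg (fun A : EB →L[ℝ] EB ↦ A w) (hasMFDerivAt_unique h1 h2)

/-- A tangent vector is the sum of a vertical vector and a vector tangent to a local section. -/
theorem exists_fundField_add {σ : B → N} {τ : N → G} {n : N}
    (hσ : ContMDiffAt 𝓘(ℝ, EB) 𝓘(ℝ, EN) ∞ σ (pr n)) (hσn : σ (pr n) = n)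
    (hτ : ContMDiffAt 𝓘(ℝ, EN) 𝓘(ℝ, EG) ∞ τ n) (hτn : τ n = 1)
    (h : ∀ᶠ n' in 𝓝 n, n' = τ n' • σ (pr n')) (v : EN) :
    ∃ a : GroupLieAlgebra 𝓘(ℝ, EG) G,
      v = vec (fundField (E := EN) 𝓘(ℝ, EG) G a n)
        + vec (mfderiv 𝓘(ℝ, EB) 𝓘(ℝ, EN) σ (pr n) (mfderiv 𝓘(ℝ, EN) 𝓘(ℝ, EB) pr n v : EB)) := by
  have h1 : HasMFDerivAt 𝓘(ℝ, EN) 𝓘(ℝ, EN) (σ ∘ pr) n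
      ((mfderiv 𝓘(ℝ, EB) 𝓘(ℝ, EN) σ (pr n)).comp (mfderiv 𝓘(ℝ, EN) 𝓘(ℝ, EB) pr n)) :=
    (hσ.mdifferentiableAt (by simp)).hasMFDerivAt.comp n
      ((hq.smooth n).mdifferentiableAt (by simp)).hasMFDerivAt
  -- Differentiate `n' = τ n' • σ (pr n')` at `n`, where `τ` is `1`.
  have h2 := mfderiv_smul_of_eq_one hq.smooth_act (hτ.mdifferentiableAt (by simp))
    h1.mdifferentiableAt hτn v
  have h3 : HasMFDerivAt 𝓘(ℝ, EN) 𝓘(ℝ, EN) (fun y ↦ τ y • (σ ∘ pr) y) n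
      (ContinuousLinearMap.id ℝ _) :=
    (hasMFDerivAt_id n).congr_of_eventuallyEq (h.mono fun y hy ↦ hy.symm)
  rw [h3.mfderiv, h1.mfderiv] at h2
  refine ⟨(mfderiv 𝓘(ℝ, EN) 𝓘(ℝ, EG) τ n v : EG), ?_⟩
  have key : ∀ (y : N) (_ : y = n) (a : EG), (fundField (E := EN) 𝓘(ℝ, EG) G a y : EN)
      = fundField (E := EN) 𝓘(ℝ, EG) G a n := by
    rintro y rfl a
    rfl
  refine Eq.trans h2 ?_
  exact congrArg (· + _) (key _ hσn _)

/-- A tangent vector in the kernel of the differential of the quotient map is vertical. -/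
theorem exists_fundField_eq [LieGroup 𝓘(ℝ, EG) ∞ G] {n : N} {v : EN}
    (hv : vec (mfderiv 𝓘(ℝ, EN) 𝓘(ℝ, EB) pr n v) = 0) :
    ∃ a : GroupLieAlgebra 𝓘(ℝ, EG) G, v = vec (fundField (E := EN) 𝓘(ℝ, EG) G a n) := by
  obtain ⟨σ, τ, hσ, hσn, hτ, hτn⟩ := hq.exists_section n
  obtain ⟨a, ha⟩ := hq.exists_fundField_add hσ.self_of_nhds.1 hσn hτ.self_of_nhds.1 hτn
    (hτ.mono fun _ h ↦ h.2) v
  refine ⟨a, ha.trans ?_⟩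
  have h1 : vec (mfderiv 𝓘(ℝ, EB) 𝓘(ℝ, EN) σ (pr n) (mfderiv 𝓘(ℝ, EN) 𝓘(ℝ, EB) pr n v : EB)) = 0 :=
    (congrArg (fun w : EB ↦ vec (mfderiv 𝓘(ℝ, EB) 𝓘(ℝ, EN) σ (pr n) w)) hv).trans (map_zero _)
  rw [h1, add_zero]

end IsPrincipalQuotient

end Principal

/-! ### Differentials of equivariant maps -/

section Equivariant

variable {E : Type*} [NormedAddCommGroup E] [NormedSpace ℝ E]
  {M : Type*} [TopologicalSpace M] [ChartedSpace E M]
  {EN : Type*} [NormedAddCommGroup EN] [NormedSpace ℝ EN]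
  {N : Type*} [TopologicalSpace N] [ChartedSpace EN N]
  {EA : Type*} [NormedAddCommGroup EA] [NormedSpace ℝ EA]
  {HA : Type*} [TopologicalSpace HA] {IA : ModelWithCorners ℝ EA HA}
  {A : Type*} [TopologicalSpace A] [ChartedSpace HA A] [Group A] [MulAction A M] [MulAction A N]

theorem mfderiv_congr_point {f : N → M} {x y : N} (h : x = y) (v : EN) :
    vec (mfderiv 𝓘(ℝ, EN) 𝓘(ℝ, E) f x v) = vec (mfderiv 𝓘(ℝ, EN) 𝓘(ℝ, E) f y v) := by
  subst h
  rfl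

/-- An equivariant map is compatible with the vector fields generated by the actions. -/
theorem mfderiv_fundField_of_equivariant (hA : ContMDiffSMul IA 𝓘(ℝ, EN) ∞ A N) {f : N → M} {n : N}
    (hf : MDifferentiableAt 𝓘(ℝ, EN) 𝓘(ℝ, E) f n) (heq : ∀ (g : A) (n : N), f (g • n) = g • f n)
    (a : GroupLieAlgebra IA A) :
    mfderiv 𝓘(ℝ, EN) 𝓘(ℝ, E) f n (fundField IA A a n) = fundField IA A a (f n) := by
  have h1 : MDifferentiableAt IA 𝓘(ℝ, EN) (fun g : A ↦ g • n) 1 :=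
    (ContMDiffAt.smul (n := ∞) contMDiffAt_id contMDiffAt_const).mdifferentiableAt (by simp)
  have h2 : MDifferentiableAt 𝓘(ℝ, EN) 𝓘(ℝ, E) f ((1 : A) • n) := by rwa [one_smul]
  have h3 := (h2.hasMFDerivAt.comp (1 : A) h1.hasMFDerivAt).mfderiv
  have h4 : f ∘ (fun g : A ↦ g • n) = fun g ↦ g • f n := funext fun g ↦ heq g n
  rw [h4] at h3
  have h5 := congrArg (fun A : EA →L[ℝ] E ↦ A a) h3
  exact (mfderiv_congr_point (EN := EN) (E := E) (f := f) (one_smul A n).symm _).trans h5.symm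

theorem mfderiv_dAct {f : N → M} {n : N} {g : A}
    (hf : MDifferentiableAt 𝓘(ℝ, EN) 𝓘(ℝ, E) f n)
    (hf' : MDifferentiableAt 𝓘(ℝ, EN) 𝓘(ℝ, E) f (g • n))
    (hN : MDifferentiableAt 𝓘(ℝ, EN) 𝓘(ℝ, EN) (fun y : N ↦ g • y) n)
    (hM : MDifferentiableAt 𝓘(ℝ, E) 𝓘(ℝ, E) (fun y : M ↦ g • y) (f n))
    (heq : ∀ n : N, f (g • n) = g • f n) (v : TangentSpace 𝓘(ℝ, EN) n) :
    vec (mfderiv 𝓘(ℝ, EN) 𝓘(ℝ, E) f (g • n) (dAct g n v))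
      = vec (dAct g (f n) (mfderiv 𝓘(ℝ, EN) 𝓘(ℝ, E) f n v)) := by
  have h1 := (hf'.hasMFDerivAt.comp n hN.hasMFDerivAt).mfderiv
  have h2 := (hM.hasMFDerivAt.comp n hf.hasMFDerivAt).mfderiv
  have h3 : f ∘ (fun y ↦ g • y) = (fun y ↦ g • y) ∘ f := funext heq
  rw [h3] at h1
  exact congrArg (fun A : EN →L[ℝ] E ↦ A v) (h1.symm.trans h2)

end Equivariant

/-- Orthogonal projection for a positive definite bilinear form. -/
theorem exists_orthogonal {V : Type*} [AddCommGroup V] [Module ℝ V]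
    (b : V →ₗ[ℝ] V →ₗ[ℝ] ℝ) (hb : ∀ v, v ≠ 0 → 0 < b v v) (S : Submodule ℝ V)
    [FiniteDimensional ℝ S] (v : V) : ∃ s ∈ S, ∀ s' ∈ S, b s' (v - s) = 0 := by
  let T : S →ₗ[ℝ] Module.Dual ℝ S :=
    { toFun := fun s ↦ (b.flip s).comp S.subtype
      map_add' := fun s s' ↦ by ext; simp
      map_smul' := fun c s ↦ by ext; simp }
  -- Positivity makes the restriction of `b` to `S` nondegenerate; in finite dimension every
  -- functional on `S` is then represented, in particular `b(·, v)`.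
  have hT : Function.Injective T := by
    rw [← LinearMap.ker_eq_bot, LinearMap.ker_eq_bot']
    intro s hs
    by_contra h0
    have h1 : b s s = 0 := congrArg (fun f : Module.Dual ℝ S ↦ f s) hs
    exact (hb s (by simpa using h0)).ne' h1
  have hT' : Function.Surjective T :=
    (LinearMap.injective_iff_surjective_of_finrank_eq_finrank
      (Subspace.dual_finrank_eq (K := ℝ) (V := S)).symm).1 hT
  obtain ⟨s, hs⟩ := hT' ((b.flip v).comp S.subtype)
  refine ⟨s, s.2, fun s' hs' ↦ ?_⟩
  have h1 : b s' s = b s' v := congrArg (fun f : Module.Dual ℝ S ↦ f ⟨s', hs'⟩) hs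
  rw [map_sub, h1, sub_self]

/-! ### Forms and horizontal lifts on the hyperkähler quotient -/

section Quotient

variable {E : Type*} [NormedAddCommGroup E] [NormedSpace ℝ E] [FiniteDimensional ℝ E]
  {M : Type*} [TopologicalSpace M] [ChartedSpace E M] [IsManifold 𝓘(ℝ, E) ∞ M]
  {H : AlmostHyperhermitian E M}
  {EG : Type*} [NormedAddCommGroup EG] [NormedSpace ℝ EG]
  {G : Type*} [TopologicalSpace G] [ChartedSpace EG G] [Group G] [LieGroup 𝓘(ℝ, EG) ∞ G]
  [MulAction G M]
  {ν₁ ν₂ ν₃ : M → GroupLieAlgebra 𝓘(ℝ, EG) G →L[ℝ] ℝ}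
  {EN : Type*} [NormedAddCommGroup EN] [NormedSpace ℝ EN]
  {N : Type*} [TopologicalSpace N] [ChartedSpace EN N]
  [MulAction G N]
  {EB : Type*} [NormedAddCommGroup EB] [NormedSpace ℝ EB] [FiniteDimensional ℝ EB]
  {B : Type*} [TopologicalSpace B] [ChartedSpace EB B] [IsManifold 𝓘(ℝ, EB) ∞ B]
  {HB : AlmostHyperhermitian EB B} {ι : N → M} {pr : N → B}

namespace IsHyperkahlerQuotient

theorem mdifferentiableAt_ι (hquot : IsHyperkahlerQuotient (EN := EN) H ν₁ ν₂ ν₃ ι pr HB) (n : N) :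
    MDifferentiableAt 𝓘(ℝ, EN) 𝓘(ℝ, E) ι n :=
  (hquot.embedding.contMDiff n).mdifferentiableAt (by simp)

theorem mdifferentiableAt_pr (hquot : IsHyperkahlerQuotient (EN := EN) H ν₁ ν₂ ν₃ ι pr HB) (n : N) :
    MDifferentiableAt 𝓘(ℝ, EN) 𝓘(ℝ, EB) pr n :=
  (hquot.quotient.smooth n).mdifferentiableAt (by simp)

theorem exists_mfderiv_pr (hquot : IsHyperkahlerQuotient (EN := EN) H ν₁ ν₂ ν₃ ι pr HB) (n : N)
    (w : TangentSpace 𝓘(ℝ, EB) (pr n)) :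
    ∃ v : TangentSpace 𝓘(ℝ, EN) n, mfderiv 𝓘(ℝ, EN) 𝓘(ℝ, EB) pr n v = w := by
  obtain ⟨σ, τ, hσ, hσn, -⟩ := hquot.quotient.exists_section n
  have h1 := hquot.quotient.mfderiv_section hσ.self_of_nhds.1 (hσ.mono fun _ h ↦ h.2) w
  let v : EN := vec (mfderiv 𝓘(ℝ, EB) 𝓘(ℝ, EN) σ (pr n) w)
  exact ⟨v, (mfderiv_congr_point (EN := EN) (E := EB) (f := pr) hσn.symm v).trans h1⟩

/-- The forms on the quotient are locally the pullbacks of the forms on `M` by sections of the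
quotient map. -/
theorem exists_local_pullback (hquot : IsHyperkahlerQuotient (EN := EN) H ν₁ ν₂ ν₃ ι pr HB)
    {α : ∀ x : M, TangentSpace 𝓘(ℝ, E) x →L[ℝ] TangentSpace 𝓘(ℝ, E) x →L[ℝ] ℝ}
    {β : ∀ x : B, TangentSpace 𝓘(ℝ, EB) x →L[ℝ] TangentSpace 𝓘(ℝ, EB) x →L[ℝ] ℝ}
    (h : ∀ (n : N) (v v' : TangentSpace 𝓘(ℝ, EN) n),
      β (pr n) (mfderiv 𝓘(ℝ, EN) 𝓘(ℝ, EB) pr n v) (mfderiv 𝓘(ℝ, EN) 𝓘(ℝ, EB) pr n v')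
        = α (ι n) (mfderiv 𝓘(ℝ, EN) 𝓘(ℝ, E) ι n v) (mfderiv 𝓘(ℝ, EN) 𝓘(ℝ, E) ι n v')) (b : B) :
    ∃ f : B → M, ContMDiffAt 𝓘(ℝ, EB) 𝓘(ℝ, E) ∞ f b ∧ ∀ᶠ y in 𝓝 b, ∀ u v,
      β y u v = α (f y) (mfderiv 𝓘(ℝ, EB) 𝓘(ℝ, E) f y u) (mfderiv 𝓘(ℝ, EB) 𝓘(ℝ, E) f y v) := by
  obtain ⟨n, rfl⟩ := hquot.quotient.surjective b
  obtain ⟨σ, τ, hσ, hσn, -⟩ := hquot.quotient.exists_section n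
  refine ⟨ι ∘ σ, ContMDiffAt.comp _ (hquot.embedding.contMDiff _) hσ.self_of_nhds.1, ?_⟩
  filter_upwards [hσ.eventually_nhds] with y hy u v
  have h1 : ∀ w : EB, vec (mfderiv 𝓘(ℝ, EB) 𝓘(ℝ, E) (ι ∘ σ) y w)
      = vec (mfderiv 𝓘(ℝ, EN) 𝓘(ℝ, E) ι (σ y) (mfderiv 𝓘(ℝ, EB) 𝓘(ℝ, EN) σ y w)) := by
    intro w
    have h2 := ((hquot.mdifferentiableAt_ι (σ y)).hasMFDerivAt.comp y
      (hy.self_of_nhds.1.mdifferentiableAt (by simp)).hasMFDerivAt).mfderiv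
    exact congrArg (fun A : EB →L[ℝ] E ↦ A w) h2
  have h2 : ∀ w : EB, vec (mfderiv 𝓘(ℝ, EN) 𝓘(ℝ, EB) pr (σ y) (mfderiv 𝓘(ℝ, EB) 𝓘(ℝ, EN) σ y w))
      = w := fun w ↦ hquot.quotient.mfderiv_section hy.self_of_nhds.1 (hy.mono fun _ h ↦ h.2) w
  have h3 := h (σ y) (mfderiv 𝓘(ℝ, EB) 𝓘(ℝ, EN) σ y u) (mfderiv 𝓘(ℝ, EB) 𝓘(ℝ, EN) σ y v)
  refine Eq.trans ?_ (h3.trans ?_)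
  · have h4 : ∀ (y' : B) (_ : y' = y) (a b : EB), β y a b = β y' a b := by
      rintro y' rfl a b
      rfl
    refine (congrArg₂ (fun a b : EB ↦ β y a b) (h2 u).symm (h2 v).symm).trans ?_
    exact h4 _ hy.self_of_nhds.2 _ _
  · exact (congrArg₂ (fun a b : E ↦ α (ι (σ y)) a b) (h1 u) (h1 v)).symm

/-- The three forms are closed as local pullbacks, and closedness implies integrability; no bracket
is computed on the quotient. -/
theorem isHyperkahler (hquot : IsHyperkahlerQuotient (EN := EN) H ν₁ ν₂ ν₃ ι pr HB)
    (hH : H.IsHyperkahler) : HB.IsHyperkahler :=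
  .of_closed
    (.of_local_pullback H.smoothTwoAt_ω₁ H.ω₁_anti hH.closed₁ HB.smoothTwoAt_ω₁ HB.ω₁_anti
      (hquot.exists_local_pullback hquot.form₁))
    (.of_local_pullback H.smoothTwoAt_ω₂ H.ω₂_anti hH.closed₂ HB.smoothTwoAt_ω₂ HB.ω₂_anti
      (hquot.exists_local_pullback hquot.form₂))
    (.of_local_pullback H.smoothTwoAt_ω₃ H.ω₃_anti hH.closed₃ HB.smoothTwoAt_ω₃ HB.ω₃_anti
      (hquot.exists_local_pullback hquot.form₃))

theorem mfderiv_ι_fundField (hquot : IsHyperkahlerQuotient (EN := EN) H ν₁ ν₂ ν₃ ι pr HB)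
    (a : GroupLieAlgebra 𝓘(ℝ, EG) G) (n : N) :
    mfderiv 𝓘(ℝ, EN) 𝓘(ℝ, E) ι n (fundField 𝓘(ℝ, EG) G a n) = fundField 𝓘(ℝ, EG) G a (ι n) :=
  mfderiv_fundField_of_equivariant hquot.quotient.smooth_act (hquot.mdifferentiableAt_ι n)
    hquot.equivariant a

/-- Every tangent vector is the sum of a horizontal and a vertical vector. -/
theorem exists_horizontal (hquot : IsHyperkahlerQuotient (EN := EN) H ν₁ ν₂ ν₃ ι pr HB) (n : N)
    (v : TangentSpace 𝓘(ℝ, EN) n) :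
    ∃ a : GroupLieAlgebra 𝓘(ℝ, EG) G, IsHorizontal (EG := EG) G H ι n
      (v - fundField 𝓘(ℝ, EG) G a n) := by
  -- The differential of the orbit map. Its range in `E` is the vertical space, onto which `v` is
  -- projected orthogonally.
  let φ : EG →L[ℝ] E := mfderiv 𝓘(ℝ, EG) 𝓘(ℝ, E) (fun g : G ↦ g • ι n) 1
  let b₀ : E →L[ℝ] E →L[ℝ] ℝ := H.g.inner (ι n)
  let b : E →ₗ[ℝ] E →ₗ[ℝ] ℝ := LinearMap.mk₂ ℝ (fun u w ↦ b₀ u w) (by simp) (by simp) (by simp)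
    (by simp)
  obtain ⟨s, hs, h⟩ := exists_orthogonal b (H.g.pos (ι n))
    (LinearMap.range (φ : EG →ₗ[ℝ] E)) (vec (mfderiv 𝓘(ℝ, EN) 𝓘(ℝ, E) ι n v))
  obtain ⟨a, rfl⟩ := hs
  refine ⟨a, fun a' ↦ ?_⟩
  have h1 := h (φ a') ⟨a', rfl⟩
  have h2 := congrArg (fun u : E ↦ b₀ (φ a') (vec (mfderiv 𝓘(ℝ, EN) 𝓘(ℝ, E) ι n v) - u))
    (hquot.mfderiv_ι_fundField a n)
  exact (congrArg (fun u : E ↦ b₀ (φ a') u) (map_sub (mfderiv 𝓘(ℝ, EN) 𝓘(ℝ, E) ι n) v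
    (fundField 𝓘(ℝ, EG) G a n))).trans (h2.trans h1)

theorem exists_horizontal_lift (hquot : IsHyperkahlerQuotient (EN := EN) H ν₁ ν₂ ν₃ ι pr HB) (n : N)
    (w : TangentSpace 𝓘(ℝ, EB) (pr n)) :
    ∃ v : TangentSpace 𝓘(ℝ, EN) n, IsHorizontal (EG := EG) G H ι n v ∧
      mfderiv 𝓘(ℝ, EN) 𝓘(ℝ, EB) pr n v = w := by
  obtain ⟨v, rfl⟩ := hquot.exists_mfderiv_pr n w
  obtain ⟨a, ha⟩ := hquot.exists_horizontal n v
  refine ⟨_, ha, ?_⟩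
  rw [map_sub]
  have h1 : mfderiv 𝓘(ℝ, EN) 𝓘(ℝ, EB) pr n (fundField 𝓘(ℝ, EG) G a n) = 0 :=
    hquot.quotient.mfderiv_fundField a n
  rw [h1, sub_zero]

/-- The inner product of a horizontal vector with an arbitrary vector is the inner product of their
projections. -/
theorem inner_of_horizontal (hquot : IsHyperkahlerQuotient (EN := EN) H ν₁ ν₂ ν₃ ι pr HB) (n : N)
    (u v : TangentSpace 𝓘(ℝ, EN) n) (hv : IsHorizontal (EG := EG) G H ι n v) :
    HB.g.inner (pr n) (mfderiv 𝓘(ℝ, EN) 𝓘(ℝ, EB) pr n u) (mfderiv 𝓘(ℝ, EN) 𝓘(ℝ, EB) pr n v)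
      = H.g.inner (ι n) (mfderiv 𝓘(ℝ, EN) 𝓘(ℝ, E) ι n u) (mfderiv 𝓘(ℝ, EN) 𝓘(ℝ, E) ι n v) := by
  -- The quotient metric is given on pairs of horizontal vectors only. The vertical part of `u` is
  -- killed by `pr` on one side and is orthogonal to `v` on the other.
  obtain ⟨a, ha⟩ := hquot.exists_horizontal n u
  have h1 := hquot.metric n _ v ha hv
  have h2 : mfderiv 𝓘(ℝ, EN) 𝓘(ℝ, EB) pr n (fundField 𝓘(ℝ, EG) G a n) = 0 :=
    hquot.quotient.mfderiv_fundField a n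
  rw [map_sub (mfderiv 𝓘(ℝ, EN) 𝓘(ℝ, EB) pr n), h2, sub_zero,
    map_sub (mfderiv 𝓘(ℝ, EN) 𝓘(ℝ, E) ι n), hquot.mfderiv_ι_fundField, map_sub] at h1
  rw [h1]
  change H.g.inner (ι n) _ _ - H.g.inner (ι n) _ _ = _
  rw [hv a, sub_zero]

end IsHyperkahlerQuotient

end Quotient

theorem form_congr_point {E : Type*} [NormedAddCommGroup E] [NormedSpace ℝ E]
    {M : Type*} [TopologicalSpace M] [ChartedSpace E M]
    (α : ∀ x : M, TangentSpace 𝓘(ℝ, E) x →L[ℝ] TangentSpace 𝓘(ℝ, E) x →L[ℝ] ℝ) {x y : M} (h : x = y)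
    (u v : E) : α x u v = α y u v := by
  subst h
  rfl

/-! ### The circle action on the quotient -/

section CircleQuotient

variable {E : Type*} [NormedAddCommGroup E] [NormedSpace ℝ E] [FiniteDimensional ℝ E]
  {M : Type*} [TopologicalSpace M] [ChartedSpace E M] [IsManifold 𝓘(ℝ, E) ∞ M]
  {H : AlmostHyperhermitian E M}
  {EG : Type*} [NormedAddCommGroup EG] [NormedSpace ℝ EG]
  {G : Type*} [TopologicalSpace G] [ChartedSpace EG G] [Group G] [LieGroup 𝓘(ℝ, EG) ∞ G]
  [MulAction G M]
  {ν₁ ν₂ ν₃ : M → GroupLieAlgebra 𝓘(ℝ, EG) G →L[ℝ] ℝ}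
  {EN : Type*} [NormedAddCommGroup EN] [NormedSpace ℝ EN] [FiniteDimensional ℝ EN]
  {N : Type*} [TopologicalSpace N] [ChartedSpace EN N] [IsManifold 𝓘(ℝ, EN) ∞ N]
  [MulAction G N]
  {EB : Type*} [NormedAddCommGroup EB] [NormedSpace ℝ EB] [FiniteDimensional ℝ EB]
  {B : Type*} [TopologicalSpace B] [ChartedSpace EB B] [IsManifold 𝓘(ℝ, EB) ∞ B]
  {HB : AlmostHyperhermitian EB B} {ι : N → M} {pr : N → B}
  [MulAction Circle M]

/-- Smooth circle actions on `N` and `B` that are compatible with the maps `ι` and `pr`. -/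
structure IsCircleQuotient (EN EB : Type*) [NormedAddCommGroup EN] [NormedSpace ℝ EN]
    [NormedAddCommGroup EB] [NormedSpace ℝ EB]
    {M N B : Type*} [TopologicalSpace N] [ChartedSpace EN N] [TopologicalSpace B]
    [ChartedSpace EB B] [MulAction Circle M] [MulAction Circle N] [MulAction Circle B]
    (ι : N → M) (pr : N → B) : Prop where
  smooth_N : ContMDiffSMul (𝓡 1) 𝓘(ℝ, EN) ∞ Circle N
  smooth_B : ContMDiffSMul (𝓡 1) 𝓘(ℝ, EB) ∞ Circle B
  ι_smul : ∀ (t : Circle) (n : N), ι (t • n) = t • ι n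
  pr_smul : ∀ (t : Circle) (n : N), pr (t • n) = t • pr n

/-- The action restricts to `N` because `ι` is injective with invariant image, and descends to `B`
because it commutes with `G`. -/
theorem IsHyperkahlerQuotient.exists_circleQuotient [SMulCommClass G Circle M]
    (hquot : IsHyperkahlerQuotient (EN := EN) H ν₁ ν₂ ν₃ ι pr HB)
    (hT : ContMDiffSMul (𝓡 1) 𝓘(ℝ, E) ∞ Circle M)
    (hmem : ∀ (t : Circle) (n : N), ∃ n', ι n' = t • ι n) :
    ∃ (_ : MulAction Circle N) (_ : MulAction Circle B), IsCircleQuotient EN EB ι pr := by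
  have hinj : Function.Injective ι := hquot.embedding.isEmbedding.injective
  have hsurj := hquot.quotient.surjective
  choose a ha using hmem
  let _ : SMul Circle N := ⟨a⟩
  let actN : MulAction Circle N := hinj.mulAction ι ha
  have ha' : ∀ (t : Circle) (n : N), ι (t • n) = t • ι n := ha
  have hcomm : ∀ (g : G) (t : Circle) (n : N), t • g • n = g • t • n := fun g t n ↦ hinj <| by
    rw [ha', hquot.equivariant, hquot.equivariant, ha', smul_comm g t]
  have hwell : ∀ (t : Circle) (n n' : N), pr n = pr n' → pr (t • n) = pr (t • n') := by
    intro t n n' h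
    obtain ⟨g, rfl⟩ := hquot.quotient.exists_smul_eq h
    rw [hcomm, hquot.quotient.invariant]
  choose lft hlft using hsurj
  let _ : SMul Circle B := ⟨fun t b ↦ pr (t • lft b)⟩
  have hpr : ∀ (t : Circle) (n : N), pr (t • n) = t • pr n := fun t n ↦
    hwell t _ _ (hlft (pr n)).symm
  let actB : MulAction Circle B := hquot.quotient.surjective.mulAction pr hpr
  have hN : ContMDiffSMul (𝓡 1) 𝓘(ℝ, EN) ∞ Circle N := by
    have h1 : ContMDiff ((𝓡 1).prod 𝓘(ℝ, EN)) 𝓘(ℝ, E) ∞ (ι ∘ fun p : Circle × N ↦ p.1 • p.2) := by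
      have h2 : (ι ∘ fun p : Circle × N ↦ p.1 • p.2) = fun p ↦ p.1 • ι p.2 :=
        funext fun p ↦ ha p.1 p.2
      rw [h2]
      exact ContMDiff.smul (n := ∞) (I := 𝓡 1) contMDiff_fst
        (hquot.embedding.contMDiff.comp contMDiff_snd)
    refine ⟨fun p ↦ ?_⟩
    -- A continuous map into `N` is smooth as soon as its composition with the immersion `ι` is.
    -- Continuity holds because `ι` is a topological embedding.
    refine (ContMDiffAt.iff_comp_isImmersionAt (f := fun p : Circle × N ↦ p.1 • p.2)
      (hquot.embedding.isImmersion.isImmersionAt (p.1 • p.2))).2 ⟨?_, h1 p⟩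
    exact (hquot.embedding.isEmbedding.continuous_iff.2 h1.continuous).continuousAt
  refine ⟨actN, actB, hN, ⟨fun p ↦ ?_⟩, ha, hpr⟩
  obtain ⟨n, hn⟩ := hquot.quotient.surjective p.2
  obtain ⟨σ, τ, hσ, hσn, -⟩ := hquot.quotient.exists_section n
  rw [hn] at hσ
  -- Near `p` the action on `B` is `(t, b) ↦ pr (t • σ b)` for a local section `σ`.
  have h1 : ContMDiffAt ((𝓡 1).prod 𝓘(ℝ, EB)) 𝓘(ℝ, EN) ∞ (fun q : Circle × B ↦ q.1 • σ q.2) p :=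
    ContMDiffAt.smul (n := ∞) (I := 𝓡 1) contMDiffAt_fst
      (ContMDiffAt.comp p (g := σ) hσ.self_of_nhds.1 contMDiffAt_snd)
  refine (ContMDiffAt.comp p (hquot.quotient.smooth _) h1).congr_of_eventuallyEq ?_
  filter_upwards [continuousAt_snd.eventually hσ] with q hq
  change q.1 • q.2 = pr (q.1 • σ q.2)
  rw [hpr, hq.2]

variable [MulAction Circle N] [MulAction Circle B]

namespace IsCircleQuotient

/-- Equivariance of `ι` and `pr` lets the differential of the action pass through both, so a
symmetry of a form on `M` becomes one on `B`. -/
theorem form_dAct (hC : IsCircleQuotient EN EB ι pr)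
    (hquot : IsHyperkahlerQuotient (EN := EN) H ν₁ ν₂ ν₃ ι pr HB)
    (hT : ContMDiffSMul (𝓡 1) 𝓘(ℝ, E) ∞ Circle M)
    {α : ∀ x : M, TangentSpace 𝓘(ℝ, E) x →L[ℝ] TangentSpace 𝓘(ℝ, E) x →L[ℝ] ℝ}
    {β : ∀ x : B, TangentSpace 𝓘(ℝ, EB) x →L[ℝ] TangentSpace 𝓘(ℝ, EB) x →L[ℝ] ℝ}
    (h : ∀ (n : N) (v v' : TangentSpace 𝓘(ℝ, EN) n),
      β (pr n) (mfderiv 𝓘(ℝ, EN) 𝓘(ℝ, EB) pr n v) (mfderiv 𝓘(ℝ, EN) 𝓘(ℝ, EB) pr n v')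
        = α (ι n) (mfderiv 𝓘(ℝ, EN) 𝓘(ℝ, E) ι n v) (mfderiv 𝓘(ℝ, EN) 𝓘(ℝ, E) ι n v'))
    (t : Circle) (n : N) (v v' : TangentSpace 𝓘(ℝ, EN) n) :
    β (t • pr n) (dAct t (pr n) (mfderiv 𝓘(ℝ, EN) 𝓘(ℝ, EB) pr n v))
        (dAct t (pr n) (mfderiv 𝓘(ℝ, EN) 𝓘(ℝ, EB) pr n v'))
      = α (t • ι n) (dAct t (ι n) (mfderiv 𝓘(ℝ, EN) 𝓘(ℝ, E) ι n v))
        (dAct t (ι n) (mfderiv 𝓘(ℝ, EN) 𝓘(ℝ, E) ι n v')) := by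
  have h1 : ∀ v : TangentSpace 𝓘(ℝ, EN) n, _ := fun v ↦
    mfderiv_dAct (hquot.mdifferentiableAt_pr n) (hquot.mdifferentiableAt_pr (t • n))
    (mdifferentiableAt_smul_right (𝓡 1) hC.smooth_N t n)
    (mdifferentiableAt_smul_right (𝓡 1) hC.smooth_B t (pr n)) (hC.pr_smul t) v
  have h2 : ∀ v : TangentSpace 𝓘(ℝ, EN) n, _ := fun v ↦
    mfderiv_dAct (hquot.mdifferentiableAt_ι n) (hquot.mdifferentiableAt_ι (t • n))
    (mdifferentiableAt_smul_right (𝓡 1) hC.smooth_N t n)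
    (mdifferentiableAt_smul_right (𝓡 1) hT t (ι n)) (hC.ι_smul t) v
  have h3 := h (t • n) (dAct t n v) (dAct t n v')
  have h4 := (congrArg₂ (fun a b : EB ↦ β (pr (t • n)) a b) (h1 v) (h1 v')).symm.trans
    (h3.trans (congrArg₂ (fun a b : E ↦ α (ι (t • n)) a b) (h2 v) (h2 v')))
  exact (form_congr_point β (hC.pr_smul t n).symm _ _).trans
    (h4.trans (form_congr_point α (hC.ι_smul t n) _ _))

theorem isRotating (hC : IsCircleQuotient EN EB ι pr)
    (hquot : IsHyperkahlerQuotient (EN := EN) H ν₁ ν₂ ν₃ ι pr HB) (hT : IsRotating H) :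
    IsRotating HB := by
  refine ⟨hC.smooth_B, fun t b w w' ↦ ?_, fun t b w w' ↦ ?_⟩
  · obtain ⟨n, rfl⟩ := hquot.quotient.surjective b
    obtain ⟨v, rfl⟩ := hquot.exists_mfderiv_pr n w
    obtain ⟨v', rfl⟩ := hquot.exists_mfderiv_pr n w'
    rw [hC.form_dAct hquot hT.smooth hquot.form₁, hT.fixes, hquot.form₁]
  · obtain ⟨n, rfl⟩ := hquot.quotient.surjective b
    obtain ⟨v, rfl⟩ := hquot.exists_mfderiv_pr n w
    obtain ⟨v', rfl⟩ := hquot.exists_mfderiv_pr n w'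
    rw [hC.form_dAct hquot hT.smooth hquot.form₂, hC.form_dAct hquot hT.smooth hquot.form₃,
      hT.rotates, hquot.form₂, hquot.form₃]

theorem mfderiv_ι_circleField (hC : IsCircleQuotient EN EB ι pr)
    (hquot : IsHyperkahlerQuotient (EN := EN) H ν₁ ν₂ ν₃ ι pr HB) (n : N) :
    mfderiv 𝓘(ℝ, EN) 𝓘(ℝ, E) ι n (fundField (𝓡 1) Circle circleGen n)
      = fundField (𝓡 1) Circle circleGen (ι n) :=
  mfderiv_fundField_of_equivariant hC.smooth_N (hquot.mdifferentiableAt_ι n) hC.ι_smul _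

theorem mfderiv_pr_circleField (hC : IsCircleQuotient EN EB ι pr)
    (hquot : IsHyperkahlerQuotient (EN := EN) H ν₁ ν₂ ν₃ ι pr HB) (n : N) :
    mfderiv 𝓘(ℝ, EN) 𝓘(ℝ, EB) pr n (fundField (𝓡 1) Circle circleGen n)
      = fundField (𝓡 1) Circle circleGen (pr n) :=
  mfderiv_fundField_of_equivariant hC.smooth_N (hquot.mdifferentiableAt_pr n) hC.pr_smul _

variable {μ : M → ℝ} {μB : B → ℝ}

theorem smooth_moment (hquot : IsHyperkahlerQuotient (EN := EN) H ν₁ ν₂ ν₃ ι pr HB)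
    (hμ : ContMDiff 𝓘(ℝ, E) 𝓘(ℝ, ℝ) ∞ μ) (hμB : ∀ n, μB (pr n) = μ (ι n)) :
    ContMDiff 𝓘(ℝ, EB) 𝓘(ℝ, ℝ) ∞ μB := by
  intro b
  obtain ⟨n, rfl⟩ := hquot.quotient.surjective b
  obtain ⟨σ, τ, hσ, hσn, -⟩ := hquot.quotient.exists_section n
  refine (ContMDiffAt.comp (pr n) (g := μ ∘ ι) ((hμ.comp hquot.embedding.contMDiff) _)
    hσ.self_of_nhds.1).congr_of_eventuallyEq ?_
  filter_upwards [hσ] with b hb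
  change _ = μ (ι (σ b))
  rw [← hμB, hb.2]

theorem dfun_moment (hquot : IsHyperkahlerQuotient (EN := EN) H ν₁ ν₂ ν₃ ι pr HB)
    (hμ : ContMDiff 𝓘(ℝ, E) 𝓘(ℝ, ℝ) ∞ μ) (hμB : ∀ n, μB (pr n) = μ (ι n)) (n : N)
    (v : TangentSpace 𝓘(ℝ, EN) n) :
    dfun μB (pr n) (mfderiv 𝓘(ℝ, EN) 𝓘(ℝ, EB) pr n v)
      = dfun μ (ι n) (mfderiv 𝓘(ℝ, EN) 𝓘(ℝ, E) ι n v) := by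
  have h1 := ((hμ.mdifferentiable (by simp) (ι n)).hasMFDerivAt.comp n
    (hquot.mdifferentiableAt_ι n).hasMFDerivAt).mfderiv
  have h2 := (((smooth_moment hquot hμ hμB).mdifferentiable (by simp) (pr n)).hasMFDerivAt.comp n
    (hquot.mdifferentiableAt_pr n).hasMFDerivAt).mfderiv
  have h3 : μB ∘ pr = μ ∘ ι := funext hμB
  rw [h3, h1] at h2
  exact (congrArg (fun A : EN →L[ℝ] ℝ ↦ A v) h2).symm

/-- The moment map of the circle action descends. -/
theorem moment (hC : IsCircleQuotient EN EB ι pr)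
    (hquot : IsHyperkahlerQuotient (EN := EN) H ν₁ ν₂ ν₃ ι pr HB)
    (hμ : ContMDiff 𝓘(ℝ, E) 𝓘(ℝ, ℝ) ∞ μ) (hμB : ∀ n, μB (pr n) = μ (ι n))
    (hm : ∀ (x : M) (v : TangentSpace 𝓘(ℝ, E) x),
      H.ω₁ x (fundField (𝓡 1) Circle circleGen x) v = dfun μ x v)
    (b : B) (w : TangentSpace 𝓘(ℝ, EB) b) :
    HB.ω₁ b (fundField (𝓡 1) Circle circleGen b) w = dfun μB b w := by
  obtain ⟨n, rfl⟩ := hquot.quotient.surjective b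
  obtain ⟨v, rfl⟩ := hquot.exists_mfderiv_pr n w
  rw [dfun_moment hquot hμ hμB, ← hm, ← hC.mfderiv_ι_circleField hquot,
    ← hC.mfderiv_pr_circleField hquot, hquot.form₁]

/-- On horizontal vectors the form `dμ ∘ I` is the pullback of the corresponding form on the
quotient. -/
theorem dI_of_horizontal (hC : IsCircleQuotient EN EB ι pr)
    (hquot : IsHyperkahlerQuotient (EN := EN) H ν₁ ν₂ ν₃ ι pr HB)
    (hμ : ContMDiff 𝓘(ℝ, E) 𝓘(ℝ, ℝ) ∞ μ) (hμB : ∀ n, μB (pr n) = μ (ι n))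
    (hm : ∀ (x : M) (v : TangentSpace 𝓘(ℝ, E) x),
      H.ω₁ x (fundField (𝓡 1) Circle circleGen x) v = dfun μ x v)
    (n : N) (v : TangentSpace 𝓘(ℝ, EN) n) (hv : IsHorizontal (EG := EG) G H ι n v) :
    HB.dI μB (pr n) (mfderiv 𝓘(ℝ, EN) 𝓘(ℝ, EB) pr n v)
      = H.dI μ (ι n) (mfderiv 𝓘(ℝ, EN) 𝓘(ℝ, E) ι n v) := by
  -- On both sides the form is the inner product with the generating field. The generating field of
  -- `N` maps to those of `M` and `B` but need not be horizontal, so horizontality of `v` is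
  -- essential.
  rw [H.dI_eq_inner hm, HB.dI_eq_inner (hC.moment hquot hμ hμB hm),
    ← hC.mfderiv_ι_circleField hquot, ← hC.mfderiv_pr_circleField hquot,
    hquot.inner_of_horizontal n _ v hv]

end IsCircleQuotient

end CircleQuotient

/-! ### Line bundles given by cocycles -/

/-- A smooth cocycle of transition functions of a complex line bundle, for an open cover indexed by
the points of the base. -/
structure LineCocycle (E : Type*) [NormedAddCommGroup E] [NormedSpace ℝ E]
    (M : Type*) [TopologicalSpace M] [ChartedSpace E M] where
  /-- the members of the open cover -/
  U : M → Set M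
  isOpen_U : ∀ i, IsOpen (U i)
  mem_U : ∀ x, x ∈ U x
  /-- the transition functions -/
  k : M → M → M → ℂ
  k_self : ∀ i, ∀ x ∈ U i, k i i x = 1
  k_comp : ∀ i j l x, x ∈ U i → x ∈ U j → x ∈ U l → k j l x * k i j x = k i l x
  smooth_k : ∀ i j x, x ∈ U i → x ∈ U j → ContMDiffAt 𝓘(ℝ, E) 𝓘(ℝ, ℂ) ∞ (k i j) x

namespace LineCocycle

variable {E : Type*} [NormedAddCommGroup E] [NormedSpace ℝ E] [FiniteDimensional ℝ E]
  {M : Type*} [TopologicalSpace M] [ChartedSpace E M] [IsManifold 𝓘(ℝ, E) ∞ M]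
  (Z : LineCocycle E M)

/-- The vector bundle core of the cocycle. -/
def core : VectorBundleCore ℂ M ℂ M where
  baseSet := Z.U
  isOpen_baseSet := Z.isOpen_U
  indexAt := id
  mem_baseSet_at := Z.mem_U
  coordChange i j x := ContinuousLinearMap.mul ℂ ℂ (Z.k i j x)
  coordChange_self i x hx v := by simp [Z.k_self i x hx]
  continuousOn_coordChange i j := (ContinuousLinearMap.mul ℂ ℂ).continuous.comp_continuousOn
    fun x hx ↦ (Z.smooth_k i j x hx.1 hx.2).continuousAt.continuousWithinAt
  coordChange_comp i j l x hx v := by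
    simp [← mul_assoc, Z.k_comp i j l x hx.1.1 hx.1.2 hx.2]

theorem localTriv_smul (i : M) {x : M} (c : ℂ) (a : Z.core.Fiber x) :
    (Z.core.localTriv i ⟨x, c • a⟩).2 = c * (Z.core.localTriv i ⟨x, a⟩).2 :=
  mul_left_comm (Z.k x i x) c (show ℂ from a)

instance contSMulComplex (x : M) : ContinuousSMul ℂ (Z.core.Fiber x) :=
  inferInstanceAs (ContinuousSMul ℂ ℂ)

instance contSMulReal (x : M) : ContinuousSMul ℝ (Z.core.Fiber x) :=
  ⟨((Complex.continuous_ofReal.comp continuous_fst).smul continuous_snd :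
    Continuous fun p : ℝ × Z.core.Fiber x ↦ (p.1 : ℂ) • p.2)⟩

instance topAddGroupFiber (x : M) : IsTopologicalAddGroup (Z.core.Fiber x) :=
  inferInstanceAs (IsTopologicalAddGroup ℂ)

theorem localTriv_isLinear (i : M) : (Z.core.localTriv i).IsLinear ℝ where
  linear _ hx :=
    { map_add := ((Z.core.localTriv i).linear ℂ hx).map_add
      map_smul := fun c a ↦ (((Z.core.localTriv i).linear ℂ hx).map_smul (c : ℂ) a).trans
        (Complex.real_smul (x := c)).symm }

theorem coordChangeL_eq (i j : M) [(Z.core.localTriv i).IsLinear ℝ]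
    [(Z.core.localTriv j).IsLinear ℝ] {x : M} (hx : x ∈ Z.U i ∩ Z.U j) :
    ((Z.core.localTriv i).coordChangeL ℝ (Z.core.localTriv j) x : ℂ →L[ℝ] ℂ)
      = ContinuousLinearMap.mul ℝ ℂ (Z.k i j x) := by
  refine ContinuousLinearMap.ext fun v ↦ ?_
  exact (Trivialization.coordChangeL_apply' (R := ℝ) (Z.core.localTriv i) (Z.core.localTriv j) hx
    v).trans ((Trivialization.coordChangeL_apply' (R := ℂ) (Z.core.localTriv i)
      (Z.core.localTriv j) hx v).symm.trans (Z.core.localTriv_coordChange_eq i j hx v))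

theorem contMDiffOn_mul_k (i j : M) :
    ContMDiffOn 𝓘(ℝ, E) 𝓘(ℝ, ℂ →L[ℝ] ℂ) ∞
      (fun x ↦ ContinuousLinearMap.mul ℝ ℂ (Z.k i j x)) (Z.U i ∩ Z.U j) := fun x hx ↦
  ((ContinuousLinearMap.mul ℝ ℂ).contDiff.contMDiff.contMDiffAt.comp x
    (Z.smooth_k i j x hx.1 hx.2)).contMDiffWithinAt

/-- The cocycle gives a complex vector bundle, but smoothness over the real base and connections use
the real structure; the transition maps are the same multiplications. -/
instance vectorBundleReal : VectorBundle ℝ ℂ Z.core.Fiber where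
  trivialization_linear' := by
    rintro _ ⟨i, rfl⟩
    exact Z.localTriv_isLinear i
  continuousOn_coordChange' := by
    rintro _ _ ⟨i, rfl⟩ ⟨j, rfl⟩
    have := Z.localTriv_isLinear i
    have := Z.localTriv_isLinear j
    exact (Z.contMDiffOn_mul_k i j).continuousOn.congr fun x hx ↦ by
      exact Z.coordChangeL_eq i j hx

instance contMDiffVectorBundle : ContMDiffVectorBundle ∞ ℂ Z.core.Fiber 𝓘(ℝ, E) where
  contMDiffOn_coordChangeL := by
    rintro _ _ ⟨i, rfl⟩ ⟨j, rfl⟩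
    have := Z.localTriv_isLinear i
    have := Z.localTriv_isLinear j
    exact (Z.contMDiffOn_mul_k i j).congr fun x hx ↦ Z.coordChangeL_eq i j hx

/-- The line bundle defined by a cocycle. -/
def line : ComplexLineBundle.{0} E M where
  Fiber := Z.core.Fiber

/-- The trivialization of the line bundle over a member of the cover. -/
def triv (i : M) : Trivialization ℂ (TotalSpace.proj : Z.line.Tot → M) := Z.core.localTriv i

instance (i : M) : MemTrivializationAtlas (Z.triv i) :=
  ⟨⟨i, rfl⟩⟩

theorem trivializationAt_eq (x : M) : trivializationAt ℂ Z.line.Fiber x = Z.triv x := rfl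

/-- The coordinate of a point of the total space. -/
def coord (i : M) (p : Z.line.Tot) : ℂ := (Z.triv i p).2

theorem coord_smul (i : M) {x : M} (c : ℂ) (a : Z.line.Fiber x) :
    Z.coord i ⟨x, c • a⟩ = c * Z.coord i ⟨x, a⟩ := Z.localTriv_smul i c a

/-- The vector with coordinate `c` in the trivialization indexed by `x`. -/
def vector (x : M) (c : ℂ) : Z.line.Fiber x := c

theorem coord_vector (i x : M) (c : ℂ) : Z.coord i ⟨x, Z.vector x c⟩ = Z.k x i x * c := rfl

theorem coord_self (x : M) (a : Z.line.Fiber x) : Z.vector x (Z.coord x ⟨x, a⟩) = a := by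
  change Z.k x x x * (show ℂ from a) = a
  rw [Z.k_self x x (Z.mem_U x)]
  exact one_mul (show ℂ from a)

theorem vector_smul (x : M) (c d : ℂ) : Z.vector x (c * d) = c • Z.vector x d := rfl

theorem vector_add (x : M) (c d : ℂ) : Z.vector x (c + d) = Z.vector x c + Z.vector x d := rfl

theorem coord_injective (i : M) {x : M} (hx : x ∈ Z.U i) {a b : Z.line.Fiber x}
    (h : Z.coord i ⟨x, a⟩ = Z.coord i ⟨x, b⟩) : a = b :=
  Z.line.triv_injective (Z.triv i) hx h

section Smooth

variable {EX : Type*} [NormedAddCommGroup EX] [NormedSpace ℝ EX] {HX : Type*} [TopologicalSpace HX]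
  {IX : ModelWithCorners ℝ EX HX} {X : Type*} [TopologicalSpace X] [ChartedSpace HX X]

theorem contMDiffAt_iff {f : X → Z.line.Tot} {x : X} (i : M) (hi : (f x).1 ∈ Z.U i) :
    ContMDiffAt IX (𝓘(ℝ, E).prod 𝓘(ℝ, ℂ)) ∞ f x ↔
      ContMDiffAt IX 𝓘(ℝ, E) ∞ (fun y ↦ (f y).1) x ∧
      ContMDiffAt IX 𝓘(ℝ, ℂ) ∞ (fun y ↦ Z.coord i (f y)) x :=
  (Z.triv i).contMDiffAt_iff (IB := 𝓘(ℝ, E)) (((Z.triv i).mem_source).2 hi)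

theorem mdifferentiableAt_iff {f : X → Z.line.Tot} {x : X} (i : M) (hi : (f x).1 ∈ Z.U i) :
    MDifferentiableAt IX (𝓘(ℝ, E).prod 𝓘(ℝ, ℂ)) f x ↔
      MDifferentiableAt IX 𝓘(ℝ, E) (fun y ↦ (f y).1) x ∧
      MDifferentiableAt IX 𝓘(ℝ, ℂ) (fun y ↦ Z.coord i (f y)) x :=
  (Z.triv i).mdifferentiableAt_totalSpace_iff 𝓘(ℝ, E) f (((Z.triv i).mem_source).2 hi)

end Smooth

end LineCocycle

/-! ### Construction of hermitian metrics -/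

section Metric

variable {E : Type*} [NormedAddCommGroup E] [NormedSpace ℝ E] [FiniteDimensional ℝ E]
  {M : Type*} [TopologicalSpace M] [ChartedSpace E M] [IsManifold 𝓘(ℝ, E) ∞ M]

/-- In a trivialization the metric is a bilinear form on `ℂ`, determined by its values on constant
pairs. -/
theorem contMDiff_inner {L : ComplexLineBundle.{w} E M}
    (inner : ∀ x, L.Fiber x →L[ℝ] L.Fiber x →L[ℝ] ℝ)
    (h : ∀ (x : M) (u v : ℂ), ContMDiffAt 𝓘(ℝ, E) 𝓘(ℝ, ℝ) ∞ (fun y ↦ inner y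
      ((trivializationAt ℂ L.Fiber x).symm y u) ((trivializationAt ℂ L.Fiber x).symm y v)) x) :
    ContMDiff 𝓘(ℝ, E) (𝓘(ℝ, E).prod 𝓘(ℝ, ℂ →L[ℝ] ℂ →L[ℝ] ℝ)) ∞
      (fun x ↦ TotalSpace.mk' (ℂ →L[ℝ] ℂ →L[ℝ] ℝ)
        (E := fun x ↦ L.Fiber x →L[ℝ] L.Fiber x →L[ℝ] ℝ) x (inner x)) := by
  intro x
  rw [contMDiffAt_hom_bundle]
  refine ⟨contMDiffAt_id, contMDiffAt_clm_of_apply fun u ↦ contMDiffAt_clm_of_apply fun v ↦ ?_⟩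
  refine (h x u v).congr_of_eventuallyEq ?_
  filter_upwards [(trivializationAt ℂ L.Fiber x).open_baseSet.mem_nhds
      (mem_baseSet_trivializationAt ℂ L.Fiber x)] with y hy
  exact (inCoordinates_apply_eq₂ (F₃ := ℝ) (E₃ := fun _ : M ↦ ℝ) hy hy (Set.mem_univ _)).trans
    (by simp)

end Metric

section

variable {E : Type*} [NormedAddCommGroup E] [NormedSpace ℝ E]
  {M : Type*} [TopologicalSpace M] [ChartedSpace E M]
  {EN : Type*} [NormedAddCommGroup EN] [NormedSpace ℝ EN]
  {N : Type*} [TopologicalSpace N] [ChartedSpace EN N]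
  {EB : Type*} [NormedAddCommGroup EB] [NormedSpace ℝ EB]
  {B : Type*} [TopologicalSpace B] [ChartedSpace EB B]
  {W : Type*} [NormedAddCommGroup W] [NormedSpace ℝ W]

/-- Functions on `M` and `B` that agree on `N` have the same derivatives along `N`. -/
theorem mvfderiv_eq_of_comp {ι : N → M} {pr : N → B} {n : N} {C : M → W} {c : B → W}
    (hι : MDifferentiableAt 𝓘(ℝ, EN) 𝓘(ℝ, E) ι n) (hpr : MDifferentiableAt 𝓘(ℝ, EN) 𝓘(ℝ, EB) pr n)
    (hC : MDifferentiableAt 𝓘(ℝ, E) 𝓘(ℝ, W) C (ι n))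
    (hc : MDifferentiableAt 𝓘(ℝ, EB) 𝓘(ℝ, W) c (pr n))
    (h : ∀ᶠ n' in 𝓝 n, C (ι n') = c (pr n')) (v : TangentSpace 𝓘(ℝ, EN) n) :
    (mvfderiv 𝓘(ℝ, E) C (ι n) (mfderiv 𝓘(ℝ, EN) 𝓘(ℝ, E) ι n v) : W)
      = mvfderiv 𝓘(ℝ, EB) c (pr n) (mfderiv 𝓘(ℝ, EN) 𝓘(ℝ, EB) pr n v) := by
  have h1 := hC.hasMFDerivAt.comp n hι.hasMFDerivAt
  have h2 := (hc.hasMFDerivAt.comp n hpr.hasMFDerivAt).congr_of_eventuallyEq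
    (f₁ := C ∘ ι) h
  exact congrArg (fun A : EN →L[ℝ] W ↦ A v) (hasMFDerivAt_unique h1 h2)

end

/-! ### Extending sections off an immersed submanifold -/

section Extension

variable {E : Type*} [NormedAddCommGroup E] [NormedSpace ℝ E] [FiniteDimensional ℝ E]
  {M : Type*} [TopologicalSpace M] [ChartedSpace E M] [IsManifold 𝓘(ℝ, E) ∞ M]
  {EN : Type*} [NormedAddCommGroup EN] [NormedSpace ℝ EN]
  {N : Type*} [TopologicalSpace N] [ChartedSpace EN N] [IsManifold 𝓘(ℝ, EN) ∞ N]
  {L : ComplexLineBundle.{w} E M} {ι : N → M} {n : N}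

/-- Sections along an immersed submanifold extend locally. -/
theorem exists_diffAt_extension [T2Space M]
    (h : Manifold.IsImmersionAt 𝓘(ℝ, EN) 𝓘(ℝ, E) ∞ ι n) {p : N → L.Tot}
    (hp : MDifferentiableAt 𝓘(ℝ, EN) (𝓘(ℝ, E).prod 𝓘(ℝ, ℂ)) p n)
    (hpι : ∀ᶠ n' in 𝓝 n, (p n').1 = ι n') :
    ∃ s : ∀ x, L.Fiber x, L.DiffAt s (ι n) ∧ ∀ᶠ n' in 𝓝 n, L.sec s (ι n') = p n' := by
  obtain ⟨ret, hret, hretι⟩ := exists_retraction h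
  obtain ⟨u, hu, h0⟩ := exists_frame (L := L) (ι n)
  have hι : MDifferentiableAt 𝓘(ℝ, EN) 𝓘(ℝ, E) ι n := h.contMDiffAt.mdifferentiableAt (by simp)
  have huι : MDifferentiableAt 𝓘(ℝ, EN) (𝓘(ℝ, E).prod 𝓘(ℝ, ℂ)) (fun n' ↦ L.sec u (ι n')) n :=
    MDifferentiableAt.comp n (g := L.sec u) (hu (ι n)).diffAt hι
  have hc := MDifferentiableAt.lineRatio hp huι hpι h0
  -- The coefficient of `p` with respect to a frame `u` is a function on `N`; it is extended by the
  -- retraction.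
  refine ⟨fun y ↦ L.ratio (p (ret y)) (L.sec u (ι (ret y))) • u y, ?_, ?_⟩
  · refine DiffAt.smul (MDifferentiableAt.comp (ι n)
      (g := fun n' ↦ L.ratio (p n') (L.sec u (ι n'))) ?_ (hret.mdifferentiableAt (by simp)))
      (hu (ι n)).diffAt
    rwa [hretι.self_of_nhds]
  · filter_upwards [hretι, hpι, hι.continuousAt.eventually
      (eventually_ne_zero (hu (ι n)).diffAt h0)] with n' h1 h2 h3
    change smulTot (L.ratio (p (ret (ι n'))) (L.sec u (ι (ret (ι n'))))) (L.sec u (ι n')) = _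
    rw [h1, ratio_smulTot h2 h3]

end Extension

theorem ComplexLineBundle.Connection.cov_congr_point {E : Type*} [NormedAddCommGroup E]
    [NormedSpace ℝ E] [FiniteDimensional ℝ E]
    {M : Type*} [TopologicalSpace M] [ChartedSpace E M] [IsManifold 𝓘(ℝ, E) ∞ M]
    {L : ComplexLineBundle.{w} E M} (D : L.Connection) (s : ∀ x, L.Fiber x) {x y : M} (h : x = y)
    {v v' : E} (hv : v = v') : (⟨x, D.cov s x v⟩ : L.Tot) = ⟨y, D.cov s y v'⟩ := by
  subst h hv
  rfl

/-! ### Equivariant frames along the zero set and their connection forms -/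

section Frame

variable {E : Type*} [NormedAddCommGroup E] [NormedSpace ℝ E] [FiniteDimensional ℝ E]
  {M : Type*} [TopologicalSpace M] [ChartedSpace E M] [IsManifold 𝓘(ℝ, E) ∞ M]
  {H : AlmostHyperhermitian E M}
  {EG : Type*} [NormedAddCommGroup EG] [NormedSpace ℝ EG]
  {G : Type*} [TopologicalSpace G] [ChartedSpace EG G] [Group G]
  [MulAction G M]
  {ν₁ ν₂ ν₃ : M → GroupLieAlgebra 𝓘(ℝ, EG) G →L[ℝ] ℝ}
  {EN : Type*} [NormedAddCommGroup EN] [NormedSpace ℝ EN] [FiniteDimensional ℝ EN]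
  {N : Type*} [TopologicalSpace N] [ChartedSpace EN N] [IsManifold 𝓘(ℝ, EN) ∞ N]
  [MulAction G N]
  {EB : Type*} [NormedAddCommGroup EB] [NormedSpace ℝ EB] [FiniteDimensional ℝ EB]
  {B : Type*} [TopologicalSpace B] [ChartedSpace EB B] [IsManifold 𝓘(ℝ, EB) ∞ B]
  {HB : AlmostHyperhermitian EB B} {ι : N → M} {pr : N → B}
  {L : ComplexLineBundle.{w} E M} {h : L.HermitianMetric} {D : L.Connection}

/-- An equivariant frame of the restriction of a line bundle to `N`, over an open subset of the
quotient `B`. Along a local section `σ` of the quotient map the frame is the restriction of a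
section `u` of the line bundle. -/
structure DescentFrame (EN EB : Type*) [NormedAddCommGroup EN] [NormedSpace ℝ EN]
    [NormedAddCommGroup EB] [NormedSpace ℝ EB] [ChartedSpace EN N] [ChartedSpace EB B]
    (ρ : Lift 𝓘(ℝ, EG) G h D) (ι : N → M) (pr : N → B) where
  /-- the open subset of the quotient -/
  U : Set B
  isOpen_U : IsOpen U
  /-- the local section of the quotient map -/
  σ : B → N
  /-- the section of the line bundle -/
  u : ∀ x, L.Fiber x
  /-- the frame -/
  f : N → L.Tot
  smooth_σ : ∀ b ∈ U, ContMDiffAt 𝓘(ℝ, EB) 𝓘(ℝ, EN) ∞ σ b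
  pr_σ : ∀ b ∈ U, pr (σ b) = b
  smooth_u : SmoothSec u
  f_fst : ∀ n, pr n ∈ U → (f n).1 = ι n
  smooth_f : ∀ n, pr n ∈ U → ContMDiffAt 𝓘(ℝ, EN) (𝓘(ℝ, E).prod 𝓘(ℝ, ℂ)) ∞ f n
  f_ne_zero : ∀ n, pr n ∈ U → (f n).2 ≠ 0
  f_smul : ∀ (g : G) (n : N), pr n ∈ U → f (g • n) = ρ.act g (f n)
  f_σ : ∀ b ∈ U, f (σ b) = L.sec u (ι (σ b))

variable {ρ : Lift 𝓘(ℝ, EG) G h D}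

theorem exists_descentFrame [T2Space M]
    (hquot : IsHyperkahlerQuotient (EN := EN) H ν₁ ν₂ ν₃ ι pr HB) (b : B) :
    ∃ F : DescentFrame EN EB ρ ι pr, b ∈ F.U := by
  obtain ⟨U, hUo, hU, σ, τ, hσ, hτ, hpr, h1⟩ := hquot.quotient.locally_trivial b
  obtain ⟨u, hu, h0⟩ := exists_frame (L := L) (ι (σ b))
  have hσ' : ∀ b ∈ U, ContMDiffAt 𝓘(ℝ, EB) 𝓘(ℝ, E) ∞ (fun b ↦ ι (σ b)) b := fun b hb ↦
    ContMDiffAt.comp b (hquot.embedding.contMDiff _) (hσ.contMDiffAt (hUo.mem_nhds hb))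
  refine ⟨{
    -- The section `u` is chosen nonzero at one point of the slice; `U` is shrunk to where it stays
    -- nonzero. Spreading it from the slice by the lifted action gives the frame.
    U := {b | b ∈ U ∧ u (ι (σ b)) ≠ 0}
    isOpen_U := ?_
    σ := σ
    u := u
    f := fun n ↦ ρ.act (τ n) (L.sec u (ι (σ (pr n))))
    smooth_σ := fun b hb ↦ hσ.contMDiffAt (hUo.mem_nhds hb.1)
    pr_σ := fun b hb ↦ hpr b hb.1
    smooth_u := hu
    f_fst := fun n hn ↦ ?_
    smooth_f := fun n hn ↦ ?_
    f_ne_zero := fun n hn ↦ ρ.act_ne_zero _ hn.2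
    f_smul := fun g n hn ↦ ?_
    f_σ := fun b hb ↦ ?_ }, hU, h0⟩
  · rw [isOpen_iff_mem_nhds]
    rintro b ⟨hb, hb0⟩
    exact (hUo.eventually_mem hb).and ((hσ' b hb).continuousAt.eventually
      (eventually_ne_zero (hu _).diffAt hb0))
  · exact (hquot.equivariant _ _).symm.trans (congrArg ι (h1 n hn.1).symm)
  · refine ρ.contMDiffAt_act (hτ.contMDiffAt ((hUo.preimage hquot.quotient.smooth.continuous).mem_nhds
      hn.1)) (ContMDiffAt.comp n (g := L.sec u) (hu _) ?_)
    exact ContMDiffAt.comp n (g := fun b ↦ ι (σ b)) (hσ' _ hn.1) (hquot.quotient.smooth n)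
  · rw [hquot.quotient.invariant, hquot.quotient.tau_smul h1 hn.1 g, ρ.act_mul]
  · rw [hpr b hb.1, hquot.quotient.tau_section hpr h1 hb.1, ρ.act_one]

namespace DescentFrame

variable (F : DescentFrame EN EB ρ ι pr)

/-- The connection form of the frame. -/
def form (b : B) : TangentSpace 𝓘(ℝ, EB) b →L[ℝ] ℂ :=
  (D.form F.u (ι (F.σ b))).comp
    ((mfderiv 𝓘(ℝ, EN) 𝓘(ℝ, E) ι (F.σ b)).comp (mfderiv 𝓘(ℝ, EB) 𝓘(ℝ, EN) F.σ b))

theorem form_congr_point {b b' : B} (hb : b = b') {v v' : EB} (hv : v = v') :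
    F.form b v = F.form b' v' := by
  subst hb hv
  rfl

theorem u_ne_zero {b : B} (hb : b ∈ F.U) : F.u (ι (F.σ b)) ≠ 0 := by
  have h1 := F.f_ne_zero (F.σ b) (by rwa [F.pr_σ b hb])
  exact snd_ne_zero_of_eq (F.f_σ b hb).symm h1

/-- The frame extends locally to a section of the line bundle. -/
theorem exists_extension [T2Space M] (hquot : IsHyperkahlerQuotient (EN := EN) H ν₁ ν₂ ν₃ ι pr HB)
    {n : N} (hn : pr n ∈ F.U) :
    ∃ s : ∀ x, L.Fiber x, L.DiffAt s (ι n) ∧ ∀ᶠ n' in 𝓝 n, L.sec s (ι n') = F.f n' :=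
  exists_diffAt_extension (hquot.embedding.isImmersion.isImmersionAt n)
    ((F.smooth_f n hn).mdifferentiableAt (by simp))
    (((F.isOpen_U.preimage hquot.quotient.smooth.continuous).eventually_mem hn).mono F.f_fst)

section Connection

variable [LieGroup 𝓘(ℝ, EG) ∞ G]

/-- An equivariant section has derivative `-i ν₁(a) s` in the direction of `a`, and `ν₁` vanishes on
the image of `ι`. This is where the choice of the level `0` enters. -/
theorem cov_fundField_eq_zero (hquot : IsHyperkahlerQuotient (EN := EN) H ν₁ ν₂ ν₃ ι pr HB)
    (hρ : ∀ a : GroupLieAlgebra 𝓘(ℝ, EG) G, ρ.IsMomentFunction a (fun x ↦ ν₁ x a))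
    {n : N} (hn : pr n ∈ F.U) {s : ∀ x, L.Fiber x} (hs : L.DiffAt s (ι n))
    (h : ∀ᶠ n' in 𝓝 n, L.sec s (ι n') = F.f n') (a : GroupLieAlgebra 𝓘(ℝ, EG) G) :
    D.cov s (ι n) (fundField 𝓘(ℝ, EG) G a (ι n)) = 0 := by
  have hν : ν₁ (ι n) = 0 := by
    have h1 : ι n ∈ Set.range ι := ⟨n, rfl⟩
    rw [hquot.range_ι] at h1
    exact h1.1
  refine ρ.cov_fundField_eq_zero (hρ a) (by rw [hν]; rfl) hs
    (snd_ne_zero_of_eq h.self_of_nhds (F.f_ne_zero n hn)) ?_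
  have h1 : ContinuousAt (fun g : G ↦ g • n) 1 :=
    (mdifferentiableAt_smul_left 𝓘(ℝ, EG) hquot.quotient.smooth_act 1 n).continuousAt
  have h2 : ∀ᶠ g in 𝓝 (1 : G), L.sec s (ι (g • n)) = F.f (g • n) := by
    refine h1.eventually (p := fun n' ↦ L.sec s (ι n') = F.f n') ?_
    change ∀ᶠ n' in 𝓝 ((1 : G) • n), _
    rwa [one_smul]
  filter_upwards [h2] with g hg
  rw [hquot.equivariant, F.f_smul g n hn, ← h.self_of_nhds] at hg
  exact mk_inj.1 hg

/-- The translate `g • σ` of the slice is again a local section of `pr`. A tangent vector splits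
into a vertical part, along which the frame is parallel, and a part tangent to this translate, along
which the `G`-invariance of `D` reduces the derivative to the one along `σ`. -/
theorem cov_eq_form_of_smul [T2Space M]
    (hquot : IsHyperkahlerQuotient (EN := EN) H ν₁ ν₂ ν₃ ι pr HB)
    (hA : ContMDiffSMul 𝓘(ℝ, EG) 𝓘(ℝ, E) ∞ G M)
    (hρ : ∀ a : GroupLieAlgebra 𝓘(ℝ, EG) G, ρ.IsMomentFunction a (fun x ↦ ν₁ x a))
    {b : B} (hb : b ∈ F.U) (g : G) {s : ∀ x, L.Fiber x} (hs : L.DiffAt s (ι (g • F.σ b)))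
    (h : ∀ᶠ n' in 𝓝 (g • F.σ b), L.sec s (ι n') = F.f n') (v : EN) :
    D.cov s (ι (g • F.σ b)) (mfderiv 𝓘(ℝ, EN) 𝓘(ℝ, E) ι (g • F.σ b) v)
      = F.form b (vec (E := EB) (mfderiv 𝓘(ℝ, EN) 𝓘(ℝ, EB) pr (g • F.σ b) v)) • s (ι (g • F.σ b)) := by
  have hAN := hquot.quotient.smooth_act
  let σ' : B → N := fun b ↦ g • F.σ b
  have hUb : ∀ᶠ b' in 𝓝 b, b' ∈ F.U := F.isOpen_U.eventually_mem hb
  have hσs : ∀ b' ∈ F.U, ContMDiffAt 𝓘(ℝ, EB) 𝓘(ℝ, EN) ∞ σ' b' := fun b' hb' ↦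
    ContMDiffAt.smul (n := ∞) (f := fun _ ↦ g) (I := 𝓘(ℝ, EG)) contMDiffAt_const (F.smooth_σ b' hb')
  have hprσ : ∀ b' ∈ F.U, pr (σ' b') = b' := fun b' hb' ↦ by
    rw [hquot.quotient.invariant, F.pr_σ b' hb']
  have hn : pr (σ' b) ∈ F.U := by rwa [hprσ b hb]
  have hι := hquot.mdifferentiableAt_ι (σ' b)
  have hι₀ := hquot.mdifferentiableAt_ι (F.σ b)
  have hσd := (hσs b hb).mdifferentiableAt (n := ∞) (by simp)
  have hσd₀ := (F.smooth_σ b hb).mdifferentiableAt (n := ∞) (by simp)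
  let A : EN →L[ℝ] E := mfderiv 𝓘(ℝ, EN) 𝓘(ℝ, E) ι (σ' b)
  let P : EN →L[ℝ] EB := mfderiv 𝓘(ℝ, EN) 𝓘(ℝ, EB) pr (σ' b)
  let S : EB →L[ℝ] EN := mfderiv 𝓘(ℝ, EB) 𝓘(ℝ, EN) σ' b
  let T : EB →L[ℝ] E := mfderiv 𝓘(ℝ, EB) 𝓘(ℝ, E) (ι ∘ σ') b
  let T₀ : EB →L[ℝ] E := mfderiv 𝓘(ℝ, EB) 𝓘(ℝ, E) (ι ∘ F.σ) b
  let C : E →L[ℝ] L.Fiber (ι (σ' b)) := D.cov s (ι (σ' b))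
  have hT : T = A.comp S := (hι.hasMFDerivAt.comp b hσd.hasMFDerivAt).mfderiv
  have hT₀ : T₀ = _ := (hι₀.hasMFDerivAt.comp b hσd₀.hasMFDerivAt).mfderiv
  have hPS : P (S (P v)) = P v :=
    hquot.quotient.mfderiv_section (hσs b hb) (hUb.mono hprσ) (P v)
  -- `v` and `S (P v)` have the same projection to `B`, so they differ by a vector tangent to the
  -- orbit.
  have hker : P (v - S (P v)) = 0 := by rw [map_sub, hPS, sub_self]
  obtain ⟨a, ha⟩ := hquot.quotient.exists_fundField_eq hker
  have hvert : A (v - S (P v)) = vec (fundField 𝓘(ℝ, EG) G a (ι (σ' b))) := by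
    rw [ha]
    exact hquot.mfderiv_ι_fundField a (σ' b)
  have hsum : A v = vec (fundField 𝓘(ℝ, EG) G a (ι (σ' b))) + T (P v) := by
    rw [← hvert, hT, ContinuousLinearMap.comp_apply, ← map_add, sub_add_cancel]
  have hzero : C (vec (fundField 𝓘(ℝ, EG) G a (ι (σ' b)))) = 0 :=
    F.cov_fundField_eq_zero hquot hρ hn hs h a
  -- the section agrees with the transported section `u` along the local section of `pr`
  have hdiff : L.DiffAt (ρ.push g F.u) (g • ι (F.σ b)) :=
    ρ.diffAt_push hA g (F.smooth_u _).diffAt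
  have hdiff' : L.DiffAt (ρ.push g F.u) ((ι ∘ σ') b) := by
    have h2 : (ι ∘ σ') b = g • ι (F.σ b) := hquot.equivariant g (F.σ b)
    rwa [h2]
  have hev : ∀ᶠ b' in 𝓝 b, s ((ι ∘ σ') b') = ρ.push g F.u ((ι ∘ σ') b') := by
    filter_upwards [hσd.continuousAt.eventually h, hUb] with b' h2 hb'
    refine mk_inj.1 (h2.trans ?_)
    change F.f (g • F.σ b') = L.sec (ρ.push g F.u) (ι (g • F.σ b'))
    rw [ρ.sec_push, hquot.equivariant, inv_smul_smul, F.f_smul g _ (by rwa [F.pr_σ b' hb']),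
      F.f_σ b' hb']
  have hcongr : C (T (P v)) = D.cov (ρ.push g F.u) ((ι ∘ σ') b) (T (P v)) :=
    D.cov_congr_comp (hι.comp b hσd) hs hdiff' hev (P v)
  -- Vectors tangent to the translated section are images under the action of `g`, so
  -- `Lift.cov_push` applies to them.
  have hTdAct : T (P v) = vec (dAct g (ι (F.σ b)) (T₀ (P v))) := by
    have h2 : (ι ∘ σ') = (fun x ↦ g • x) ∘ (ι ∘ F.σ) :=
      funext fun b' ↦ hquot.equivariant g (F.σ b')
    have h3 := ((mdifferentiableAt_smul_right 𝓘(ℝ, EG) hA g (ι (F.σ b))).hasMFDerivAt.comp b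
      (hι₀.comp b hσd₀).hasMFDerivAt).mfderiv
    exact congrArg (fun A : EB →L[ℝ] E ↦ A (P v)) ((congrArg (fun f : B → M ↦
      (mfderiv 𝓘(ℝ, EB) 𝓘(ℝ, E) f b : EB →L[ℝ] E)) h2).trans h3)
  have hform : F.form b (P v) = D.form F.u (ι (F.σ b)) (T₀ (P v)) := by rw [hT₀]; rfl
  have hu : (⟨_, D.cov F.u (ι (F.σ b)) (T₀ (P v))⟩ : L.Tot)
      = smulTot (F.form b (P v)) (F.f (F.σ b)) := by
    rw [F.f_σ b hb, hform]
    exact mk_inj.2 (D.form_smul (F.u_ne_zero hb) _).symm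
  have hmain : (⟨ι (σ' b), C (T (P v))⟩ : L.Tot) = ⟨ι (σ' b), F.form b (P v) • s (ι (σ' b))⟩ := by
    calc (⟨ι (σ' b), C (T (P v))⟩ : L.Tot)
      _ = ⟨ι (σ' b), D.cov (ρ.push g F.u) ((ι ∘ σ') b) (T (P v))⟩ := mk_inj.2 hcongr
      _ = ⟨g • ι (F.σ b), D.cov (ρ.push g F.u) (g • ι (F.σ b))
            (dAct g (ι (F.σ b)) (T₀ (P v)))⟩ :=
          D.cov_congr_point _ (hquot.equivariant g (F.σ b)) hTdAct
      _ = ρ.act g ⟨_, D.cov F.u (ι (F.σ b)) (T₀ (P v))⟩ :=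
          mk_inj.2 (ρ.cov_push g (F.smooth_u _).diffAt _)
      _ = smulTot (F.form b (P v)) (L.sec s (ι (σ' b))) := by
          rw [hu, ρ.act_smulTot, h.self_of_nhds, F.f_smul g _ (by rwa [F.pr_σ b hb])]
  change C (A v) = F.form b (P v) • s (ι (σ' b))
  rw [hsum, map_add, hzero, zero_add]
  exact mk_inj.1 hmain

/-- The covariant derivative along `N` of the equivariant frame is the pullback of the connection
form on the quotient. -/
theorem cov_eq_form [T2Space M]
    (hquot : IsHyperkahlerQuotient (EN := EN) H ν₁ ν₂ ν₃ ι pr HB)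
    (hA : ContMDiffSMul 𝓘(ℝ, EG) 𝓘(ℝ, E) ∞ G M)
    (hρ : ∀ a : GroupLieAlgebra 𝓘(ℝ, EG) G, ρ.IsMomentFunction a (fun x ↦ ν₁ x a))
    {n : N} (hn : pr n ∈ F.U) {s : ∀ x, L.Fiber x} (hs : L.DiffAt s (ι n))
    (h : ∀ᶠ n' in 𝓝 n, L.sec s (ι n') = F.f n') (v : TangentSpace 𝓘(ℝ, EN) n) :
    D.cov s (ι n) (mfderiv 𝓘(ℝ, EN) 𝓘(ℝ, E) ι n v)
      = F.form (pr n) (mfderiv 𝓘(ℝ, EN) 𝓘(ℝ, EB) pr n v) • s (ι n) := by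
  obtain ⟨b, hb⟩ : ∃ b, pr n = b := ⟨_, rfl⟩
  rw [hb] at hn
  obtain ⟨g, rfl⟩ := hquot.quotient.exists_smul_eq ((F.pr_σ b hn).trans hb.symm)
  refine (F.cov_eq_form_of_smul hquot hA hρ hn g hs h v).trans ?_
  exact congrArg (fun c : ℂ ↦ c • s _) (F.form_congr_point hb.symm rfl)

/-- The covariant derivative along `N` of a multiple of the equivariant frame. -/
theorem cov_eq [T2Space M]
    (hquot : IsHyperkahlerQuotient (EN := EN) H ν₁ ν₂ ν₃ ι pr HB)
    (hA : ContMDiffSMul 𝓘(ℝ, EG) 𝓘(ℝ, E) ∞ G M)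
    (hρ : ∀ a : GroupLieAlgebra 𝓘(ℝ, EG) G, ρ.IsMomentFunction a (fun x ↦ ν₁ x a))
    {n : N} (hn : pr n ∈ F.U) {s : ∀ x, L.Fiber x} (hs : L.DiffAt s (ι n)) {c : B → ℂ}
    (hc : MDifferentiableAt 𝓘(ℝ, EB) 𝓘(ℝ, ℂ) c (pr n))
    (h : ∀ᶠ n' in 𝓝 n, L.sec s (ι n') = smulTot (c (pr n')) (F.f n'))
    (v : TangentSpace 𝓘(ℝ, EN) n) :
    (⟨ι n, D.cov s (ι n) (mfderiv 𝓘(ℝ, EN) 𝓘(ℝ, E) ι n v)⟩ : L.Tot)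
      = smulTot ((mvfderiv 𝓘(ℝ, EB) c (pr n) (mfderiv 𝓘(ℝ, EN) 𝓘(ℝ, EB) pr n v) : ℂ)
          + c (pr n) * F.form (pr n) (mfderiv 𝓘(ℝ, EN) 𝓘(ℝ, EB) pr n v)) (F.f n) := by
  obtain ⟨s₁, hs₁, h₁⟩ := F.exists_extension hquot hn
  obtain ⟨ret, hret, hretι⟩ := exists_retraction (hquot.embedding.isImmersion.isImmersionAt n)
  -- The coefficient lives on `B`; the retraction makes it a function near `ι n` in `M`, so that the
  -- Leibniz rule on `M` can be used.
  let C : M → ℂ := fun x ↦ c (pr (ret x))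
  have hC : MDifferentiableAt 𝓘(ℝ, E) 𝓘(ℝ, ℂ) C (ι n) := by
    refine MDifferentiableAt.comp (ι n) (g := fun n' ↦ c (pr n')) ?_
      (hret.mdifferentiableAt (by simp))
    rw [hretι.self_of_nhds]
    exact hc.comp n (hquot.mdifferentiableAt_pr n)
  have hCc : ∀ᶠ n' in 𝓝 n, C (ι n') = c (pr n') := hretι.mono fun n' h ↦ by
    change c (pr (ret (ι n'))) = _
    rw [h]
  have hev : ∀ᶠ n' in 𝓝 n, s (ι n') = C (ι n') • s₁ (ι n') := by
    filter_upwards [h, h₁, hCc] with n' h2 h3 h4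
    refine mk_inj.1 (h2.trans ?_)
    rw [← h3, h4]
    rfl
  rw [← h₁.self_of_nhds]
  refine mk_inj.2 ?_
  rw [D.cov_congr_comp (hquot.mdifferentiableAt_ι n) hs (DiffAt.smul hC hs₁) hev,
    D.cov_smul hC hs₁, F.cov_eq_form hquot hA hρ hn hs₁ h₁,
    mvfderiv_eq_of_comp (hquot.mdifferentiableAt_ι n) (hquot.mdifferentiableAt_pr n) hC hc hCc,
    hCc.self_of_nhds, smul_smul, ← add_smul, add_comm]
  rfl

end Connection

end DescentFrame

end Frame

theorem ComplexLineBundle.ratio_add {E : Type*} [NormedAddCommGroup E]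
    [NormedSpace ℝ E] [FiniteDimensional ℝ E]
    {M : Type*} [TopologicalSpace M] [ChartedSpace E M] [IsManifold 𝓘(ℝ, E) ∞ M]
    {L : ComplexLineBundle.{w} E M} {x : M} (v v' : L.Fiber x) {p : L.Tot} (hp : p.1 = x)
    (h0 : p.2 ≠ 0) : L.ratio ⟨x, v + v'⟩ p = L.ratio ⟨x, v⟩ p + L.ratio ⟨x, v'⟩ p := by
  obtain ⟨y, e⟩ := p
  obtain rfl : y = x := hp
  exact smul_cancel h0 (by rw [add_smul, ratio_smul h0, ratio_smul h0, ratio_smul h0])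

theorem LineCocycle.tot_ext {E : Type*} [NormedAddCommGroup E] [NormedSpace ℝ E]
    [FiniteDimensional ℝ E]
    {M : Type*} [TopologicalSpace M] [ChartedSpace E M] [IsManifold 𝓘(ℝ, E) ∞ M]
    (Z : LineCocycle E M) (i : M) {p q : Z.line.Tot} (h : p.1 = q.1) (hi : p.1 ∈ Z.U i)
    (hc : Z.coord i p = Z.coord i q) : p = q := by
  obtain ⟨x, a⟩ := p
  obtain ⟨y, b⟩ := q
  obtain rfl : x = y := h
  rw [Z.coord_injective i hi hc]

/-! ### The line bundle on the quotient and the identification with the restriction of `L` -/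

section Descent

variable {E : Type*} [NormedAddCommGroup E] [NormedSpace ℝ E] [FiniteDimensional ℝ E]
  {M : Type*} [TopologicalSpace M] [T2Space M] [ChartedSpace E M] [IsManifold 𝓘(ℝ, E) ∞ M]
  {H : AlmostHyperhermitian E M}
  {EG : Type*} [NormedAddCommGroup EG] [NormedSpace ℝ EG]
  {G : Type*} [TopologicalSpace G] [ChartedSpace EG G] [Group G] [LieGroup 𝓘(ℝ, EG) ∞ G]
  [MulAction G M]
  {ν₁ ν₂ ν₃ : M → GroupLieAlgebra 𝓘(ℝ, EG) G →L[ℝ] ℝ}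
  {EN : Type*} [NormedAddCommGroup EN] [NormedSpace ℝ EN] [FiniteDimensional ℝ EN]
  {N : Type*} [TopologicalSpace N] [ChartedSpace EN N] [IsManifold 𝓘(ℝ, EN) ∞ N]
  [MulAction G N]
  {EB : Type*} [NormedAddCommGroup EB] [NormedSpace ℝ EB] [FiniteDimensional ℝ EB]
  {B : Type*} [TopologicalSpace B] [ChartedSpace EB B] [IsManifold 𝓘(ℝ, EB) ∞ B]
  {HB : AlmostHyperhermitian EB B} {ι : N → M} {pr : N → B}
  {L : ComplexLineBundle.{w} E M} {h : L.HermitianMetric} {D : L.Connection}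
  {ρ : Lift 𝓘(ℝ, EG) G h D}

/-- The data from which a line bundle on a hyperkähler quotient is constructed: equivariant frames
of the restriction of `L` to the zero set of the moment maps, over a cover of the quotient. -/
structure DescentCover (H : AlmostHyperhermitian E M)
    (ν₁ ν₂ ν₃ : M → GroupLieAlgebra 𝓘(ℝ, EG) G →L[ℝ] ℝ) (HB : AlmostHyperhermitian EB B)
    (ρ : Lift 𝓘(ℝ, EG) G h D) (EN : Type*) [NormedAddCommGroup EN] [NormedSpace ℝ EN]
    [ChartedSpace EN N] (ι : N → M) (pr : N → B) where
  hquot : IsHyperkahlerQuotient (EN := EN) H ν₁ ν₂ ν₃ ι pr HB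
  smul : ContMDiffSMul 𝓘(ℝ, EG) 𝓘(ℝ, E) ∞ G M
  moment : ∀ a : GroupLieAlgebra 𝓘(ℝ, EG) G, ρ.IsMomentFunction a (fun x ↦ ν₁ x a)
  /-- the frames -/
  F : B → DescentFrame EN EB ρ ι pr
  mem : ∀ b, b ∈ (F b).U

namespace DescentCover

variable (C : DescentCover H ν₁ ν₂ ν₃ HB ρ EN ι pr)

theorem ratio_frame_smul {i j : B} (g : G) {n : N} (hi : pr n ∈ (C.F i).U) (hj : pr n ∈ (C.F j).U) :
    L.ratio ((C.F i).f (g • n)) ((C.F j).f (g • n)) = L.ratio ((C.F i).f n) ((C.F j).f n) := by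
  rw [(C.F i).f_smul g n hi, (C.F j).f_smul g n hj, ρ.ratio_act g _ ((C.F j).f_ne_zero n hj)]
  rw [(C.F i).f_fst n hi, (C.F j).f_fst n hj]

/-- The transition functions between the frames. -/
def k (i j b : B) : ℂ :=
  L.ratio ((C.F i).f (Function.surjInv C.hquot.quotient.surjective b))
    ((C.F j).f (Function.surjInv C.hquot.quotient.surjective b))

/-- The transition function is defined with a chosen point of the orbit; both frames are
equivariant, so any other point gives the same ratio. -/
theorem k_eq {i j : B} {n : N} (hi : pr n ∈ (C.F i).U) (hj : pr n ∈ (C.F j).U) :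
    C.k i j (pr n) = L.ratio ((C.F i).f n) ((C.F j).f n) := by
  have h1 := Function.surjInv_eq C.hquot.quotient.surjective (pr n)
  obtain ⟨g, hg⟩ := C.hquot.quotient.exists_smul_eq h1
  rw [k]
  conv_rhs => rw [hg]
  rw [C.ratio_frame_smul g (by rwa [h1]) (by rwa [h1])]

theorem fst_eq {i j : B} {n : N} (hi : pr n ∈ (C.F i).U) (hj : pr n ∈ (C.F j).U) :
    ((C.F i).f n).1 = ((C.F j).f n).1 := by
  rw [(C.F i).f_fst n hi, (C.F j).f_fst n hj]

/-- The cocycle of the line bundle on the quotient. -/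
def cocycle : LineCocycle EB B where
  U b := (C.F b).U
  isOpen_U b := (C.F b).isOpen_U
  mem_U := C.mem
  k := C.k
  k_self i b hb := by
    obtain ⟨n, rfl⟩ := C.hquot.quotient.surjective b
    rw [C.k_eq hb hb]
    exact ratio_self ((C.F i).f_ne_zero n hb)
  k_comp i j l b hi hj hl := by
    obtain ⟨n, rfl⟩ := C.hquot.quotient.surjective b
    rw [C.k_eq hj hl, C.k_eq hi hj, C.k_eq hi hl, mul_comm]
    exact ratio_mul (C.fst_eq hi hj) (C.fst_eq hj hl) ((C.F j).f_ne_zero n hj)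
      ((C.F l).f_ne_zero n hl)
  smooth_k i j b hi hj := by
    have hσ := (C.F i).smooth_σ b hi
    have hU : ∀ᶠ b' in 𝓝 b, b' ∈ (C.F i).U ∩ (C.F j).U :=
      ((C.F i).isOpen_U.inter (C.F j).isOpen_U).eventually_mem ⟨hi, hj⟩
    have hpr := (C.F i).pr_σ
    have hi' : pr ((C.F i).σ b) ∈ (C.F i).U := by rwa [hpr b hi]
    have hj' : pr ((C.F i).σ b) ∈ (C.F j).U := by rwa [hpr b hi]
    have h1 : ContMDiffAt 𝓘(ℝ, EB) 𝓘(ℝ, ℂ) ∞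
        (fun b' ↦ L.ratio ((C.F i).f ((C.F i).σ b')) ((C.F j).f ((C.F i).σ b'))) b := by
      refine ContMDiffAt.lineRatio
        (ContMDiffAt.comp b (g := (C.F i).f) ((C.F i).smooth_f _ hi') hσ)
        (ContMDiffAt.comp b (g := (C.F j).f) ((C.F j).smooth_f _ hj') hσ) ?_
        ((C.F j).f_ne_zero _ hj')
      filter_upwards [hU] with b' hb'
      exact C.fst_eq (by rw [hpr b' hb'.1]; exact hb'.1) (by rw [hpr b' hb'.1]; exact hb'.2)
    refine h1.congr_of_eventuallyEq ?_
    filter_upwards [hU] with b' hb'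
    have h2 := C.k_eq (i := i) (j := j) (n := (C.F i).σ b') (by rw [hpr b' hb'.1]; exact hb'.1)
      (by rw [hpr b' hb'.1]; exact hb'.2)
    rwa [hpr b' hb'.1] at h2

/-- The line bundle on the quotient. -/
abbrev line : ComplexLineBundle.{0} EB B := C.cocycle.line

/-- The map from the restriction of `L` to `N` to the line bundle on the quotient. -/
def mapTot (n : N) (p : L.Tot) : C.line.Tot :=
  ⟨pr n, C.cocycle.vector (pr n) (L.ratio p ((C.F (pr n)).f n))⟩

/-- `mapTot` is defined with the frame indexed by `pr n`. The cocycle rule shows that in every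
trivialization the coordinate is the coefficient with respect to the corresponding frame. -/
theorem coord_mapTot {i : B} {n : N} (hi : pr n ∈ (C.F i).U) {p : L.Tot} (hp : p.1 = ι n) :
    C.cocycle.coord i (C.mapTot n p) = L.ratio p ((C.F i).f n) := by
  have h1 := C.mem (pr n)
  refine (C.cocycle.coord_vector i (pr n) _).trans ?_
  change C.k (pr n) i (pr n) * _ = _
  rw [C.k_eq h1 hi, mul_comm]
  exact ratio_mul (hp.trans ((C.F _).f_fst n h1).symm) (C.fst_eq h1 hi) ((C.F _).f_ne_zero n h1)
    ((C.F i).f_ne_zero n hi)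

theorem mapTot_smul (g : G) (n : N) {p : L.Tot} (hp : p.1 = ι n) :
    C.mapTot (g • n) (ρ.act g p) = C.mapTot n p := by
  have hpr : pr (g • n) = pr n := C.hquot.quotient.invariant g n
  have h1 := C.mem (pr n)
  have h1' : pr (g • n) ∈ (C.F (pr n)).U := by rwa [hpr]
  refine C.cocycle.tot_ext (pr n) hpr h1' ?_
  rw [C.coord_mapTot h1' (by rw [ρ.act_fst, hp, C.hquot.equivariant]), C.coord_mapTot h1 hp,
    (C.F _).f_smul g n h1, ρ.ratio_act g (hp.trans ((C.F _).f_fst n h1).symm)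
      ((C.F _).f_ne_zero n h1)]

theorem mapTot_smulTot (n : N) (c : ℂ) {p : L.Tot} (hp : p.1 = ι n) :
    C.mapTot n (smulTot c p) = smulTot c (C.mapTot n p) := by
  have h1 := C.mem (pr n)
  refine mk_inj.2 ?_
  rw [ratio_smulTot_left (hp.trans ((C.F _).f_fst n h1).symm) ((C.F _).f_ne_zero n h1)]
  exact C.cocycle.vector_smul _ _ _

/-- The identification of the fibres of the restriction of `L` to `N` with the fibres of the line
bundle on the quotient. -/
def q (n : N) : L.Fiber (ι n) ≃ₗ[ℂ] C.line.Fiber (pr n) :=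
  have h1 := C.mem (pr n)
  have h2 := (C.F (pr n)).f_ne_zero n h1
  have h3 := (C.F (pr n)).f_fst n h1
  LinearEquiv.ofBijective
    { toFun := fun v ↦ C.cocycle.vector (pr n) (L.ratio ⟨ι n, v⟩ ((C.F (pr n)).f n))
      map_add' := fun v v' ↦ by
        rw [ratio_add v v' h3 h2, C.cocycle.vector_add]
      map_smul' := fun c v ↦ by
        have h4 := ratio_smulTot_left (p := (⟨ι n, v⟩ : L.Tot)) h3.symm h2 c
        exact (congrArg (C.cocycle.vector (pr n)) h4).trans (C.cocycle.vector_smul _ _ _) }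
    ⟨fun v v' hv ↦ by
      have h4 : L.ratio ⟨ι n, v⟩ ((C.F (pr n)).f n) = L.ratio ⟨ι n, v'⟩ ((C.F (pr n)).f n) := hv
      have h5 := ratio_smulTot (p := (⟨ι n, v⟩ : L.Tot)) h3.symm h2
      rw [h4, ratio_smulTot (p := (⟨ι n, v'⟩ : L.Tot)) h3.symm h2] at h5
      exact (mk_inj.1 h5).symm,
    fun a ↦ by
      let c := C.cocycle.coord (pr n) ⟨pr n, a⟩
      refine ⟨fiberOf (smulTot c ((C.F (pr n)).f n)) h3, ?_⟩
      have h4 := mk_fiberOf (smulTot c ((C.F (pr n)).f n)) h3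
      refine (congrArg (fun p ↦ C.cocycle.vector (pr n) (L.ratio p ((C.F (pr n)).f n))) h4).trans ?_
      exact (congrArg _ (ratio_smulTot_self h2 c)).trans (C.cocycle.coord_self _ _)⟩

theorem mk_q (n : N) (v : L.Fiber (ι n)) :
    (⟨pr n, C.q n v⟩ : C.line.Tot) = C.mapTot n ⟨ι n, v⟩ := rfl

theorem q_eq_iff (n : N) (v : L.Fiber (ι n)) (r : ∀ b, C.line.Fiber b) :
    C.q n v = r (pr n) ↔ C.mapTot n ⟨ι n, v⟩ = C.line.sec r (pr n) :=
  mk_inj.symm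

/-- Every point of the fibre over `pr n` comes from the fibre over `ι n`. -/
theorem exists_mapTot_eq {n : N} {P : C.line.Tot} (hP : P.1 = pr n) :
    ∃ p : L.Tot, p.1 = ι n ∧ C.mapTot n p = P := by
  obtain ⟨b, a⟩ := P
  obtain rfl : b = pr n := hP
  refine ⟨⟨ι n, (C.q n).symm a⟩, rfl, ?_⟩
  rw [← mk_q, LinearEquiv.apply_symm_apply]

section Smooth

variable {EX : Type*} [NormedAddCommGroup EX] [NormedSpace ℝ EX] {HX : Type*} [TopologicalSpace HX]
  {IX : ModelWithCorners ℝ EX HX} {X : Type*} [TopologicalSpace X] [ChartedSpace HX X]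

theorem eventually_mem {n : X → N} {x : X} (hn : ContinuousAt n x) {i : B}
    (hi : pr (n x) ∈ (C.F i).U) : ∀ᶠ y in 𝓝 x, pr (n y) ∈ (C.F i).U :=
  hn.eventually (((C.F i).isOpen_U.preimage C.hquot.quotient.smooth.continuous).eventually_mem hi)

/-- In coordinates `mapTot` takes the coefficient with respect to a smooth frame along `N`;
multiplying the frame by the coefficient recovers the point. This transfers smoothness in both
directions. -/
theorem contMDiffAt_mapTot_iff {n : X → N} {p : X → L.Tot} {x : X}
    (hn : ContMDiffAt IX 𝓘(ℝ, EN) ∞ n x) (hp : ∀ᶠ y in 𝓝 x, (p y).1 = ι (n y)) :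
    ContMDiffAt IX (𝓘(ℝ, EB).prod 𝓘(ℝ, ℂ)) ∞ (fun y ↦ C.mapTot (n y) (p y)) x ↔
      ContMDiffAt IX (𝓘(ℝ, E).prod 𝓘(ℝ, ℂ)) ∞ p x := by
  have h1 := C.mem (pr (n x))
  have hU := C.eventually_mem hn.continuousAt h1
  have hf : ContMDiffAt IX (𝓘(ℝ, E).prod 𝓘(ℝ, ℂ)) ∞ (fun y ↦ (C.F (pr (n x))).f (n y)) x :=
    ContMDiffAt.comp x (g := (C.F (pr (n x))).f) ((C.F _).smooth_f _ h1) hn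
  have hfst : ∀ᶠ y in 𝓝 x, (p y).1 = ((C.F (pr (n x))).f (n y)).1 := by
    filter_upwards [hU, hp] with y hy hpy
    rw [hpy, (C.F _).f_fst _ hy]
  have hco : ∀ᶠ y in 𝓝 x, C.cocycle.coord (pr (n x)) (C.mapTot (n y) (p y))
      = L.ratio (p y) ((C.F (pr (n x))).f (n y)) := by
    filter_upwards [hU, hp] with y hy hpy using C.coord_mapTot hy hpy
  rw [C.cocycle.contMDiffAt_iff (f := fun y ↦ C.mapTot (n y) (p y)) (pr (n x)) h1]
  constructor
  · rintro ⟨-, h2⟩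
    refine ((h2.congr_of_eventuallyEq (hco.mono fun _ h ↦ h.symm)).lineSmul hf).congr_of_eventuallyEq ?_
    filter_upwards [hU, hfst] with y hy hy'
    exact (ratio_smulTot hy' ((C.F _).f_ne_zero _ hy)).symm
  · intro h2
    exact ⟨ContMDiffAt.comp x (g := pr) (C.hquot.quotient.smooth _) hn,
      (h2.lineRatio hf hfst ((C.F _).f_ne_zero _ h1)).congr_of_eventuallyEq hco⟩

theorem mdifferentiableAt_mapTot_iff {n : X → N} {p : X → L.Tot} {x : X}
    (hn : MDifferentiableAt IX 𝓘(ℝ, EN) n x) (hp : ∀ᶠ y in 𝓝 x, (p y).1 = ι (n y)) :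
    MDifferentiableAt IX (𝓘(ℝ, EB).prod 𝓘(ℝ, ℂ)) (fun y ↦ C.mapTot (n y) (p y)) x ↔
      MDifferentiableAt IX (𝓘(ℝ, E).prod 𝓘(ℝ, ℂ)) p x := by
  have h1 := C.mem (pr (n x))
  have hU := C.eventually_mem hn.continuousAt h1
  have hf : MDifferentiableAt IX (𝓘(ℝ, E).prod 𝓘(ℝ, ℂ)) (fun y ↦ (C.F (pr (n x))).f (n y)) x :=
    MDifferentiableAt.comp x (g := (C.F (pr (n x))).f)
      (((C.F _).smooth_f _ h1).mdifferentiableAt (by simp)) hn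
  have hfst : ∀ᶠ y in 𝓝 x, (p y).1 = ((C.F (pr (n x))).f (n y)).1 := by
    filter_upwards [hU, hp] with y hy hpy
    rw [hpy, (C.F _).f_fst _ hy]
  have hco : ∀ᶠ y in 𝓝 x, C.cocycle.coord (pr (n x)) (C.mapTot (n y) (p y))
      = L.ratio (p y) ((C.F (pr (n x))).f (n y)) := by
    filter_upwards [hU, hp] with y hy hpy using C.coord_mapTot hy hpy
  rw [C.cocycle.mdifferentiableAt_iff (f := fun y ↦ C.mapTot (n y) (p y)) (pr (n x)) h1]
  constructor
  · rintro ⟨-, h2⟩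
    refine ((h2.congr_of_eventuallyEq (hco.mono fun _ h ↦ h.symm)).lineSmul hf).congr_of_eventuallyEq ?_
    filter_upwards [hU, hfst] with y hy hy'
    exact (ratio_smulTot hy' ((C.F _).f_ne_zero _ hy)).symm
  · intro h2
    exact ⟨MDifferentiableAt.comp x (g := pr) (C.hquot.mdifferentiableAt_pr _) hn,
      (h2.lineRatio hf hfst ((C.F _).f_ne_zero _ h1)).congr_of_eventuallyEq hco⟩

end Smooth

/-- A differentiable section on the quotient lifts to a section of `L`. -/
theorem exists_lift {r : ∀ b, C.line.Fiber b} {n : N} (hr : C.line.DiffAt r (pr n)) :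
    ∃ s : ∀ x, L.Fiber x, L.DiffAt s (ι n) ∧ ∀ᶠ n' in 𝓝 n, C.q n' (s (ι n')) = r (pr n') := by
  -- Along `N` the lift is forced to be `q⁻¹ (r ∘ pr)`; it is then extended to a neighbourhood in
  -- `M`.
  have h1 : MDifferentiableAt 𝓘(ℝ, EN) (𝓘(ℝ, E).prod 𝓘(ℝ, ℂ))
      (fun n' ↦ (⟨ι n', (C.q n').symm (r (pr n'))⟩ : L.Tot)) n := by
    refine (C.mdifferentiableAt_mapTot_iff mdifferentiableAt_id (.of_forall fun _ ↦ rfl)).1 ?_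
    refine (MDifferentiableAt.comp n (g := C.line.sec r) hr
      (C.hquot.mdifferentiableAt_pr n)).congr_of_eventuallyEq (.of_forall fun n' ↦ ?_)
    exact ((C.q_eq_iff n' _ r).1 ((C.q n').apply_symm_apply _))
  obtain ⟨s, hs, h2⟩ := exists_diffAt_extension (C.hquot.embedding.isImmersion.isImmersionAt n) h1
    (.of_forall fun _ ↦ rfl)
  refine ⟨s, hs, h2.mono fun n' hn' ↦ ?_⟩
  rw [mk_inj.1 hn', LinearEquiv.apply_symm_apply]

end DescentCover

end Descent

/-! ### Smoothness of a pulled back 1-form -/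

section Pullback

variable {E : Type*} [NormedAddCommGroup E] [NormedSpace ℝ E] [FiniteDimensional ℝ E]
  {M : Type*} [TopologicalSpace M] [ChartedSpace E M] [IsManifold 𝓘(ℝ, E) ∞ M]
  {EB : Type*} [NormedAddCommGroup EB] [NormedSpace ℝ EB] [FiniteDimensional ℝ EB]
  {B : Type*} [TopologicalSpace B] [ChartedSpace EB B] [IsManifold 𝓘(ℝ, EB) ∞ B]
  {W : Type*} [NormedAddCommGroup W] [NormedSpace ℝ W]

theorem SmoothOneAt.pullback {f : B → M} {b : B} (hf : ContMDiffAt 𝓘(ℝ, EB) 𝓘(ℝ, E) ∞ f b)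
    {α : ∀ y : M, TangentSpace 𝓘(ℝ, E) y →L[ℝ] W} (hα : SmoothOneAt α (f b))
    {β : ∀ y : B, TangentSpace 𝓘(ℝ, EB) y →L[ℝ] W}
    (hβ : ∀ᶠ y in 𝓝 b, ∀ u, β y u = α (f y) (mfderiv 𝓘(ℝ, EB) 𝓘(ℝ, E) f y u)) :
    SmoothOneAt β b := by
  intro X hX
  have hm := contDiffAt_mapCoord hf
  have h1 : ContDiffAt ℝ ∞ (oneCoord (f b) α)
      (mapCoord (E := E) (EB := EB) f b (extChartAt 𝓘(ℝ, EB) b b)) := by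
    rw [mapCoord_self]
    exact contDiffAt_oneCoord hα
  have h2 : ContDiffAt ℝ ∞ (fun z ↦ oneCoord (f b) α (mapCoord (E := E) (EB := EB) f b z)
      (fderiv ℝ (mapCoord (E := E) (EB := EB) f b) z (fieldCoord b X z)))
      (extChartAt 𝓘(ℝ, EB) b b) :=
    (h1.comp _ hm).clm_apply ((hm.fderiv_right (m := ∞) (by simp)).clm_apply
      (contDiffAt_fieldCoord hX))
  refine (ContMDiffAt.comp b h2.contMDiffAt
    (contMDiffAt_extChartAt (I := 𝓘(ℝ, EB)) (x := b))).congr_of_eventuallyEq ?_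
  have h3 := (continuousAt_extChartAt (I := 𝓘(ℝ, EB)) b).eventually
    (eventually_frameAt_fderiv_mapCoord hf)
  filter_upwards [hβ, h3, (chartAt EB b).open_source.mem_nhds (mem_chart_source EB b)] with y hy hz hs
  have hs' : y ∈ (extChartAt 𝓘(ℝ, EB) b).source := by rwa [extChartAt_source]
  have h4 : (extChartAt 𝓘(ℝ, EB) b).symm (extChartAt 𝓘(ℝ, EB) b y) = y :=
    (extChartAt 𝓘(ℝ, EB) b).left_inv hs'
  have h5 : (extChartAt 𝓘(ℝ, E) (f b)).symm
      (mapCoord (E := E) (EB := EB) f b (extChartAt 𝓘(ℝ, EB) b y))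
      = f ((extChartAt 𝓘(ℝ, EB) b).symm (extChartAt 𝓘(ℝ, EB) b y)) :=
    (extChartAt 𝓘(ℝ, E) (f b)).left_inv (by rw [extChartAt_source]; exact hz.1)
  rw [Function.comp_apply, oneCoord_apply, h5, hz.2, fieldCoord,
    frameAt_coframeAt (by rw [h4]; exact hs), h4]
  exact hy _

end Pullback

/-! ### Connections on the line bundle of a cocycle -/

section LineCocycle

variable {E : Type*} [NormedAddCommGroup E] [NormedSpace ℝ E] [FiniteDimensional ℝ E]
  {M : Type*} [TopologicalSpace M] [ChartedSpace E M] [IsManifold 𝓘(ℝ, E) ∞ M]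

namespace LineCocycle

variable (Z : LineCocycle E M)

/-- The inverse of the coordinate on a fibre, as a continuous linear map. -/
def vectorL (x : M) : ℂ →L[ℝ] Z.line.Fiber x where
  toFun := Z.vector x
  map_add' := Z.vector_add x
  map_smul' c d := (congrArg (Z.vector x) Complex.real_smul).trans (Z.vector_smul x c d)
  cont := continuous_id

theorem coord_add' (i : M) {x : M} (a b : Z.line.Fiber x) :
    Z.coord i ⟨x, a + b⟩ = Z.coord i ⟨x, a⟩ + Z.coord i ⟨x, b⟩ :=
  mul_add (Z.k x i x) (show ℂ from a) (show ℂ from b)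

theorem coord_vector_self (x : M) (c : ℂ) : Z.coord x ⟨x, Z.vector x c⟩ = c := by
  rw [coord_vector, Z.k_self x x (Z.mem_U x), one_mul]

theorem mdifferentiableAt_coord {r : ∀ x, Z.line.Fiber x} {i x : M} (hi : x ∈ Z.U i)
    (hr : Z.line.DiffAt r x) :
    MDifferentiableAt 𝓘(ℝ, E) 𝓘(ℝ, ℂ) (fun y ↦ Z.coord i (Z.line.sec r y)) x :=
  ((Z.mdifferentiableAt_iff (f := Z.line.sec r) i hi).1 hr).2

theorem contMDiffAt_coord {r : ∀ x, Z.line.Fiber x} {i x : M} (hi : x ∈ Z.U i)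
    (hr : Z.line.SmoothAt r x) :
    ContMDiffAt 𝓘(ℝ, E) 𝓘(ℝ, ℂ) ∞ (fun y ↦ Z.coord i (Z.line.sec r y)) x :=
  ((Z.contMDiffAt_iff (f := Z.line.sec r) i hi).1 hr).2

/-- The covariant derivative with given connection forms. -/
def covAt (θ : ∀ x : M, TangentSpace 𝓘(ℝ, E) x →L[ℝ] ℂ) (r : ∀ x, Z.line.Fiber x) (x : M) :
    TangentSpace 𝓘(ℝ, E) x →L[ℝ] Z.line.Fiber x :=
  (Z.vectorL x).comp (mvfderiv 𝓘(ℝ, E) (fun y ↦ Z.coord x (Z.line.sec r y)) x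
    + (ContinuousLinearMap.mul ℝ ℂ (Z.coord x (Z.line.sec r x))).comp (θ x))

theorem covAt_apply (θ : ∀ x : M, TangentSpace 𝓘(ℝ, E) x →L[ℝ] ℂ) (r : ∀ x, Z.line.Fiber x) (x : M)
    (v : TangentSpace 𝓘(ℝ, E) x) : Z.covAt θ r x v
      = Z.vector x ((mvfderiv 𝓘(ℝ, E) (fun y ↦ Z.coord x (Z.line.sec r y)) x v : ℂ)
        + Z.coord x (Z.line.sec r x) * θ x v) := rfl

theorem covAt_add (θ : ∀ x : M, TangentSpace 𝓘(ℝ, E) x →L[ℝ] ℂ) {r r' : ∀ x, Z.line.Fiber x} {x : M}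
    (hr : Z.line.DiffAt r x) (hr' : Z.line.DiffAt r' x) :
    Z.covAt θ (r + r') x = Z.covAt θ r x + Z.covAt θ r' x := by
  refine ContinuousLinearMap.ext fun v ↦ ?_
  have h1 : (fun y ↦ Z.coord x (Z.line.sec (r + r') y))
      = (fun y ↦ Z.coord x (Z.line.sec r y)) + fun y ↦ Z.coord x (Z.line.sec r' y) :=
    funext fun y ↦ Z.coord_add' x (r y) (r' y)
  have h2 : Z.coord x (Z.line.sec (r + r') x) = _ := Z.coord_add' x (r x) (r' x)
  rw [add_apply, covAt_apply, covAt_apply, covAt_apply, ← vector_add, h1, h2,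
    mvfderiv_add (Z.mdifferentiableAt_coord (Z.mem_U x) hr)
      (Z.mdifferentiableAt_coord (Z.mem_U x) hr'), add_apply]
  congr 1
  simp only [sec]
  ring

theorem covAt_smul (θ : ∀ x : M, TangentSpace 𝓘(ℝ, E) x →L[ℝ] ℂ) {r : ∀ x, Z.line.Fiber x} {x : M}
    {F : M → ℂ} (hF : MDifferentiableAt 𝓘(ℝ, E) 𝓘(ℝ, ℂ) F x) (hr : Z.line.DiffAt r x)
    (v : TangentSpace 𝓘(ℝ, E) x) : Z.covAt θ (fun y ↦ F y • r y) x v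
      = F x • Z.covAt θ r x v + (mvfderiv 𝓘(ℝ, E) F x v : ℂ) • r x := by
  have h1 : ∀ y, Z.coord x (Z.line.sec (fun y ↦ F y • r y) y) = F y * Z.coord x (Z.line.sec r y) :=
    fun y ↦ Z.coord_smul x (F y) (r y)
  have h2 : r x = Z.vector x (Z.coord x (Z.line.sec r x)) := (Z.coord_self x (r x)).symm
  rw [covAt_apply, covAt_apply, funext h1, h1,
    mvfderiv_complexMul hF (Z.mdifferentiableAt_coord (Z.mem_U x) hr)]
  conv_rhs => rw [h2]
  rw [← vector_smul, ← vector_smul, ← vector_add]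
  congr 1
  ring

/-- The connection with given connection forms. -/
def connection (θ : ∀ x : M, TangentSpace 𝓘(ℝ, E) x →L[ℝ] ℂ)
    (hθ : ∀ (r : ∀ x, Z.line.Fiber x) (X : ∀ x : M, TangentSpace 𝓘(ℝ, E) x) (x : M), SmoothSec r →
      SmoothFieldAt X x → Z.line.SmoothAt (fun y ↦ Z.covAt θ r y (X y)) x) : Z.line.Connection where
  cov :=
    { toFun := Z.covAt θ
      isCovariantDerivativeOnUniv :=
        { add := fun hr hr' _ ↦ Z.covAt_add θ hr hr'
          leibniz := by
            intro r g x hr hg _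
            have hg' : HasMFDerivAt 𝓘(ℝ, E) 𝓘(ℝ, ℂ) (fun y ↦ (g y : ℂ)) x
                (Complex.ofRealCLM.comp (mfderiv 𝓘(ℝ, E) 𝓘(ℝ, ℝ) g x)) :=
              (Complex.ofRealCLM.hasFDerivAt (x := g x)).hasMFDerivAt.comp x hg.hasMFDerivAt
            refine ContinuousLinearMap.ext fun v ↦ ?_
            refine (Z.covAt_smul θ hg'.mdifferentiableAt hr v).trans ?_
            have h1 : (mvfderiv 𝓘(ℝ, E) (fun y ↦ (g y : ℂ)) x v : ℂ)
                = ((mvfderiv 𝓘(ℝ, E) g x v : ℝ) : ℂ) :=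
              congrArg (fun A : E →L[ℝ] ℂ ↦ A v) hg'.mfderiv
            rw [h1]
            rfl } }
  smooth := contMDiffCovariantDerivative_of_apply hθ
  complexLinear := by
    intro r x hr v
    have h1 := Z.covAt_smul θ (F := fun _ ↦ Complex.I) mdifferentiableAt_const hr v
    have h2 : (mvfderiv 𝓘(ℝ, E) (fun _ : M ↦ Complex.I) x v : ℂ) = 0 := by
      rw [mvfderiv_const]
      rfl
    rw [h2, zero_smul, add_zero] at h1
    exact h1

/-- A globally smooth section that coincides near `i` with the frame indexed by `i`; in it the
connection form is the prescribed one. -/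
theorem exists_smoothSec_coord [T2Space M] (i : M) :
    ∃ r : ∀ x, Z.line.Fiber x, SmoothSec r ∧ ∀ᶠ y in 𝓝 i, Z.coord i (Z.line.sec r y) = 1 := by
  -- By the cocycle rule `k x i x * k i x x = 1`, so this vector has coordinate `1` in the
  -- trivialization indexed by `i`.
  let t : ∀ x, Z.line.Fiber x := fun x ↦ Z.vector x (Z.k i x x)
  have ht : ∀ y ∈ Z.U i, Z.coord i (Z.line.sec t y) = 1 := by
    intro y hy
    refine (Z.coord_vector i y _).trans ?_
    rw [mul_comm, mul_comm, Z.k_comp i y i y hy (Z.mem_U y) hy, Z.k_self i y hy]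
  obtain ⟨ψ, -, hψ⟩ := (SmoothBumpFunction.nhds_basis_tsupport (I := 𝓘(ℝ, E)) i).mem_iff.1
    ((Z.isOpen_U i).mem_nhds (Z.mem_U i))
  have hUi : ∀ y ∈ Z.U i, ∀ᶠ y' in 𝓝 y, y' ∈ Z.U i := fun y hy ↦ (Z.isOpen_U i).eventually_mem hy
  have hts : ∀ y ∈ Z.U i, Z.line.SmoothAt t y := by
    intro y hy
    refine (Z.contMDiffAt_iff (f := Z.line.sec t) i hy).2 ⟨contMDiffAt_id, ?_⟩
    exact contMDiffAt_const.congr_of_eventuallyEq ((hUi y hy).mono ht)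
  refine ⟨fun y ↦ (ψ y : ℝ) • t y, ?_, ?_⟩
  · have h1 : ContMDiffOn 𝓘(ℝ, E) (𝓘(ℝ, E).prod 𝓘(ℝ, ℂ)) ∞
        (fun y ↦ TotalSpace.mk' ℂ y (t y)) (Z.U i) := fun y hy ↦ (hts y hy).contMDiffWithinAt
    exact ContMDiffOn.smul_section_of_tsupport (V := Z.line.Fiber) (F := ℂ) (ψ := ψ)
      (ψ.contMDiff.contMDiffOn) (Z.isOpen_U i) hψ h1
  · filter_upwards [hUi i (Z.mem_U i), ψ.eventuallyEq_one] with y hy h1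
    have h2 : Z.coord i ⟨y, ((ψ y : ℝ) : ℂ) • t y⟩ = ((ψ y : ℝ) : ℂ) * Z.coord i ⟨y, t y⟩ :=
      Z.coord_smul i _ _
    refine h2.trans ?_
    rw [h1]
    exact (one_mul _).trans (ht y hy)

end LineCocycle

end LineCocycle

/-! ### The descended connection -/

section Descent

variable {E : Type*} [NormedAddCommGroup E] [NormedSpace ℝ E] [FiniteDimensional ℝ E]
  {M : Type*} [TopologicalSpace M] [T2Space M] [ChartedSpace E M] [IsManifold 𝓘(ℝ, E) ∞ M]
  {H : AlmostHyperhermitian E M}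
  {EG : Type*} [NormedAddCommGroup EG] [NormedSpace ℝ EG]
  {G : Type*} [TopologicalSpace G] [ChartedSpace EG G] [Group G] [LieGroup 𝓘(ℝ, EG) ∞ G]
  [MulAction G M]
  {ν₁ ν₂ ν₃ : M → GroupLieAlgebra 𝓘(ℝ, EG) G →L[ℝ] ℝ}
  {EN : Type*} [NormedAddCommGroup EN] [NormedSpace ℝ EN] [FiniteDimensional ℝ EN]
  {N : Type*} [TopologicalSpace N] [ChartedSpace EN N] [IsManifold 𝓘(ℝ, EN) ∞ N]
  [MulAction G N]
  {EB : Type*} [NormedAddCommGroup EB] [NormedSpace ℝ EB] [FiniteDimensional ℝ EB]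
  {B : Type*} [TopologicalSpace B] [ChartedSpace EB B] [IsManifold 𝓘(ℝ, EB) ∞ B]
  {HB : AlmostHyperhermitian EB B} {ι : N → M} {pr : N → B}
  {L : ComplexLineBundle.{w} E M} {h : L.HermitianMetric} {D : L.Connection}
  {ρ : Lift 𝓘(ℝ, EG) G h D}

namespace DescentCover

variable (C : DescentCover H ν₁ ν₂ ν₃ HB ρ EN ι pr)

/-- The coordinates of a section of the line bundle on the quotient are the coefficients of the
corresponding invariant section of `L`. -/
theorem sec_eq_smulTot {s : ∀ x, L.Fiber x} {r : ∀ b, C.line.Fiber b} {n : N}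
    (h : C.q n (s (ι n)) = r (pr n)) {i : B} (hi : pr n ∈ (C.F i).U) :
    L.sec s (ι n) = smulTot (C.cocycle.coord i (C.line.sec r (pr n))) ((C.F i).f n) := by
  have h1 := (C.q_eq_iff n _ r).1 h
  rw [← h1, C.coord_mapTot hi rfl, ratio_smulTot ((C.F i).f_fst n hi).symm ((C.F i).f_ne_zero n hi)]
  rfl

theorem cov_eq_smulTot {s : ∀ x, L.Fiber x} {r : ∀ b, C.line.Fiber b} {n : N}
    (hs : L.DiffAt s (ι n)) (hr : C.line.DiffAt r (pr n))
    (h : ∀ᶠ n' in 𝓝 n, C.q n' (s (ι n')) = r (pr n')) {i : B} (hi : pr n ∈ (C.F i).U)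
    (v : TangentSpace 𝓘(ℝ, EN) n) :
    (⟨ι n, D.cov s (ι n) (mfderiv 𝓘(ℝ, EN) 𝓘(ℝ, E) ι n v)⟩ : L.Tot)
      = smulTot ((mvfderiv 𝓘(ℝ, EB) (fun b ↦ C.cocycle.coord i (C.line.sec r b)) (pr n)
            (mfderiv 𝓘(ℝ, EN) 𝓘(ℝ, EB) pr n v) : ℂ)
          + C.cocycle.coord i (C.line.sec r (pr n))
            * (C.F i).form (pr n) (mfderiv 𝓘(ℝ, EN) 𝓘(ℝ, EB) pr n v)) ((C.F i).f n) := by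
  refine (C.F i).cov_eq C.hquot C.smul C.moment hi hs
    (c := fun b ↦ C.cocycle.coord i (C.line.sec r b)) (C.cocycle.mdifferentiableAt_coord hi hr) ?_ v
  filter_upwards [h, C.eventually_mem (n := id) continuousAt_id hi] with n' h1 h2
  exact C.sec_eq_smulTot h1 h2

/-- The frame forms were chosen so that covariant differentiation on the quotient corresponds to
that of `L` along `N`, in every tangent direction of `N`. -/
theorem q_cov_eq_covAt {s : ∀ x, L.Fiber x} {r : ∀ b, C.line.Fiber b} {n : N}
    (hs : L.DiffAt s (ι n)) (hr : C.line.DiffAt r (pr n))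
    (h : ∀ᶠ n' in 𝓝 n, C.q n' (s (ι n')) = r (pr n')) (v : TangentSpace 𝓘(ℝ, EN) n) :
    C.q n (D.cov s (ι n) (mfderiv 𝓘(ℝ, EN) 𝓘(ℝ, E) ι n v))
      = C.cocycle.covAt (fun b ↦ (C.F b).form b) r (pr n) (mfderiv 𝓘(ℝ, EN) 𝓘(ℝ, EB) pr n v) := by
  refine (congrArg (fun p ↦ C.cocycle.vector (pr n) (L.ratio p ((C.F (pr n)).f n)))
    (C.cov_eq_smulTot hs hr h (C.mem (pr n)) v)).trans ?_
  exact congrArg _ (ratio_smulTot_self ((C.F _).f_ne_zero n (C.mem _)) _)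

/-- Independence of the frame is obtained by lifting the section to `L`: there the covariant
derivative exists without a frame, so the transformation law of the forms need not be computed. -/
theorem coord_covAt {r : ∀ b, C.line.Fiber b} {b : B} (hr : C.line.DiffAt r b) {i : B}
    (hi : b ∈ (C.F i).U) (u : TangentSpace 𝓘(ℝ, EB) b) :
    C.cocycle.coord i ⟨b, C.cocycle.covAt (fun b ↦ (C.F b).form b) r b u⟩
      = (mvfderiv 𝓘(ℝ, EB) (fun b ↦ C.cocycle.coord i (C.line.sec r b)) b u : ℂ)
          + C.cocycle.coord i (C.line.sec r b) * (C.F i).form b u := by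
  obtain ⟨n, rfl⟩ := C.hquot.quotient.surjective b
  obtain ⟨v, rfl⟩ := C.hquot.exists_mfderiv_pr n u
  obtain ⟨s, hs, h⟩ := C.exists_lift hr
  rw [← C.q_cov_eq_covAt hs hr h, C.mk_q, C.coord_mapTot hi rfl, C.cov_eq_smulTot hs hr h hi v,
    ratio_smulTot_self ((C.F _).f_ne_zero n hi)]

theorem contMDiffAt_comp_section {i b : B} (hi : b ∈ (C.F i).U) :
    ContMDiffAt 𝓘(ℝ, EB) 𝓘(ℝ, E) ∞ (fun b ↦ ι ((C.F i).σ b)) b :=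
  ContMDiffAt.comp b (g := ι) (C.hquot.embedding.contMDiff _) ((C.F i).smooth_σ b hi)

theorem form_eq {i b : B} (hi : b ∈ (C.F i).U) (u : TangentSpace 𝓘(ℝ, EB) b) :
    (C.F i).form b u = D.form (C.F i).u (ι ((C.F i).σ b))
      (mfderiv 𝓘(ℝ, EB) 𝓘(ℝ, E) (fun b ↦ ι ((C.F i).σ b)) b u) := by
  have h1 : mfderiv 𝓘(ℝ, EB) 𝓘(ℝ, E) (fun b ↦ ι ((C.F i).σ b)) b
      = (mfderiv 𝓘(ℝ, EN) 𝓘(ℝ, E) ι ((C.F i).σ b)).comp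
        (mfderiv 𝓘(ℝ, EB) 𝓘(ℝ, EN) (C.F i).σ b) :=
    mfderiv_comp b (g := ι) (C.hquot.mdifferentiableAt_ι _)
      (((C.F i).smooth_σ b hi).mdifferentiableAt (by simp))
  rw [h1]
  rfl

theorem smoothOneAt_form {i b : B} (hi : b ∈ (C.F i).U) : SmoothOneAt (C.F i).form b := by
  refine SmoothOneAt.pullback (C.contMDiffAt_comp_section hi)
    (Connection.smoothOneAt_form D (C.F i).smooth_u ((C.F i).u_ne_zero hi)) ?_
  filter_upwards [(C.F i).isOpen_U.eventually_mem hi] with y hy u using C.form_eq hy u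

theorem smoothAt_covAt {r : ∀ b, C.line.Fiber b} (hr : SmoothSec r)
    {X : ∀ b : B, TangentSpace 𝓘(ℝ, EB) b} {b : B} (hX : SmoothFieldAt X b) :
    C.line.SmoothAt (fun y ↦ C.cocycle.covAt (fun b ↦ (C.F b).form b) r y (X y)) b := by
  refine (C.cocycle.contMDiffAt_iff
    (f := C.line.sec fun y ↦ C.cocycle.covAt (fun b ↦ (C.F b).form b) r y (X y)) b
    (C.mem b)).2 ⟨contMDiffAt_id, ?_⟩
  have h1 := C.cocycle.contMDiffAt_coord (i := b) (C.mem b) (hr b)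
  refine ((smoothOneAt_mvfderiv h1 X hX).add
    (h1.complexMul (C.smoothOneAt_form (C.mem b) X hX))).congr_of_eventuallyEq ?_
  filter_upwards [(C.F b).isOpen_U.eventually_mem (C.mem b)] with y hy
  exact C.coord_covAt (hr y).diffAt hy (X y)

/-- The connection on the quotient. -/
def connection : C.line.Connection :=
  C.cocycle.connection (fun b ↦ (C.F b).form b) fun _ _ _ hr hX ↦ C.smoothAt_covAt hr hX

theorem q_cov {s : ∀ x, L.Fiber x} {r : ∀ b, C.line.Fiber b} {n : N}
    (hs : L.DiffAt s (ι n)) (hr : C.line.DiffAt r (pr n))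
    (h : ∀ᶠ n' in 𝓝 n, C.q n' (s (ι n')) = r (pr n')) (v : TangentSpace 𝓘(ℝ, EN) n) :
    C.q n (D.cov s (ι n) (mfderiv 𝓘(ℝ, EN) 𝓘(ℝ, E) ι n v))
      = C.connection.cov r (pr n) (mfderiv 𝓘(ℝ, EN) 𝓘(ℝ, EB) pr n v) :=
  C.q_cov_eq_covAt hs hr h v

end DescentCover

end Descent

/-! ### Hermitian metrics on the line bundle of a cocycle -/

section LineCocycle

variable {E : Type*} [NormedAddCommGroup E] [NormedSpace ℝ E] [FiniteDimensional ℝ E]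
  {M : Type*} [TopologicalSpace M] [ChartedSpace E M] [IsManifold 𝓘(ℝ, E) ∞ M]

namespace LineCocycle

variable (Z : LineCocycle E M)

/-- The coordinate on a fibre, as a continuous linear map. -/
def coordL (x : M) : Z.line.Fiber x →L[ℝ] ℂ where
  toFun a := Z.coord x ⟨x, a⟩
  map_add' a b := Z.coord_add' x a b
  map_smul' c a := (Z.coord_smul x (c : ℂ) a).trans Complex.real_smul.symm
  cont := continuous_const_mul (Z.k x x x)

/-- A vector with constant coordinate `u` in the trivialization at `x` changes its coordinate by the
transition function when read at the index `y` of its own fibre. -/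
theorem coord_symm {x y : M} (hy : y ∈ Z.U x) (u : ℂ) :
    Z.coord y ⟨y, (Z.triv x).symm y u⟩ = Z.k x y y * u := by
  have h1 : Z.coord x ⟨y, (Z.triv x).symm y u⟩ = u :=
    congrArg Prod.snd ((Z.triv x).apply_mk_symm (b := y) hy u)
  have h2 := Z.coord_vector x y (Z.coord y ⟨y, (Z.triv x).symm y u⟩)
  rw [Z.coord_self, h1] at h2
  conv_rhs => rw [h2]
  rw [← mul_assoc, Z.k_comp y x y y (Z.mem_U y) hy (Z.mem_U y), Z.k_self y y (Z.mem_U y), one_mul]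

/-- The inner product on a fibre for which the frame has squared norm `r`. -/
def fiberInner (r : ℝ) (x : M) : Z.line.Fiber x →L[ℝ] Z.line.Fiber x →L[ℝ] ℝ :=
  r • (ContinuousLinearMap.precomp ℝ (Z.coordL x)).comp
    ((innerSL ℝ : ℂ →L[ℝ] ℂ →L[ℝ] ℝ).comp (Z.coordL x))

theorem fiberInner_apply (r : ℝ) (x : M) (a b : Z.line.Fiber x) :
    Z.fiberInner r x a b = r * inner ℝ (Z.coord x ⟨x, a⟩) (Z.coord x ⟨x, b⟩) := rfl

/-- The hermitian metric with given squared norms of the frames of the cocycle. -/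
def metric (ℓ : M → ℝ) (hpos : ∀ x, 0 < ℓ x)
    (hℓ : ∀ x, ContMDiffAt 𝓘(ℝ, E) 𝓘(ℝ, ℝ) ∞ (fun y ↦ ℓ y * Complex.normSq (Z.k x y y)) x) :
    Z.line.HermitianMetric where
  re :=
    { inner := fun x ↦ Z.fiberInner (ℓ x) x
      symm := fun x a b ↦ by
        rw [Z.fiberInner_apply, Z.fiberInner_apply, real_inner_comm]
      pos := fun x a ha ↦ by
        rw [Z.fiberInner_apply]
        refine mul_pos (hpos x) (real_inner_self_pos.2 fun h0 ↦ ha ?_)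
        exact Z.coord_injective x (Z.mem_U x) (h0.trans (map_zero (Z.coordL x)).symm)
      isVonNBounded := fun x ↦ by
        have h1 : Bornology.IsVonNBounded ℝ {c : ℂ | ℓ x * (inner ℝ c c : ℝ) < 1} := by
          refine (NormedSpace.isVonNBounded_iff ℝ).2 ((isBounded_iff_forall_norm_le).2
            ⟨1 + 1 / ℓ x, fun c hc ↦ ?_⟩)
          have h2 : ℓ x * ‖c‖ ^ 2 < 1 := by
            rw [← real_inner_self_eq_norm_sq]
            exact hc
          have h3 : ‖c‖ ^ 2 < 1 / ℓ x := by
            rw [lt_div_iff₀ (hpos x), mul_comm]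
            exact h2
          -- From `(‖c‖ - 1)² ≥ 0` one gets `2 ‖c‖ ≤ 1 + ‖c‖²`, which explains the bound `1 + 1 / ℓ
          -- x`.
          nlinarith [sq_nonneg (‖c‖ - 1), norm_nonneg c]
        refine (h1.image (Z.vectorL x)).subset ?_
        exact fun a ha ↦ ⟨Z.coord x ⟨x, a⟩, ha, Z.coord_self x a⟩
      contMDiff := by
        refine contMDiff_inner _ fun x u v ↦ ?_
        -- The factor `ℓ y * |k x y y|²` is the squared norm at `y` of the frame indexed by `x`; `ℓ`
        -- alone uses a different frame at each point and need not be smooth.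
        have h1 : ContMDiffAt 𝓘(ℝ, E) 𝓘(ℝ, ℝ) ∞
            (fun y ↦ ℓ y * Complex.normSq (Z.k x y y) * inner ℝ u v) x := (hℓ x).mul contMDiffAt_const
        refine h1.congr_of_eventuallyEq ?_
        filter_upwards [(Z.isOpen_U x).eventually_mem (Z.mem_U x)] with y hy
        rw [trivializationAt_eq, Z.fiberInner_apply, Z.coord_symm hy, Z.coord_symm hy, mul_assoc]
        congr 1
        rw [Complex.inner, Complex.inner, map_mul, mul_mul_mul_comm, Complex.mul_conj, Complex.re_ofReal_mul] }
  invariant x a b := by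
    rw [Z.fiberInner_apply, Z.fiberInner_apply, Z.coord_smul, Z.coord_smul, Complex.inner, Complex.inner, map_mul, mul_mul_mul_comm,
      Complex.mul_conj, Complex.normSq_I, Complex.ofReal_one, one_mul]

theorem metric_apply {ℓ : M → ℝ} (hpos : ∀ x, 0 < ℓ x)
    (hℓ : ∀ x, ContMDiffAt 𝓘(ℝ, E) 𝓘(ℝ, ℝ) ∞ (fun y ↦ ℓ y * Complex.normSq (Z.k x y y)) x)
    (x : M) (a b : Z.line.Fiber x) : (Z.metric ℓ hpos hℓ).re.inner x a b
      = ℓ x * inner ℝ (Z.coord x ⟨x, a⟩) (Z.coord x ⟨x, b⟩) := rfl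

end LineCocycle

variable {L : ComplexLineBundle.{w} E M} (h : L.HermitianMetric)

namespace ComplexLineBundle.HermitianMetric

theorem inner_smul_smul {x : M} (c d : ℂ) (a : L.Fiber x) :
    h.re.inner x (c • a) (d • a) = h.re.inner x a a * inner ℝ c d := by
  have h1 : h.re.inner x a (d • a) = d.re * h.re.inner x a a := by
    rw [h.re.symm, h.inner_smul_self]
  have h2 : h.re.inner x (Complex.I • a) (d • a) = d.im * h.re.inner x a a := by
    rw [h.inner_I_left, h.re.symm, smul_smul, h.inner_smul_self, Complex.I_mul_re, neg_mul, neg_neg]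
  rw [h.inner_smul_left, h1, h2, Complex.inner]
  simp only [Complex.mul_re, Complex.conj_re, Complex.conj_im]
  ring

/-- The squared norm on the total space. -/
def normSq (p : L.Tot) : ℝ := h.re.inner p.1 p.2 p.2

theorem normSq_pos {p : L.Tot} (hp : p.2 ≠ 0) : 0 < h.normSq p := h.re.pos _ _ hp

theorem normSq_smulTot (c : ℂ) (p : L.Tot) :
    h.normSq (smulTot c p) = h.normSq p * Complex.normSq c := by
  refine (h.inner_smul_smul c c p.2).trans ?_
  rw [real_inner_self_eq_norm_sq, Complex.normSq_eq_norm_sq]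
  rfl

theorem contMDiffAt_normSq {u : ∀ x, L.Fiber x} {x : M} (hu : L.SmoothAt u x) :
    ContMDiffAt 𝓘(ℝ, E) 𝓘(ℝ, ℝ) ∞ (fun y ↦ h.normSq (L.sec u y)) x := by
  have h1 := ContMDiffAt.clm_bundle_apply₂ (F₁ := ℂ) (F₂ := ℂ) (F₃ := ℝ)
    (E₃ := fun _ : M ↦ ℝ) (h.re.contMDiff x) hu hu
  exact (contMDiffAt_totalSpace).1 h1 |>.2

end ComplexLineBundle.HermitianMetric

end LineCocycle

/-! ### The descended metric, its compatibility with the connection, and the curvature -/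

section Descent

variable {E : Type*} [NormedAddCommGroup E] [NormedSpace ℝ E] [FiniteDimensional ℝ E]
  {M : Type*} [TopologicalSpace M] [T2Space M] [ChartedSpace E M] [IsManifold 𝓘(ℝ, E) ∞ M]
  {H : AlmostHyperhermitian E M}
  {EG : Type*} [NormedAddCommGroup EG] [NormedSpace ℝ EG]
  {G : Type*} [TopologicalSpace G] [ChartedSpace EG G] [Group G] [LieGroup 𝓘(ℝ, EG) ∞ G]
  [MulAction G M]
  {ν₁ ν₂ ν₃ : M → GroupLieAlgebra 𝓘(ℝ, EG) G →L[ℝ] ℝ}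
  {EN : Type*} [NormedAddCommGroup EN] [NormedSpace ℝ EN] [FiniteDimensional ℝ EN]
  {N : Type*} [TopologicalSpace N] [ChartedSpace EN N] [IsManifold 𝓘(ℝ, EN) ∞ N]
  [MulAction G N]
  {EB : Type*} [NormedAddCommGroup EB] [NormedSpace ℝ EB] [FiniteDimensional ℝ EB]
  {B : Type*} [TopologicalSpace B] [ChartedSpace EB B] [IsManifold 𝓘(ℝ, EB) ∞ B]
  {HB : AlmostHyperhermitian EB B} {ι : N → M} {pr : N → B}
  {L : ComplexLineBundle.{w} E M} {h : L.HermitianMetric} {D : L.Connection}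
  {ρ : Lift 𝓘(ℝ, EG) G h D}

namespace DescentCover

variable (C : DescentCover H ν₁ ν₂ ν₃ HB ρ EN ι pr)

/-- The squared norm of the frame indexed by `b` over the point `b`. -/
def frameNormSq (b : B) : ℝ := h.normSq ((C.F b).f ((C.F b).σ b))

theorem normSq_act (g : G) (p : L.Tot) : h.normSq (ρ.act g p) = h.normSq p :=
  ρ.isometry g p.1 p.2 p.2

/-- The frame is equivariant and the lift isometric, so the norm is constant on orbits. -/
theorem frameNormSq_eq {n : N} : C.frameNormSq (pr n) = h.normSq ((C.F (pr n)).f n) := by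
  have h1 := C.mem (pr n)
  have h2 := (C.F (pr n)).pr_σ _ h1
  obtain ⟨g, hg⟩ := C.hquot.quotient.exists_smul_eq h2
  rw [frameNormSq, ← normSq_act (ρ := ρ) g, ← (C.F (pr n)).f_smul g _ (by rwa [h2])]
  exact congrArg (fun n' ↦ h.normSq ((C.F (pr n)).f n')) hg.symm

theorem contMDiffAt_frameNormSq (x : B) : ContMDiffAt 𝓘(ℝ, EB) 𝓘(ℝ, ℝ) ∞
    (fun y ↦ C.frameNormSq y * Complex.normSq (C.k x y y)) x := by
  have h1 := C.mem x
  have h2 : ContMDiffAt 𝓘(ℝ, EB) 𝓘(ℝ, ℝ) ∞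
      (fun y ↦ h.normSq (L.sec (C.F x).u (ι ((C.F x).σ y)))) x :=
    ContMDiffAt.comp x (g := fun z ↦ h.normSq (L.sec (C.F x).u z))
      (h.contMDiffAt_normSq ((C.F x).smooth_u _)) (C.contMDiffAt_comp_section h1)
  refine h2.congr_of_eventuallyEq ?_
  filter_upwards [(C.F x).isOpen_U.eventually_mem h1] with y hy
  have h3 := (C.F x).pr_σ y hy
  have h4 := C.mem y
  have h5 : pr ((C.F x).σ y) ∈ (C.F x).U := by rwa [h3]
  have h6 : pr ((C.F x).σ y) ∈ (C.F y).U := by rwa [h3]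
  have h7 := C.k_eq h5 h6
  have h8 := C.frameNormSq_eq (n := (C.F x).σ y)
  rw [h3] at h7 h8
  rw [h7, h8, ← h.normSq_smulTot, ratio_smulTot (C.fst_eq h5 h6) ((C.F y).f_ne_zero _ h6),
    (C.F x).f_σ y hy]

/-- The hermitian metric on the quotient. -/
def metric : C.line.HermitianMetric :=
  C.cocycle.metric C.frameNormSq (fun b ↦ h.normSq_pos ((C.F b).f_ne_zero _ (by
    rw [(C.F b).pr_σ b (C.mem b)]; exact C.mem b))) C.contMDiffAt_frameNormSq

theorem metric_q (n : N) (v v' : L.Fiber (ι n)) :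
    C.metric.re.inner (pr n) (C.q n v) (C.q n v') = h.re.inner (ι n) v v' := by
  have h1 := C.mem (pr n)
  have h2 := (C.F (pr n)).f_ne_zero n h1
  have h3 := (C.F (pr n)).f_fst n h1
  refine (C.cocycle.metric_apply _ _ (pr n) _ _).trans ?_
  rw [mk_q, mk_q, C.coord_mapTot h1 rfl, C.coord_mapTot h1 rfl, C.frameNormSq_eq]
  generalize (C.F (pr n)).f n = p at h2 h3
  obtain ⟨x, e⟩ := p
  obtain rfl : x = ι n := h3
  conv_rhs => rw [← ratio_smul h2 v, ← ratio_smul h2 v', h.inner_smul_smul]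
  rfl

theorem metric_of_q {n : N} {v v' : L.Fiber (ι n)} {a a' : C.line.Fiber (pr n)} (h1 : C.q n v = a)
    (h2 : C.q n v' = a') : C.metric.re.inner (pr n) a a' = h.re.inner (ι n) v v' := by
  rw [← h1, ← h2, C.metric_q]

/-- Both sections are lifted to `L`. Their inner product on `M` restricts to `N` as the pullback of
the one on `B`, so the compatibility on `M` projects. -/
theorem connection_isCompatible (hD : D.IsCompatible h 0) : C.connection.IsCompatible C.metric 0 := by
  intro r r' b hr hr' w
  obtain ⟨n, rfl⟩ := C.hquot.quotient.surjective b
  obtain ⟨v, rfl⟩ := C.hquot.exists_mfderiv_pr n w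
  obtain ⟨s, hs, h1⟩ := C.exists_lift hr
  obtain ⟨s', hs', h1'⟩ := C.exists_lift hr'
  have h2 := hD s s' (ι n) hs hs' (mfderiv 𝓘(ℝ, EN) 𝓘(ℝ, E) ι n v)
  simp only [Pi.zero_apply, mul_zero, Real.exp_zero, one_mul] at h2 ⊢
  rw [← C.q_cov hs hr h1, ← C.q_cov hs' hr' h1', C.metric_of_q rfl h1'.self_of_nhds,
    C.metric_of_q h1.self_of_nhds rfl, ← h2]
  refine (mvfderiv_eq_of_comp (C.hquot.mdifferentiableAt_ι n) (C.hquot.mdifferentiableAt_pr n)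
    (h.mdifferentiableAt_inner hs hs') (C.metric.mdifferentiableAt_inner hr hr') ?_ v).symm
  filter_upwards [h1, h1'] with n' h3 h4 using (C.metric_of_q h3 h4).symm

/-- A section whose coordinate is constantly `1` near `y` has no derivative term; only the frame
form is left. -/
theorem connection_form_eq {r : ∀ b, C.line.Fiber b} (hr : SmoothSec r) {b y : B}
    (hy : y ∈ (C.F b).U) (h1 : ∀ᶠ z in 𝓝 y, C.cocycle.coord b (C.line.sec r z) = 1) :
    C.connection.form r y = (C.F b).form y := by
  have h2 : C.cocycle.coord b (C.line.sec r y) = 1 := h1.self_of_nhds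
  have h0 : r y ≠ 0 := fun h0 ↦ by
    have h3 := C.cocycle.coord_smul b (0 : ℂ) (r y)
    rw [zero_smul, zero_mul, ← h0] at h3
    exact one_ne_zero (h2.symm.trans h3)
  refine ContinuousLinearMap.ext fun u ↦ ?_
  have h4 : (mvfderiv 𝓘(ℝ, EB) (fun z ↦ C.cocycle.coord b (C.line.sec r z)) y u : ℂ) = 0 := by
    have h5 : HasMFDerivAt 𝓘(ℝ, EB) 𝓘(ℝ, ℂ) (fun z ↦ C.cocycle.coord b (C.line.sec r z)) y 0 :=
      (hasMFDerivAt_const (1 : ℂ) y).congr_of_eventuallyEq h1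
    exact congrArg (fun A : EB →L[ℝ] ℂ ↦ A u) h5.mfderiv
  rw [Connection.form_apply]
  refine (ratio_eq_triv (C.cocycle.triv b) (p := ⟨y, C.connection.cov r y u⟩) (q := ⟨y, r y⟩)
    hy rfl h0).trans ?_
  refine (congrArg₂ (· / ·) (C.coord_covAt (hr y).diffAt hy u) h2).trans ?_
  rw [h4, h2, zero_add, one_mul, div_one]

/-- The connection form on `B` is the pullback by `ι ∘ σ` of a connection form on `M`. Exterior
differentiation commutes with pullback, and `pr ∘ σ = id` turns the pullback of `ω₁` into the form
of `B`. -/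
theorem connection_hasCurvature [T2Space B] (hD : D.HasCurvature H.ω₁) : C.connection.HasCurvature HB.ω₁ := by
  refine C.connection.hasCurvature_of_extD_form fun b ↦ ?_
  obtain ⟨r, hr, h1⟩ := C.cocycle.exists_smoothSec_coord b
  have hb := C.mem b
  have h2 : C.cocycle.coord b (C.line.sec r b) = 1 := h1.self_of_nhds
  have h0 : r b ≠ 0 := fun h0 ↦ by
    have h3 := C.cocycle.coord_smul b (0 : ℂ) (r b)
    rw [zero_smul, zero_mul, ← h0] at h3
    exact one_ne_zero (h2.symm.trans h3)
  refine ⟨r, hr, h0, fun v v' ↦ ?_⟩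
  have hU := (C.F b).isOpen_U.eventually_mem hb
  have h3 : ∀ᶠ y in 𝓝 b, C.connection.form r y = (C.F b).form y := by
    filter_upwards [hU, h1.eventually_nhds] with y hy h4 using C.connection_form_eq hr hy h4
  have h4 := extD_pullback (C.contMDiffAt_comp_section hb)
    (Connection.smoothOneAt_form D (C.F b).smooth_u ((C.F b).u_ne_zero hb))
    (hU.mono fun y hy u ↦ C.form_eq hy u) v v'
  rw [extD_congr h3, h4, D.extD_form hD (C.F b).smooth_u ((C.F b).u_ne_zero hb)]
  congr 2
  have hσ := (C.F b).smooth_σ b hb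
  let σ' : EB →L[ℝ] EN := mfderiv 𝓘(ℝ, EB) 𝓘(ℝ, EN) (C.F b).σ b
  let A : EB →L[ℝ] E := mfderiv 𝓘(ℝ, EB) 𝓘(ℝ, E) (fun b' ↦ ι ((C.F b).σ b')) b
  let A' : EN →L[ℝ] E := mfderiv 𝓘(ℝ, EN) 𝓘(ℝ, E) ι ((C.F b).σ b)
  have h5 : ∀ w, A w = A' (σ' w) := fun w ↦ congrArg (fun A : EB →L[ℝ] E ↦ A w)
    (mfderiv_comp b (g := ι) (C.hquot.mdifferentiableAt_ι _) (hσ.mdifferentiableAt (by simp)))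
  have h6 := C.hquot.form₁ ((C.F b).σ b) (σ' v) (σ' v')
  have h7 := fun w ↦ C.hquot.quotient.mfderiv_section hσ (hU.mono (C.F b).pr_σ) w
  refine (congrArg₂ (fun w w' : E ↦ H.ω₁ (ι ((C.F b).σ b)) w w') (h5 v) (h5 v')).trans ?_
  refine h6.symm.trans ?_
  refine (congrArg₂ (fun w w' : EB ↦ HB.ω₁ (pr ((C.F b).σ b)) w w') (h7 v) (h7 v')).trans ?_
  exact form_congr_point HB.ω₁ ((C.F b).pr_σ b hb) v v'

end DescentCover

end Descent

/-! ### The descended circle action -/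

section Descent

variable {E : Type*} [NormedAddCommGroup E] [NormedSpace ℝ E] [FiniteDimensional ℝ E]
  {M : Type*} [TopologicalSpace M] [T2Space M] [ChartedSpace E M] [IsManifold 𝓘(ℝ, E) ∞ M]
  {H : AlmostHyperhermitian E M}
  {EG : Type*} [NormedAddCommGroup EG] [NormedSpace ℝ EG]
  {G : Type*} [TopologicalSpace G] [ChartedSpace EG G] [Group G] [LieGroup 𝓘(ℝ, EG) ∞ G]
  [MulAction G M]
  {ν₁ ν₂ ν₃ : M → GroupLieAlgebra 𝓘(ℝ, EG) G →L[ℝ] ℝ}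
  {EN : Type*} [NormedAddCommGroup EN] [NormedSpace ℝ EN] [FiniteDimensional ℝ EN]
  {N : Type*} [TopologicalSpace N] [ChartedSpace EN N] [IsManifold 𝓘(ℝ, EN) ∞ N]
  [MulAction G N]
  {EB : Type*} [NormedAddCommGroup EB] [NormedSpace ℝ EB] [FiniteDimensional ℝ EB]
  {B : Type*} [TopologicalSpace B] [ChartedSpace EB B] [IsManifold 𝓘(ℝ, EB) ∞ B]
  {HB : AlmostHyperhermitian EB B} {ι : N → M} {pr : N → B}
  {L : ComplexLineBundle.{w} E M} {h : L.HermitianMetric} {D : L.Connection}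
  {ρ : Lift 𝓘(ℝ, EG) G h D}

namespace DescentCover

theorem mapTot_injective (C : DescentCover H ν₁ ν₂ ν₃ HB ρ EN ι pr) {n : N} {p p' : L.Tot}
    (hp : p.1 = ι n) (hp' : p'.1 = ι n) (h : C.mapTot n p = C.mapTot n p') : p = p' := by
  obtain ⟨x, v⟩ := p
  obtain ⟨x', v'⟩ := p'
  obtain rfl : x = ι n := hp
  obtain rfl : x' = ι n := hp'
  rw [(C.q n).injective (mk_inj.1 h)]

theorem normSq_mapTot (C : DescentCover H ν₁ ν₂ ν₃ HB ρ EN ι pr) {n : N} {p : L.Tot}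
    (hp : p.1 = ι n) : C.metric.normSq (C.mapTot n p) = h.normSq p := by
  obtain ⟨x, v⟩ := p
  obtain rfl : x = ι n := hp
  exact C.metric_q n v v

theorem eq_mapTot_section (C : DescentCover H ν₁ ν₂ ν₃ HB ρ EN ι pr) {i : B} {P : C.line.Tot}
    (hi : P.1 ∈ (C.F i).U) :
    C.mapTot ((C.F i).σ P.1) (smulTot (C.cocycle.coord i P) ((C.F i).f ((C.F i).σ P.1))) = P := by
  have h1 := (C.F i).pr_σ _ hi
  have h2 : pr ((C.F i).σ P.1) ∈ (C.F i).U := by rwa [h1]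
  refine C.cocycle.tot_ext i h1 h2 ?_
  rw [C.coord_mapTot h2 (p := smulTot _ _) ((C.F i).f_fst _ h2), ratio_smulTot_self ((C.F i).f_ne_zero _ h2)]

variable [MulAction Circle M] [MulAction Circle N] [MulAction Circle B] [SMulCommClass G Circle M]
  (C : DescentCover H ν₁ ν₂ ν₃ HB ρ EN ι pr) (hC : IsCircleQuotient EN EB ι pr)
  (Λ : Lift (𝓡 1) Circle h D)
  (hcomm : ∀ (g : G) (t : Circle) (p : L.Tot), ρ.act g (Λ.act t p) = Λ.act t (ρ.act g p))

/-- The factor by which the lifted circle action multiplies the frames. -/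
def circleFactor (t : Circle) (b : B) : ℂ :=
  L.ratio (Λ.act t ((C.F b).f (Function.surjInv C.hquot.quotient.surjective b)))
    ((C.F (t • b)).f (t • Function.surjInv C.hquot.quotient.surjective b))

include hC in
theorem mem_smul (t : Circle) (n : N) : pr (t • n) ∈ (C.F (t • pr n)).U := by
  rw [hC.pr_smul]
  exact C.mem _

include hC in
theorem _root_.HyperKahler.IsCircleQuotient.lift_act_fst (t : Circle) {n : N} {p : L.Tot} (hp : p.1 = ι n) : (Λ.act t p).1 = ι (t • n) := by
  rw [Λ.act_fst, hp, hC.ι_smul]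

include hC hcomm in
-- The factor does not depend on the point of the orbit, because the frames are `G`-equivariant and
-- the two lifted actions commute.
theorem circleFactor_eq (t : Circle) (n : N) : C.circleFactor Λ t (pr n)
    = L.ratio (Λ.act t ((C.F (pr n)).f n)) ((C.F (t • pr n)).f (t • n)) := by
  have h1 := Function.surjInv_eq C.hquot.quotient.surjective (pr n)
  have hm := C.mem_smul hC t (Function.surjInv C.hquot.quotient.surjective (pr n))
  have hm' : pr (Function.surjInv C.hquot.quotient.surjective (pr n)) ∈ (C.F (pr n)).U := by
    rw [h1]
    exact C.mem _
  rw [circleFactor]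
  generalize Function.surjInv C.hquot.quotient.surjective (pr n) = m at h1 hm hm'
  obtain ⟨g, hg⟩ := C.hquot.quotient.exists_smul_eq h1
  rw [h1] at hm
  have h2 : t • g • m = g • t • m := C.hquot.embedding.isEmbedding.injective <| by
    rw [hC.ι_smul, C.hquot.equivariant, C.hquot.equivariant, hC.ι_smul, smul_comm g t]
  have h3 : (C.F (t • pr n)).f (t • n) = ρ.act g ((C.F (t • pr n)).f (t • m)) := by
    rw [← (C.F (t • pr n)).f_smul g _ hm, ← h2]
    exact congrArg (fun n' ↦ (C.F (t • pr n)).f (t • n')) hg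
  have h4 : (C.F (pr n)).f n = ρ.act g ((C.F (pr n)).f m) := by
    rw [← (C.F (pr n)).f_smul g _ hm']
    exact congrArg (C.F (pr n)).f hg
  rw [h3, h4, ← hcomm, ρ.ratio_act g _ ((C.F (t • pr n)).f_ne_zero _ hm)]
  rw [hC.lift_act_fst Λ t ((C.F _).f_fst _ hm'), (C.F _).f_fst _ hm]

/-- The lifted circle action, as a map of the fibres of the line bundle on the quotient. -/
def circleMap (t : Circle) (b : B) : C.line.Fiber b →ₗ[ℂ] C.line.Fiber (t • b) where
  toFun v := C.cocycle.vector (t • b) (C.circleFactor Λ t b * C.cocycle.coord b ⟨b, v⟩)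
  map_add' v v' := by rw [C.cocycle.coord_add', mul_add, C.cocycle.vector_add]
  map_smul' c v := by
    rw [C.cocycle.coord_smul, mul_left_comm, C.cocycle.vector_smul, RingHom.id_apply]

/-- The lifted circle action on the total space of the line bundle on the quotient. -/
def circleAct (t : Circle) (P : C.line.Tot) : C.line.Tot := ⟨t • P.1, C.circleMap Λ t P.1 P.2⟩

include hC hcomm in
-- This characterizes the action on the quotient bundle: all its properties follow from those of `Λ`
-- because `mapTot` reaches every point.
theorem circleAct_mapTot (t : Circle) {n : N} {p : L.Tot} (hp : p.1 = ι n) :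
    C.circleAct Λ t (C.mapTot n p) = C.mapTot (t • n) (Λ.act t p) := by
  have hm := C.mem_smul hC t n
  have h1 : (C.mapTot n p).1 = pr n := rfl
  refine C.cocycle.tot_ext (t • pr n) (hC.pr_smul t n).symm (C.mem _) ?_
  rw [C.coord_mapTot hm (hC.lift_act_fst Λ t hp)]
  refine (C.cocycle.coord_vector_self (t • pr n) _).trans ?_
  refine (congrArg₂ (· * ·) (C.circleFactor_eq hC Λ hcomm t n)
    (C.coord_mapTot (C.mem (pr n)) hp)).trans ?_
  have h2 := (C.F (pr n)).f_fst n (C.mem _)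
  have h3 := (C.F (pr n)).f_ne_zero n (C.mem _)
  have h4 : p.1 = ((C.F (pr n)).f n).1 := hp.trans h2.symm
  change _ * _ = _
  rw [mul_comm, ← Λ.ratio_act t h4 h3]
  refine ratio_mul (congrArg (t • ·) h4) ?_ (Λ.act_ne_zero t h3) ((C.F _).f_ne_zero _ hm)
  rw [hC.lift_act_fst Λ t h2, (C.F _).f_fst _ hm]

include hC hcomm in
theorem normSq_circleAct (t : Circle) (P : C.line.Tot) :
    C.metric.normSq (C.circleAct Λ t P) = C.metric.normSq P := by
  obtain ⟨n, hn⟩ := C.hquot.quotient.surjective P.1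
  obtain ⟨p, hp, rfl⟩ := C.exists_mapTot_eq hn.symm
  rw [C.circleAct_mapTot hC Λ hcomm t hp, C.normSq_mapTot hp,
    C.normSq_mapTot (hC.lift_act_fst Λ t hp)]
  exact Λ.isometry t p.1 p.2 p.2

/-- Polarization. It reduces the isometry property of the fibre maps to preservation of the norm on
the total space. -/
theorem inner_eq_normSq (b : B) (v v' : C.line.Fiber b) : C.metric.re.inner b v v'
    = (C.metric.normSq ⟨b, v + v'⟩ - C.metric.normSq ⟨b, v⟩ - C.metric.normSq ⟨b, v'⟩) / 2 := by
  simp only [HermitianMetric.normSq, map_add, add_apply]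
  rw [C.metric.re.symm b v' v]
  ring

include hC hcomm in
-- Near `P` write a point as its coordinate times the frame over the slice, act by `Λ` in `L` and
-- project back; each of these maps is smooth.
theorem contMDiff_circleAct : ContMDiff ((𝓡 1).prod (𝓘(ℝ, EB).prod 𝓘(ℝ, ℂ)))
    (𝓘(ℝ, EB).prod 𝓘(ℝ, ℂ)) ∞ (fun p : Circle × C.line.Tot ↦ C.circleAct Λ p.1 p.2) := by
  rintro ⟨t, P⟩
  have := hC.smooth_N
  have hb := C.mem P.1
  have hb' := (C.F P.1).pr_σ _ hb
  have hP : ContMDiffAt ((𝓡 1).prod (𝓘(ℝ, EB).prod 𝓘(ℝ, ℂ))) (𝓘(ℝ, EB).prod 𝓘(ℝ, ℂ)) ∞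
      (fun p : Circle × C.line.Tot ↦ p.2) (t, P) := contMDiffAt_snd
  have h1 := (C.cocycle.contMDiffAt_iff (f := fun p : Circle × C.line.Tot ↦ p.2) (x := (t, P))
    P.1 hb).1 hP
  have hσ : ContMDiffAt ((𝓡 1).prod (𝓘(ℝ, EB).prod 𝓘(ℝ, ℂ))) 𝓘(ℝ, EN) ∞
      (fun p : Circle × C.line.Tot ↦ (C.F P.1).σ p.2.1) (t, P) :=
    ContMDiffAt.comp (t, P) (g := (C.F P.1).σ) ((C.F P.1).smooth_σ _ hb) h1.1
  have hU : ∀ᶠ p : Circle × C.line.Tot in 𝓝 (t, P), p.2.1 ∈ (C.F P.1).U :=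
    h1.1.continuousAt.eventually ((C.F P.1).isOpen_U.eventually_mem hb)
  have hf : ContMDiffAt ((𝓡 1).prod (𝓘(ℝ, EB).prod 𝓘(ℝ, ℂ))) (𝓘(ℝ, E).prod 𝓘(ℝ, ℂ)) ∞
      (fun p : Circle × C.line.Tot ↦ (C.F P.1).f ((C.F P.1).σ p.2.1)) (t, P) :=
    ContMDiffAt.comp (t, P) (g := (C.F P.1).f) ((C.F P.1).smooth_f _ (by rwa [hb'])) hσ
  have h2 := Λ.contMDiffAt_act (k := fun p : Circle × C.line.Tot ↦ p.1) contMDiffAt_fst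
    (h1.2.lineSmul hf)
  have h3 : ContMDiffAt ((𝓡 1).prod (𝓘(ℝ, EB).prod 𝓘(ℝ, ℂ))) 𝓘(ℝ, EN) ∞
      (fun p : Circle × C.line.Tot ↦ p.1 • (C.F P.1).σ p.2.1) (t, P) :=
    ContMDiffAt.smul (n := ∞) (I := 𝓡 1) contMDiffAt_fst hσ
  have h4 : ∀ p : Circle × C.line.Tot, p.2.1 ∈ (C.F P.1).U →
      (smulTot (C.cocycle.coord P.1 p.2) ((C.F P.1).f ((C.F P.1).σ p.2.1))).1
        = ι ((C.F P.1).σ p.2.1) := fun p hp ↦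
    (C.F P.1).f_fst _ (by rwa [(C.F P.1).pr_σ _ hp])
  refine ((C.contMDiffAt_mapTot_iff h3 (hU.mono fun p hp ↦
    hC.lift_act_fst Λ p.1 (h4 p hp))).2 h2).congr_of_eventuallyEq ?_
  filter_upwards [hU] with p hp
  rw [← C.circleAct_mapTot hC Λ hcomm p.1 (h4 p hp), C.eq_mapTot_section hp]

include hC hcomm in
-- If `s` lifts `r` near `n`, then `s` transported by `t` lifts `r'` near `t • n`; parallelism of
-- `Λ` projects to the quotient.
theorem connection_circleMap (hT : ContMDiffSMul (𝓡 1) 𝓘(ℝ, E) ∞ Circle M) (t : Circle)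
    {r r' : ∀ b, C.line.Fiber b}
    (hrr' : ∀ b, r' (t • b) = C.circleMap Λ t b (r b)) {b : B} (hr : C.line.DiffAt r b)
    (w : TangentSpace 𝓘(ℝ, EB) b) :
    C.connection.cov r' (t • b) (dAct t b w) = C.circleMap Λ t b (C.connection.cov r b w) := by
  obtain ⟨n, rfl⟩ := C.hquot.quotient.surjective b
  obtain ⟨v, rfl⟩ := C.hquot.exists_mfderiv_pr n w
  obtain ⟨s, hs, h1⟩ := C.exists_lift hr
  have hsec : ∀ y, C.line.sec r' y = C.circleAct Λ t (C.line.sec r (t⁻¹ • y)) := by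
    intro y
    have h2 : C.line.sec r' (t • t⁻¹ • y) = C.circleAct Λ t (C.line.sec r (t⁻¹ • y)) :=
      mk_inj.2 (hrr' (t⁻¹ • y))
    rwa [smul_inv_smul] at h2
  have hr' : C.line.DiffAt r' (t • pr n) := by
    have h2 : MDifferentiableAt 𝓘(ℝ, EB) (𝓘(ℝ, EB).prod 𝓘(ℝ, ℂ)) (fun y ↦ C.line.sec r (t⁻¹ • y))
        (t • pr n) := by
      refine MDifferentiableAt.comp (t • pr n) (g := C.line.sec r) ?_
        (mdifferentiableAt_smul_right (𝓡 1) hC.smooth_B t⁻¹ (t • pr n))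
      rw [inv_smul_smul]
      exact hr
    exact (MDifferentiableAt.comp (t • pr n)
      (g := fun p : Circle × C.line.Tot ↦ C.circleAct Λ p.1 p.2)
      ((C.contMDiff_circleAct hC Λ hcomm _).mdifferentiableAt (by simp))
      (mdifferentiableAt_const (c := t) |>.prodMk h2)).congr_of_eventuallyEq (.of_forall hsec)
  have hs' : L.DiffAt (Λ.push t s) (ι (t • n)) := by
    rw [hC.ι_smul]
    exact Λ.diffAt_push hT t hs
  have h2 : ∀ᶠ n' in 𝓝 (t • n), C.q n' (Λ.push t s (ι n')) = r' (pr n') := by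
    have h3 : Filter.Tendsto (fun n' : N ↦ t⁻¹ • n') (𝓝 (t • n)) (𝓝 n) := by
      have h4 := (mdifferentiableAt_smul_right (E := EN) (𝓡 1) hC.smooth_N t⁻¹ (t • n)).continuousAt
      rwa [ContinuousAt, inv_smul_smul] at h4
    filter_upwards [h3.eventually h1] with n' hn'
    refine (C.q_eq_iff n' _ r').2 ?_
    have h5 := (C.q_eq_iff _ _ r).1 hn'
    have h6 : (⟨ι n', Λ.push t s (ι n')⟩ : L.Tot) = Λ.act t (L.sec s (ι (t⁻¹ • n'))) := by
      rw [hC.ι_smul]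
      exact Λ.sec_push t s (ι n')
    rw [h6, hsec, ← hC.pr_smul, ← h5, C.circleAct_mapTot hC Λ hcomm t rfl, smul_inv_smul]
    rfl
  have hr'' : C.line.DiffAt r' (pr (t • n)) := by rwa [hC.pr_smul]
  have h3 := C.q_cov hs' hr'' h2 (dAct t n v)
  refine (mk_inj (x := t • pr n)).1 ?_
  have h4 : vec _ = vec _ := mfderiv_dAct (E := EB) (C.hquot.mdifferentiableAt_pr n)
    (C.hquot.mdifferentiableAt_pr (t • n))
    (mdifferentiableAt_smul_right (𝓡 1) hC.smooth_N t n)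
    (mdifferentiableAt_smul_right (𝓡 1) hC.smooth_B t (pr n)) (hC.pr_smul t) v
  have h5 : vec _ = vec _ := mfderiv_dAct (E := E) (C.hquot.mdifferentiableAt_ι n)
    (C.hquot.mdifferentiableAt_ι (t • n))
    (mdifferentiableAt_smul_right (𝓡 1) hC.smooth_N t n)
    (mdifferentiableAt_smul_right (𝓡 1) hT t (ι n)) (hC.ι_smul t) v
  refine (C.connection.cov_congr_point r' (hC.pr_smul t n).symm h4.symm).trans ?_
  refine (mk_inj.2 h3.symm).trans ?_
  refine (congrArg (C.mapTot (t • n)) (D.cov_congr_point (Λ.push t s) (hC.ι_smul t n) h5)).trans ?_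
  refine (congrArg (C.mapTot (t • n)) (mk_inj.2 (Λ.cov_push t hs _))).trans ?_
  refine (C.circleAct_mapTot hC Λ hcomm t (n := n)
    (p := ⟨ι n, D.cov s (ι n) (mfderiv 𝓘(ℝ, EN) 𝓘(ℝ, E) ι n v)⟩) rfl).symm.trans ?_
  exact congrArg (fun a ↦ C.circleAct Λ t ⟨pr n, a⟩) (C.q_cov hs hr h1 v)

/-- The descended lift of the circle action. -/
def circleLift (hT : ContMDiffSMul (𝓡 1) 𝓘(ℝ, E) ∞ Circle M) :
    Lift (𝓡 1) Circle C.metric C.connection where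
  map := C.circleMap Λ
  map_one b v := by
    obtain ⟨n, rfl⟩ := C.hquot.quotient.surjective b
    obtain ⟨p, hp, h1⟩ := C.exists_mapTot_eq (n := n) (P := ⟨pr n, v⟩) rfl
    change C.circleAct Λ 1 ⟨pr n, v⟩ = _
    rw [← h1, C.circleAct_mapTot hC Λ hcomm 1 hp, one_smul, Λ.act_one]
  map_mul t t' b v := by
    obtain ⟨n, rfl⟩ := C.hquot.quotient.surjective b
    obtain ⟨p, hp, h1⟩ := C.exists_mapTot_eq (n := n) (P := ⟨pr n, v⟩) rfl
    change C.circleAct Λ (t * t') ⟨pr n, v⟩ = C.circleAct Λ t (C.circleAct Λ t' ⟨pr n, v⟩)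
    rw [← h1, C.circleAct_mapTot hC Λ hcomm _ hp, C.circleAct_mapTot hC Λ hcomm _ hp,
      C.circleAct_mapTot hC Λ hcomm _ (hC.lift_act_fst Λ t' hp), mul_smul, Λ.act_mul]
  smooth := C.contMDiff_circleAct hC Λ hcomm
  isometry t b v v' := by
    rw [C.inner_eq_normSq, C.inner_eq_normSq, ← map_add]
    have h1 := fun v ↦ C.normSq_circleAct hC Λ hcomm t ⟨b, v⟩
    exact congrArg (· / 2) (congrArg₂ (· - ·) (congrArg₂ (· - ·) (h1 (v + v')) (h1 v)) (h1 v'))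
  parallel t r r' hr _ hd w := C.connection_circleMap hC Λ hcomm hT t hr hd w

theorem circleLift_act (hT : ContMDiffSMul (𝓡 1) 𝓘(ℝ, E) ∞ Circle M) (t : Circle) {n : N}
    {p : L.Tot} (hp : p.1 = ι n) :
    (C.circleLift hC Λ hcomm hT).act t (C.mapTot n p) = C.mapTot (t • n) (Λ.act t p) :=
  C.circleAct_mapTot hC Λ hcomm t hp

theorem circleLift_isMomentFunction (hT : ContMDiffSMul (𝓡 1) 𝓘(ℝ, E) ∞ Circle M)
    {μ : M → ℝ} {μB : B → ℝ} (hμB : ∀ n, μB (pr n) = μ (ι n))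
    (hμ : Λ.IsMomentFunction circleGen μ) :
    (C.circleLift hC Λ hcomm hT).IsMomentFunction circleGen μB := by
  intro b r c hr h0 hc
  obtain ⟨n, rfl⟩ := C.hquot.quotient.surjective b
  obtain ⟨s, hs, h1⟩ := C.exists_lift hr
  have h2 := h1.self_of_nhds
  have h0' : s (ι n) ≠ 0 := fun h3 ↦ h0 (by rw [← h2, h3, map_zero])
  let c' : Circle → ℂ := fun t ↦ L.ratio (L.sec s (t • ι n)) (Λ.act t (L.sec s (ι n)))
  have h3 := hμ (ι n) s c' hs h0' fun t ↦ (ratio_smul (Λ.map_ne_zero t h0') _).symm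
  -- The lift `s` corresponds to `r` only near `n`, so the functions `c` and `c'` agree only near
  -- `1`, which suffices for their derivatives.
  have h4 : c' =ᶠ[𝓝 1] c := by
    have h5 : Filter.Tendsto (fun t : Circle ↦ t • n) (𝓝 1) (𝓝 n) := by
      have h6 := (mdifferentiableAt_smul_left (E := EN) (𝓡 1) hC.smooth_N (1 : Circle) n).continuousAt
      rwa [ContinuousAt, one_smul] at h6
    filter_upwards [h5.eventually h1] with t ht
    have h6 := (C.q_eq_iff _ _ r).1 ht
    have h7 : C.line.sec r (t • pr n)
        = smulTot (c t) ((C.circleLift hC Λ hcomm hT).act t (C.line.sec r (pr n))) :=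
      mk_inj.2 (hc t)
    have h9 : (Λ.act t ⟨ι n, s (ι n)⟩).1 = ι (t • n) :=
      hC.lift_act_fst Λ t rfl
    rw [hC.pr_smul, h7, ← (C.q_eq_iff n _ r).1 h2, C.circleLift_act hC Λ hcomm hT t (p := ⟨ι n, s (ι n)⟩) rfl,
      ← C.mapTot_smulTot _ _ h9] at h6
    have h10 := C.mapTot_injective rfl (p' := smulTot (c t) (Λ.act t ⟨ι n, s (ι n)⟩)) h9 h6
    change L.ratio (L.sec s (t • ι n)) _ = _
    rw [← hC.ι_smul]
    exact (congrArg (fun p ↦ L.ratio p _) h10).trans (ratio_smulTot_self (Λ.act_ne_zero t h0') _)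
  have h5 : derivOne (𝓡 1) Circle c' circleGen = derivOne (𝓡 1) Circle c circleGen := by
    rw [derivOne, derivOne, h4.mfderiv_eq]
    rfl
  rw [h5, ← hC.mfderiv_ι_circleField C.hquot] at h3
  have h6 := congrArg (C.q n) h3
  rw [map_smul, map_add, map_smul, C.q_cov hs hr h1, h2, hC.mfderiv_pr_circleField C.hquot] at h6
  rw [hμB]
  exact h6

end DescentCover

end Descent

/-! ### The descended hyperholomorphic line bundle -/

section Descent

variable {E : Type*} [NormedAddCommGroup E] [NormedSpace ℝ E] [FiniteDimensional ℝ E]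
  {M : Type*} [TopologicalSpace M] [T2Space M] [ChartedSpace E M] [IsManifold 𝓘(ℝ, E) ∞ M]
  {H : AlmostHyperhermitian E M}
  {EG : Type*} [NormedAddCommGroup EG] [NormedSpace ℝ EG]
  {G : Type*} [TopologicalSpace G] [ChartedSpace EG G] [Group G] [LieGroup 𝓘(ℝ, EG) ∞ G]
  [MulAction G M]
  {ν₁ ν₂ ν₃ : M → GroupLieAlgebra 𝓘(ℝ, EG) G →L[ℝ] ℝ}
  {EN : Type*} [NormedAddCommGroup EN] [NormedSpace ℝ EN] [FiniteDimensional ℝ EN]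
  {N : Type*} [TopologicalSpace N] [ChartedSpace EN N] [IsManifold 𝓘(ℝ, EN) ∞ N]
  [MulAction G N]
  {EB : Type*} [NormedAddCommGroup EB] [NormedSpace ℝ EB] [FiniteDimensional ℝ EB]
  {B : Type*} [TopologicalSpace B] [ChartedSpace EB B] [IsManifold 𝓘(ℝ, EB) ∞ B]
  {HB : AlmostHyperhermitian EB B} {ι : N → M} {pr : N → B}
  [MulAction Circle M] [MulAction Circle N] [MulAction Circle B] [SMulCommClass G Circle M]
  [T2Space B] {Q : HyperholomorphicLineBundle.{w} H} {ρ : Lift 𝓘(ℝ, EG) G Q.h Q.nabla}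

namespace DescentCover

variable (C : DescentCover H ν₁ ν₂ ν₃ HB ρ EN ι pr) (hC : IsCircleQuotient EN EB ι pr)
  (hT : ContMDiffSMul (𝓡 1) 𝓘(ℝ, E) ∞ Circle M)
  (hcomm : ∀ (g : G) (t : Circle) (p : Q.L.Tot), ρ.act g (Q.lift.act t p) = Q.lift.act t (ρ.act g p))
  {μB : B → ℝ} (hμB : ∀ n, μB (pr n) = Q.μ (ι n))

/-- The hyperholomorphic line bundle on the quotient. -/
def bundle : HyperholomorphicLineBundle.{0} HB where
  L := C.line
  h := C.metric
  nabla := C.connection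
  unitary := C.connection_isCompatible Q.unitary
  curvature := C.connection_hasCurvature Q.curvature
  lift := C.circleLift hC Q.lift hcomm hT
  μ := μB
  smooth_μ := IsCircleQuotient.smooth_moment C.hquot Q.smooth_μ hμB
  moment_μ := hC.moment C.hquot Q.smooth_μ hμB Q.moment_μ
  lift_μ := C.circleLift_isMomentFunction hC Q.lift hcomm hT hμB Q.lift_μ
  hyp := C.connection.addForm (hypOne HB μB)
    (smoothOneAt_hypOne HB (IsCircleQuotient.smooth_moment C.hquot Q.smooth_μ hμB))
  hyp_compatible := addForm_hypOne_isCompatible HB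
    (IsCircleQuotient.smooth_moment C.hquot Q.smooth_μ hμB) (C.connection_isCompatible Q.unitary) _
  hyp_dbar := addForm_hypOne_sameDbar HB _

include C hC in
-- The real part `dμ` agrees on all vectors tangent to `N`; the imaginary part `dμ ∘ I` is compared
-- on horizontal vectors.
theorem hypOne_of_horizontal (n : N) (v : TangentSpace 𝓘(ℝ, EN) n)
    (hv : IsHorizontal (EG := EG) G H ι n v) (hμB : ∀ n, μB (pr n) = Q.μ (ι n)) :
    hypOne HB μB (pr n) (mfderiv 𝓘(ℝ, EN) 𝓘(ℝ, EB) pr n v)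
      = hypOne H Q.μ (ι n) (mfderiv 𝓘(ℝ, EN) 𝓘(ℝ, E) ι n v) := by
  have h1 := IsCircleQuotient.dfun_moment C.hquot Q.smooth_μ hμB n v
  have h2 := hC.dI_of_horizontal C.hquot Q.smooth_μ hμB Q.moment_μ n v hv
  rw [AlmostHyperhermitian.dI_apply, AlmostHyperhermitian.dI_apply] at h2
  rw [hypOne_apply, hypOne_apply, h1, h2]

include hC in
theorem q_hyp_cov (hμB : ∀ n, μB (pr n) = Q.μ (ι n)) {s : ∀ x, Q.L.Fiber x}
    {r : ∀ b, C.line.Fiber b} {n : N} (hs : Q.L.DiffAt s (ι n)) (hr : C.line.DiffAt r (pr n))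
    (h : ∀ᶠ n' in 𝓝 n, C.q n' (s (ι n')) = r (pr n')) (v : TangentSpace 𝓘(ℝ, EN) n)
    (hv : IsHorizontal (EG := EG) G H ι n v) :
    C.q n (Q.hyp.cov s (ι n) (mfderiv 𝓘(ℝ, EN) 𝓘(ℝ, E) ι n v))
      = C.connection.cov r (pr n) (mfderiv 𝓘(ℝ, EN) 𝓘(ℝ, EB) pr n v)
        + hypOne HB μB (pr n) (mfderiv 𝓘(ℝ, EN) 𝓘(ℝ, EB) pr n v) • r (pr n) := by
  rw [cov_eq_add_hypOne H Q.smooth_μ Q.unitary Q.hyp_compatible Q.hyp_dbar hs, map_add, map_smul,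
    C.q_cov hs hr h, h.self_of_nhds, ← C.hypOne_of_horizontal hC n v hv hμB]

theorem contMDiffAt_symm {r : ∀ b, C.line.Fiber b} {n : N} (hr : C.line.SmoothAt r (pr n)) :
    ContMDiffAt 𝓘(ℝ, EN) (𝓘(ℝ, E).prod 𝓘(ℝ, ℂ)) ∞
      (fun n' ↦ (⟨ι n', (C.q n').symm (r (pr n'))⟩ : Q.L.Tot)) n := by
  refine (C.contMDiffAt_mapTot_iff (n := id) contMDiffAt_id (.of_forall fun _ ↦ rfl)).1 ?_
  refine (ContMDiffAt.comp n (g := C.line.sec r) hr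
    (C.hquot.quotient.smooth n)).congr_of_eventuallyEq (.of_forall fun n' ↦ ?_)
  exact (C.q_eq_iff n' _ r).1 ((C.q n').apply_symm_apply _)

theorem bundle_descends : Descends (EN := EN) ρ ι pr (C.bundle hC hT hcomm hμB) C.q where
  smooth _ _ hr := C.contMDiffAt_symm hr
  invariant g n v v' hvv' := by
    have h1 := C.mapTot_smul g n (p := ⟨ι n, v⟩) rfl
    rw [hvv'] at h1
    exact h1
  circle t n n' v v' hvv' := by
    -- Comparing base points forces `n' = t • n`, the case handled by `circleLift_act`.
    have h1 : ι n' = ι (t • n) := by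
      rw [hC.ι_smul]
      exact (congrArg TotalSpace.proj hvv').symm
    obtain rfl := C.hquot.embedding.isEmbedding.injective h1
    refine (C.circleLift_act hC Q.lift hcomm hT t (p := ⟨ι n, v⟩) rfl).trans ?_
    rw [hvv']
    rfl
  μ_eq := hμB
  isometry := C.metric_q
  connection s r n hs hr h v := C.q_cov hs hr h v
  hyp_isometry n v v' := congrArg₂ (fun a b ↦ Real.exp (2 * a) * b) (hμB n) (C.metric_q n v v')
  hyp_connection s r n hs hr h v hv := by
    refine (C.q_hyp_cov hC hμB hs hr h v hv).trans ?_
    exact (C.connection.addForm_cov (smoothOneAt_hypOne HB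
      (IsCircleQuotient.smooth_moment C.hquot Q.smooth_μ hμB)) r (pr n) _).symm

end DescentCover

end Descent

/-! ### Uniqueness of the descended line bundle -/

section Descent

variable {E : Type*} [NormedAddCommGroup E] [NormedSpace ℝ E] [FiniteDimensional ℝ E]
  {M : Type*} [TopologicalSpace M] [T2Space M] [ChartedSpace E M] [IsManifold 𝓘(ℝ, E) ∞ M]
  {H : AlmostHyperhermitian E M}
  {EG : Type*} [NormedAddCommGroup EG] [NormedSpace ℝ EG]
  {G : Type*} [TopologicalSpace G] [ChartedSpace EG G] [Group G] [LieGroup 𝓘(ℝ, EG) ∞ G]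
  [MulAction G M]
  {ν₁ ν₂ ν₃ : M → GroupLieAlgebra 𝓘(ℝ, EG) G →L[ℝ] ℝ}
  {EN : Type*} [NormedAddCommGroup EN] [NormedSpace ℝ EN] [FiniteDimensional ℝ EN]
  {N : Type*} [TopologicalSpace N] [ChartedSpace EN N] [IsManifold 𝓘(ℝ, EN) ∞ N]
  [MulAction G N]
  {EB : Type*} [NormedAddCommGroup EB] [NormedSpace ℝ EB] [FiniteDimensional ℝ EB]
  {B : Type*} [TopologicalSpace B] [ChartedSpace EB B] [IsManifold 𝓘(ℝ, EB) ∞ B]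
  {HB : AlmostHyperhermitian EB B} {ι : N → M} {pr : N → B}
  [MulAction Circle M] [MulAction Circle B] [T2Space B]
  {Q : HyperholomorphicLineBundle.{w} H} {ρ : Lift 𝓘(ℝ, EG) G Q.h Q.nabla}

namespace Descends

section

variable {R : HyperholomorphicLineBundle.{w'} HB}
  {q : ∀ n : N, Q.L.Fiber (ι n) ≃ₗ[ℂ] R.L.Fiber (pr n)}
  (hd : Descends (EN := EN) ρ ι pr R q)
  (hquot : IsHyperkahlerQuotient (EN := EN) H ν₁ ν₂ ν₃ ι pr HB)

theorem ratio_symm {r r₀ : ∀ b, R.L.Fiber b} {n : N} (h0 : r₀ (pr n) ≠ 0) :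
    Q.L.ratio ⟨ι n, (q n).symm (r (pr n))⟩ ⟨ι n, (q n).symm (r₀ (pr n))⟩
      = R.L.ratio (R.L.sec r (pr n)) (R.L.sec r₀ (pr n)) := by
  have h0' : (q n).symm (r₀ (pr n)) ≠ 0 := by simpa using h0
  refine smul_cancel h0' ?_
  rw [ratio_smul h0', ← map_smul]
  exact congrArg _ (ratio_smul h0 _).symm

include hd hquot in
-- `Descends` states only that smooth sections of `R` pull back to smooth ones. For the converse,
-- divide by a smooth frame `r₀`: the ratio is the same on `N` and on `B`, and a local section of
-- `pr` brings it down.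
theorem smoothAt_iff {r : ∀ b, R.L.Fiber b} {n : N} : R.L.SmoothAt r (pr n) ↔
    ContMDiffAt 𝓘(ℝ, EN) (𝓘(ℝ, E).prod 𝓘(ℝ, ℂ)) ∞
      (fun n' ↦ (⟨ι n', (q n').symm (r (pr n'))⟩ : Q.L.Tot)) n := by
  refine ⟨hd.smooth r n, fun hr ↦ ?_⟩
  obtain ⟨r₀, hr₀, h0⟩ := exists_frame (L := R.L) (pr n)
  obtain ⟨σ, τ, hσ, hσn, -⟩ := hquot.quotient.exists_section n
  have hU := eventually_ne_zero (hr₀ (pr n)).diffAt h0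
  have h0' : (q n).symm (r₀ (pr n)) ≠ 0 := by simpa using h0
  have h1 := hr.lineRatio (hd.smooth r₀ n (hr₀ _)) (.of_forall fun _ ↦ rfl) h0'
  rw [← hσn] at h1
  have h2 : ContMDiffAt 𝓘(ℝ, EB) 𝓘(ℝ, ℂ) ∞
      (fun b ↦ R.L.ratio (R.L.sec r b) (R.L.sec r₀ b)) (pr n) := by
    refine (ContMDiffAt.comp (pr n) h1 hσ.self_of_nhds.1).congr_of_eventuallyEq ?_
    filter_upwards [hσ, hU] with b hb hb0
    have h3 := ratio_symm (q := q) (r := r) (r₀ := r₀) (n := σ b) (by rwa [hb.2])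
    exact (h3.trans (congrArg (fun b ↦ R.L.ratio (R.L.sec r b) (R.L.sec r₀ b)) hb.2)).symm
  exact (SmoothAt.smul h2 (hr₀ _)).congr (hU.mono fun b hb ↦ (ratio_smul hb _).symm)

include hd hquot in
theorem diffAt_iff {r : ∀ b, R.L.Fiber b} {n : N} : R.L.DiffAt r (pr n) ↔
    MDifferentiableAt 𝓘(ℝ, EN) (𝓘(ℝ, E).prod 𝓘(ℝ, ℂ))
      (fun n' ↦ (⟨ι n', (q n').symm (r (pr n'))⟩ : Q.L.Tot)) n := by
  obtain ⟨r₀, hr₀, h0⟩ := exists_frame (L := R.L) (pr n)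
  have hU := eventually_ne_zero (hr₀ (pr n)).diffAt h0
  have h0' : (q n).symm (r₀ (pr n)) ≠ 0 := by simpa using h0
  have hp₀ := (hd.smooth r₀ n (hr₀ _)).mdifferentiableAt (by simp)
  have hpr := hquot.mdifferentiableAt_pr n
  constructor
  · intro hr
    obtain ⟨F, hF, h1⟩ := (hr₀ (pr n)).diffAt.exists_smul h0 hr
    refine ((MDifferentiableAt.comp n (g := F) hF hpr).lineSmul hp₀).congr_of_eventuallyEq ?_
    filter_upwards [hpr.continuousAt.eventually h1] with n' hn'
    rw [hn', map_smul]
    rfl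
  · intro hr
    obtain ⟨σ, τ, hσ, hσn, -⟩ := hquot.quotient.exists_section n
    have h1 := hr.lineRatio hp₀ (.of_forall fun _ ↦ rfl) h0'
    rw [← hσn] at h1
    have h2 : MDifferentiableAt 𝓘(ℝ, EB) 𝓘(ℝ, ℂ)
        (fun b ↦ R.L.ratio (R.L.sec r b) (R.L.sec r₀ b)) (pr n) := by
      refine (MDifferentiableAt.comp (pr n) h1
        (hσ.self_of_nhds.1.mdifferentiableAt (by simp))).congr_of_eventuallyEq ?_
      filter_upwards [hσ, hU] with b hb hb0
      have h3 := ratio_symm (q := q) (r := r) (r₀ := r₀) (n := σ b) (by rwa [hb.2])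
      exact (h3.trans (congrArg (fun b ↦ R.L.ratio (R.L.sec r b) (R.L.sec r₀ b)) hb.2)).symm
    exact (DiffAt.smul h2 (hr₀ _).diffAt).congr (hU.mono fun b hb ↦ (ratio_smul hb _).symm)

include hd hquot in
theorem exists_lift {r : ∀ b, R.L.Fiber b} {n : N} (hr : R.L.DiffAt r (pr n)) :
    ∃ s : ∀ x, Q.L.Fiber x, Q.L.DiffAt s (ι n) ∧ ∀ᶠ n' in 𝓝 n, q n' (s (ι n')) = r (pr n') := by
  obtain ⟨s, hs, h2⟩ := exists_diffAt_extension (hquot.embedding.isImmersion.isImmersionAt n)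
    ((hd.diffAt_iff hquot).1 hr) (.of_forall fun _ ↦ rfl)
  refine ⟨s, hs, h2.mono fun n' hn' ↦ ?_⟩
  rw [mk_inj.1 hn', LinearEquiv.apply_symm_apply]

end

variable {R : HyperholomorphicLineBundle.{0} HB} {R' : HyperholomorphicLineBundle.{w'} HB}
  {q : ∀ n : N, Q.L.Fiber (ι n) ≃ₗ[ℂ] R.L.Fiber (pr n)}
  {q' : ∀ n : N, Q.L.Fiber (ι n) ≃ₗ[ℂ] R'.L.Fiber (pr n)}
  (hd : Descends (EN := EN) ρ ι pr R q) (hd' : Descends (EN := EN) ρ ι pr R' q')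
  (hquot : IsHyperkahlerQuotient (EN := EN) H ν₁ ν₂ ν₃ ι pr HB)

include hd hd' hquot in
-- The only candidate is `q' ∘ q⁻¹` at a point over `b`. The relation is stated in the total spaces
-- because the fibres over `pr n` and `b` are different types.
theorem exists_fiberEquiv (b : B) : ∃ φ : R.L.Fiber b ≃ₗ[ℂ] R'.L.Fiber b,
    ∀ (n : N) (v : Q.L.Fiber (ι n)) (a : R.L.Fiber b), (⟨pr n, q n v⟩ : R.L.Tot) = ⟨b, a⟩ →
      (⟨pr n, q' n v⟩ : R'.L.Tot) = ⟨b, φ a⟩ := by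
  obtain ⟨n₀, rfl⟩ := hquot.quotient.surjective b
  refine ⟨(q n₀).symm ≪≫ₗ q' n₀, fun n v a h ↦ ?_⟩
  -- Any other point over `b` is `g • n₀`; invariance of `q` and of `q'` carries the relation from
  -- `n₀` to it.
  obtain ⟨g, rfl⟩ := hquot.quotient.exists_smul_eq (congrArg TotalSpace.proj h).symm
  have h1 : (ρ.act g ⟨ι n₀, (q n₀).symm a⟩).1 = ι (g • n₀) := (hquot.equivariant g n₀).symm
  have h2 := (mk_fiberOf _ h1).symm
  have h3 := hd.invariant g n₀ _ _ h2
  rw [LinearEquiv.apply_symm_apply, ← h] at h3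
  have h4 := (q (g • n₀)).injective (mk_inj.1 h3)
  rw [← h4]
  exact hd'.invariant g n₀ _ _ h2

variable {φ : ∀ b : B, R.L.Fiber b ≃ₗ[ℂ] R'.L.Fiber b}
  (hφ : ∀ (n : N) (v : Q.L.Fiber (ι n)), φ (pr n) (q n v) = q' n v)

include hφ in
theorem symm_apply (n : N) (a : R.L.Fiber (pr n)) : (q' n).symm (φ (pr n) a) = (q n).symm a := by
  rw [LinearEquiv.symm_apply_eq, ← hφ, LinearEquiv.apply_symm_apply]

include hd hd' hquot hφ in
-- One section of `Q.L` represents both `r` and `φ r`, so each derivative on the two bundles is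
-- computed from the same section on `M`.
theorem exists_common_lift {r : ∀ b, R.L.Fiber b} {n : N} (hr : R.L.DiffAt r (pr n)) :
    ∃ s : ∀ x, Q.L.Fiber x, Q.L.DiffAt s (ι n) ∧ (∀ᶠ n' in 𝓝 n, q n' (s (ι n')) = r (pr n')) ∧
      (∀ᶠ n' in 𝓝 n, q' n' (s (ι n')) = φ (pr n') (r (pr n'))) ∧
      R'.L.DiffAt (fun b ↦ φ b (r b)) (pr n) := by
  obtain ⟨s, hs, h⟩ := hd.exists_lift hquot hr
  refine ⟨s, hs, h, h.mono fun n' hn' ↦ by rw [← hφ, hn'], (hd'.diffAt_iff hquot).2 ?_⟩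
  simp only [symm_apply hφ]
  exact (hd.diffAt_iff hquot).1 hr

include hd hd' hquot hφ in
theorem isIsomorphism (hmem : ∀ (t : Circle) (n : N), ∃ n', ι n' = t • ι n) :
    IsIsomorphism R R' φ where
  smooth r b := by
    obtain ⟨n, rfl⟩ := hquot.quotient.surjective b
    rw [hd.smoothAt_iff hquot, hd'.smoothAt_iff hquot]
    simp only [symm_apply hφ]
  circle t b v := by
    obtain ⟨n, rfl⟩ := hquot.quotient.surjective b
    obtain ⟨a, rfl⟩ := (q n).surjective v
    obtain ⟨n', hn'⟩ := hmem t n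
    have h1 : (Q.lift.act t ⟨ι n, a⟩).1 = ι n' := hn'.symm
    have h2 := (mk_fiberOf _ h1).symm
    have h3 := hd.circle t n n' a _ h2
    have h4 := hd'.circle t n n' a _ h2
    -- `t • pr n` and `pr n'` are equal by the equality in the total space; quantifying over the
    -- base point allows it to be substituted.
    have key : ∀ (b : B) (x : R.L.Fiber b) (y : R'.L.Fiber b) (v : Q.L.Fiber (ι n')),
        (⟨b, x⟩ : R.L.Tot) = ⟨pr n', q n' v⟩ → (⟨b, y⟩ : R'.L.Tot) = ⟨pr n', q' n' v⟩ →
          φ b x = y := by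
      intro b x y v hx hy
      obtain rfl : b = pr n' := congrArg TotalSpace.proj hx
      rw [mk_inj.1 hx, mk_inj.1 hy, hφ]
    rw [hφ]
    exact key _ _ _ _ h3 h4
  μ_eq b := by
    obtain ⟨n, rfl⟩ := hquot.quotient.surjective b
    rw [hd.μ_eq, hd'.μ_eq]
  isometry b v v' := by
    obtain ⟨n, rfl⟩ := hquot.quotient.surjective b
    obtain ⟨a, rfl⟩ := (q n).surjective v
    obtain ⟨a', rfl⟩ := (q n).surjective v'
    rw [hφ, hφ, hd.isometry, hd'.isometry]
  connection r b hr u := by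
    obtain ⟨n, rfl⟩ := hquot.quotient.surjective b
    obtain ⟨v, rfl⟩ := hquot.exists_mfderiv_pr n u
    obtain ⟨s, hs, h, h', hr'⟩ := hd.exists_common_lift hd' hquot hφ hr
    rw [← hd.connection s r n hs hr h, hφ]
    exact (hd'.connection s _ n hs hr' h' v).symm
  hyp_connection r b hr u := by
    obtain ⟨n, rfl⟩ := hquot.quotient.surjective b
    -- The hyperholomorphic connections are related only in horizontal directions, so the lift of
    -- `u` must be horizontal.
    obtain ⟨v, hv, rfl⟩ := hquot.exists_horizontal_lift n u
    obtain ⟨s, hs, h, h', hr'⟩ := hd.exists_common_lift hd' hquot hφ hr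
    rw [← hd.hyp_connection s r n hs hr h v hv, hφ]
    exact (hd'.hyp_connection s _ n hs hr' h' v hv).symm

include hd hd' hquot in
/-- Two descended line bundles are isomorphic by a unique isomorphism. -/
theorem existsUnique_isomorphism (hmem : ∀ (t : Circle) (n : N), ∃ n', ι n' = t • ι n) :
    ∃! φ : ∀ b : B, R.L.Fiber b ≃ₗ[ℂ] R'.L.Fiber b,
      IsIsomorphism R R' φ ∧ ∀ (n : N) (v : Q.L.Fiber (ι n)), φ (pr n) (q n v) = q' n v := by
  choose φ h using hd.exists_fiberEquiv hd' hquot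
  have hφ : ∀ (n : N) (v : Q.L.Fiber (ι n)), φ (pr n) (q n v) = q' n v :=
    fun n v ↦ (mk_inj.1 (h (pr n) n v _ rfl)).symm
  refine ⟨φ, ⟨hd.isIsomorphism hd' hquot hφ hmem, hφ⟩, fun ψ hψ ↦ funext fun b ↦ ?_⟩
  obtain ⟨n, rfl⟩ := hquot.quotient.surjective b
  refine LinearEquiv.ext fun a ↦ ?_
  obtain ⟨v, rfl⟩ := (q n).surjective a
  rw [hψ.2, hφ]

end Descends

end Descent

end HyperKahler

end

/-! ### The descent theorem -/

theorem theorem2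
    -- the hyperkähler manifold `M`
    {E : Type*} [NormedAddCommGroup E] [NormedSpace ℝ E] [FiniteDimensional ℝ E]
    {M : Type*} [TopologicalSpace M] [T2Space M] [SecondCountableTopology M]
    [ChartedSpace E M] [IsManifold 𝓘(ℝ, E) ∞ M]
    (H : AlmostHyperhermitian E M) (hH : H.IsHyperkahler)
    -- the circle action on `M` and the hyperholomorphic line bundle of `M`
    [MulAction Circle M] (hT : IsRotating H)
    (Q : HyperholomorphicLineBundle.{w} H)
    -- the Lie group `G`, its triholomorphic action on `M` and its action on the line bundle,
    -- which commute with the circle actions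
    {EG : Type*} [NormedAddCommGroup EG] [NormedSpace ℝ EG] [FiniteDimensional ℝ EG]
    {G : Type*} [TopologicalSpace G] [ChartedSpace EG G] [Group G] [LieGroup 𝓘(ℝ, EG) ∞ G]
    [MulAction G M] (hG : IsTriholomorphic (EG := EG) H G) [SMulCommClass G Circle M]
    (ρ : Lift 𝓘(ℝ, EG) G Q.h Q.nabla)
    (hcomm : ∀ (g : G) (t : Circle) (p : Q.L.Tot),
      ρ.act g (Q.lift.act t p) = Q.lift.act t (ρ.act g p))
    -- the moment maps of `G`
    (ν₁ ν₂ ν₃ : M → GroupLieAlgebra 𝓘(ℝ, EG) G →L[ℝ] ℝ)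
    (hν₁ : IsMomentMap H.ω₁ ν₁) (hν₂ : IsMomentMap H.ω₂ ν₂) (hν₃ : IsMomentMap H.ω₃ ν₃)
    (hρ : ∀ a : GroupLieAlgebra 𝓘(ℝ, EG) G, ρ.IsMomentFunction a (fun x ↦ ν₁ x a))
    (hνc : ∀ (t : Circle) (x : M) (a : GroupLieAlgebra 𝓘(ℝ, EG) G),
      (ν₂ (t • x) a : ℂ) + Complex.I * (ν₃ (t • x) a : ℂ)
        = (t : ℂ) * ((ν₂ x a : ℂ) + Complex.I * (ν₃ x a : ℂ)))
    -- the submanifold `N = ν⁻¹(0)` and the hyperkähler quotient `B = N / G`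
    {EN : Type*} [NormedAddCommGroup EN] [NormedSpace ℝ EN] [FiniteDimensional ℝ EN]
    {N : Type*} [TopologicalSpace N] [ChartedSpace EN N] [IsManifold 𝓘(ℝ, EN) ∞ N]
    [MulAction G N]
    {EB : Type*} [NormedAddCommGroup EB] [NormedSpace ℝ EB] [FiniteDimensional ℝ EB]
    {B : Type*} [TopologicalSpace B] [T2Space B] [SecondCountableTopology B]
    [ChartedSpace EB B] [IsManifold 𝓘(ℝ, EB) ∞ B]
    (HB : AlmostHyperhermitian EB B) (ι : N → M) (pr : N → B)
    (hquot : IsHyperkahlerQuotient (EN := EN) H ν₁ ν₂ ν₃ ι pr HB) :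
    HB.IsHyperkahler ∧
    ∃ _ : MulAction Circle B,
      (∀ (t : Circle) (n : N), ∃ n' : N, ι n' = t • ι n ∧ pr n' = t • pr n) ∧
      IsRotating HB ∧
      ∃ (R : HyperholomorphicLineBundle.{0} HB)
        (q : ∀ n : N, Q.L.Fiber (ι n) ≃ₗ[ℂ] R.L.Fiber (pr n)),
        IsHyperholomorphic HB R.hyp ∧
        Descends (EN := EN) ρ ι pr R q ∧
        ∀ (R' : HyperholomorphicLineBundle.{w'} HB)
          (q' : ∀ n : N, Q.L.Fiber (ι n) ≃ₗ[ℂ] R'.L.Fiber (pr n)),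
          Descends (EN := EN) ρ ι pr R' q' →
          ∃! φ : ∀ b : B, R.L.Fiber b ≃ₗ[ℂ] R'.L.Fiber b,
            IsIsomorphism R R' φ ∧ ∀ (n : N) (v : Q.L.Fiber (ι n)), φ (pr n) (q n v) = q' n v := by
  have hcommM : SMulCommClass Circle G M := SMulCommClass.symm G Circle M
  have hmem : ∀ (t : Circle) (n : N), ∃ n', ι n' = t • ι n := by
    intro t n
    have h1 : ι n ∈ Set.range ι := ⟨n, rfl⟩
    rw [hquot.range_ι] at h1
    have h2 : t • ι n ∈ Set.range ι := by
      rw [hquot.range_ι]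
      -- At a zero of `ν₂` and `ν₃` the rotated combination vanishes, and its real and imaginary
      -- parts are the two moment maps at `t • ι n`.
      have h3 := fun a ↦ hνc t (ι n) a
      simp only [h1.2.1, h1.2.2, zero_apply, Complex.ofReal_zero, mul_zero,
        add_zero] at h3
      refine ⟨ContinuousLinearMap.ext fun a ↦ ?_, ContinuousLinearMap.ext fun a ↦ ?_,
        ContinuousLinearMap.ext fun a ↦ ?_⟩
      -- `ν₁` is invariant because it is determined by a lift of `G` that commutes with the lifted
      -- circle action.
      · refine (ρ.momentFunction_smul hG.smooth hT.smooth Q.lift hcomm (hρ a) t (ι n)).trans ?_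
        rw [h1.1]
      · simpa using congrArg Complex.re (h3 a)
      · simpa using congrArg Complex.im (h3 a)
    exact h2
  obtain ⟨actN, actB, hC⟩ := hquot.exists_circleQuotient hT.smooth hmem
  choose F hF using fun b ↦ exists_descentFrame (ρ := ρ) hquot b
  let C : DescentCover H ν₁ ν₂ ν₃ HB ρ EN ι pr := ⟨hquot, hG.smooth, hρ, F, hF⟩
  -- The same argument with the roles of `G` and the circle exchanged makes `μ` invariant under `G`,
  -- so it descends to `B`.
  have hμ : ∀ (g : G) (x : M), Q.μ (g • x) = Q.μ x :=
    Q.lift.momentFunction_smul hT.smooth hG.smooth ρ (fun t g p ↦ (hcomm g t p).symm) Q.lift_μ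
  have hμB : ∀ n, Q.μ (ι (Function.surjInv hquot.quotient.surjective (pr n))) = Q.μ (ι n) := by
    intro n
    obtain ⟨g, hg⟩ := hquot.quotient.exists_smul_eq
      (Function.surjInv_eq hquot.quotient.surjective (pr n))
    conv_rhs => rw [hg, hquot.equivariant, hμ]
  have hHB := hquot.isHyperkahler hH
  have hTB := hC.isRotating hquot hT
  let R : HyperholomorphicLineBundle.{0} HB := C.bundle hC hT.smooth hcomm
    (μB := fun b ↦ Q.μ (ι (Function.surjInv hquot.quotient.surjective b))) hμB
  have hd : Descends (EN := EN) ρ ι pr R C.q := C.bundle_descends hC hT.smooth hcomm hμB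
  exact ⟨hHB, actB, fun t n ↦ ⟨t • n, hC.ι_smul t n, hC.pr_smul t n⟩, hTB, R, C.q,
    R.isHyperholomorphic hHB hTB, hd, fun R' q' hd' ↦ hd.existsUnique_isomorphism hd' hquot hmem⟩
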